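/- **Setting.** Let $\kappa,r,\zeta,\xi\in\mathbb C^\times$, put $\omega=-\frac{2\pi i}{\kappa r}$ (that is, $\omega=\frac{\pi i t}{\kappa r}$ with $t=-2$) and $q=\exp(\pi i\omega/r)$, and assume $q\neq\pm1$. Let $\mathcal C$ be the category of complex vector spaces with a diagonalisable endomorphism $h$, with the tensor product of vector spaces, $h_{V\otimes W}=h_V\otimes 1+1\otimes h_W$, trivial associator and the braiding $v\otimes w\mapsto e^{\kappa\mu\nu}\,w\otimes v$ for $hv=\mu v$, $hw=\nu w$. Let $\mathbb C_\mu$ be the one-dimensional space with $h=\mu$. Let $A_r$ be the algebra in $\mathcal C$ with basis $(\delta_n)_{n\in\mathbb Z}$, $\delta_m\delta_n=\delta_{m+n}$, $h\delta_n=nr\,\delta_n$. Let $\mathcal D$ be the monoidal category of $A_r$-bimodules in $\mathcal C$ with the tensor product $\otimes=\otimes_{A_r}$, and $\mathcal Z(\mathcal D)$ its Drinfeld centre (pairs of $Z\in\mathcal D$ and a half-braiding $\varphi_{Z,X}:Z\otimes X\to X\otimes Z$). For $E\in\mathcal C$ let $\alpha^\pm(E)\in\mathcal Z(\mathcal D)$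 be $A_r\otimes_{\mathbb C}E$ with left multiplication, the right action $(a\otimes v)\delta_n=e^{\pm\kappa\mu nr}a\delta_n\otimes v$ and the half-braiding $(a\otimes v)\otimes x\mapsto e^{\pm\kappa\mu\nu}\,ax\otimes(1\otimes v)$, for $hv=\mu v$, $hx=\nu x$. Put $F^\pm=\alpha^\pm(\mathbb C_\omega\oplus\mathbb C_{-\omega})$, $F=F^+\oplus F^-$, and let $b:F^+\otimes F^-\to A_r$ be the bimodule map $(a\otimes v)\otimes(a'\otimes w)\mapsto(\zeta v_\omega w_{-\omega}+\xi v_{-\omega}w_\omega)\,aa'$. **The category $\mathcal D_F'$.** Objects of $\mathcal D_F$ are pairs $(X,m)$ with $X\in\mathcal D$ and $m:F\otimes X\to X$ a morphism of $\mathcal D$, with restrictions $m_\pm:F^\pm\otimes X\to X$; morphisms $f$ satisfy $f m=m(1\otimes f)$. $\mathcal D_F'$ is the full subcategory of the $(X,m)$ with $$m_+(1\otimes m_-)-m_-(1\otimes m_+)(\varphi_{F^+,F^-}\otimes1)=b\otimes1-(1\otimes b)\,\varphi_{F^+\otimes F^-,X}.$$ **Yetter-Drinfeld modules.** Let $\mathcal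 T(F^+)=\bigoplus_n (F^+)^{\otimes n}$ be the tensor algebra of $F^+$ in $\mathcal Z(\mathcal D)$ as a Hopf algebra in $\mathcal Z(\mathcal D)$ ($F^+$ primitive, $\Delta$ multiplicative with respect to the braiding $\varphi$), and $\mathcal T(F^-)$ likewise the tensor algebra of $F^-$, as a Hopf algebra in $\mathcal Z(\mathcal D)$ with the reversed braiding $\varphi^{-1}$. Write $A=\mathcal T(F^+)$, $B=\mathcal T(F^-)$. A Hopf pairing is a morphism $\rho:A\otimes B\to A_r$ of $\mathcal D$ with $\rho(\mu_A\otimes1)=\rho(1\otimes\rho\otimes1)(1\otimes1\otimes\Delta_B)$, $\rho(1\otimes\mu_B)=\rho(1\otimes\rho\otimes1)(\Delta_A\otimes1\otimes1)$, $\rho(\eta_A\otimes1)=\varepsilon_B$, $\rho(1\otimes\eta_B)=\varepsilon_A$. The category $A\,\mathrm{YD}_\rho\,B$ has as objects the $X\in\mathcal D$ with a left $A$-action $m_+$ and a right $B$-action $m_-$ such that, as morphisms $A\otimes X\otimes B\to X$, $$(m_+\otimes\rho)(1\otimes\varphi_{A,X}\otimes1)(1\otimes1\otimes m_-\otimes1)(\Delta_A\otimes1\otimes\Delta_B)=(\rho\otimes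 m_-)(1\otimes\varphi_{B,X}^{-1}\otimes1)(1\otimes m_+\otimes1\otimes1)(\Delta_A\otimes1\otimes\Delta_B),$$ and as morphisms the morphisms of $\mathcal D$ that commute with both actions. The restriction functor $R:A\,\mathrm{YD}_\rho\,B\to\mathcal D_F$ keeps $X$, restricts $m_+$ to $F^+$, and takes $F^-\otimes X\xrightarrow{\varphi_{F^-,X}}X\otimes F^-\to X\otimes B\xrightarrow{m_-}X$. **Quantum groups.** $U_q=U_q(L\mathfrak{sl}_2)$ is the bialgebra over $\mathbb C$ with generators $e_0^\pm,e_1^\pm$, $k=k_0=k_1^{-1}$, $k^{-1}=k_0^{-1}=k_1$ and relations ($i,j\in\{0,1\}$) $kk^{-1}=1=k^{-1}k$, $k_ie_i^\pm k_i^{-1}=q^{\pm2}e_i^\pm$, $[e_i^+,e_j^-]=\delta_{ij}\frac{k_i-k_i^{-1}}{q-q^{-1}}$, $(e_i^\pm)^3e_j^\pm-[3]_q(e_i^\pm)^2e_j^\pm e_i^\pm+[3]_qe_i^\pm e_j^\pm(e_i^\pm)^2-e_j^\pm(e_i^\pm)^3=0$ with $[3]_q=q^2+1+q^{-2}$, the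 coproduct $\Delta(e_i^+)=e_i^+\otimes k_i+1\otimes e_i^+$, $\Delta(e_i^-)=e_i^-\otimes1+k_i^{-1}\otimes e_i^-$, $\Delta(k^{\pm1})=k^{\pm1}\otimes k^{\pm1}$, and the counit $\varepsilon(e_i^\pm)=0$, $\varepsilon(k)=1$. Let $\mathrm{Rep}_{\langle k\rangle}(U_q)$ be the monoidal category of $U_q$-modules on which $k$ acts diagonalisably. Let $B_F$ be the algebra with generators $k^{\pm1},f^\pm,\bar f^\pm$ and relations $kk^{-1}=1=k^{-1}k$, $kf^\pm k^{-1}=q^{\pm2}f^\pm$, $k\bar f^\pm k^{-1}=q^{\pm2}\bar f^\pm$, and $\psi:B_F\to U_q$ the homomorphism $$k\mapsto k_0,\quad f^+\mapsto e_0^+k_0^{-1},\quad f^-\mapsto\xi\tfrac{q-q^{-1}}{q^2}e_1^+k_1^{-1},\quad \bar f^+\mapsto e_1^-,\quad \bar f^-\mapsto\zeta\tfrac{q-q^{-1}}{q^2}e_0^- .$$ **The functor.** For a vector space $X$ with a diagonalisable automorphism $k$ let $\mathcal I(X)=A_r\otimes_{\mathbb C}X\in\mathcal D$, where $A_r$ acts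 from both sides by multiplication on $A_r$, and $h(\delta_n\otimes v)=(nr+r\ell)\,\delta_n\otimes v$ for $kv=e^{2\pi i\ell}v$ with $\mathrm{Re}\,\ell\in[0,1)$. With $k$ acting on $X\otimes_{\mathbb C}Y$ by $k\otimes k$, let $\mathcal I_{X,Y}:\mathcal I(X)\otimes\mathcal I(Y)\to\mathcal I(X\otimes_{\mathbb C}Y)$ be the morphism $(a\otimes v)\otimes(a'\otimes w)\mapsto aa'\delta_n\otimes(v\otimes w)$ with $n=\lfloor\mathrm{Re}(\ell+\ell')\rfloor$, for $kv=e^{2\pi i\ell}v$, $kw=e^{2\pi i\ell'}w$, $\mathrm{Re}\,\ell,\mathrm{Re}\,\ell'\in[0,1)$. Let $\tilde E^\pm=\mathbb C e_0\oplus\mathbb C e_1$ with $ke_0=q^2e_0$, $ke_1=q^{-2}e_1$. Choose $c_0,c_1\in\mathbb C^\times$ and let $g:\mathcal I(\tilde E^+)\oplus\mathcal I(\tilde E^-)\to F^+\oplus F^-$ be the isomorphism with components $a\otimes e_0\mapsto c_0^{\pm}\,a\delta_{n_0}\otimes 1_{\omega}$, $a\otimes e_1\mapsto c_1^{\pm}\,a\delta_{n_1}\otimes1_{-\omega}$,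 where $n_0=-\lfloor\mathrm{Re}(\omega/r)\rfloor$, $n_1=-\lfloor\mathrm{Re}(-\omega/r)\rfloor$, $(c_0^+,c_1^+)=(c_0,c_1)$ and $(c_0^-,c_1^-)=(c_1^{-1},c_0^{-1})$; this normalisation makes $b\circ(g\otimes g)$ correspond to the pairing $e_0\otimes e_1\mapsto\zeta$, $e_1\otimes e_0\mapsto\xi$ of $\tilde E^+$ and $\tilde E^-$. Let $\Psi:\mathrm{Rep}_{\langle k\rangle}(U_q)\to\mathcal D_F$ be the composite of the pullback along $\psi$, the functor which sends a $B_F$-module $V$ to $V$ with $k$ and the maps $\tilde E^+\otimes V\to V$, $e_0\otimes v\mapsto f^+v$, $e_1\otimes v\mapsto f^-v$ and $\tilde E^-\otimes V\to V$, $e_0\otimes v\mapsto\bar f^+v$, $e_1\otimes v\mapsto\bar f^-v$, and the functor $\mathcal I_g:(X,m)\mapsto(\mathcal I(X),\ \mathcal I(m)\circ\mathcal I_{\tilde E,X}\circ(g^{-1}\otimes1))$. **Theorem.** The tensor algebras $\mathcal T(F^+)$, $\mathcal T(F^-)$ exist, and $b$ extends to a unique Hopf pairing $\rho:\mathcal T(F^+)\otimes\mathcal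 T(F^-)\to A_r$. The functor $R$ takes values in $\mathcal D_F'$ and is an isomorphism of categories $\mathcal T(F^+)\,\mathrm{YD}_\rho\,\mathcal T(F^-)\to\mathcal D_F'$, with inverse $S$; the functor $\Psi$ also takes values in $\mathcal D_F'$. The category $\mathcal T(F^+)\,\mathrm{YD}_\rho\,\mathcal T(F^-)$ is monoidal, with the tensor product of $\mathcal D$, the actions $(m_+\otimes m_+)(1\otimes\varphi_{A,X}\otimes1)(\Delta_A\otimes1\otimes1)$ and $(m_-\otimes m_-)(1\otimes\varphi_{B,Y}^{-1}\otimes1)(1\otimes1\otimes\Delta_B)$ on $X\otimes Y$, and the unit $A_r$ with the actions through the counits. The composite $$S\circ\Psi:\ \mathrm{Rep}_{\langle k\rangle}(U_q(L\mathfrak{sl}_2))\longrightarrow\mathcal T(F^+)\,\mathrm{YD}_\rho\,\mathcal T(F^-)$$ is a (strong) monoidal functor, with the tensor structure $\mathcal I_{V,W}$ on underlying bimodules, and it is full and faithful; so it identifies the category of $U_q(L\mathfrak{sl}_2)$-modules with diagonalisable $k$ with a full subcategory of $\mathcal T(F^+)\,\mathrm{YD}_\rho\,\mathcal T(F^-)$.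 -/

import Mathlib

open CategoryTheory MonoidalCategory Limits TensorProduct

noncomputable section

namespace CBoson

/-! ### Diagonalisable endomorphisms -/

section Diag

variable {V W M : Type} [AddCommGroup V] [Module ℂ V] [AddCommGroup W] [Module ℂ W]
  [AddCommGroup M] [Module ℂ M]

/-- An endomorphism is diagonalisable if its eigenvectors span. -/
def IsDiag (T : Module.End ℂ V) : Prop := ⨆ μ, T.eigenspace μ = ⊤

theorem isDiag_iff (T : Module.End ℂ V) :
    IsDiag T ↔ ∀ P : Submodule ℂ V, (∀ (μ : ℂ) (v : V), T v = μ • v → v ∈ P) → P = ⊤ := by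
  constructor
  · intro h P hP
    rw [eq_top_iff, ← h]
    exact iSup_le fun μ v hv => hP μ v (Module.End.mem_eigenspace_iff.1 hv)
  · intro h
    exact h _ fun μ v hv => (le_iSup (fun μ => T.eigenspace μ) μ) (Module.End.mem_eigenspace_iff.2 hv)

theorem IsDiag.ind {T : Module.End ℂ V} (hT : IsDiag T) {P : V → Prop} (v : V) (h0 : P 0)
    (h1 : ∀ (μ : ℂ) (v : V), T v = μ • v → P v) (h2 : ∀ v w, P v → P w → P (v + w)) : P v := by
  have hv : v ∈ ⨆ μ, T.eigenspace μ := hT ▸ Submodule.mem_top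
  exact Submodule.iSup_induction _ (motive := P) hv
    (fun μ v hv => h1 μ v (Module.End.mem_eigenspace_iff.1 hv)) h0 h2

theorem IsDiag.ext {T : Module.End ℂ V} (hT : IsDiag T) {f g : V →ₗ[ℂ] M}
    (h : ∀ (μ : ℂ) (v : V), T v = μ • v → f v = g v) : f = g :=
  LinearMap.eqLocus_eq_top.1 ((isDiag_iff T).1 hT (LinearMap.eqLocus f g) h)

theorem IsDiag.ext₂ {T : Module.End ℂ V} (hT : IsDiag T) {T' : Module.End ℂ W} (hT' : IsDiag T')
    {f g : V ⊗[ℂ] W →ₗ[ℂ] M} (h : ∀ (a : ℂ) (v : V) (b : ℂ) (w : W), T v = a • v → T' w = b • w →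
      f (v ⊗ₜ w) = g (v ⊗ₜ w)) : f = g := by
  apply TensorProduct.ext
  refine hT.ext fun a v hv => hT'.ext fun b w hw => ?_
  simpa using h a v b w hv hw

theorem IsDiag.of_map {T : Module.End ℂ V} (hT : IsDiag T) {S : Module.End ℂ W} (f : V →ₗ[ℂ] W)
    (hf : Function.Surjective f) (h : ∀ v, S (f v) = f (T v)) : IsDiag S := by
  rw [isDiag_iff]
  intro P hP
  have : P.comap f = ⊤ := (isDiag_iff T).1 hT _ fun μ v hv => hP μ _ (by rw [h, hv, map_smul])
  rw [eq_top_iff]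
  intro w _
  obtain ⟨v, rfl⟩ := hf w
  have : v ∈ P.comap f := this ▸ Submodule.mem_top
  exact this

theorem IsDiag.tensor {T : Module.End ℂ V} (hT : IsDiag T) {T' : Module.End ℂ W} (hT' : IsDiag T')
    {S : Module.End ℂ (V ⊗[ℂ] W)} (c : ℂ → ℂ → ℂ)
    (h : ∀ (a : ℂ) (v : V) (b : ℂ) (w : W), T v = a • v → T' w = b • w →
      S (v ⊗ₜ w) = c a b • (v ⊗ₜ w)) : IsDiag S := by
  rw [isDiag_iff]
  intro P hP
  have : P.mkQ = 0 := hT.ext₂ hT' fun a v b w hv hw => by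
    simpa using hP _ _ (h a v b w hv hw)
  rw [← Submodule.ker_mkQ P, this, LinearMap.ker_zero]

theorem exists_glue {T : Module.End ℂ V} (hT : IsDiag T) (f : ℂ → V →ₗ[ℂ] M) :
    ∃ g : V →ₗ[ℂ] M, ∀ (μ : ℂ) (v : V), T v = μ • v → g v = f μ v := by
  classical
  have hi : DirectSum.IsInternal (fun μ => T.eigenspace μ) :=
    (DirectSum.isInternal_submodule_iff_iSupIndep_and_iSup_eq_top _).2
      ⟨T.eigenspaces_iSupIndep, hT⟩
  let e := LinearEquiv.ofBijective (DirectSum.coeLinearMap fun μ => T.eigenspace μ) hi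
  refine ⟨(DirectSum.toModule ℂ ℂ M fun μ => (f μ).comp (T.eigenspace μ).subtype).comp
    e.symm.toLinearMap, fun μ v hv => ?_⟩
  have hv' : v ∈ T.eigenspace μ := Module.End.mem_eigenspace_iff.2 hv
  have : e (DirectSum.lof ℂ ℂ (fun μ => T.eigenspace μ) μ ⟨v, hv'⟩) = v := by
    exact DirectSum.coeLinearMap_lof (fun μ => T.eigenspace μ) μ ⟨v, hv'⟩
  have h2 : e.symm v = DirectSum.lof ℂ ℂ (fun μ => T.eigenspace μ) μ ⟨v, hv'⟩ := by
    rw [LinearEquiv.symm_apply_eq, this]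
  simp [h2]

open Classical in
/-- The linear map which is equal to `f μ` on the eigenspace of `T` for the eigenvalue `μ`. -/
def glue (T : Module.End ℂ V) (f : ℂ → V →ₗ[ℂ] M) : V →ₗ[ℂ] M :=
  if h : ∃ g : V →ₗ[ℂ] M, ∀ (μ : ℂ) (v : V), T v = μ • v → g v = f μ v then h.choose else 0

theorem glue_apply {T : Module.End ℂ V} (hT : IsDiag T) (f : ℂ → V →ₗ[ℂ] M) {μ : ℂ} {v : V}
    (hv : T v = μ • v) : glue T f v = f μ v := by
  have h := exists_glue hT f
  rw [glue, dif_pos h]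
  exact h.choose_spec μ v hv

/-- The bilinear map `(v, w) ↦ exp(κ μ ν) B(v, w)` for eigenvectors `v`, `w` with eigenvalues
`μ`, `ν`. -/
def tw (κ : ℂ) (T : Module.End ℂ V) (S : Module.End ℂ W) (B : V →ₗ[ℂ] W →ₗ[ℂ] M) :
    V →ₗ[ℂ] W →ₗ[ℂ] M :=
  glue T fun μ => B.compl₂ (glue S fun ν => Complex.exp (κ * μ * ν) • LinearMap.id)

theorem tw_apply (κ : ℂ) {T : Module.End ℂ V} (hT : IsDiag T) {S : Module.End ℂ W} (hS : IsDiag S)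
    (B : V →ₗ[ℂ] W →ₗ[ℂ] M) {μ ν : ℂ} {v : V} {w : W} (hv : T v = μ • v) (hw : S w = ν • w) :
    tw κ T S B v w = Complex.exp (κ * μ * ν) • B v w := by
  simp [tw, glue_apply hT _ hv, glue_apply hS _ hw]

/-- `φ(T)` for a diagonalisable endomorphism `T` and a function `φ` on the complex numbers. -/
def fcalc (T : Module.End ℂ V) (φ : ℂ → ℂ) : Module.End ℂ V := glue T fun μ => φ μ • LinearMap.id

theorem fcalc_apply {T : Module.End ℂ V} (hT : IsDiag T) (φ : ℂ → ℂ) {μ : ℂ} {v : V}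
    (hv : T v = μ • v) : fcalc T φ v = φ μ • v := by
  simp [fcalc, glue_apply hT _ hv]

/-- The diagonal endomorphism of `ι →₀ ℂ` with eigenvalues `d`. -/
def diagEnd {ι : Type} (d : ι → ℂ) : Module.End ℂ (ι →₀ ℂ) :=
  Finsupp.lsum ℂ fun i => d i • Finsupp.lsingle i

@[simp] theorem diagEnd_single {ι : Type} (d : ι → ℂ) (i : ι) (c : ℂ) :
    diagEnd d (Finsupp.single i c) = d i • Finsupp.single i c := by
  simp [diagEnd]

theorem diagEnd_apply {ι : Type} (d : ι → ℂ) (v : ι →₀ ℂ) (i : ι) :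
    diagEnd d v i = d i * v i := by
  classical
  induction v using Finsupp.induction_linear with
  | zero => simp
  | add v w hv hw => simp [hv, hw, mul_add]
  | single j c =>
    rw [diagEnd_single]
    by_cases h : j = i
    · subst h; simp
    · simp [h]

theorem isDiag_diagEnd {ι : Type} (d : ι → ℂ) : IsDiag (diagEnd d) := by
  rw [isDiag_iff]
  intro P hP
  have : P.mkQ = 0 := by
    ext i
    simpa using hP _ _ (diagEnd_single d i 1)
  rw [← Submodule.ker_mkQ P, this, LinearMap.ker_zero]

end Diag


/-- A vector space with a diagonalisable endomorphism `h`. -/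
structure HVect where
  V : Type
  [acg : AddCommGroup V]
  [mod : Module ℂ V]
  h : Module.End ℂ V
  diag : IsDiag h

attribute [instance] HVect.acg HVect.mod

/-! ### The algebra `A_r` and its bimodules -/

/-- The underlying algebra of `A_r`: it has the basis `δ_n = single n 1`, `n ∈ ℤ`, and the
product `δ_m δ_n = δ_{m+n}`. -/
abbrev Alg : Type := AddMonoidAlgebra ℂ ℤ

/-- The endomorphism `h` on `A_r`, given by `h δ_n = (n r) δ_n`. -/
def algH (r : ℂ) : Module.End ℂ Alg :=
  (AddMonoidAlgebra.coeffLinearEquiv ℂ).symm.toLinearMap ∘ₗ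
    diagEnd (fun n : ℤ => (n : ℂ) * r) ∘ₗ (AddMonoidAlgebra.coeffLinearEquiv ℂ).toLinearMap

/-- The basis element `δ_n`. -/
def dl (n : ℤ) : Alg := AddMonoidAlgebra.single n 1

theorem dl_mul (m n : ℤ) : dl m * dl n = dl (m + n) := by
  simp [dl, AddMonoidAlgebra.single_mul_single, -LaurentPolynomial.single_eq_C_mul_T]

theorem dl_zero : dl 0 = 1 := rfl

theorem Alg.ind {P : Alg → Prop} (a : Alg) (h0 : P 0) (h1 : ∀ (c : ℂ) (n : ℤ), P (c • dl n))
    (h2 : ∀ a b, P a → P b → P (a + b)) : P a := by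
  induction a using AddMonoidAlgebra.induction_linear with
  | zero => exact h0
  | add x y hx hy => exact h2 x y hx hy
  | single n c =>
    have : (AddMonoidAlgebra.single n c : Alg) = c • dl n := by
      rw [dl, AddMonoidAlgebra.smul_single, smul_eq_mul, mul_one]
    rw [this]
    exact h1 c n

theorem Alg.ext {M : Type} [AddCommGroup M] [Module ℂ M] {f g : Alg →ₗ[ℂ] M}
    (h : ∀ n, f (dl n) = g (dl n)) : f = g := by
  refine LinearMap.ext fun a => ?_
  induction a using Alg.ind with
  | h0 => simp
  | h1 c n => rw [map_smul, map_smul, h]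
  | h2 a b ha hb => rw [map_add, map_add, ha, hb]

theorem algH_dl (r : ℂ) (n : ℤ) : algH r (dl n) = ((n : ℂ) * r) • dl n := by
  rw [dl, algH, LinearMap.comp_apply, LinearMap.comp_apply]
  erw [diagEnd_single (fun n : ℤ => (n : ℂ) * r) n 1]
  rfl

theorem algH_diag (r : ℂ) : IsDiag (algH r) := by
  rw [isDiag_iff]
  intro P hP
  have : P.mkQ = 0 := Alg.ext fun n => by
    simpa using hP _ _ (algH_dl r n)
  rw [← Submodule.ker_mkQ P, this, LinearMap.ker_zero]

theorem algH_mul (r : ℂ) (a b : Alg) : algH r (a * b) = algH r a * b + a * algH r b := by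
  have : (algH r).comp (LinearMap.mul' ℂ Alg) = (LinearMap.mul' ℂ Alg).comp
      (TensorProduct.map (algH r) LinearMap.id + TensorProduct.map LinearMap.id (algH r)) := by
    apply TensorProduct.ext
    refine Alg.ext fun m => LinearMap.ext fun b => ?_
    revert b
    refine LinearMap.congr_fun (Alg.ext fun n => ?_)
    change algH r (LinearMap.mul' ℂ Alg (dl m ⊗ₜ dl n)) = LinearMap.mul' ℂ Alg
      (algH r (dl m) ⊗ₜ dl n + dl m ⊗ₜ algH r (dl n))
    simp only [LinearMap.mul'_apply, dl_mul, algH_dl, map_add, smul_mul_assoc, mul_smul_comm,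
      ← add_smul]
    push_cast
    ring_nf
  simpa using LinearMap.congr_fun this (a ⊗ₜ b)

/-- A bimodule over the commutative algebra `A_r` in the category of vector spaces with
diagonalisable endomorphism `h`, whose tensor product carries the endomorphism `h ⊗ 1 + 1 ⊗ h`:
the left action `lact` and the right action `ract` are actions by morphisms
`A_r ⊗ V → V` and `V ⊗ A_r → V`, that is, they are compatible with `h`. -/
structure Bim (r : ℂ) where
  V : Type
  [acg : AddCommGroup V]
  [mod : Module ℂ V]
  h : Module.End ℂ V
  diag : IsDiag h
  lact : Alg →ₐ[ℂ] Module.End ℂ V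
  ract : Alg →ₐ[ℂ] Module.End ℂ V
  middle : ∀ a b v, lact a (ract b v) = ract b (lact a v)
  h_lact : ∀ a v, h (lact a v) = lact (algH r a) v + lact a (h v)
  h_ract : ∀ a v, h (ract a v) = ract (algH r a) v + ract a (h v)

attribute [instance] Bim.acg Bim.mod

namespace Bim

variable {r : ℂ}

/-- A homomorphism of bimodules. -/
@[ext]
structure Hom (X Y : Bim r) where
  lin : X.V →ₗ[ℂ] Y.V
  comm_h : ∀ v, lin (X.h v) = Y.h (lin v)
  comm_l : ∀ a v, lin (X.lact a v) = Y.lact a (lin v)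
  comm_r : ∀ a v, lin (X.ract a v) = Y.ract a (lin v)

attribute [simp] Hom.comm_h Hom.comm_l Hom.comm_r

instance : Category (Bim r) where
  Hom := Hom
  id X := ⟨LinearMap.id, fun _ => rfl, fun _ _ => rfl, fun _ _ => rfl⟩
  comp f g := ⟨g.lin.comp f.lin, fun v => by simp, fun a v => by simp, fun a v => by simp⟩

theorem hom_ext {X Y : Bim r} {f g : X ⟶ Y} (h : f.lin = g.lin) : f = g := Hom.ext h

@[simp] theorem id_lin (X : Bim r) : (𝟙 X : X ⟶ X).lin = LinearMap.id := rfl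
@[simp] theorem comp_lin {X Y Z : Bim r} (f : X ⟶ Y) (g : Y ⟶ Z) :
    (f ≫ g).lin = g.lin.comp f.lin := rfl

/-- A bijective homomorphism of bimodules is an isomorphism. -/
@[simps]
def isoMk {X Y : Bim r} (f : X ⟶ Y) (g : Y.V →ₗ[ℂ] X.V) (h1 : g.comp f.lin = LinearMap.id)
    (h2 : f.lin.comp g = LinearMap.id) : X ≅ Y :=
  have k1 : ∀ x, g (f.lin x) = x := LinearMap.congr_fun h1
  have k2 : ∀ x, f.lin (g x) = x := LinearMap.congr_fun h2
  { hom := f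
    inv := ⟨g, fun v => by rw [← k1 (X.h (g v))]; simp [k2],
      fun a v => by rw [← k1 (X.lact a (g v))]; simp [k2],
      fun a v => by rw [← k1 (X.ract a (g v))]; simp [k2]⟩
    hom_inv_id := hom_ext h1
    inv_hom_id := hom_ext h2 }

/-! The sum of bimodule homomorphisms -/

instance (X Y : Bim r) : Zero (X ⟶ Y) := ⟨⟨0, by simp, by simp, by simp⟩⟩
instance (X Y : Bim r) : Add (X ⟶ Y) :=
  ⟨fun f g => ⟨f.lin + g.lin, by simp, by simp, by simp⟩⟩
instance (X Y : Bim r) : Neg (X ⟶ Y) := ⟨fun f => ⟨-f.lin, by simp, by simp, by simp⟩⟩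
instance (X Y : Bim r) : Sub (X ⟶ Y) :=
  ⟨fun f g => ⟨f.lin - g.lin, by simp, by simp, by simp⟩⟩
instance (X Y : Bim r) : SMul ℕ (X ⟶ Y) :=
  ⟨fun n f => ⟨n • f.lin, by simp, by simp, by simp⟩⟩
instance (X Y : Bim r) : SMul ℤ (X ⟶ Y) :=
  ⟨fun n f => ⟨n • f.lin, by simp, by simp, by simp⟩⟩

instance (X Y : Bim r) : AddCommGroup (X ⟶ Y) :=
  Function.Injective.addCommGroup (fun f : X ⟶ Y => f.lin) (fun _ _ => hom_ext) rfl
    (fun _ _ => rfl) (fun _ => rfl) (fun _ _ => rfl) (fun _ _ => rfl) (fun _ _ => rfl)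

@[simp] theorem add_lin {X Y : Bim r} (f g : X ⟶ Y) : (f + g).lin = f.lin + g.lin := rfl

instance : Preadditive (Bim r) where
  add_comp _ _ _ _ _ _ := by apply hom_ext; simp [LinearMap.comp_add]
  comp_add _ _ _ _ _ _ := by apply hom_ext; simp [LinearMap.add_comp]

/-! The tensor product over `A_r` -/

section Tensor

variable (X Y : Bim r)

/-- The relations `x a ⊗ y = x ⊗ a y`. -/
def rel : Submodule ℂ (X.V ⊗[ℂ] Y.V) :=
  Submodule.span ℂ {t | ∃ x a y, t = X.ract a x ⊗ₜ[ℂ] y - x ⊗ₜ[ℂ] Y.lact a y}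

/-- The tensor product over `A_r` as a vector space. -/
abbrev T : Type := (X.V ⊗[ℂ] Y.V) ⧸ rel X Y

variable {X Y}

/-- The element `x ⊗ y` of the tensor product over `A_r`. -/
def tm₀ : X.V →ₗ[ℂ] Y.V →ₗ[ℂ] T X Y := (TensorProduct.mk ℂ X.V Y.V).compr₂ (rel X Y).mkQ

theorem tm₀_balanced (x : X.V) (a : Alg) (y : Y.V) :
    tm₀ (X.ract a x) y = tm₀ x (Y.lact a y) := by
  simp only [tm₀, LinearMap.compr₂_apply, TensorProduct.mk_apply, Submodule.mkQ_apply]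
  rw [Submodule.Quotient.eq]
  exact Submodule.subset_span ⟨x, a, y, rfl⟩

variable {M : Type} [AddCommGroup M] [Module ℂ M]

/-- The linear map on the tensor product induced by a balanced bilinear map. -/
def lift₀ (B : X.V →ₗ[ℂ] Y.V →ₗ[ℂ] M)
    (hB : ∀ x a y, B (X.ract a x) y = B x (Y.lact a y)) : T X Y →ₗ[ℂ] M :=
  (rel X Y).liftQ (TensorProduct.lift B) (by
    rw [rel, Submodule.span_le]
    rintro _ ⟨x, a, y, rfl⟩
    simp [hB])

@[simp] theorem lift₀_tm (B : X.V →ₗ[ℂ] Y.V →ₗ[ℂ] M)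
    (hB : ∀ x a y, B (X.ract a x) y = B x (Y.lact a y)) (x : X.V) (y : Y.V) :
    lift₀ B hB (tm₀ x y) = B x y := by
  simp [lift₀, tm₀]

theorem T.ext {f g : T X Y →ₗ[ℂ] M} (h : ∀ x y, f (tm₀ x y) = g (tm₀ x y)) : f = g := by
  apply Submodule.linearMap_qext
  apply TensorProduct.ext
  ext x y
  exact h x y

theorem T.ext_apply {f g : T X Y →ₗ[ℂ] M} (h : ∀ x y, f (tm₀ x y) = g (tm₀ x y)) (t : T X Y) :
    f t = g t := LinearMap.congr_fun (T.ext h) t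

variable (X Y)

/-- The endomorphism `h ⊗ 1 + 1 ⊗ h`. -/
def tensH : Module.End ℂ (T X Y) :=
  lift₀ (tm₀.comp X.h + tm₀.compl₂ Y.h) fun x a y => by
    simp [X.h_ract, Y.h_lact, tm₀_balanced, add_left_comm, add_assoc]

@[simp] theorem tensH_tm (x : X.V) (y : Y.V) :
    tensH X Y (tm₀ x y) = tm₀ (X.h x) y + tm₀ x (Y.h y) := by simp [tensH]

theorem tensH_diag : IsDiag (tensH X Y) := by
  let S : Module.End ℂ (X.V ⊗[ℂ] Y.V) :=
    TensorProduct.map X.h LinearMap.id + TensorProduct.map LinearMap.id Y.h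
  have hS : IsDiag S := X.diag.tensor Y.diag (fun a b => a + b) fun a v b w hv hw => by
    simp [S, hv, hw, add_smul, TensorProduct.smul_tmul']
  refine hS.of_map (rel X Y).mkQ (Submodule.mkQ_surjective _) fun v => ?_
  have : (tensH X Y).comp (rel X Y).mkQ = (rel X Y).mkQ.comp S := by
    apply TensorProduct.ext
    ext x y
    simp only [S]
    exact tensH_tm X Y x y
  exact LinearMap.congr_fun this v

/-- The left action on the tensor product. -/
def tensL : Alg →ₐ[ℂ] Module.End ℂ (T X Y) := AlgHom.ofLinearMap
    { toFun a := lift₀ (tm₀.comp (X.lact a)) fun x b y => by simp [X.middle, tm₀_balanced]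
      map_add' a b := by apply T.ext; simp
      map_smul' c a := by apply T.ext; simp }
    (by apply T.ext; simp) (fun a b => by apply T.ext; simp)

/-- The right action on the tensor product. -/
def tensR : Alg →ₐ[ℂ] Module.End ℂ (T X Y) := AlgHom.ofLinearMap
    { toFun a := lift₀ (tm₀.compl₂ (Y.ract a)) fun x b y => by simp [← Y.middle, tm₀_balanced]
      map_add' a b := by apply T.ext; simp
      map_smul' c a := by apply T.ext; simp }
    (by apply T.ext; simp) (fun a b => by apply T.ext; simp)

@[simp] theorem tensL_tm (a : Alg) (x : X.V) (y : Y.V) :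
    tensL X Y a (tm₀ x y) = tm₀ (X.lact a x) y := by simp [tensL]

@[simp] theorem tensR_tm (a : Alg) (x : X.V) (y : Y.V) :
    tensR X Y a (tm₀ x y) = tm₀ x (Y.ract a y) := by simp [tensR]

/-- The tensor product of bimodules over `A_r`. -/
def tens : Bim r where
  V := T X Y
  h := tensH X Y
  diag := tensH_diag X Y
  lact := tensL X Y
  ract := tensR X Y
  middle a b v := by
    refine T.ext_apply (f := tensL X Y a ∘ₗ tensR X Y b)
      (g := tensR X Y b ∘ₗ tensL X Y a) (fun x y => ?_) v
    simp
  h_lact a v := by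
    refine T.ext_apply (f := tensH X Y ∘ₗ tensL X Y a)
      (g := tensL X Y (algH r a) + tensL X Y a ∘ₗ tensH X Y) (fun x y => ?_) v
    simp [X.h_lact, add_assoc]
  h_ract a v := by
    refine T.ext_apply (f := tensH X Y ∘ₗ tensR X Y a)
      (g := tensR X Y (algH r a) + tensR X Y a ∘ₗ tensH X Y) (fun x y => ?_) v
    simp [Y.h_ract, add_left_comm]

variable {X Y}

/-- The element `x ⊗ y` of the tensor product over `A_r`. -/
def tm : X.V →ₗ[ℂ] Y.V →ₗ[ℂ] (tens X Y).V := tm₀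

theorem tm_balanced (x : X.V) (a : Alg) (y : Y.V) :
    tm (X.ract a x) y = tm x (Y.lact a y) := tm₀_balanced x a y

@[simp] theorem h_tm (x : X.V) (y : Y.V) :
    (tens X Y).h (tm x y) = tm (X.h x) y + tm x (Y.h y) := tensH_tm X Y x y

@[simp] theorem lact_tm (a : Alg) (x : X.V) (y : Y.V) :
    (tens X Y).lact a (tm x y) = tm (X.lact a x) y := tensL_tm X Y a x y

@[simp] theorem ract_tm (a : Alg) (x : X.V) (y : Y.V) :
    (tens X Y).ract a (tm x y) = tm x (Y.ract a y) := tensR_tm X Y a x y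

/-- The linear map on the tensor product induced by a balanced bilinear map. -/
def lift (B : X.V →ₗ[ℂ] Y.V →ₗ[ℂ] M)
    (hB : ∀ x a y, B (X.ract a x) y = B x (Y.lact a y)) : (tens X Y).V →ₗ[ℂ] M := lift₀ B hB

@[simp] theorem lift_tm (B : X.V →ₗ[ℂ] Y.V →ₗ[ℂ] M)
    (hB : ∀ x a y, B (X.ract a x) y = B x (Y.lact a y)) (x : X.V) (y : Y.V) :
    lift B hB (tm x y) = B x y := lift₀_tm B hB x y

theorem lin_ext {f g : (tens X Y).V →ₗ[ℂ] M} (h : ∀ x y, f (tm x y) = g (tm x y)) : f = g :=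
  T.ext h

theorem lin_ext_apply {f g : (tens X Y).V →ₗ[ℂ] M} (h : ∀ x y, f (tm x y) = g (tm x y))
    (t : (tens X Y).V) : f t = g t := LinearMap.congr_fun (lin_ext h) t

theorem thom_ext {Z : Bim r} {f g : tens X Y ⟶ Z}
    (h : ∀ x y, f.lin (tm x y) = g.lin (tm x y)) : f = g := hom_ext (lin_ext h)

theorem tens_ind {P : (tens X Y).V → Prop} (t : (tens X Y).V) (h0 : P 0)
    (h1 : ∀ x y, P (tm x y)) (h2 : ∀ t s, P t → P s → P (t + s)) : P t := by
  obtain ⟨t, rfl⟩ := Submodule.mkQ_surjective (rel X Y) t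
  induction t using TensorProduct.induction_on with
  | zero => simpa using! h0
  | tmul x y => exact h1 x y
  | add t s ht hs => simpa using! h2 _ _ ht hs

/-- A homomorphism out of a tensor product, from an equivariant balanced bilinear map. -/
def liftHom {Z : Bim r} (B : X.V →ₗ[ℂ] Y.V →ₗ[ℂ] Z.V)
    (hB : ∀ x a y, B (X.ract a x) y = B x (Y.lact a y))
    (hh : ∀ x y, B (X.h x) y + B x (Y.h y) = Z.h (B x y))
    (hl : ∀ a x y, B (X.lact a x) y = Z.lact a (B x y))
    (hr : ∀ a x y, B x (Y.ract a y) = Z.ract a (B x y)) : tens X Y ⟶ Z where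
  lin := lift B hB
  comm_h := lin_ext_apply (f := lift B hB ∘ₗ (tens X Y).h) (g := Z.h ∘ₗ lift B hB) (by simp [hh])
  comm_l a := lin_ext_apply (f := lift B hB ∘ₗ (tens X Y).lact a) (g := Z.lact a ∘ₗ lift B hB)
    (by simp [hl])
  comm_r a := lin_ext_apply (f := lift B hB ∘ₗ (tens X Y).ract a) (g := Z.ract a ∘ₗ lift B hB)
    (by simp [hr])

@[simp] theorem liftHom_tm {Z : Bim r} (B : X.V →ₗ[ℂ] Y.V →ₗ[ℂ] Z.V) (hB hh hl hr)
    (x : X.V) (y : Y.V) : (liftHom (Z := Z) B hB hh hl hr).lin (tm x y) = B x y := lift_tm B hB x y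

/-- The tensor product of homomorphisms. -/
def mapHom {X' Y' : Bim r} (f : X ⟶ X') (g : Y ⟶ Y') : tens X Y ⟶ tens X' Y' :=
  liftHom ((tm.comp f.lin).compl₂ g.lin) (fun x a y => by simp [tm_balanced]) (by simp) (by simp)
    (by simp)

@[simp] theorem mapHom_tm {X' Y' : Bim r} (f : X ⟶ X') (g : Y ⟶ Y') (x : X.V) (y : Y.V) :
    (mapHom f g).lin (tm x y) = tm (f.lin x) (g.lin y) := liftHom_tm _ _ _ _ _ x y

end Tensor

/-- The tensor unit `A_r`. -/
def one (r : ℂ) : Bim r where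
  V := Alg
  h := algH r
  diag := algH_diag r
  lact := Algebra.lmul ℂ Alg
  ract := Algebra.lmul ℂ Alg
  middle a b v := by simp [mul_left_comm]
  h_lact a v := by simp [algH_mul]
  h_ract a v := by simp [algH_mul]



/-- An element of `A_r` as an element of the tensor unit. -/
def uu : Alg →ₗ[ℂ] (one r).V := LinearMap.id

theorem one_forall {P : (one r).V → Prop} : (∀ a, P a) ↔ ∀ a : Alg, P (uu a) := Iff.rfl

@[simp] theorem one_h (a : Alg) : (one r).h (uu a) = uu (algH r a) := rfl
@[simp] theorem one_lact (a b : Alg) : (one r).lact a (uu b) = uu (a * b) := rfl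
@[simp] theorem one_ract (a b : Alg) : (one r).ract a (uu b) = uu (a * b) := rfl

/-- `(a, x) ↦ a x` -/
def lactU (X : Bim r) : (one r).V →ₗ[ℂ] X.V →ₗ[ℂ] X.V := X.lact.toLinearMap

@[simp] theorem lactU_uu (X : Bim r) (a : Alg) (x : X.V) : lactU X (uu a) x = X.lact a x := rfl

/-- `(x, a) ↦ x a` -/
def ractU (X : Bim r) : X.V →ₗ[ℂ] (one r).V →ₗ[ℂ] X.V :=
  LinearMap.flip (M := (one r).V) X.ract.toLinearMap

@[simp] theorem ractU_uu (X : Bim r) (a : Alg) (x : X.V) : ractU X x (uu a) = X.ract a x := rfl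

theorem lact_comm (X : Bim r) (a b : Alg) (x : X.V) :
    X.lact a (X.lact b x) = X.lact b (X.lact a x) := by
  rw [← Module.End.mul_apply, ← map_mul, mul_comm, map_mul, Module.End.mul_apply]

theorem ract_comm (X : Bim r) (a b : Alg) (x : X.V) :
    X.ract a (X.ract b x) = X.ract b (X.ract a x) := by
  rw [← Module.End.mul_apply, ← map_mul, mul_comm, map_mul, Module.End.mul_apply]

/-- `(x ⊗ y, z) ↦ x ⊗ (y ⊗ z)` -/
def assocB (X Y Z : Bim r) : (tens X Y).V →ₗ[ℂ] Z.V →ₗ[ℂ] (tens X (tens Y Z)).V :=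
  lift (LinearMap.mk₂ ℂ (fun x y => (tm x).comp (tm y))
    (by intros; ext; simp) (by intros; ext; simp) (by intros; ext; simp) (by intros; ext; simp))
    (fun x a y => by ext z; simp [tm_balanced])

@[simp] theorem assocB_tm (X Y Z : Bim r) (x : X.V) (y : Y.V) (z : Z.V) :
    assocB X Y Z (tm x y) z = tm x (tm y z) := by simp [assocB]

/-- `(x, y ⊗ z) ↦ (x ⊗ y) ⊗ z` -/
def assocB' (X Y Z : Bim r) : X.V →ₗ[ℂ] (tens Y Z).V →ₗ[ℂ] (tens (tens X Y) Z).V :=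
  (lift (LinearMap.mk₂ ℂ (fun y z => (tm.flip z).comp (tm.flip y))
    (by intros; ext; simp) (by intros; ext; simp) (by intros; ext; simp) (by intros; ext; simp))
    (fun y a z => by ext x; simp [← tm_balanced])).flip

@[simp] theorem assocB'_tm (X Y Z : Bim r) (x : X.V) (y : Y.V) (z : Z.V) :
    assocB' X Y Z x (tm y z) = tm (tm x y) z := by simp [assocB']

/-- The associativity isomorphism `(x ⊗ y) ⊗ z ↦ x ⊗ (y ⊗ z)`. -/
def assoc (X Y Z : Bim r) : tens (tens X Y) Z ≅ tens X (tens Y Z) := isoMk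
  (liftHom (assocB X Y Z)
    (fun t a z => by
      induction t using tens_ind with
      | h0 => simp
      | h1 => simp [tm_balanced]
      | h2 t s ht hs => simp only [map_add, LinearMap.add_apply, ht, hs])
    (fun t z => by
      induction t using tens_ind with
      | h0 => simp
      | h1 => simp [add_assoc]
      | h2 t s ht hs => simp only [map_add, LinearMap.add_apply, ← ht, ← hs]; abel)
    (fun a t z => by
      induction t using tens_ind with
      | h0 => simp
      | h1 => simp
      | h2 t s ht hs => simp only [map_add, LinearMap.add_apply, ht, hs])
    (fun a t z => by
      induction t using tens_ind with
      | h0 => simp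
      | h1 => simp
      | h2 t s ht hs => simp only [map_add, LinearMap.add_apply, ht, hs]))
  (lift (assocB' X Y Z)
    (fun x a t => by
      induction t using tens_ind with
      | h0 => simp
      | h1 => simp [tm_balanced]
      | h2 t s ht hs => simp only [map_add, ht, hs]))
  (lin_ext fun t z => by
    induction t using tens_ind with
    | h0 => simp
    | h1 => simp
    | h2 t s ht hs => simp_all)
  (lin_ext fun x t => by
    induction t using tens_ind with
    | h0 => simp
    | h1 => simp
    | h2 t s ht hs => simp_all)

@[simp] theorem assoc_tm (X Y Z : Bim r) (x : X.V) (y : Y.V) (z : Z.V) :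
    (assoc X Y Z).hom.lin (tm (tm x y) z) = tm x (tm y z) := by simp [assoc]

@[simp] theorem assoc_inv_tm (X Y Z : Bim r) (x : X.V) (y : Y.V) (z : Z.V) :
    (assoc X Y Z).inv.lin (tm x (tm y z)) = tm (tm x y) z := by simp [assoc]

/-- The left unit isomorphism `a ⊗ x ↦ a x`. -/
def lunit (X : Bim r) : tens (one r) X ≅ X := isoMk
  (liftHom (lactU X) (fun a b x => by revert a; simp [one_forall, lact_comm])
    (fun a x => by revert a; simp [one_forall, X.h_lact])
    (fun b a x => by revert a; simp [one_forall])
    (fun b a x => by revert a; simp [one_forall, X.middle]))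
  (tm (uu 1))
  (lin_ext (by simp [one_forall, ← tm_balanced]))
  (by ext x; simp)

@[simp] theorem lunit_tm (X : Bim r) (a : Alg) (x : X.V) :
    (lunit X).hom.lin (tm (uu a) x) = X.lact a x := by simp [lunit]

/-- The right unit isomorphism `x ⊗ a ↦ x a`. -/
def runit (X : Bim r) : tens X (one r) ≅ X := isoMk
  (liftHom (ractU X) (fun x a b => by revert b; simp [one_forall, ract_comm])
    (fun x a => by revert a; simp [one_forall, X.h_ract, add_comm])
    (fun b x a => by revert a; simp [one_forall, X.middle])
    (fun b x a => by revert a; simp [one_forall]))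
  (tm.flip (uu 1))
  (lin_ext (by simp [one_forall, tm_balanced]))
  (by ext x; simp)

@[simp] theorem runit_tm (X : Bim r) (a : Alg) (x : X.V) :
    (runit X).hom.lin (tm x (uu a)) = X.ract a x := by simp [runit]

theorem thom_ext₃ {X Y Z W : Bim r} {f g : tens (tens X Y) Z ⟶ W}
    (h : ∀ x y z, f.lin (tm (tm x y) z) = g.lin (tm (tm x y) z)) : f = g :=
  thom_ext fun t z => by
    induction t using tens_ind with
    | h0 => simp
    | h1 x y => exact h x y z
    | h2 t s ht hs => simp only [map_add, LinearMap.add_apply, ht, hs]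

theorem thom_ext₃' {X Y Z W : Bim r} {f g : tens X (tens Y Z) ⟶ W}
    (h : ∀ x y z, f.lin (tm x (tm y z)) = g.lin (tm x (tm y z))) : f = g :=
  thom_ext fun x t => by
    induction t using tens_ind with
    | h0 => simp
    | h1 y z => exact h x y z
    | h2 t s ht hs => simp only [map_add, ht, hs]

theorem thom_ext₄ {X Y Z W M : Bim r} {f g : tens (tens (tens X Y) Z) W ⟶ M}
    (h : ∀ x y z w, f.lin (tm (tm (tm x y) z) w) = g.lin (tm (tm (tm x y) z) w)) : f = g :=
  thom_ext₃ fun t z w => by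
    induction t using tens_ind with
    | h0 => simp
    | h1 x y => exact h x y z w
    | h2 t s ht hs => simp only [map_add, LinearMap.add_apply, ht, hs]

instance : MonoidalCategory (Bim r) where
  tensorObj := tens
  tensorUnit := one r
  tensorHom f g := mapHom f g
  whiskerLeft X _ _ f := mapHom (𝟙 X) f
  whiskerRight f X := mapHom f (𝟙 X)
  associator := assoc
  leftUnitor := lunit
  rightUnitor := runit
  tensorHom_def f g := thom_ext (by simp)
  id_tensorHom_id _ _ := thom_ext (by simp)
  tensorHom_comp_tensorHom _ _ _ _ := thom_ext (by simp)
  whiskerLeft_id _ _ := thom_ext (by simp)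
  id_whiskerRight _ _ := thom_ext (by simp)
  associator_naturality _ _ _ := thom_ext₃ (by simp)
  leftUnitor_naturality _ := thom_ext (by simp [one_forall])
  rightUnitor_naturality _ := thom_ext (by simp [one_forall])
  pentagon _ _ _ _ := thom_ext₄ (by simp)
  triangle _ _ := thom_ext₃ (by simp [one_forall, tm_balanced])

/-! Elementwise description of the monoidal structure -/

section Elements

variable {X Y Z X' Y' : Bim r}

/-- The element `x ⊗ y` of the tensor product over `A_r`. -/
def tmul (x : X.V) (y : Y.V) : (X ⊗ Y : Bim r).V := tm x y

theorem tmul_balanced (x : X.V) (a : Alg) (y : Y.V) :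
    tmul (X.ract a x) y = tmul x (Y.lact a y) := tm₀_balanced x a y

theorem tmul_smul (c : ℂ) (x : X.V) (y : Y.V) : tmul x (c • y) = c • tmul x y :=
  map_smul (tm x) c y

theorem smul_tmul (c : ℂ) (x : X.V) (y : Y.V) : tmul (c • x) y = c • tmul x y :=
  LinearMap.map_smul₂ tm c x y

theorem h_tmul (x : X.V) (y : Y.V) : (X ⊗ Y).h (tmul x y) = tmul (X.h x) y + tmul x (Y.h y) :=
  h_tm x y

theorem lact_tmul (a : Alg) (x : X.V) (y : Y.V) :
    (X ⊗ Y).lact a (tmul x y) = tmul (X.lact a x) y := lact_tm a x y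

theorem ract_tmul (a : Alg) (x : X.V) (y : Y.V) :
    (X ⊗ Y).ract a (tmul x y) = tmul x (Y.ract a y) := ract_tm a x y

@[simp] theorem whiskerLeft_tmul (f : Y ⟶ Y') (x : X.V) (y : Y.V) :
    (X ◁ f).lin (tmul x y) = tmul x (f.lin y) := mapHom_tm (𝟙 X) f x y

@[simp] theorem whiskerRight_tmul (f : X ⟶ X') (x : X.V) (y : Y.V) :
    (f ▷ Y).lin (tmul x y) = tmul (f.lin x) y := mapHom_tm f (𝟙 Y) x y

@[simp] theorem associator_tmul (x : X.V) (y : Y.V) (z : Z.V) :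
    (α_ X Y Z).hom.lin (tmul (tmul x y) z) = tmul x (tmul y z) := assoc_tm X Y Z x y z

@[simp] theorem associator_inv_tmul (x : X.V) (y : Y.V) (z : Z.V) :
    (α_ X Y Z).inv.lin (tmul x (tmul y z)) = tmul (tmul x y) z := assoc_inv_tm X Y Z x y z

end Elements

end Bim
end CBoson

end

noncomputable section

namespace CBoson

/-! ### Induced bimodules and their half-braidings -/

theorem fcalc_mul {V : Type} [AddCommGroup V] [Module ℂ V] {T : Module.End ℂ V} (hT : IsDiag T)
    (φ ψ : ℂ → ℂ) : fcalc T (fun z => φ z * ψ z) = fcalc T φ * fcalc T ψ :=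
  hT.ext fun μ v hv => by
    simp [fcalc_apply hT _ hv, smul_smul, mul_comm]

theorem fcalc_one {V : Type} [AddCommGroup V] [Module ℂ V] {T : Module.End ℂ V} (hT : IsDiag T) :
    fcalc T (fun _ => 1) = 1 :=
  hT.ext fun μ v hv => by simp [fcalc_apply hT _ hv]

section Alpha

variable (r κ : ℂ) (E : HVect)

/-- The endomorphism `h ⊗ 1 + 1 ⊗ h` of `A_r ⊗ E`. -/
def alphaH : Module.End ℂ (Alg ⊗[ℂ] E.V) :=
  TensorProduct.map (algH r) LinearMap.id + TensorProduct.map LinearMap.id E.h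

/-- The left action of `A_r` on `A_r ⊗ E`, given by multiplication. -/
def alphaL : Alg →ₐ[ℂ] Module.End ℂ (Alg ⊗[ℂ] E.V) := AlgHom.ofLinearMap
  ((TensorProduct.mapBilinear (RingHom.id ℂ) Alg E.V Alg E.V).flip LinearMap.id ∘ₗ LinearMap.mul ℂ Alg)
  (by ext; simp) (by intros; ext; simp [mul_assoc])

/-- The right action of `A_r` on `A_r ⊗ E`: the braiding `v ⊗ a ↦ exp(κ deg(v) deg(a)) a ⊗ v`,
followed by the multiplication. -/
def alphaR : Alg →ₐ[ℂ] Module.End ℂ (Alg ⊗[ℂ] E.V) :=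
  AddMonoidAlgebra.lift ℂ _ ℤ
    { toFun n := TensorProduct.map (LinearMap.mulLeft ℂ (dl n.toAdd))
        (fcalc E.h fun z => Complex.exp (κ * (n.toAdd * r) * z))
      map_one' := by
        simp [dl_zero, fcalc_one E.diag]; exact TensorProduct.map_id
      map_mul' m n := by
        rw [← TensorProduct.map_mul, ← fcalc_mul E.diag]
        congr 1
        · rw [toAdd_mul, ← dl_mul, LinearMap.mulLeft_mul]; rfl
        · congr 1
          ext z
          rw [← Complex.exp_add, toAdd_mul]
          push_cast
          ring_nf }

theorem alphaH_tmul (a : Alg) (v : E.V) :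
    alphaH r E (a ⊗ₜ v) = algH r a ⊗ₜ v + a ⊗ₜ E.h v := by simp [alphaH]

theorem alphaL_tmul (a b : Alg) (v : E.V) : alphaL E a (b ⊗ₜ v) = (a * b) ⊗ₜ v := by
  simp [alphaL]

theorem alphaR_tmul (n : ℤ) (b : Alg) {μ : ℂ} {v : E.V} (hv : E.h v = μ • v) :
    alphaR r κ E (dl n) (b ⊗ₜ v) = Complex.exp (κ * (n * r) * μ) • (dl n * b) ⊗ₜ v := by
  have : alphaR r κ E (dl n) = _ := AddMonoidAlgebra.lift_single _ n 1
  rw [this]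
  simp [fcalc_apply E.diag _ hv]


variable {E} in
theorem alpha_ind {P : Alg ⊗[ℂ] E.V → Prop} (t : Alg ⊗[ℂ] E.V) (h0 : P 0)
    (h1 : ∀ (n : ℤ) (μ : ℂ) (v : E.V), E.h v = μ • v → P (dl n ⊗ₜ v))
    (h2 : ∀ t s, P t → P s → P (t + s)) : P t := by
  induction t using TensorProduct.induction_on with
  | zero => exact h0
  | add t s ht hs => exact h2 t s ht hs
  | tmul a v =>
    induction a using Alg.ind with
    | h0 => simpa using h0
    | h2 a b ha hb => simpa [TensorProduct.add_tmul] using h2 _ _ ha hb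
    | h1 c n =>
      rw [TensorProduct.smul_tmul]
      induction (c • v) using E.diag.ind with
      | h0 => simpa using h0
      | h1 μ v hv => exact h1 n μ v hv
      | h2 v w hv hw => simpa [TensorProduct.tmul_add] using h2 _ _ hv hw

/-- The bimodule `A_r ⊗ E`, with the left action given by the multiplication and the right action
given by the braiding `v ⊗ a ↦ exp(κ deg(v) deg(a)) a ⊗ v` and the multiplication. -/
def alpha : Bim r where
  V := Alg ⊗[ℂ] E.V
  h := alphaH r E
  diag := (algH_diag r).tensor E.diag (fun a b => a + b) fun a v b w hv hw => by
    simp [alphaH_tmul, hv, hw, add_smul, TensorProduct.smul_tmul']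
  lact := alphaL E
  ract := alphaR r κ E
  middle a b t := by
    induction b using Alg.ind with
    | h0 => simp
    | h2 b c hb hc => simp [hb, hc]
    | h1 c m =>
      induction t using alpha_ind with
      | h0 => simp
      | h2 t s ht hs => simp_all
      | h1 n μ v hv => simp [alphaL_tmul, alphaR_tmul r κ E m _ hv, mul_left_comm]
  h_lact a t := by
    induction t using TensorProduct.induction_on with
    | zero => simp
    | add t s ht hs => simp only [map_add, ht, hs]; abel
    | tmul b v => simp [alphaH_tmul, alphaL_tmul, algH_mul, TensorProduct.add_tmul, add_assoc]
  h_ract a t := by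
    induction a using Alg.ind with
    | h0 => simp
    | h2 b c hb hc => simp only [map_add, LinearMap.add_apply, hb, hc]; abel
    | h1 c m =>
      induction t using alpha_ind with
      | h0 => simp
      | h2 t s ht hs => simp only [map_add, ht, hs]; abel
      | h1 n μ v hv =>
        simp only [alphaH_tmul, alphaR_tmul r κ E m _ hv, algH_mul, map_add,
          algH_dl, hv, map_smul, LinearMap.smul_apply, TensorProduct.tmul_smul,
          TensorProduct.smul_tmul', smul_mul_assoc, mul_smul_comm]
        simp only [← TensorProduct.add_tmul]
        congr 1
        module

/-- The element `a ⊗ v`. -/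
def aa : Alg →ₗ[ℂ] E.V →ₗ[ℂ] (alpha r κ E).V := TensorProduct.mk ℂ Alg E.V

variable {r κ E}

theorem h_aa (a : Alg) {μ : ℂ} {v : E.V} (hv : E.h v = μ • v) :
    (alpha r κ E).h (aa r κ E a v) = aa r κ E (algH r a) v + μ • aa r κ E a v := by
  rw [← map_smul, ← hv]; exact alphaH_tmul r E a v

theorem lact_aa (a b : Alg) (v : E.V) : (alpha r κ E).lact a (aa r κ E b v) = aa r κ E (a * b) v :=
  alphaL_tmul E a b v

theorem ract_aa (n : ℤ) (b : Alg) {μ : ℂ} {v : E.V} (hv : E.h v = μ • v) :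
    (alpha r κ E).ract (dl n) (aa r κ E b v) =
      Complex.exp (κ * (n * r) * μ) • aa r κ E (dl n * b) v :=
  alphaR_tmul r κ E n b hv

theorem aa_ind {P : (alpha r κ E).V → Prop} (t : (alpha r κ E).V) (h0 : P 0)
    (h1 : ∀ (n : ℤ) (μ : ℂ) (v : E.V), E.h v = μ • v → P (aa r κ E (dl n) v))
    (h2 : ∀ t s, P t → P s → P (t + s)) : P t :=
  alpha_ind t h0 h1 h2

variable (r κ E) (X : Bim r)

open Bim

/-- `(a ⊗ v, x) ↦ exp(κ deg(v) deg(x)) a x ⊗ (1 ⊗ v)` -/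
def fwd : (alpha r κ E).V →ₗ[ℂ] X.V →ₗ[ℂ] (tens X (alpha r κ E)).V :=
  TensorProduct.lift (LinearMap.mk₂ ℂ
    (fun a v => (tens X (alpha r κ E)).lact a ∘ₗ tw κ E.h X.h (tm.flip ∘ₗ aa r κ E 1) v)
    (by intros; ext; simp) (by intros; ext; simp) (by intros; ext; simp) (by intros; ext; simp))

/-- `(x, a ⊗ v) ↦ exp(- κ deg(v) deg(x a)) (1 ⊗ v) ⊗ x a` -/
def bwd : X.V →ₗ[ℂ] (alpha r κ E).V →ₗ[ℂ] (tens (alpha r κ E) X).V :=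
  LinearMap.flip (TensorProduct.lift (LinearMap.mk₂ ℂ
    (fun a v => tw (-κ) E.h X.h (tm ∘ₗ aa r κ E 1) v ∘ₗ X.ract a)
    (by intros; ext; simp) (by intros; ext; simp) (by intros; ext; simp) (by intros; ext; simp)))

variable {r κ E X}

theorem fwd_aa (a : Alg) {μ ν : ℂ} {v : E.V} {x : X.V} (hv : E.h v = μ • v) (hx : X.h x = ν • x) :
    fwd r κ E X (aa r κ E a v) x =
      Complex.exp (κ * μ * ν) • tm (X.lact a x) (aa r κ E 1 v) := by
  have : fwd r κ E X (aa r κ E a v) = _ := TensorProduct.lift.tmul a v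
  rw [this]
  simp [tw_apply κ E.diag X.diag _ hv hx]

theorem bwd_aa' (a : Alg) (v : E.V) (x : X.V) : bwd r κ E X x (aa r κ E a v) =
    tw (-κ) E.h X.h (tm ∘ₗ aa r κ E 1) v (X.ract a x) := by
  have : (bwd r κ E X).flip (aa r κ E a v) = _ := TensorProduct.lift.tmul a v
  exact LinearMap.congr_fun this x

theorem bwd_aa (a : Alg) {μ ν : ℂ} {v : E.V} {x : X.V} (hv : E.h v = μ • v)
    (hx : X.h (X.ract a x) = ν • X.ract a x) :
    bwd r κ E X x (aa r κ E a v) =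
      Complex.exp (-κ * μ * ν) • tm (aa r κ E 1 v) (X.ract a x) := by
  rw [bwd_aa', tw_apply (-κ) E.diag X.diag _ hv hx]
  rfl

theorem h_lact_dl (X : Bim r) (n : ℤ) {ν : ℂ} {x : X.V} (hx : X.h x = ν • x) :
    X.h (X.lact (dl n) x) = (n * r + ν) • X.lact (dl n) x := by
  rw [X.h_lact, algH_dl, hx]; simp [add_smul]

theorem h_ract_dl (X : Bim r) (n : ℤ) {ν : ℂ} {x : X.V} (hx : X.h x = ν • x) :
    X.h (X.ract (dl n) x) = (n * r + ν) • X.ract (dl n) x := by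
  rw [X.h_ract, algH_dl, hx]; simp [add_smul]

theorem tm_aa (x : X.V) (a : Alg) (v : E.V) :
    tm x (aa r κ E a v) = tm (X.ract a x) (aa r κ E 1 v) := by
  rw [tm_balanced, lact_aa, mul_one]

theorem aa_tm (n : ℤ) {μ : ℂ} {v : E.V} (hv : E.h v = μ • v) (x : X.V) :
    tm (aa r κ E (dl n) v) x =
      Complex.exp (-(κ * (n * r) * μ)) • tm (aa r κ E 1 v) (X.lact (dl n) x) := by
  rw [← tm_balanced, ract_aa n 1 hv, mul_one, LinearMap.map_smul₂, smul_smul, ← Complex.exp_add]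
  simp

theorem fwd_balanced (t : (alpha r κ E).V) (a : Alg) (x : X.V) :
    fwd r κ E X ((alpha r κ E).ract a t) x = fwd r κ E X t (X.lact a x) := by
  induction a using Alg.ind with
  | h0 => simp
  | h2 a b ha hb => simp only [map_add, LinearMap.add_apply, ha, hb]
  | h1 c m =>
    induction t using aa_ind with
    | h0 => simp
    | h2 t s ht hs => simp only [map_add, LinearMap.add_apply, ht, hs]
    | h1 n μ v hv =>
      induction x using X.diag.ind with
      | h0 => simp
      | h2 t s ht hs => simp only [map_add, ht, hs]
      | h1 ν x hx =>
        simp only [map_smul, LinearMap.smul_apply, ract_aa m _ hv, fwd_aa _ hv hx,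
          fwd_aa _ hv (h_lact_dl X m hx), smul_smul, map_mul, Module.End.mul_apply]
        rw [lact_comm, mul_assoc, ← Complex.exp_add]
        congr 3
        ring

theorem fwd_ract (a : Alg) (t : (alpha r κ E).V) (x : X.V) :
    fwd r κ E X t (X.ract a x) = (tens X (alpha r κ E)).ract a (fwd r κ E X t x) := by
  induction a using Alg.ind with
  | h0 => simp
  | h2 a b ha hb => simp only [map_add, LinearMap.add_apply, ha, hb]
  | h1 c m =>
    induction t using aa_ind with
    | h0 => simp
    | h2 t s ht hs => simp only [map_add, LinearMap.add_apply, ht, hs]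
    | h1 n μ v hv =>
      induction x using X.diag.ind with
      | h0 => simp
      | h2 t s ht hs => simp only [map_add, ht, hs]
      | h1 ν x hx =>
        simp only [map_smul, LinearMap.smul_apply, fwd_aa _ hv hx, ract_tm, ract_aa m _ hv,
          fwd_aa _ hv (h_ract_dl X m hx), smul_smul]
        rw [mul_one, tm_aa _ (dl m), ← X.middle, mul_left_comm, ← Complex.exp_add]
        congr 3
        ring

theorem fwd_lact (a : Alg) (t : (alpha r κ E).V) (x : X.V) :
    fwd r κ E X ((alpha r κ E).lact a t) x = (tens X (alpha r κ E)).lact a (fwd r κ E X t x) := by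
  induction t using aa_ind with
  | h0 => simp
  | h2 t s ht hs => simp only [map_add, LinearMap.add_apply, ht, hs]
  | h1 n μ v hv =>
    induction x using X.diag.ind with
    | h0 => simp
    | h2 t s ht hs => simp only [map_add, ht, hs]
    | h1 ν x hx => simp [lact_aa, fwd_aa _ hv hx]

theorem fwd_h (t : (alpha r κ E).V) (x : X.V) :
    fwd r κ E X ((alpha r κ E).h t) x + fwd r κ E X t (X.h x) =
      (tens X (alpha r κ E)).h (fwd r κ E X t x) := by
  induction t using aa_ind with
  | h0 => simp
  | h2 t s ht hs => simp only [map_add, LinearMap.add_apply, ← ht, ← hs]; abel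
  | h1 n μ v hv =>
    induction x using X.diag.ind with
    | h0 => simp
    | h2 t s ht hs => simp only [map_add, ← ht, ← hs]; abel
    | h1 ν x hx =>
      have h1 : algH r 1 = 0 := by rw [← dl_zero, algH_dl]; simp
      simp only [h_aa _ hv, fwd_aa _ hv hx, map_add, map_smul, hx, h_tm, h_lact_dl X n hx, algH_dl,
        LinearMap.add_apply, LinearMap.smul_apply, h1, map_zero, zero_add, LinearMap.zero_apply]
      module

theorem bwd_balanced (x : X.V) (a : Alg) (t : (alpha r κ E).V) :
    bwd r κ E X (X.ract a x) t = bwd r κ E X x ((alpha r κ E).lact a t) := by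
  induction t using aa_ind with
  | h0 => simp
  | h2 t s ht hs => simp only [map_add, ht, hs]
  | h1 n μ v hv => rw [lact_aa, bwd_aa', bwd_aa', ract_comm, map_mul]; rfl

theorem alphaTens_ind {P : (tens (alpha r κ E) X).V → Prop} (t : (tens (alpha r κ E) X).V) (h0 : P 0)
    (h1 : ∀ (μ : ℂ) (v : E.V) (ν : ℂ) (x : X.V), E.h v = μ • v → X.h x = ν • x →
      P (tm (aa r κ E 1 v) x)) (h2 : ∀ t s, P t → P s → P (t + s)) : P t := by
  induction t using tens_ind with
  | h0 => exact h0
  | h2 t s ht hs => exact h2 t s ht hs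
  | h1 t x =>
    induction t using aa_ind with
    | h0 => simpa using h0
    | h2 t s ht hs => simpa using h2 _ _ ht hs
    | h1 n μ v hv =>
      rw [aa_tm n hv, ← map_smul]
      induction (Complex.exp (-(κ * (n * r) * μ)) • X.lact (dl n) x) using X.diag.ind with
      | h0 => simpa using h0
      | h2 t s ht hs => simpa using h2 _ _ ht hs
      | h1 ν x hx => exact h1 μ v ν x hv hx

theorem alphaTens_ind₂ {Y : Bim r} {P : (tens (alpha r κ E) (tens X Y)).V → Prop}
    (t : (tens (alpha r κ E) (tens X Y)).V) (h0 : P 0)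
    (h1 : ∀ (μ : ℂ) (v : E.V) (ν : ℂ) (x : X.V) (ξ : ℂ) (y : Y.V), E.h v = μ • v → X.h x = ν • x →
      Y.h y = ξ • y → P (tm (aa r κ E 1 v) (tm x y)))
    (h2 : ∀ t s, P t → P s → P (t + s)) : P t := by
  induction t using alphaTens_ind with
  | h0 => exact h0
  | h2 t s ht hs => exact h2 t s ht hs
  | h1 μ v ν t hv h9 =>
    clear h9
    induction t using tens_ind with
    | h0 => simpa using h0
    | h2 t s ht hs => simpa using h2 _ _ ht hs
    | h1 x y =>
      induction x using X.diag.ind with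
      | h0 => simpa using h0
      | h2 t s ht hs => simpa using h2 _ _ ht hs
      | h1 μ' x hx =>
        induction y using Y.diag.ind with
        | h0 => simpa using h0
        | h2 t s ht hs => simpa using h2 _ _ ht hs
        | h1 ν' y hy => exact h1 μ v μ' x ν' y hv hx hy

theorem tensAlpha_ind {P : (tens X (alpha r κ E)).V → Prop} (t : (tens X (alpha r κ E)).V) (h0 : P 0)
    (h1 : ∀ (μ : ℂ) (v : E.V) (ν : ℂ) (x : X.V), E.h v = μ • v → X.h x = ν • x →
      P (tm x (aa r κ E 1 v))) (h2 : ∀ t s, P t → P s → P (t + s)) : P t := by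
  induction t using tens_ind with
  | h0 => exact h0
  | h2 t s ht hs => exact h2 t s ht hs
  | h1 x t =>
    induction t using aa_ind with
    | h0 => simpa using h0
    | h2 t s ht hs => simpa using h2 _ _ ht hs
    | h1 n μ v hv =>
      rw [tm_aa]
      induction (X.ract (dl n) x) using X.diag.ind with
      | h0 => simpa using h0
      | h2 t s ht hs => simpa using h2 _ _ ht hs
      | h1 ν x hx => exact h1 μ v ν x hv hx

/-- The half-braiding `(a ⊗ v) ⊗ x ↦ exp(κ deg(v) deg(x)) a x ⊗ (1 ⊗ v)`. -/
def hb (r κ : ℂ) (E : HVect) (X : Bim r) : tens (alpha r κ E) X ≅ tens X (alpha r κ E) :=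
  isoMk (liftHom (fwd r κ E X) fwd_balanced fwd_h fwd_lact fwd_ract)
    (lift (bwd r κ E X) bwd_balanced)
    (LinearMap.ext fun t => by
      induction t using alphaTens_ind with
      | h0 => simp
      | h2 t s ht hs => simp only [map_add, ht, hs]
      | h1 μ v ν x hv hx =>
        have : X.h (X.ract 1 x) = ν • X.ract 1 x := by simpa using hx
        simp [fwd_aa 1 hv hx, bwd_aa 1 hv this, smul_smul, ← Complex.exp_add])
    (LinearMap.ext fun t => by
      induction t using tensAlpha_ind with
      | h0 => simp
      | h2 t s ht hs => simp only [map_add, ht, hs]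
      | h1 μ v ν x hv hx =>
        have : X.h (X.ract 1 x) = ν • X.ract 1 x := by simpa using hx
        simp [fwd_aa 1 hv hx, bwd_aa 1 hv this, smul_smul, ← Complex.exp_add])

theorem hb_tm {μ ν : ℂ} {v : E.V} {x : X.V} (hv : E.h v = μ • v) (hx : X.h x = ν • x) :
    (hb r κ E X).hom.lin (tm (aa r κ E 1 v) x) =
      Complex.exp (κ * μ * ν) • tm x (aa r κ E 1 v) := by
  simp [hb, fwd_aa 1 hv hx]

/-- The induced bimodule `A_r ⊗ E` as an object of the Drinfeld centre. -/
def alphaC (r κ : ℂ) (E : HVect) : Center (Bim r) := ⟨alpha r κ E,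
  { β X := hb r κ E X
    monoidal X Y := hom_ext (LinearMap.ext fun t => by
      change (hb r κ E (tens X Y)).hom.lin t = (assoc X Y (alpha r κ E)).inv.lin
        ((mapHom (𝟙 X) (hb r κ E Y).hom).lin ((assoc X (alpha r κ E) Y).hom.lin
        ((mapHom (hb r κ E X).hom (𝟙 Y)).lin ((assoc (alpha r κ E) X Y).inv.lin t))))
      induction t using alphaTens_ind₂ with
      | h0 => simp
      | h2 t s ht hs => simp only [map_add, ht, hs]
      | h1 μ v ν x ξ y hv hx hy =>
        have : (tens X Y).h (tm x y) = (ν + ξ) • tm x y := by simp [hx, hy, add_smul]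
        simp [hb_tm hv hx, hb_tm hv hy, hb_tm hv this, smul_smul, ← Complex.exp_add, mul_add])
    naturality {X Y} f := hom_ext (LinearMap.ext fun t => by
      change (hb r κ E Y).hom.lin ((mapHom (𝟙 (alpha r κ E)) f).lin t) =
        (mapHom f (𝟙 (alpha r κ E))).lin ((hb r κ E X).hom.lin t)
      induction t using alphaTens_ind with
      | h0 => simp
      | h2 t s ht hs => simp only [map_add, ht, hs]
      | h1 μ v ν x hv hx =>
        have : Y.h (f.lin x) = ν • f.lin x := by rw [← f.comm_h, hx, map_smul]
        simp [hb_tm hv hx, hb_tm hv this]) }⟩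

end Alpha

end CBoson

end

noncomputable section

namespace CBoson

open Bim

/-! ### The objects `F^±` and the pairing `b` -/

/-- `ω = π i t / (κ r)` for `t = -2`. -/
def om (κ r : ℂˣ) : ℂ := Real.pi * Complex.I * (-2) / (κ * r)

theorem exp_om (κ r : ℂˣ) (n : ℤ) : Complex.exp (κ * (n * r) * om κ r) = 1 := by
  rw [Complex.exp_eq_one_iff]
  refine ⟨-n, ?_⟩
  have := κ.ne_zero
  have := r.ne_zero
  simp only [om]
  push_cast
  field_simp

/-- The vector space `ℂ_ω ⊕ ℂ_{-ω}` with diagonalisable endomorphism. -/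
def fund (ω : ℂ) : HVect where
  V := Fin 2 →₀ ℂ
  h := diagEnd ![ω, -ω]
  diag := isDiag_diagEnd _

/-- The basis vectors of `ℂ_ω ⊕ ℂ_{-ω}`. -/
def fe (ω : ℂ) (i : Fin 2) : (fund ω).V := Finsupp.single i 1

theorem fe_h (ω : ℂ) (i : Fin 2) : (fund ω).h (fe ω i) = (![ω, -ω] i) • fe ω i :=
  diagEnd_single _ i 1

/-- `F^+` and `F^-`: the bimodule `A_r ⊗ (ℂ_ω ⊕ ℂ_{-ω})`, made an object of the Drinfeld centre
through the braiding (for `F^+`) and the inverse braiding (for `F^-`). -/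
def Fp (κ r : ℂˣ) : Center (Bim (r : ℂ)) := alphaC r κ (fund (om κ r))

/-- The object `F^-` of the Drinfeld centre. -/
def Fm (κ r : ℂˣ) : Center (Bim (r : ℂ)) := alphaC r (-κ) (fund (om κ r))

theorem ract_fund {κ r : ℂˣ} {s : ℂ} (hs : s = κ ∨ s = -κ) (a b : Alg) (v : (fund (om κ r)).V) :
    (alpha r s (fund (om κ r))).ract a (aa r s (fund (om κ r)) b v) =
      aa r s (fund (om κ r)) (a * b) v := by
  induction a using Alg.ind with
  | h0 => simp
  | h2 a c ha hc => simp only [map_add, LinearMap.add_apply, ha, hc, add_mul]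
  | h1 c n =>
    have : ((alpha r s (fund (om κ r))).ract (dl n)) ∘ₗ (aa r s (fund (om κ r)) b) =
        aa r s (fund (om κ r)) (dl n * b) := by
      refine Finsupp.lhom_ext fun i d => ?_
      have h1 : (fund (om κ r)).h (Finsupp.single i d) = (![om κ r, -om κ r] i) •
        Finsupp.single i d := diagEnd_single _ i d
      have h2 : Complex.exp (s * (n * r) * ![om κ r, -om κ r] i) = 1 := by
        have h3 := exp_om κ r n
        have h4 : Complex.exp (-(κ * (n * r) * om κ r)) = 1 := by rw [Complex.exp_neg, h3, inv_one]
        rcases hs with rfl | rfl <;> fin_cases i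
        · simpa using h3
        · simpa using h4
        · simpa using h4
        · simpa using h3
      exact (ract_aa n b h1).trans (by rw [h2, one_smul]; rfl)
    simp only [map_smul, LinearMap.smul_apply, smul_mul_assoc]
    rw [← this]
    rfl

/-- The bilinear form on `ℂ_ω ⊕ ℂ_{-ω}` with `(v_ω, v_{-ω}) ↦ ζ`, `(v_{-ω}, v_ω) ↦ ξ`. -/
def form (ζ ξ : ℂ) : (Fin 2 →₀ ℂ) →ₗ[ℂ] (Fin 2 →₀ ℂ) →ₗ[ℂ] ℂ :=
  LinearMap.mk₂ ℂ (fun v w => ζ * v 0 * w 1 + ξ * v 1 * w 0)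
    (by intros; simp; ring) (by intros; simp; ring) (by intros; simp; ring) (by intros; simp; ring)

theorem form_h (ζ ξ ω : ℂ) (v w : Fin 2 →₀ ℂ) :
    form ζ ξ (diagEnd ![ω, -ω] v) w + form ζ ξ v (diagEnd ![ω, -ω] w) = 0 := by
  simp [form, diagEnd_apply]
  ring

section Bil

variable {V W P : Type} [AddCommGroup V] [Module ℂ V] [AddCommGroup W] [Module ℂ W]
  [AddCommGroup P] [Module ℂ P]

/-- The bilinear map `(a ⊗ v, a' ⊗ w) ↦ (a a') S(v, w)`, for a bilinear map `S` with values in an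
`A_r`-module. -/
def bil (L : Alg →ₐ[ℂ] Module.End ℂ P) (S : V →ₗ[ℂ] W →ₗ[ℂ] P) :
    Alg ⊗[ℂ] V →ₗ[ℂ] Alg ⊗[ℂ] W →ₗ[ℂ] P :=
  (TensorProduct.mk ℂ _ _).compr₂ (TensorProduct.lift L.toLinearMap ∘ₗ
    TensorProduct.map (LinearMap.mul' ℂ Alg) (TensorProduct.lift S) ∘ₗ
      (TensorProduct.tensorTensorTensorComm ℂ Alg V Alg W).toLinearMap)

theorem bil_tmul (L : Alg →ₐ[ℂ] Module.End ℂ P) (S : V →ₗ[ℂ] W →ₗ[ℂ] P) (a a' : Alg) (v : V)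
    (w : W) : bil L S (a ⊗ₜ v) (a' ⊗ₜ w) = L (a * a') (S v w) := by simp [bil]

end Bil

theorem aa_ext₂ {r κ κ' : ℂ} {E E' : HVect} {M : Type} [AddCommGroup M] [Module ℂ M]
    {f g : (alpha r κ E).V →ₗ[ℂ] (alpha r κ' E').V →ₗ[ℂ] M}
    (h : ∀ a v a' w, f (aa r κ E a v) (aa r κ' E' a' w) = g (aa r κ E a v) (aa r κ' E' a' w))
    (t : (alpha r κ E).V) (s : (alpha r κ' E').V) : f t s = g t s := by
  have : f = g := TensorProduct.ext (LinearMap.ext fun a => LinearMap.ext fun v =>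
    TensorProduct.ext (LinearMap.ext fun a' => LinearMap.ext fun w => h a v a' w))
  rw [this]

/-- `bil` for induced bimodules. -/
def abil {r κ κ' : ℂ} {E E' : HVect} {X : Bim r} (S : E.V →ₗ[ℂ] E'.V →ₗ[ℂ] X.V) :
    (alpha r κ E).V →ₗ[ℂ] (alpha r κ' E').V →ₗ[ℂ] X.V := bil X.lact S

theorem abil_aa {r κ κ' : ℂ} {E E' : HVect} {X : Bim r} (S : E.V →ₗ[ℂ] E'.V →ₗ[ℂ] X.V)
    (a : Alg) (v : E.V) (a' : Alg) (w : E'.V) :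
    abil S (aa r κ E a v) (aa r κ' E' a' w) = X.lact (a * a') (S v w) :=
  bil_tmul X.lact S a a' v w

/-- The homomorphism `(a ⊗ v) ⊗ (a' ⊗ w) ↦ (a a') S(v, w)`. It is defined for
a bilinear map `S` which is compatible with `h` and for which `1 ⊗ v`, `1 ⊗ w` and `S(v, w)` commute
with `A_r`. -/
def bilHom {r κ κ' : ℂ} {E E' : HVect} {X : Bim r} (S : E.V →ₗ[ℂ] E'.V →ₗ[ℂ] X.V)
    (hE : ∀ a b v, (alpha r κ E).ract a (aa r κ E b v) = aa r κ E (a * b) v)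
    (hE' : ∀ a b v, (alpha r κ' E').ract a (aa r κ' E' b v) = aa r κ' E' (a * b) v)
    (hS : ∀ v w, X.h (S v w) = S (E.h v) w + S v (E'.h w))
    (hr : ∀ a v w, X.ract a (S v w) = X.lact a (S v w)) :
    alpha r κ E ⊗ alpha r κ' E' ⟶ X :=
  liftHom (abil S)
    (fun t b s => aa_ext₂ (f := (abil S) ∘ₗ (alpha r κ E).ract b)
      (g := (abil S).compl₂ ((alpha r κ' E').lact b)) (fun a v a' w => by
        simp only [LinearMap.comp_apply, LinearMap.compl₂_apply]
        rw [hE, lact_aa, abil_aa, abil_aa]; ring_nf) t s)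
    (aa_ext₂ (f := (abil S) ∘ₗ (alpha r κ E).h + (abil S).compl₂ (alpha r κ' E').h)
      (g := (abil S).compr₂ X.h) (fun a v a' w => by
        have h1 : ∀ (κ : ℂ) (E : HVect) a v, (alpha r κ E).h (aa r κ E a v) =
          aa r κ E (algH r a) v + aa r κ E a (E.h v) := fun κ E a v => alphaH_tmul r E a v
        simp only [LinearMap.comp_apply, LinearMap.compl₂_apply, LinearMap.compr₂_apply,
          h1, map_add, LinearMap.add_apply, abil_aa, X.h_lact, hS, algH_mul]
        abel))
    (fun b => aa_ext₂ (f := (abil S) ∘ₗ (alpha r κ E).lact b)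
      (g := (abil S).compr₂ (X.lact b)) (fun a v a' w => by
        simp only [LinearMap.comp_apply, LinearMap.compr₂_apply]
        rw [lact_aa, abil_aa, abil_aa, mul_assoc, map_mul]; rfl))
    (fun b => aa_ext₂ (f := (abil S).compl₂ ((alpha r κ' E').ract b))
      (g := (abil S).compr₂ (X.ract b)) (fun a v a' w => by
        simp only [LinearMap.compl₂_apply, LinearMap.compr₂_apply]
        rw [hE', abil_aa, abil_aa, ← X.middle, hr, mul_left_comm, mul_comm, map_mul]; rfl))

/-- The morphism `b : F^+ ⊗ F^- ⟶ A_r`, `(a ⊗ v) ⊗ (a' ⊗ w) ↦ form(v, w) a a'`. -/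
def pairing (ζ ξ κ r : ℂˣ) : (Fp κ r).1 ⊗ (Fm κ r).1 ⟶ 𝟙_ (Bim (r : ℂ)) :=
  bilHom (X := one r) (E := fund (om κ r)) (E' := fund (om κ r))
    ((form ζ ξ).compr₂ (LinearMap.toSpanSingleton ℂ (one (r : ℂ)).V (uu 1)))
    (ract_fund (Or.inl rfl)) (ract_fund (Or.inr rfl))
    (fun v w => by
      have h2 := form_h ζ ξ (om κ r) v w
      have h1 : algH r 1 = 0 := by rw [← dl_zero, algH_dl]; simp
      change (one (r : ℂ)).h (form ζ ξ v w • uu 1) = form ζ ξ _ w • uu 1 + form ζ ξ v _ • uu 1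
      rw [map_smul, one_h, h1, map_zero, smul_zero, ← add_smul]
      exact ((congrArg (· • _) h2).trans (zero_smul _ _)).symm)
    (fun a v w => by
      change (one (r : ℂ)).ract a (form ζ ξ v w • uu 1) = (one (r : ℂ)).lact a (form ζ ξ v w • uu 1)
      rw [map_smul, map_smul, one_ract, one_lact])

end CBoson

end

noncomputable section

namespace CBoson

open Bim

/-- The logarithm `ℓ` with `exp(2 π i ℓ) = z` and real part in `[0, 1)`. -/
def lg (z : ℂ) : ℂ :=
  Complex.log z / (2 * Real.pi * Complex.I) - ⌊(Complex.log z / (2 * Real.pi * Complex.I)).re⌋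

theorem exp_lg {z : ℂ} (hz : z ≠ 0) : Complex.exp (2 * Real.pi * Complex.I * lg z) = z := by
  have h : 2 * Real.pi * Complex.I ≠ 0 := Complex.two_pi_I_ne_zero
  rw [lg, mul_sub, mul_div_cancel₀ _ h, Complex.exp_sub, Complex.exp_log hz, mul_comm _ (Int.cast _),
    Complex.exp_int_mul_two_pi_mul_I, div_one]

theorem lg_exp (s : ℂ) : lg (Complex.exp (2 * Real.pi * Complex.I * s)) = s - ⌊s.re⌋ := by
  have h : 2 * Real.pi * Complex.I ≠ 0 := Complex.two_pi_I_ne_zero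
  obtain ⟨n, hn⟩ := Complex.exp_eq_exp_iff_exists_int.1
    (Complex.exp_log (Complex.exp_ne_zero (2 * Real.pi * Complex.I * s)))
  have h2 : Complex.log (Complex.exp (2 * Real.pi * Complex.I * s)) / (2 * Real.pi * Complex.I) =
      s + n := by
    rw [hn]; field_simp
  rw [lg, h2]
  simp

theorem lg_mul {z w : ℂ} (hz : z ≠ 0) (hw : w ≠ 0) :
    lg z + lg w = lg (z * w) + ⌊(lg z + lg w).re⌋ := by
  have : z * w = Complex.exp (2 * Real.pi * Complex.I * (lg z + lg w)) := by
    rw [mul_add, Complex.exp_add, exp_lg hz, exp_lg hw]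
  rw [this, lg_exp]
  ring

theorem isDiag_fcalc {V : Type} [AddCommGroup V] [Module ℂ V] {T : Module.End ℂ V} (hT : IsDiag T)
    (φ : ℂ → ℂ) : IsDiag (fcalc T φ) := by
  rw [isDiag_iff]
  intro P hP
  exact (isDiag_iff T).1 hT P fun μ v hv => hP (φ μ) v (fcalc_apply hT φ hv)

theorem fcalc_comm {V W : Type} [AddCommGroup V] [Module ℂ V] [AddCommGroup W] [Module ℂ W]
    {T : Module.End ℂ V} (hT : IsDiag T) {S : Module.End ℂ W} (hS : IsDiag S) (φ : ℂ → ℂ)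
    (f : V →ₗ[ℂ] W) (hf : ∀ v, f (T v) = S (f v)) (v : V) :
    f (fcalc T φ v) = fcalc S φ (f v) := by
  have : f ∘ₗ fcalc T φ = fcalc S φ ∘ₗ f := hT.ext fun μ v hv => by
    have : S (f v) = μ • f v := by rw [← hf, hv, map_smul]
    simp [fcalc_apply hT φ hv, fcalc_apply hS φ this]
  exact LinearMap.congr_fun this v

/-- A vector space with a diagonalisable automorphism `k`. -/
structure KVect where
  V : Type
  [acg : AddCommGroup V]
  [mod : Module ℂ V]
  k : Module.End ℂ V
  unit : IsUnit k
  diag : IsDiag k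

attribute [instance] KVect.acg KVect.mod

theorem KVect.ne_zero (X : KVect) {z : ℂ} {v : X.V} (hv : X.k v = z • v) (h : v ≠ 0) : z ≠ 0 := by
  rintro rfl
  apply h
  obtain ⟨u, hu⟩ := X.unit
  have : (↑u⁻¹ * ↑u : Module.End ℂ X.V) v = 0 := by
    rw [hu, Module.End.mul_apply, hv, zero_smul, map_zero]
  simpa using this

/-- The tensor product, on which `k` acts as `k ⊗ k`. -/
def KVect.tens (X Y : KVect) : KVect where
  V := X.V ⊗[ℂ] Y.V
  k := TensorProduct.map X.k Y.k
  unit := by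
    obtain ⟨u, hu⟩ := X.unit
    obtain ⟨w, hw⟩ := Y.unit
    refine isUnit_iff_exists.2 ⟨TensorProduct.map (↑u⁻¹ : Module.End ℂ X.V) (↑w⁻¹ : Module.End ℂ Y.V),
      ?_, ?_⟩
    all_goals
      rw [← hu, ← hw, ← TensorProduct.map_mul]
      simp
  diag := X.diag.tensor Y.diag (fun a b => a * b) fun a v b w hv hw => by
    simp [hv, hw, TensorProduct.smul_tmul', smul_smul, mul_comm]

/-- The space `X` with the endomorphism `h` which is equal to `r ℓ` on the eigenspace of `k` for the
eigenvalue `exp(2 π i ℓ)`, where the real part of `ℓ` is in `[0, 1)`. -/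
def KVect.wt (X : KVect) (r : ℂ) : HVect where
  V := X.V
  h := fcalc X.k fun z => r * lg z
  diag := isDiag_fcalc X.diag _

theorem KVect.wt_h (X : KVect) (r : ℂ) {z : ℂ} {v : X.V} (hv : X.k v = z • v) :
    (X.wt r).h v = (r * lg z) • v := fcalc_apply X.diag (fun z => r * lg z) hv

theorem algH_one (r : ℂ) : algH r 1 = 0 := by rw [← dl_zero, algH_dl]; simp

theorem h_aa_one {r κ : ℂ} {E : HVect} (v : E.V) :
    (alpha r κ E).h (aa r κ E 1 v) = aa r κ E 1 (E.h v) :=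
  (alphaH_tmul r E 1 v).trans (by rw [algH_one, TensorProduct.zero_tmul, zero_add]; rfl)

theorem ract_zero {r : ℂ} {E : HVect} (a b : Alg) (v : E.V) :
    (alpha r 0 E).ract a (aa r 0 E b v) = aa r 0 E (a * b) v := by
  induction a using Alg.ind with
  | h0 => simp
  | h2 a c ha hc => simp only [map_add, LinearMap.add_apply, ha, hc, add_mul]
  | h1 c n =>
    induction v using E.diag.ind with
    | h0 => simp
    | h2 v w hv hw => simp only [map_add, hv, hw]
    | h1 μ v hv => simp [ract_aa n b hv]

theorem aa_ind₂ {r κ : ℂ} {E : HVect} {P : (alpha r κ E).V → Prop} (t : (alpha r κ E).V)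
    (h0 : P 0) (h1 : ∀ a v, P (aa r κ E a v)) (h2 : ∀ t s, P t → P s → P (t + s)) : P t := by
  induction t using TensorProduct.induction_on with
  | zero => exact h0
  | tmul a v => exact h1 a v
  | add t s ht hs => exact h2 t s ht hs

/-- `a ⊗ v ↦ a S(v)` -/
def alift {r κ : ℂ} {E : HVect} {X : Bim r} (S : E.V →ₗ[ℂ] X.V) : (alpha r κ E).V →ₗ[ℂ] X.V :=
  TensorProduct.lift ((LinearMap.lcomp ℂ X.V S) ∘ₗ X.lact.toLinearMap)

@[simp] theorem alift_aa {r κ : ℂ} {E : HVect} {X : Bim r} (S : E.V →ₗ[ℂ] X.V) (a : Alg) (v : E.V) :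
    alift S (aa r κ E a v) = X.lact a (S v) := TensorProduct.lift.tmul a v

/-- The homomorphism `a ⊗ v ↦ a S(v)`. It is defined for a linear map `S` which is compatible
with `h` and for which `1 ⊗ v` and `S(v)` commute with `A_r`. -/
def homOf {r κ : ℂ} {E : HVect} {X : Bim r} (S : E.V →ₗ[ℂ] X.V)
    (hE : ∀ a b v, (alpha r κ E).ract a (aa r κ E b v) = aa r κ E (a * b) v)
    (hS : ∀ v, X.h (S v) = S (E.h v)) (hr : ∀ a v, X.ract a (S v) = X.lact a (S v)) :
    alpha r κ E ⟶ X where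
  lin := alift S
  comm_h t := by
    induction t using aa_ind₂ with
    | h0 => simp
    | h2 t s ht hs => simp only [map_add, ht, hs]
    | h1 a v =>
      have : (alpha r κ E).h (aa r κ E a v) = aa r κ E (algH r a) v + aa r κ E a (E.h v) :=
        alphaH_tmul r E a v
      simp [X.h_lact, hS, this]
  comm_l a t := by
    induction t using aa_ind₂ with
    | h0 => simp
    | h2 t s ht hs => simp only [map_add, ht, hs]
    | h1 b v => simp [lact_aa]
  comm_r a t := by
    induction t using aa_ind₂ with
    | h0 => simp
    | h2 t s ht hs => simp only [map_add, ht, hs]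
    | h1 b v => simp [hE, ← X.middle, hr, lact_comm X a b]

theorem homOf_aa {r κ : ℂ} {E : HVect} {X : Bim r} (S : E.V →ₗ[ℂ] X.V) (hE hS hr) (a : Alg)
    (v : E.V) : (homOf (κ := κ) (X := X) S hE hS hr).lin (aa r κ E a v) = X.lact a (S v) :=
  alift_aa S a v

/-- The functor `𝓘` on objects. -/
abbrev KVect.I (X : KVect) (r : ℂ) : Bim r := alpha r 0 (X.wt r)

/-- The functor `𝓘` on morphisms: `a ⊗ v ↦ a ⊗ f(v)`. -/
def KVect.mapI {X Y : KVect} (r : ℂ) (f : X.V →ₗ[ℂ] Y.V) (hf : ∀ v, f (X.k v) = Y.k (f v)) :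
    X.I r ⟶ Y.I r :=
  homOf (E := X.wt r) (X := alpha r 0 (Y.wt r)) (aa r 0 (Y.wt r) 1 ∘ₗ f) ract_zero
    (fun v => by
      change _ = aa r 0 (Y.wt r) 1 (f (fcalc X.k _ v))
      rw [fcalc_comm X.diag Y.diag _ f hf v]
      exact h_aa_one (E := Y.wt r) (f v))
    (fun a v => (ract_zero (E := Y.wt r) a 1 (f v)).trans
      (lact_aa (E := Y.wt r) a 1 (f v)).symm)

/-- The bilinear map `(v, w) ↦ v ⊗ w`. -/
def KVect.tt (X Y : KVect) (r : ℂ) : X.V →ₗ[ℂ] Y.V →ₗ[ℂ] ((X.tens Y).wt r).V :=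
  TensorProduct.mk ℂ X.V Y.V

theorem KVect.tt_h (X Y : KVect) (r : ℂ) {z w : ℂ} {x : X.V} {y : Y.V} (hx : X.k x = z • x)
    (hy : Y.k y = w • y) : ((X.tens Y).wt r).h (X.tt Y r x y) =
      (r * lg (z * w)) • X.tt Y r x y :=
  (X.tens Y).wt_h r (v := (x ⊗ₜ[ℂ] y : X.V ⊗[ℂ] Y.V)) (by
    change TensorProduct.map X.k Y.k (x ⊗ₜ y) = _
    rw [TensorProduct.map_tmul, hx, hy, TensorProduct.smul_tmul_smul]
    rfl)

/-- The bilinear map `(v, w) ↦ δ_n ⊗ (v ⊗ w)`, where `n` is the integral part of the real part of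
`ℓ + ℓ'`, for `v` and `w` eigenvectors of `k` with eigenvalues `exp(2 π i ℓ)` and `exp(2 π i ℓ')`,
where the real parts of `ℓ` and `ℓ'` are in `[0, 1)`. -/
def KVect.sig (X Y : KVect) (r : ℂ) : X.V →ₗ[ℂ] Y.V →ₗ[ℂ] ((X.tens Y).I r).V :=
  glue X.k fun z => LinearMap.flip <| glue Y.k fun w => LinearMap.flip <|
    (X.tt Y r).compr₂ (aa r 0 ((X.tens Y).wt r) (dl ⌊(lg z + lg w).re⌋))

theorem KVect.sig_apply (X Y : KVect) (r : ℂ) {z w : ℂ} {x : X.V} {y : Y.V} (hx : X.k x = z • x)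
    (hy : Y.k y = w • y) : X.sig Y r x y =
      aa r 0 ((X.tens Y).wt r) (dl ⌊(lg z + lg w).re⌋) (X.tt Y r x y) := by
  rw [sig, glue_apply X.diag _ hx, LinearMap.flip_apply, glue_apply Y.diag _ hy]
  rfl

theorem KVect.bil_ext {X Y : KVect} {M : Type} [AddCommGroup M] [Module ℂ M]
    {f g : X.V →ₗ[ℂ] Y.V →ₗ[ℂ] M}
    (h : ∀ (z w : ℂ) (x : X.V) (y : Y.V), z ≠ 0 → w ≠ 0 → X.k x = z • x → Y.k y = w • y →
      f x y = g x y) (x : X.V) (y : Y.V) : f x y = g x y := by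
  refine LinearMap.congr_fun₂ (X.diag.ext fun z x hx => Y.diag.ext fun w y hy => ?_) x y
  rcases eq_or_ne x 0 with rfl | hx0
  · simp
  rcases eq_or_ne y 0 with rfl | hy0
  · simp
  exact h z w x y (X.ne_zero hx hx0) (Y.ne_zero hy hy0) hx hy

theorem KVect.sig_h (X Y : KVect) (r : ℂ) : ∀ (x : X.V) (y : Y.V),
    ((X.tens Y).I r).h (X.sig Y r x y) = X.sig Y r (fcalc X.k (fun z => r * lg z) x) y +
      X.sig Y r x (fcalc Y.k (fun z => r * lg z) y) :=
  KVect.bil_ext (f := (X.sig Y r).compr₂ ((X.tens Y).I r).h)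
    (g := (X.sig Y r) ∘ₗ (fcalc X.k fun z => r * lg z) +
      (X.sig Y r).compl₂ (fcalc Y.k fun z => r * lg z)) fun z w x y hz hw hx hy => by
    simp only [LinearMap.compr₂_apply, LinearMap.add_apply, LinearMap.comp_apply,
      LinearMap.compl₂_apply, fcalc_apply X.diag _ hx, fcalc_apply Y.diag _ hy, map_smul,
      LinearMap.smul_apply, X.sig_apply Y r hx hy, h_aa _ (X.tt_h Y r hx hy), algH_dl]
    rw [← add_smul, ← add_smul]
    congr 1
    linear_combination (-r) * lg_mul hz hw

theorem KVect.sig_r (X Y : KVect) (r : ℂ) (a : Alg) : ∀ (x : X.V) (y : Y.V),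
    ((X.tens Y).I r).ract a (X.sig Y r x y) = ((X.tens Y).I r).lact a (X.sig Y r x y) :=
  KVect.bil_ext (f := (X.sig Y r).compr₂ (((X.tens Y).I r).ract a))
    (g := (X.sig Y r).compr₂ (((X.tens Y).I r).lact a)) fun z w x y hz hw hx hy => by
    simp only [LinearMap.compr₂_apply, X.sig_apply Y r hx hy, ract_zero, lact_aa]

/-- The tensor structure of `𝓘`. -/
def KVect.mu (X Y : KVect) (r : ℂ) : X.I r ⊗ Y.I r ⟶ (X.tens Y).I r :=
  bilHom (E := X.wt r) (E' := Y.wt r) (X := (X.tens Y).I r) (X.sig Y r) ract_zero ract_zero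
    (X.sig_h Y r) (X.sig_r Y r)

/-! ### The isomorphisms `g^±` -/

/-- `q = exp(π i ω / r)` -/
def qq (κ r : ℂˣ) : ℂ := Complex.exp (Real.pi * Complex.I * om κ r / r)

theorem qq_ne_zero (κ r : ℂˣ) : qq κ r ≠ 0 := Complex.exp_ne_zero _

/-- The space `ℂ_{q^2} ⊕ ℂ_{q^{-2}}` with the automorphism `k`. -/
def fundK (κ r : ℂˣ) : KVect where
  V := Fin 2 →₀ ℂ
  k := diagEnd ![qq κ r ^ 2, (qq κ r ^ 2)⁻¹]
  unit := isUnit_iff_exists.2 ⟨diagEnd ![(qq κ r ^ 2)⁻¹, qq κ r ^ 2], by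
    constructor <;> refine LinearMap.ext fun v => Finsupp.ext fun i => ?_ <;>
      rw [Module.End.mul_apply, diagEnd_apply, diagEnd_apply] <;> fin_cases i <;>
      simp [qq_ne_zero]⟩
  diag := isDiag_diagEnd _

/-- `r ℓ ± n r = ± ω` for `exp(2 π i ℓ) = q^{± 2}`. -/
theorem lg_qq (κ r : ℂˣ) (i : Fin 2) :
    r * lg (![qq κ r ^ 2, (qq κ r ^ 2)⁻¹] i) =
      (-⌊(![om κ r, -om κ r] i / r).re⌋ : ℤ) * r + ![om κ r, -om κ r] i := by
  have hr := r.ne_zero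
  have h : ![qq κ r ^ 2, (qq κ r ^ 2)⁻¹] i =
      Complex.exp (2 * Real.pi * Complex.I * (![om κ r, -om κ r] i / r)) := by
    have : qq κ r ^ 2 = Complex.exp (2 * Real.pi * Complex.I * (om κ r / r)) := by
      rw [qq, ← Complex.exp_nat_mul]
      congr 1
      push_cast
      ring
    fin_cases i
    · exact this
    · change (qq κ r ^ 2)⁻¹ = Complex.exp (2 * Real.pi * Complex.I * (-om κ r / r))
      rw [this, ← Complex.exp_neg]
      congr 1
      ring
  rw [h, lg_exp]
  field_simp
  push_cast
  ring

/-- The integers `n` with `n r ± ω = r ℓ` for `exp(2 π i ℓ) = q^{± 2}`. -/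
def nn (κ r : ℂˣ) (i : Fin 2) : ℤ := -⌊(![om κ r, -om κ r] i / r).re⌋

/-- The basis vectors of `ℂ_{q^2} ⊕ ℂ_{q^{-2}}`. -/
def fke (κ r : ℂˣ) (i : Fin 2) : ((fundK κ r).wt r).V := Finsupp.single i (1 : ℂ)

theorem fke_ext₁ {κ r : ℂˣ} {M : Type} [AddCommGroup M] [Module ℂ M]
    {f g : ((fundK κ r).wt r).V →ₗ[ℂ] M} (h : ∀ i, f (fke κ r i) = g (fke κ r i)) : f = g :=
  Finsupp.lhom_ext' fun i => LinearMap.ext_ring (h i)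

theorem fke_h (κ r : ℂˣ) (i : Fin 2) : ((fundK κ r).wt r).h (fke κ r i) =
    ((nn κ r i : ℂ) * r + ![om κ r, -om κ r] i) • fke κ r i := by
  rw [nn, ← lg_qq]
  exact (fundK κ r).wt_h r (diagEnd_single _ i 1)

/-- `e_i ↦ c_i δ_n ⊗ e_i` -/
def gS (κ r : ℂˣ) (s : ℂ) (c : Fin 2 → ℂˣ) :
    ((fundK κ r).wt r).V →ₗ[ℂ] (alpha r s (fund (om κ r))).V :=
  Finsupp.linearCombination ℂ fun i =>
    (c i : ℂ) • aa r s (fund (om κ r)) (dl (nn κ r i)) (fe (om κ r) i)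

/-- `e_i ↦ c_i⁻¹ δ_{-n} ⊗ e_i` -/
def gS' (κ r : ℂˣ) (c : Fin 2 → ℂˣ) : (fund (om κ r)).V →ₗ[ℂ] ((fundK κ r).I r).V :=
  Finsupp.linearCombination ℂ fun i =>
    ((c i)⁻¹ : ℂ) • aa r 0 ((fundK κ r).wt r) (dl (-nn κ r i)) (fke κ r i)

theorem gS_fke (κ r : ℂˣ) (s : ℂ) (c : Fin 2 → ℂˣ) (i : Fin 2) : gS κ r s c (fke κ r i) =
    (c i : ℂ) • aa r s (fund (om κ r)) (dl (nn κ r i)) (fe (om κ r) i) :=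
  (Finsupp.linearCombination_single ℂ _ _).trans (one_smul _ _)

theorem gS'_fe (κ r : ℂˣ) (c : Fin 2 → ℂˣ) (i : Fin 2) : gS' κ r c (fe (om κ r) i) =
    ((c i)⁻¹ : ℂ) • aa r 0 ((fundK κ r).wt r) (dl (-nn κ r i)) (fke κ r i) :=
  (Finsupp.linearCombination_single ℂ _ _).trans (one_smul _ _)

theorem gS_r (κ r : ℂˣ) {s : ℂ} (hs : s = κ ∨ s = -κ) (c : Fin 2 → ℂˣ) (a : Alg) :
    (alpha r s (fund (om κ r))).ract a ∘ₗ gS κ r s c =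
      (alpha r s (fund (om κ r))).lact a ∘ₗ gS κ r s c :=
  fke_ext₁ fun i => by
    simp only [LinearMap.comp_apply, gS_fke, map_smul, ract_fund hs, lact_aa]

theorem gS_h (κ r : ℂˣ) (s : ℂ) (c : Fin 2 → ℂˣ) :
    (alpha r s (fund (om κ r))).h ∘ₗ gS κ r s c = gS κ r s c ∘ₗ ((fundK κ r).wt r).h :=
  fke_ext₁ fun i => by
    simp only [LinearMap.comp_apply, gS_fke, map_smul, fke_h, h_aa _ (fe_h _ i), algH_dl,
      LinearMap.smul_apply, ← add_smul]
    simp only [smul_smul, mul_comm]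

theorem fe_ext {r s ω : ℂ} {M : Type} [AddCommGroup M] [Module ℂ M]
    {f g : (alpha r s (fund ω)).V →ₗ[ℂ] M}
    (h : ∀ a i, f (aa r s (fund ω) a (fe ω i)) = g (aa r s (fund ω) a (fe ω i))) : f = g :=
  TensorProduct.ext (LinearMap.ext fun a => Finsupp.lhom_ext' fun i => LinearMap.ext_ring (h a i))

theorem fke_ext {κ r : ℂˣ} {M : Type} [AddCommGroup M] [Module ℂ M]
    {f g : ((fundK κ r).I r).V →ₗ[ℂ] M}
    (h : ∀ a i, f (aa r 0 ((fundK κ r).wt r) a (fke κ r i)) =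
      g (aa r 0 ((fundK κ r).wt r) a (fke κ r i))) : f = g :=
  TensorProduct.ext (LinearMap.ext fun a => Finsupp.lhom_ext' fun i => LinearMap.ext_ring (h a i))

/-- The isomorphism `𝓘(ℂ_{q^2} ⊕ ℂ_{q^{-2}}) ≅ A_r ⊗ (ℂ_ω ⊕ ℂ_{-ω})` which sends
`a ⊗ e_i` to `c_i (a δ_n) ⊗ e_i` where `n r ± ω = r ℓ` for `exp(2 π i ℓ) = q^{± 2}`. -/
def gIso (κ r : ℂˣ) {s : ℂ} (hs : s = κ ∨ s = -κ) (c : Fin 2 → ℂˣ) :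
    (fundK κ r).I r ≅ alpha r s (fund (om κ r)) :=
  isoMk (homOf (E := (fundK κ r).wt r) (gS κ r s c) ract_zero
      (LinearMap.congr_fun (gS_h κ r s c)) (fun a => LinearMap.congr_fun (gS_r κ r hs c a)))
    (alift (E := fund (om κ r)) (X := (fundK κ r).I r) (gS' κ r c))
    (fke_ext fun a i => by
      rw [LinearMap.comp_apply, homOf_aa, gS_fke, map_smul, map_smul, lact_aa, alift_aa, gS'_fe,
        map_smul, lact_aa, mul_assoc, dl_mul, add_neg_cancel, dl_zero, mul_one, smul_smul,
        mul_inv_cancel₀ (c i).ne_zero, one_smul, LinearMap.id_apply])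
    (fe_ext fun a i => by
      rw [LinearMap.comp_apply, alift_aa, gS'_fe, map_smul, map_smul, lact_aa, homOf_aa, gS_fke,
        map_smul, lact_aa, mul_assoc, dl_mul, neg_add_cancel, dl_zero, mul_one, smul_smul,
        inv_mul_cancel₀ (c i).ne_zero, one_smul, LinearMap.id_apply])

end CBoson

end

noncomputable section

namespace CBoson

/-! ### Tensor products of representations of a bialgebra -/

section Act

variable {H : Type} [Ring H] [Bialgebra ℂ H]
variable {V W U V' W' : Type} [AddCommGroup V] [Module ℂ V] [AddCommGroup W] [Module ℂ W]
  [AddCommGroup U] [Module ℂ U] [AddCommGroup V'] [Module ℂ V'] [AddCommGroup W'] [Module ℂ W']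

/-- The action of `H ⊗ K` on `V ⊗ W`. -/
def act₂ {K : Type} [Ring K] [Algebra ℂ K] (ρ : H →ₐ[ℂ] Module.End ℂ V)
    (σ : K →ₐ[ℂ] Module.End ℂ W) : H ⊗[ℂ] K →ₐ[ℂ] Module.End ℂ (V ⊗[ℂ] W) :=
  (Module.endTensorEndAlgHom (R := ℂ) (S := ℂ) (A := ℂ) (M := V) (N := W)).comp
    (Algebra.TensorProduct.map ρ σ)

@[simp] theorem act₂_tmul {K : Type} [Ring K] [Algebra ℂ K] (ρ : H →ₐ[ℂ] Module.End ℂ V)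
    (σ : K →ₐ[ℂ] Module.End ℂ W) (a : H) (b : K) (v : V) (w : W) :
    act₂ ρ σ (a ⊗ₜ b) (v ⊗ₜ w) = ρ a v ⊗ₜ σ b w := rfl

/-- The tensor product of two representations: `H` acts on `V ⊗ W` through its coproduct. -/
def tensRep (ρ : H →ₐ[ℂ] Module.End ℂ V) (σ : H →ₐ[ℂ] Module.End ℂ W) :
    H →ₐ[ℂ] Module.End ℂ (V ⊗[ℂ] W) := (act₂ ρ σ).comp (Bialgebra.comulAlgHom ℂ H)

theorem tensRep_apply (ρ : H →ₐ[ℂ] Module.End ℂ V) (σ : H →ₐ[ℂ] Module.End ℂ W) (a : H) :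
    tensRep ρ σ a = act₂ ρ σ (Coalgebra.comul a) := rfl

/-- The trivial representation: `H` acts on `ℂ` through its counit. -/
def oneRep (H : Type) [Ring H] [Bialgebra ℂ H] : H →ₐ[ℂ] Module.End ℂ ℂ :=
  (Algebra.ofId ℂ (Module.End ℂ ℂ)).comp (Bialgebra.counitAlgHom ℂ H)

theorem oneRep_apply (a : H) (c : ℂ) : oneRep H a c = Coalgebra.counit (R := ℂ) a * c := rfl

variable (ρ : H →ₐ[ℂ] Module.End ℂ V) (σ : H →ₐ[ℂ] Module.End ℂ W) (τ : H →ₐ[ℂ] Module.End ℂ U)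

theorem tensRep_natural {ρ' : H →ₐ[ℂ] Module.End ℂ V'} {σ' : H →ₐ[ℂ] Module.End ℂ W'}
    (f : V →ₗ[ℂ] V') (g : W →ₗ[ℂ] W') (hf : ∀ a v, f (ρ a v) = ρ' a (f v))
    (hg : ∀ a v, g (σ a v) = σ' a (g v)) (a : H) (t : V ⊗[ℂ] W) :
    TensorProduct.map f g (tensRep ρ σ a t) = tensRep ρ' σ' a (TensorProduct.map f g t) := by
  rw [tensRep_apply, tensRep_apply]
  generalize (Coalgebra.comul a : H ⊗[ℂ] H) = s
  induction s using TensorProduct.induction_on with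
  | zero => simp
  | add s s' hs hs' => simp only [map_add, LinearMap.add_apply, hs, hs']
  | tmul a b =>
    induction t using TensorProduct.induction_on with
    | zero => simp
    | add t t' ht ht' => simp only [map_add, ht, ht']
    | tmul v w => simp [hf, hg]

theorem act_right (s : H ⊗[ℂ] H) : act₂ ρ (tensRep σ τ) s =
    act₂ ρ (act₂ σ τ) (TensorProduct.map LinearMap.id Coalgebra.comul s) := by
  induction s using TensorProduct.induction_on with
  | zero => rw [map_zero, map_zero, map_zero]
  | tmul a b => rfl
  | add t s ht hs => rw [map_add, map_add, map_add, ht, hs]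

theorem act_left' (s : H ⊗[ℂ] H) (b : H) (v : V) (w : W) (u : U) :
    TensorProduct.assoc ℂ V W U (act₂ ρ σ s (v ⊗ₜ w) ⊗ₜ τ b u) =
      act₂ ρ (act₂ σ τ) (TensorProduct.assoc ℂ H H H (s ⊗ₜ b)) (v ⊗ₜ (w ⊗ₜ u)) := by
  induction s using TensorProduct.induction_on with
  | zero => simp
  | tmul a c => rfl
  | add t s ht hs => simp only [map_add, LinearMap.add_apply, TensorProduct.add_tmul, ht, hs]

theorem act_left (s : H ⊗[ℂ] H) (v : V) (w : W) (u : U) :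
    TensorProduct.assoc ℂ V W U (act₂ (tensRep ρ σ) τ s ((v ⊗ₜ w) ⊗ₜ u)) =
      act₂ ρ (act₂ σ τ) (TensorProduct.assoc ℂ H H H
        (TensorProduct.map Coalgebra.comul LinearMap.id s)) (v ⊗ₜ (w ⊗ₜ u)) := by
  induction s using TensorProduct.induction_on with
  | zero => simp
  | tmul a b => exact act_left' ρ σ τ _ b v w u
  | add t s ht hs => simp only [map_add, LinearMap.add_apply, ht, hs]

theorem tensRep_assoc (a : H) (t : (V ⊗[ℂ] W) ⊗[ℂ] U) :
    TensorProduct.assoc ℂ V W U (tensRep (tensRep ρ σ) τ a t) =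
      tensRep ρ (tensRep σ τ) a (TensorProduct.assoc ℂ V W U t) := by
  induction t using TensorProduct.induction_on with
  | zero => simp
  | add t s ht hs => simp only [map_add, ht, hs]
  | tmul t u =>
    induction t using TensorProduct.induction_on with
    | zero => simp
    | add t s ht hs => simp only [map_add, TensorProduct.add_tmul, ht, hs]
    | tmul v w =>
      rw [tensRep_apply, tensRep_apply, act_left, act_right, TensorProduct.assoc_tmul]
      exact congrArg (fun x => act₂ ρ (act₂ σ τ) x (v ⊗ₜ (w ⊗ₜ u)))
        (Coalgebra.coassoc_apply (R := ℂ) a)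

theorem tensRep_lid (a : H) (t : ℂ ⊗[ℂ] V) :
    TensorProduct.lid ℂ V (tensRep (oneRep H) ρ a t) = ρ a (TensorProduct.lid ℂ V t) := by
  induction t using TensorProduct.induction_on with
  | zero => simp
  | add t s ht hs => simp only [map_add, ht, hs]
  | tmul c v =>
    have h : ∀ s : H ⊗[ℂ] H, TensorProduct.lid ℂ V (act₂ (oneRep H) ρ s (c ⊗ₜ v)) =
        c • ρ (TensorProduct.lid ℂ H (TensorProduct.map Coalgebra.counit LinearMap.id s)) v := by
      intro s
      induction s using TensorProduct.induction_on with
      | zero => simp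
      | add t s ht hs => simp only [map_add, LinearMap.add_apply, smul_add, ht, hs]
      | tmul a b => simp [oneRep_apply, smul_smul, mul_comm]
    have h2 := Coalgebra.rTensor_counit_comul (R := ℂ) a
    rw [LinearMap.rTensor] at h2
    rw [tensRep_apply, h, h2]
    simp

theorem tensRep_rid (a : H) (t : V ⊗[ℂ] ℂ) :
    TensorProduct.rid ℂ V (tensRep ρ (oneRep H) a t) = ρ a (TensorProduct.rid ℂ V t) := by
  induction t using TensorProduct.induction_on with
  | zero => simp
  | add t s ht hs => simp only [map_add, ht, hs]
  | tmul v c =>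
    have h : ∀ s : H ⊗[ℂ] H, TensorProduct.rid ℂ V (act₂ ρ (oneRep H) s (v ⊗ₜ c)) =
        c • ρ (TensorProduct.rid ℂ H (TensorProduct.map LinearMap.id Coalgebra.counit s)) v := by
      intro s
      induction s using TensorProduct.induction_on with
      | zero => simp
      | add t s ht hs => simp only [map_add, LinearMap.add_apply, smul_add, ht, hs]
      | tmul a b => simp [oneRep_apply, smul_smul, mul_comm]
    have h2 := Coalgebra.lTensor_counit_comul (R := ℂ) a
    rw [LinearMap.lTensor] at h2
    rw [tensRep_apply, h, h2]
    simp

end Act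

/-! ### Representations with diagonalisable `k` -/

/-- A representation of the algebra `H` on which the element `k` acts diagonalisably. -/
structure RepK (H : Type) [Ring H] [Algebra ℂ H] (k : H) where
  V : Type
  [acg : AddCommGroup V]
  [mod : Module ℂ V]
  ρ : H →ₐ[ℂ] Module.End ℂ V
  diag : IsDiag (ρ k)

attribute [instance] RepK.acg RepK.mod

namespace RepK

section Cat

variable {H : Type} [Ring H] [Algebra ℂ H] {k : H}

/-- A homomorphism of representations. -/
@[ext]
structure Hom (X Y : RepK H k) where
  lin : X.V →ₗ[ℂ] Y.V
  comm : ∀ a v, lin (X.ρ a v) = Y.ρ a (lin v)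

attribute [simp] Hom.comm

instance : Category (RepK H k) where
  Hom := Hom
  id X := ⟨LinearMap.id, fun _ _ => rfl⟩
  comp f g := ⟨g.lin.comp f.lin, fun a v => by simp⟩

theorem hom_ext {X Y : RepK H k} {f g : X ⟶ Y} (h : f.lin = g.lin) : f = g := Hom.ext h

@[simp] theorem id_lin (X : RepK H k) : (𝟙 X : X ⟶ X).lin = LinearMap.id := rfl
@[simp] theorem comp_lin {X Y Z : RepK H k} (f : X ⟶ Y) (g : Y ⟶ Z) :
    (f ≫ g).lin = g.lin.comp f.lin := rfl

/-- A linear isomorphism which is compatible with the actions is an isomorphism. -/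
def isoMk {X Y : RepK H k} (e : X.V ≃ₗ[ℂ] Y.V) (h : ∀ a v, e (X.ρ a v) = Y.ρ a (e v)) : X ≅ Y where
  hom := ⟨e.toLinearMap, h⟩
  inv := ⟨e.symm.toLinearMap, fun a v => by
    have := h a (e.symm v)
    simp only [LinearEquiv.apply_symm_apply] at this
    simp [← this]⟩
  hom_inv_id := hom_ext (by ext; simp)
  inv_hom_id := hom_ext (by ext; simp)

@[simp] theorem isoMk_hom_lin {X Y : RepK H k} (e : X.V ≃ₗ[ℂ] Y.V) (h) (v : X.V) :
    (isoMk (X := X) (Y := Y) e h).hom.lin v = e v := rfl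

/-- The pullback of representations along an algebra homomorphism. -/
@[simps]
def pullback {H' : Type} [Ring H'] [Algebra ℂ H'] {k' : H'} (ψ : H →ₐ[ℂ] H') (hk : ψ k = k') :
    RepK H' k' ⥤ RepK H k where
  obj X := ⟨X.V, X.ρ.comp ψ, by subst hk; exact X.diag⟩
  map f := ⟨f.lin, fun a v => f.comm (ψ a) v⟩

end Cat

section Tensor

variable {H : Type} [Ring H] [Bialgebra ℂ H] {k : H} [hk : Fact (IsGroupLikeElem ℂ k)]

/-- The tensor product of representations. -/
@[simps]
def tens (X Y : RepK H k) : RepK H k where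
  V := X.V ⊗[ℂ] Y.V
  ρ := tensRep X.ρ Y.ρ
  diag := X.diag.tensor Y.diag (fun a b => a * b) fun a v b w hv hw => by
    simp [tensRep_apply, hk.out, hv, hw, TensorProduct.smul_tmul', smul_smul, mul_comm]

/-- The trivial representation. -/
@[simps]
def one (H : Type) [Ring H] [Bialgebra ℂ H] (k : H) : RepK H k where
  V := ℂ
  ρ := oneRep H
  diag := by
    rw [isDiag_iff]
    intro P hP
    rw [eq_top_iff]
    intro v _
    exact hP _ v rfl

/-- The tensor product of homomorphisms. -/
def mapHom {X X' Y Y' : RepK H k} (f : X ⟶ X') (g : Y ⟶ Y') : tens X Y ⟶ tens X' Y' where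
  lin := TensorProduct.map f.lin g.lin
  comm := tensRep_natural X.ρ Y.ρ f.lin g.lin f.comm g.comm

theorem thom_ext {X Y Z : RepK H k} {f g : tens X Y ⟶ Z}
    (h : ∀ (v : X.V) (w : Y.V), f.lin (v ⊗ₜ[ℂ] w : X.V ⊗[ℂ] Y.V) =
      g.lin (v ⊗ₜ[ℂ] w : X.V ⊗[ℂ] Y.V)) : f = g :=
  hom_ext (TensorProduct.ext' h)

theorem thom_ext₃ {X Y Z U : RepK H k} {f g : tens (tens X Y) Z ⟶ U}
    (h : ∀ (v : X.V) (w : Y.V) (u : Z.V),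
      f.lin ((v ⊗ₜ[ℂ] w : X.V ⊗[ℂ] Y.V) ⊗ₜ[ℂ] u : (X.V ⊗[ℂ] Y.V) ⊗[ℂ] Z.V) =
      g.lin ((v ⊗ₜ[ℂ] w : X.V ⊗[ℂ] Y.V) ⊗ₜ[ℂ] u : (X.V ⊗[ℂ] Y.V) ⊗[ℂ] Z.V)) : f = g :=
  hom_ext (TensorProduct.ext_threefold h)

theorem thom_ext₄ {X Y Z U W : RepK H k} {f g : tens (tens (tens X Y) Z) U ⟶ W}
    (h : ∀ (x : X.V) (y : Y.V) (z : Z.V) (u : U.V),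
      f.lin (((x ⊗ₜ[ℂ] y : X.V ⊗[ℂ] Y.V) ⊗ₜ[ℂ] z : (X.V ⊗[ℂ] Y.V) ⊗[ℂ] Z.V) ⊗ₜ[ℂ] u :
        ((X.V ⊗[ℂ] Y.V) ⊗[ℂ] Z.V) ⊗[ℂ] U.V) =
      g.lin (((x ⊗ₜ[ℂ] y : X.V ⊗[ℂ] Y.V) ⊗ₜ[ℂ] z : (X.V ⊗[ℂ] Y.V) ⊗[ℂ] Z.V) ⊗ₜ[ℂ] u :
        ((X.V ⊗[ℂ] Y.V) ⊗[ℂ] Z.V) ⊗[ℂ] U.V)) : f = g :=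
  hom_ext (TensorProduct.ext (TensorProduct.ext_threefold fun x y z =>
    LinearMap.ext fun u => h x y z u))

instance : MonoidalCategory (RepK H k) where
  tensorObj := tens
  tensorUnit := one H k
  tensorHom f g := mapHom f g
  whiskerLeft X _ _ f := mapHom (𝟙 X) f
  whiskerRight f X := mapHom f (𝟙 X)
  associator X Y Z := isoMk (TensorProduct.assoc ℂ X.V Y.V Z.V) (tensRep_assoc X.ρ Y.ρ Z.ρ)
  leftUnitor X := isoMk (TensorProduct.lid ℂ X.V) (tensRep_lid X.ρ)
  rightUnitor X := isoMk (TensorProduct.rid ℂ X.V) (tensRep_rid X.ρ)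
  tensorHom_def f g := thom_ext fun _ _ => rfl
  id_tensorHom_id _ _ := thom_ext fun _ _ => rfl
  tensorHom_comp_tensorHom _ _ _ _ := thom_ext fun _ _ => rfl
  whiskerLeft_id _ _ := thom_ext fun _ _ => rfl
  id_whiskerRight _ _ := thom_ext fun _ _ => rfl
  associator_naturality _ _ _ := thom_ext₃ fun _ _ _ => rfl
  leftUnitor_naturality f := thom_ext fun (c : ℂ) v => (map_smul f.lin c v).symm
  rightUnitor_naturality f := thom_ext fun v (c : ℂ) => (map_smul f.lin c v).symm
  pentagon W X Y Z := thom_ext₄ fun _ _ _ _ => rfl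
  triangle X Y := thom_ext₃ fun v (c : ℂ) w => (TensorProduct.smul_tmul c v w).symm

end Tensor
end RepK
end CBoson

end

noncomputable section

namespace CBoson

/-! ### The quantum loop algebra of `sl₂` -/

section Serre

variable {R : Type} [Ring R] [Algebra ℂ R]

/-- The expression `x³ y - c x² y x + c x y x² - y x³`. -/
def serre (c : ℂ) (x y : R) : R := x ^ 3 * y - c • (x ^ 2 * y * x) + c • (x * y * x ^ 2) - y * x ^ 3

theorem serre_self (c : ℂ) (x : R) : serre c x x = 0 := by
  have h1 : x ^ 2 * x * x = x ^ 4 := by noncomm_ring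
  have h2 : x * x * x ^ 2 = x ^ 4 := by noncomm_ring
  have h3 : x ^ 3 * x = x ^ 4 := by noncomm_ring
  have h4 : x * x ^ 3 = x ^ 4 := by noncomm_ring
  rw [serre, h1, h2, h3, h4]
  abel

theorem serre_add (p : ℂˣ) {a b c d : R} (hba : b * a = (p : ℂ)⁻¹ • (a * b))
    (hbc : b * c = (p : ℂ) • (c * b)) (hda : d * a = (p : ℂ) • (a * d))
    (h1 : serre (p + 1 + (p : ℂ)⁻¹) a c = 0) (h2 : serre (p + 1 + (p : ℂ)⁻¹) b d = 0) :
    serre (p + 1 + (p : ℂ)⁻¹) (a + b) (c + d) = 0 := by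
  have hba' : ∀ x, b * (a * x) = (p : ℂ)⁻¹ • (a * (b * x)) := fun x => by
    rw [← mul_assoc, hba, smul_mul_assoc, mul_assoc]
  have hbc' : ∀ x, b * (c * x) = (p : ℂ) • (c * (b * x)) := fun x => by
    rw [← mul_assoc, hbc, smul_mul_assoc, mul_assoc]
  have hda' : ∀ x, d * (a * x) = (p : ℂ) • (a * (d * x)) := fun x => by
    rw [← mul_assoc, hda, smul_mul_assoc, mul_assoc]
  have hp := p.ne_zero
  rw [← add_zero (0 : R)]
  nth_rw 1 [← h1]
  rw [← h2, ← sub_eq_zero]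
  simp only [serre, pow_succ, pow_zero, one_mul, mul_add, add_mul, mul_assoc, hba, hba', hbc, hbc',
    hda, hda', mul_smul_comm, smul_mul_assoc, smul_add, smul_smul]
  match_scalars <;> field_simp <;> ring

end Serre

/-- The generators `e_i^+`, `e_i^-`, `k_i` of the quantum loop algebra. -/
inductive UGen : Type
  | ep (i : Fin 2)
  | em (i : Fin 2)
  | K (i : Fin 2)

/-- The defining relations of the quantum loop algebra. Here `i + 1` is the other element of
`Fin 2`, and `k_{i+1}` is the inverse of `k_i`; the number `q² + 1 + q⁻²` is the quantum integer
`[3]_q`. -/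
structure URels (q : ℂˣ) {R : Type} [Ring R] [Algebra ℂ R] (ep em K : Fin 2 → R) : Prop where
  inv : ∀ i, K i * K (i + 1) = 1
  kp : ∀ i, K i * ep i * K (i + 1) = ((q ^ 2 : ℂˣ) : ℂ) • ep i
  km : ∀ i, K i * em i * K (i + 1) = ((q ^ 2 : ℂˣ) : ℂ)⁻¹ • em i
  comm : ∀ i j, ep i * em j - em j * ep i =
    if i = j then ((q : ℂ) - (q : ℂ)⁻¹)⁻¹ • (K i - K (i + 1)) else 0
  serre_p : ∀ i j, serre (((q ^ 2 : ℂˣ) : ℂ) + 1 + ((q ^ 2 : ℂˣ) : ℂ)⁻¹) (ep i) (ep j) = 0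
  serre_m : ∀ i j, serre (((q ^ 2 : ℂˣ) : ℂ) + 1 + ((q ^ 2 : ℂˣ) : ℂ)⁻¹) (em i) (em j) = 0

/-- The relations as relations in the free algebra. -/
inductive URel (q : ℂˣ) : FreeAlgebra ℂ UGen → FreeAlgebra ℂ UGen → Prop
  | inv (i) : URel q (.ι ℂ (.K i) * .ι ℂ (.K (i + 1))) 1
  | kp (i) : URel q (.ι ℂ (.K i) * .ι ℂ (.ep i) * .ι ℂ (.K (i + 1)))
      (((q ^ 2 : ℂˣ) : ℂ) • .ι ℂ (.ep i))
  | km (i) : URel q (.ι ℂ (.K i) * .ι ℂ (.em i) * .ι ℂ (.K (i + 1)))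
      (((q ^ 2 : ℂˣ) : ℂ)⁻¹ • .ι ℂ (.em i))
  | comm (i j) : URel q (.ι ℂ (.ep i) * .ι ℂ (.em j) - .ι ℂ (.em j) * .ι ℂ (.ep i))
      (if i = j then ((q : ℂ) - (q : ℂ)⁻¹)⁻¹ • (.ι ℂ (.K i) - .ι ℂ (.K (i + 1))) else 0)
  | serre_p (i j) : URel q (serre (((q ^ 2 : ℂˣ) : ℂ) + 1 + ((q ^ 2 : ℂˣ) : ℂ)⁻¹)
      (.ι ℂ (.ep i)) (.ι ℂ (.ep j))) 0
  | serre_m (i j) : URel q (serre (((q ^ 2 : ℂˣ) : ℂ) + 1 + ((q ^ 2 : ℂˣ) : ℂ)⁻¹)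
      (.ι ℂ (.em i)) (.ι ℂ (.em j))) 0

/-- The algebra `U_q(L sl₂)`. -/
def Uq (q : ℂˣ) : Type := RingQuot (URel q)

namespace Uq

variable (q : ℂˣ)

instance : Ring (Uq q) := inferInstanceAs (Ring (RingQuot (URel q)))
instance : Algebra ℂ (Uq q) := inferInstanceAs (Algebra ℂ (RingQuot (URel q)))

/-- The projection from the free algebra. -/
def mk : FreeAlgebra ℂ UGen →ₐ[ℂ] Uq q := RingQuot.mkAlgHom ℂ (URel q)

/-- The generators of `U_q(L sl₂)`. -/
def gen (g : UGen) : Uq q := mk q (.ι ℂ g)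

theorem mk_rel {a b : FreeAlgebra ℂ UGen} (h : URel q a b) : mk q a = mk q b :=
  RingQuot.mkAlgHom_rel ℂ h

theorem map_serre {R S : Type} [Ring R] [Algebra ℂ R] [Ring S] [Algebra ℂ S] (f : R →ₐ[ℂ] S)
    (c : ℂ) (x y : R) : f (serre c x y) = serre c (f x) (f y) := by simp [serre]

theorem rels : URels q (fun i => gen q (.ep i)) (fun i => gen q (.em i))
    (fun i => gen q (.K i)) where
  inv i := by simpa [gen] using mk_rel q (.inv i)
  kp i := by simpa only [gen, map_mul, map_smul] using mk_rel q (.kp i)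
  km i := by simpa only [gen, map_mul, map_smul] using mk_rel q (.km i)
  comm i j := by
    have := mk_rel q (.comm i j)
    split_ifs at this ⊢ with h
    · simpa only [gen, map_sub, map_mul, map_smul] using this
    · simpa only [gen, map_sub, map_mul, map_zero] using this
  serre_p i j := by simpa only [gen, map_serre, map_zero] using mk_rel q (.serre_p i j)
  serre_m i j := by simpa only [gen, map_serre, map_zero] using mk_rel q (.serre_m i j)

variable {q} {R : Type} [Ring R] [Algebra ℂ R]

/-- The images of the generators. -/
def genMap (ep em K : Fin 2 → R) : UGen → R
  | .ep i => ep i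
  | .em i => em i
  | .K i => K i

/-- The homomorphism given by elements which satisfy the relations. -/
def lift {ep em K : Fin 2 → R} (h : URels q ep em K) : Uq q →ₐ[ℂ] R :=
  RingQuot.liftAlgHom ℂ ⟨FreeAlgebra.lift ℂ (genMap ep em K), fun a b hab => by
    induction hab with
    | inv i => simpa [genMap] using h.inv i
    | kp i => simpa only [map_mul, map_smul, FreeAlgebra.lift_ι_apply, genMap] using h.kp i
    | km i => simpa only [map_mul, map_smul, FreeAlgebra.lift_ι_apply, genMap] using h.km i
    | comm i j =>
      have := h.comm i j
      split_ifs at this ⊢ with h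
      · simpa only [map_sub, map_mul, map_smul, FreeAlgebra.lift_ι_apply, genMap] using this
      · simpa only [map_sub, map_mul, map_zero, FreeAlgebra.lift_ι_apply, genMap] using this
    | serre_p i j =>
      simpa only [map_serre, map_zero, FreeAlgebra.lift_ι_apply, genMap] using h.serre_p i j
    | serre_m i j =>
      simpa only [map_serre, map_zero, FreeAlgebra.lift_ι_apply, genMap] using h.serre_m i j⟩

@[simp] theorem lift_gen {ep em K : Fin 2 → R} (h : URels q ep em K) (g : UGen) :
    lift h (gen q g) = genMap ep em K g := by
  rw [gen, lift, mk]
  exact (RingQuot.liftAlgHom_mkAlgHom_apply _ _ _ _).trans (FreeAlgebra.lift_ι_apply _ _)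

theorem hom_ext {f g : Uq q →ₐ[ℂ] R} (h : ∀ x, f (gen q x) = g (gen q x)) : f = g :=
  RingQuot.ringQuot_ext' ℂ f g (FreeAlgebra.hom_ext (funext h))

end Uq

/-! Compatibility of the Serre expression with tensor products -/

section SerreTensor

variable {R S : Type} [Ring R] [Algebra ℂ R] [Ring S] [Algebra ℂ S]

theorem serre_tmul (c : ℂ) {x y : R} (k k' : S) (hk : k * k' = k' * k) (h : serre c x y = 0) :
    serre c (x ⊗ₜ[ℂ] k) (y ⊗ₜ[ℂ] k') = 0 := by
  have hc : Commute k k' := hk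
  have e1 : k ^ 2 * k' * k = k ^ 3 * k' := by
    rw [mul_assoc, ← hk, ← mul_assoc, pow_succ k 2]
  have e2 : k * k' * k ^ 2 = k ^ 3 * k' := by
    rw [mul_assoc, ← (hc.pow_left 2).eq, ← mul_assoc, pow_succ' k 2]
  have e3 : k' * k ^ 3 = k ^ 3 * k' := (hc.pow_left 3).eq.symm
  have : serre c (x ⊗ₜ[ℂ] k) (y ⊗ₜ[ℂ] k') = serre c x y ⊗ₜ[ℂ] (k ^ 3 * k') := by
    simp only [serre, Algebra.TensorProduct.tmul_pow, Algebra.TensorProduct.tmul_mul_tmul, e1, e2,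
      e3, TensorProduct.sub_tmul, TensorProduct.add_tmul, TensorProduct.smul_tmul']
  rw [this, h, TensorProduct.zero_tmul]

theorem serre_tmul' (c : ℂ) {x y : S} (k k' : R) (hk : k * k' = k' * k) (h : serre c x y = 0) :
    serre c (k ⊗ₜ[ℂ] x) (k' ⊗ₜ[ℂ] y) = 0 := by
  have h1 := serre_tmul c k k' hk h
  have h2 := Uq.map_serre (Algebra.TensorProduct.comm ℂ S R).toAlgHom c (x ⊗ₜ[ℂ] k) (y ⊗ₜ[ℂ] k')
  rw [h1, map_zero] at h2
  exact h2.symm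

theorem serre_one (c : ℂ) (x y : S) (h : serre c x y = 0) :
    serre c ((1 : R) ⊗ₜ[ℂ] x) (1 ⊗ₜ[ℂ] y) = 0 := serre_tmul' c 1 1 rfl h

theorem serre_one' (c : ℂ) (x y : R) (h : serre c x y = 0) :
    serre c (x ⊗ₜ[ℂ] (1 : S)) (y ⊗ₜ[ℂ] 1) = 0 := serre_tmul c 1 1 rfl h

end SerreTensor

namespace URels

variable {q : ℂˣ} {R S : Type} [Ring R] [Algebra ℂ R] [Ring S] [Algebra ℂ S]
  {ep em K : Fin 2 → R} {ep' em' K' : Fin 2 → S}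

theorem fin2 (i : Fin 2) : i + 1 + 1 = i := by fin_cases i <;> rfl

theorem inv' (h : URels q ep em K) (i : Fin 2) : K (i + 1) * K i = 1 := by
  have := h.inv (i + 1)
  rwa [fin2] at this

theorem aux (p : ℂˣ) {k k' e : R} (h1 : k * k' = 1) (h2 : k' * k = 1) (h3 : k * e * k' = (p : ℂ) • e) :
    k * e = (p : ℂ) • (e * k) ∧ k' * e = (p : ℂ)⁻¹ • (e * k') := by
  constructor
  · have := congrArg (· * k) h3
    simpa [mul_assoc, h2] using this
  · have : k' * (k * e * k') = k' * ((p : ℂ) • e) := congrArg (k' * ·) h3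
    rw [← mul_assoc, ← mul_assoc, h2, one_mul, mul_smul_comm] at this
    rw [this, smul_smul, inv_mul_cancel₀ p.ne_zero, one_smul]

theorem kep (h : URels q ep em K) (i : Fin 2) :
    K i * ep i = ((q ^ 2 : ℂˣ) : ℂ) • (ep i * K i) := (aux _ (h.inv i) (h.inv' i) (h.kp i)).1

theorem kep' (h : URels q ep em K) (i : Fin 2) :
    K (i + 1) * ep i = ((q ^ 2 : ℂˣ) : ℂ)⁻¹ • (ep i * K (i + 1)) :=
  (aux _ (h.inv i) (h.inv' i) (h.kp i)).2

theorem kem (h : URels q ep em K) (i : Fin 2) :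
    K i * em i = ((q ^ 2 : ℂˣ) : ℂ)⁻¹ • (em i * K i) := by
  have h3 := h.km i
  rw [← Units.val_inv_eq_inv_val] at h3 ⊢
  exact (aux _ (h.inv i) (h.inv' i) h3).1

theorem kem' (h : URels q ep em K) (i : Fin 2) :
    K (i + 1) * em i = ((q ^ 2 : ℂˣ) : ℂ) • (em i * K (i + 1)) := by
  have h3 := h.km i
  rw [← Units.val_inv_eq_inv_val] at h3
  have := (aux _ (h.inv i) (h.inv' i) h3).2
  rwa [← Units.val_inv_eq_inv_val, inv_inv] at this

theorem or2 (i j : Fin 2) : j = i ∨ j = i + 1 := by fin_cases i <;> fin_cases j <;> simp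

/-- The formulas for the coproduct are compatible with the relations. -/
theorem tensor (h : URels q ep em K) (h' : URels q ep' em' K') :
    URels q (R := R ⊗[ℂ] S) (fun i => ep i ⊗ₜ K' i + 1 ⊗ₜ ep' i)
      (fun i => em i ⊗ₜ 1 + K (i + 1) ⊗ₜ em' i) (fun i => K i ⊗ₜ K' i) where
  inv i := by simp [h.inv, h'.inv, Algebra.TensorProduct.one_def]
  kp i := by
    have h1 : K' i * K' i * K' (i + 1) = K' i := by rw [mul_assoc, h'.inv, mul_one]
    simp only [mul_add, add_mul, Algebra.TensorProduct.tmul_mul_tmul, h.kp, h'.kp, h.inv, h1,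
      mul_one, smul_add, TensorProduct.smul_tmul', TensorProduct.tmul_smul]
  km i := by
    simp only [mul_add, add_mul, Algebra.TensorProduct.tmul_mul_tmul, h.km, h'.km, h.inv, h'.inv,
      mul_one, one_mul, smul_add, TensorProduct.smul_tmul', TensorProduct.tmul_smul]
  comm i j := by
    have e1 : (ep i ⊗ₜ[ℂ] K' i + 1 ⊗ₜ ep' i) * (em j ⊗ₜ[ℂ] 1 + K (j + 1) ⊗ₜ em' j) -
        (em j ⊗ₜ[ℂ] 1 + K (j + 1) ⊗ₜ em' j) * (ep i ⊗ₜ[ℂ] K' i + 1 ⊗ₜ ep' i) =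
        (ep i * em j - em j * ep i) ⊗ₜ[ℂ] K' i + K (j + 1) ⊗ₜ[ℂ] (ep' i * em' j - em' j * ep' i) +
        ((ep i * K (j + 1)) ⊗ₜ[ℂ] (K' i * em' j) - (K (j + 1) * ep i) ⊗ₜ[ℂ] (em' j * K' i)) := by
      simp only [mul_add, add_mul, Algebra.TensorProduct.tmul_mul_tmul, mul_one, one_mul,
        TensorProduct.sub_tmul, TensorProduct.tmul_sub]
      abel
    have hq := (q ^ 2).ne_zero
    have e2 : (ep i * K (j + 1)) ⊗ₜ[ℂ] (K' i * em' j) =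
        (K (j + 1) * ep i) ⊗ₜ[ℂ] (em' j * K' i) := by
      rcases or2 i j with rfl | rfl
      · rw [h.kep', h'.kem, TensorProduct.smul_tmul, TensorProduct.tmul_smul]
      · have := h'.kem' (i + 1)
        rw [fin2] at this
        rw [fin2, h.kep, this, TensorProduct.smul_tmul, TensorProduct.tmul_smul]
    rw [e1, e2, sub_self, add_zero, h.comm, h'.comm]
    split_ifs with hij
    · subst hij
      simp only [TensorProduct.tmul_smul, TensorProduct.smul_tmul', TensorProduct.sub_tmul,
        TensorProduct.tmul_sub, smul_sub]
      abel
    · simp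
  serre_p i j := by
    rcases or2 i j with rfl | rfl
    · exact serre_self _ _
    have h1 := h'.kep' (i + 1)
    rw [fin2] at h1
    refine serre_add (q ^ 2) ?_ ?_ ?_ ?_ ?_
    · simp only [Algebra.TensorProduct.tmul_mul_tmul, mul_one, one_mul, h'.kep,
        TensorProduct.tmul_smul, smul_smul]
      rw [inv_mul_cancel₀ (q ^ 2).ne_zero, one_smul]
    · simp only [Algebra.TensorProduct.tmul_mul_tmul, mul_one, one_mul, h'.kep',
        TensorProduct.tmul_smul, smul_smul]
      rw [mul_inv_cancel₀ (q ^ 2).ne_zero, one_smul]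
    · simp only [Algebra.TensorProduct.tmul_mul_tmul, mul_one, one_mul, h1,
        TensorProduct.tmul_smul, smul_smul]
      rw [mul_inv_cancel₀ (q ^ 2).ne_zero, one_smul]
    · have h2 : K' i * K' (i + 1) = K' (i + 1) * K' i := by rw [h'.inv, h'.inv']
      refine serre_tmul _ _ _ h2 (h.serre_p i (i + 1))
    · exact serre_one _ _ _ (h'.serre_p i (i + 1))
  serre_m i j := by
    rcases or2 i j with rfl | rfl
    · exact serre_self _ _
    have h1 := h.kem (i + 1)
    have h3 := h.kem' (i + 1)
    have h4 := h.kem i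
    rw [fin2] at h3
    have hc : (((q ^ 2 : ℂˣ) : ℂ) + 1 + ((q ^ 2 : ℂˣ) : ℂ)⁻¹) =
        ((((q ^ 2)⁻¹ : ℂˣ) : ℂ) + 1 + (((q ^ 2)⁻¹ : ℂˣ) : ℂ)⁻¹) := by
      rw [Units.val_inv_eq_inv_val, inv_inv]; ring
    have g1 := h.serre_m i (i + 1)
    have g2 := h'.serre_m i (i + 1)
    rw [hc] at g1 g2 ⊢
    refine serre_add (q ^ 2)⁻¹ ?_ ?_ ?_ ?_ ?_
    · simp only [Algebra.TensorProduct.tmul_mul_tmul, mul_one, one_mul, h.kem',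
        TensorProduct.smul_tmul', Units.val_inv_eq_inv_val, inv_inv]
    · simp only [Algebra.TensorProduct.tmul_mul_tmul, mul_one, one_mul, h1,
        TensorProduct.smul_tmul', Units.val_inv_eq_inv_val]
    · simp only [Algebra.TensorProduct.tmul_mul_tmul, mul_one, one_mul, fin2, h4,
        TensorProduct.smul_tmul', Units.val_inv_eq_inv_val]
    · exact serre_one' _ _ _ g1
    · rw [fin2]
      have h2 : K (i + 1) * K i = K i * K (i + 1) := by rw [h.inv, h.inv']
      exact serre_tmul' _ _ _ h2 g2

end URels

namespace Uq

variable (q : ℂˣ)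

theorem gen_eq_genMap (g : UGen) : gen q g =
    genMap (fun i => gen q (.ep i)) (fun i => gen q (.em i)) (fun i => gen q (.K i)) g := by
  cases g <;> rfl

/-- The coproduct `e_i^+ ↦ e_i^+ ⊗ k_i + 1 ⊗ e_i^+`, `e_i^- ↦ e_i^- ⊗ 1 + k_i⁻¹ ⊗ e_i^-`,
`k_i ↦ k_i ⊗ k_i`. -/
def comul : Uq q →ₐ[ℂ] Uq q ⊗[ℂ] Uq q := lift ((rels q).tensor (rels q))

theorem counit_rels : URels q (R := ℂ) (fun _ => 0) (fun _ => 0) (fun _ => 1) where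
  inv i := by simp
  kp i := by simp
  km i := by simp
  comm i j := by simp
  serre_p i j := by simp [serre]
  serre_m i j := by simp [serre]

/-- The counit `e_i^± ↦ 0`, `k_i ↦ 1`. -/
def counit : Uq q →ₐ[ℂ] ℂ := lift (counit_rels q)

theorem comul_ep (i : Fin 2) : comul q (gen q (.ep i)) =
    gen q (.ep i) ⊗ₜ gen q (.K i) + 1 ⊗ₜ gen q (.ep i) := lift_gen _ _

theorem comul_em (i : Fin 2) : comul q (gen q (.em i)) =
    gen q (.em i) ⊗ₜ 1 + gen q (.K (i + 1)) ⊗ₜ gen q (.em i) := lift_gen _ _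

theorem comul_K (i : Fin 2) : comul q (gen q (.K i)) = gen q (.K i) ⊗ₜ gen q (.K i) := lift_gen _ _

theorem counit_ep (i : Fin 2) : counit q (gen q (.ep i)) = 0 := lift_gen _ _
theorem counit_em (i : Fin 2) : counit q (gen q (.em i)) = 0 := lift_gen _ _
theorem counit_K (i : Fin 2) : counit q (gen q (.K i)) = 1 := lift_gen _ _

instance : Bialgebra ℂ (Uq q) := Bialgebra.ofAlgHom (comul q) (counit q)
  (hom_ext fun g => by
    cases g <;> simp [comul_ep, comul_em, comul_K, TensorProduct.add_tmul, TensorProduct.tmul_add,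
      Algebra.TensorProduct.one_def, add_assoc])
  (hom_ext fun g => by
    cases g <;> simp [comul_ep, comul_em, comul_K, counit_ep, counit_em, counit_K])
  (hom_ext fun g => by
    cases g <;> simp [comul_ep, comul_em, comul_K, counit_ep, counit_em, counit_K])

instance : Fact (IsGroupLikeElem ℂ (gen q (.K 0))) := ⟨⟨counit_K q 0, comul_K q 0⟩⟩

end Uq

end CBoson

end

noncomputable section

namespace CBoson

/-! ### The category `D_F` and the commutation condition -/

section Perturbed

variable {D : Type 1} [Category.{0} D] [MonoidalCategory D]

/-- Objects `(X, m)` of `D_F` for `F = F^+ ⊕ F^-`: the morphism `m : F ⊗ X ⟶ X` is given by its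
restrictions to `F^+ ⊗ X` and `F^- ⊗ X`. -/
structure DF (P M : Center D) where
  X : D
  mp : P.1 ⊗ X ⟶ X
  mm : M.1 ⊗ X ⟶ X

namespace DF

variable {P M : Center D}

/-- Morphisms in `D_F`. -/
@[ext]
structure Hom (X Y : DF P M) where
  hom : X.X ⟶ Y.X
  comm_p : P.1 ◁ hom ≫ Y.mp = X.mp ≫ hom
  comm_m : M.1 ◁ hom ≫ Y.mm = X.mm ≫ hom

attribute [simp] Hom.comm_p Hom.comm_m

instance : Category (DF P M) where
  Hom := Hom
  id X := ⟨𝟙 X.X, by simp, by simp⟩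
  comp f g := ⟨f.hom ≫ g.hom,
    by rw [MonoidalCategory.whiskerLeft_comp, Category.assoc, g.comm_p, ← Category.assoc, f.comm_p,
      Category.assoc],
    by rw [MonoidalCategory.whiskerLeft_comp, Category.assoc, g.comm_m, ← Category.assoc, f.comm_m,
      Category.assoc]⟩
  id_comp f := Hom.ext (Category.id_comp f.hom)
  comp_id f := Hom.ext (Category.comp_id f.hom)
  assoc f g h := Hom.ext (Category.assoc f.hom g.hom h.hom)

/-- The forgetful functor. -/
@[simps]
def forget (P M : Center D) : DF P M ⥤ D where
  obj X := X.X
  map f := f.hom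

/-- The half-braiding `φ_{F^+ ⊗ F^-,X}`. -/
def halfBr (P M : Center D) (X : D) : (P.1 ⊗ M.1) ⊗ X ⟶ X ⊗ (P.1 ⊗ M.1) := ((P ⊗ M).2.β X).hom

/-- The commutation condition with `b`:
`m_+ (1 ⊗ m_-) - m_- (1 ⊗ m_+) (φ_{F^+,F^-} ⊗ 1) = b ⊗ 1 - (1 ⊗ b) φ_{F^+ ⊗ F^-,X}`. -/
def CommCond [Preadditive D] (b : P.1 ⊗ M.1 ⟶ 𝟙_ D) : ObjectProperty (DF P M) := fun X =>
  (α_ P.1 M.1 X.X).hom ≫ P.1 ◁ X.mm ≫ X.mp -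
      (P.2.β M.1).hom ▷ X.X ≫ (α_ M.1 P.1 X.X).hom ≫ M.1 ◁ X.mp ≫ X.mm =
    b ▷ X.X ≫ (λ_ X.X).hom - halfBr P M X.X ≫ X.X ◁ b ≫ (ρ_ X.X).hom

end DF

/-! ### Tensor algebras -/

/-- The tensor power `F^{⊗ n}` in the Drinfeld centre. -/
def cpow (F : Center D) : ℕ → Center D
  | 0 => 𝟙_ (Center D)
  | n + 1 => cpow F n ⊗ F

/-- The morphism `F^{⊗ n} ⟶ T` induced by a morphism `F ⟶ T` to an algebra. -/
def cpowMap {F T : Center D} [MonObj T] (ι : F ⟶ T) : (n : ℕ) → (cpow F n ⟶ T)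
  | 0 => MonObj.one
  | n + 1 => (cpowMap ι n ⊗ₘ ι) ≫ MonObj.mul

/-- The multiplication of an algebra in the centre, as a morphism of `D`. -/
def mulC (T : Center D) [MonObj T] : T.1 ⊗ T.1 ⟶ T.1 := (MonObj.mul (X := T)).f

/-- The unit of an algebra in the centre, as a morphism of `D`. -/
def oneC (T : Center D) [MonObj T] : 𝟙_ D ⟶ T.1 := (MonObj.one (X := T)).f

/-- The braiding `φ_{T,T}`. -/
def braidOver (T : Center D) : T.1 ⊗ T.1 ⟶ T.1 ⊗ T.1 := (T.2.β T.1).hom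

/-- The inverse braiding `φ_{T,T}⁻¹`. -/
def braidUnder (T : Center D) : T.1 ⊗ T.1 ⟶ T.1 ⊗ T.1 := (T.2.β T.1).inv

/-- The tensor algebra of `F`: an algebra `T` in the Drinfeld centre with a morphism `ι : F ⟶ T`
such that `T` is the direct sum of the tensor powers of `F` through the morphisms induced by `ι`,
together with the coproduct and the counit given on `F` by `ι ⊗ η + η ⊗ ι` and `0`
and extended multiplicatively, where the product on `T ⊗ T` is `(μ ⊗ μ) (1 ⊗ c ⊗ 1)`. The morphism
`c` is `φ_{T,T}` for the Hopf algebra in the centre, and `φ_{T,T}⁻¹` for the Hopf algebra in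
the centre with reversed braiding. -/
structure TensorAlg [Preadditive D] (F : Center D)
    (c : ∀ T : Center D, T.1 ⊗ T.1 ⟶ T.1 ⊗ T.1) where
  T : Center D
  [mon : MonObj T]
  ι : F ⟶ T
  isColimit : IsColimit (Cofan.mk T.1 fun n => (cpowMap ι n).f)
  Δ : T.1 ⟶ T.1 ⊗ T.1
  ε : T.1 ⟶ 𝟙_ D
  one_Δ : oneC T ≫ Δ =
    (λ_ (𝟙_ D)).inv ≫ (oneC T ⊗ₘ oneC T)
  mul_Δ : mulC T ≫ Δ = (Δ ⊗ₘ Δ) ⊗≫ T.1 ◁ c T ▷ T.1 ⊗≫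
    (mulC T ⊗ₘ mulC T)
  ι_Δ : ι.f ≫ Δ = (ρ_ F.1).inv ≫ (ι.f ⊗ₘ oneC T) +
    (λ_ F.1).inv ≫ (oneC T ⊗ₘ ι.f)
  one_ε : oneC T ≫ ε = 𝟙 _
  mul_ε : mulC T ≫ ε = (ε ⊗ₘ ε) ≫ (λ_ (𝟙_ D)).hom
  ι_ε : ι.f ≫ ε = 0

attribute [instance] TensorAlg.mon

/-! ### Hopf pairings and Yetter-Drinfeld modules -/

variable [Preadditive D] {P M : Center D}

/-- A Hopf pairing: the products and the coproducts, and the units and the counits, are dual with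
respect to `ρ`. The tensor powers are paired from the inside to the outside. -/
structure IsHopfPairing (A : TensorAlg P braidOver) (B : TensorAlg M braidUnder)
    (ρ : A.T.1 ⊗ B.T.1 ⟶ 𝟙_ D) : Prop where
  mul_left : mulC A.T ▷ B.T.1 ≫ ρ =
    (A.T.1 ⊗ A.T.1) ◁ B.Δ ⊗≫ A.T.1 ◁ ρ ▷ B.T.1 ⊗≫ ρ
  mul_right : A.T.1 ◁ mulC B.T ≫ ρ =
    A.Δ ▷ (B.T.1 ⊗ B.T.1) ⊗≫ A.T.1 ◁ ρ ▷ B.T.1 ⊗≫ ρ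
  one_left : oneC A.T ▷ B.T.1 ≫ ρ = (λ_ B.T.1).hom ≫ B.ε
  one_right : A.T.1 ◁ oneC B.T ≫ ρ = (ρ_ A.T.1).hom ≫ A.ε

/-- Yetter-Drinfeld modules for the Hopf algebras `A`, `B` and the Hopf pairing `ρ`: left
`A`-modules and right `B`-modules which satisfy the Yetter-Drinfeld condition. -/
structure YD (A : TensorAlg P braidOver) (B : TensorAlg M braidUnder)
    (ρ : A.T.1 ⊗ B.T.1 ⟶ 𝟙_ D) where
  X : D
  mp : A.T.1 ⊗ X ⟶ X
  mm : X ⊗ B.T.1 ⟶ X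
  one_mp : oneC A.T ▷ X ≫ mp = (λ_ X).hom
  mul_mp : mulC A.T ▷ X ≫ mp = (α_ A.T.1 A.T.1 X).hom ≫ A.T.1 ◁ mp ≫ mp
  one_mm : X ◁ oneC B.T ≫ mm = (ρ_ X).hom
  mul_mm : X ◁ mulC B.T ≫ mm = (α_ X B.T.1 B.T.1).inv ≫ mm ▷ B.T.1 ≫ mm
  yd : ((A.Δ ▷ X) ⊗ₘ B.Δ) ⊗≫ (A.T.1 ⊗ A.T.1) ◁ mm ▷ B.T.1 ⊗≫
      A.T.1 ◁ (A.T.2.β X).hom ▷ B.T.1 ⊗≫ (mp ⊗ₘ ρ) ≫ (ρ_ X).hom =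
    ((A.Δ ▷ X) ⊗ₘ B.Δ) ⊗≫ A.T.1 ◁ mp ▷ (B.T.1 ⊗ B.T.1) ⊗≫
      A.T.1 ◁ (B.T.2.β X).inv ▷ B.T.1 ⊗≫ (ρ ⊗ₘ mm) ≫ (λ_ X).hom

namespace YD

variable {A : TensorAlg P braidOver} {B : TensorAlg M braidUnder} {ρ : A.T.1 ⊗ B.T.1 ⟶ 𝟙_ D}

/-- Homomorphisms of Yetter-Drinfeld modules. -/
@[ext]
structure Hom (X Y : YD A B ρ) where
  hom : X.X ⟶ Y.X
  comm_p : A.T.1 ◁ hom ≫ Y.mp = X.mp ≫ hom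
  comm_m : hom ▷ B.T.1 ≫ Y.mm = X.mm ≫ hom

instance : Category (YD A B ρ) where
  Hom := Hom
  id X := ⟨𝟙 X.X, by simp, by simp⟩
  comp f g := ⟨f.hom ≫ g.hom,
    by rw [MonoidalCategory.whiskerLeft_comp, Category.assoc, g.comm_p, ← Category.assoc, f.comm_p,
      Category.assoc],
    by rw [MonoidalCategory.comp_whiskerRight, Category.assoc, g.comm_m, ← Category.assoc,
      f.comm_m, Category.assoc]⟩
  id_comp f := Hom.ext (Category.id_comp f.hom)
  comp_id f := Hom.ext (Category.comp_id f.hom)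
  assoc f g h := Hom.ext (Category.assoc f.hom g.hom h.hom)

variable (A B ρ) in
/-- The forgetful functor. -/
@[simps]
def forget : YD A B ρ ⥤ D where
  obj X := X.X
  map f := f.hom

theorem restrict_aux {F T X Y : D} (i : F ⟶ T) (f : X ⟶ Y) (m : T ⊗ X ⟶ X) (n : T ⊗ Y ⟶ Y)
    (h : T ◁ f ≫ n = m ≫ f) : F ◁ f ≫ i ▷ Y ≫ n = (i ▷ X ≫ m) ≫ f := by
  rw [← Category.assoc, MonoidalCategory.whisker_exchange, Category.assoc, h, Category.assoc]

theorem restrict_aux' {F T X Y : D} (b : HalfBraiding F) (i : F ⟶ T) (f : X ⟶ Y) (m : X ⊗ T ⟶ X)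
    (n : Y ⊗ T ⟶ Y) (h : f ▷ T ≫ n = m ≫ f) :
    F ◁ f ≫ (b.β Y).hom ≫ Y ◁ i ≫ n = ((b.β X).hom ≫ X ◁ i ≫ m) ≫ f := by
  rw [b.naturality_assoc, ← MonoidalCategory.whisker_exchange_assoc, h]
  simp only [Category.assoc]

variable (A B ρ) in
/-- The restriction of the actions to `F^+` and `F^-`; the right action of `F^-` is
made a left action by `φ_{F^-,X}`. -/
@[simps]
def restrict : YD A B ρ ⥤ DF P M where
  obj X := ⟨X.X, A.ι.f ▷ X.X ≫ X.mp, (M.2.β X.X).hom ≫ X.X ◁ B.ι.f ≫ X.mm⟩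
  map {X Y} f := ⟨f.hom, restrict_aux A.ι.f f.hom X.mp Y.mp f.comm_p,
    restrict_aux' M.2 B.ι.f f.hom X.mm Y.mm f.comm_m⟩

/-- The left action on the tensor product. -/
def tensP (X Y : YD A B ρ) : A.T.1 ⊗ (X.X ⊗ Y.X) ⟶ X.X ⊗ Y.X :=
  A.Δ ▷ (X.X ⊗ Y.X) ⊗≫ A.T.1 ◁ (A.T.2.β X.X).hom ▷ Y.X ⊗≫ (X.mp ⊗ₘ Y.mp)

/-- The right action on the tensor product. -/
def tensM (X Y : YD A B ρ) : (X.X ⊗ Y.X) ⊗ B.T.1 ⟶ X.X ⊗ Y.X :=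
  (X.X ⊗ Y.X) ◁ B.Δ ⊗≫ X.X ◁ (B.T.2.β Y.X).inv ▷ B.T.1 ⊗≫ (X.mm ⊗ₘ Y.mm)

/-- The monoidal structure on the category of Yetter-Drinfeld modules is the tensor
product in `D` with the actions through the coproducts, and the unit object is the unit of `D` with
the actions through the counits. -/
structure IsStd (A : TensorAlg P braidOver) (B : TensorAlg M braidUnder)
    (ρ : A.T.1 ⊗ B.T.1 ⟶ 𝟙_ D) [MonoidalCategory (YD A B ρ)] [(forget A B ρ).Monoidal] : Prop where
  tens_p : ∀ X Y : YD A B ρ, A.T.1 ◁ Functor.LaxMonoidal.μ (forget A B ρ) X Y ≫ (X ⊗ Y).mp =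
    tensP X Y ≫ Functor.LaxMonoidal.μ (forget A B ρ) X Y
  tens_m : ∀ X Y : YD A B ρ, Functor.LaxMonoidal.μ (forget A B ρ) X Y ▷ B.T.1 ≫ (X ⊗ Y).mm =
    tensM X Y ≫ Functor.LaxMonoidal.μ (forget A B ρ) X Y
  one_p : A.T.1 ◁ Functor.LaxMonoidal.ε (forget A B ρ) ≫ (𝟙_ (YD A B ρ)).mp =
    (A.ε ▷ 𝟙_ D ≫ (λ_ (𝟙_ D)).hom) ≫ Functor.LaxMonoidal.ε (forget A B ρ)
  one_m : Functor.LaxMonoidal.ε (forget A B ρ) ▷ B.T.1 ≫ (𝟙_ (YD A B ρ)).mm =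
    (𝟙_ D ◁ B.ε ≫ (λ_ (𝟙_ D)).hom) ≫ Functor.LaxMonoidal.ε (forget A B ρ)

end YD

end Perturbed
end CBoson

end

noncomputable section

namespace CBoson

/-! ### The algebra `B_F` and its homomorphism to the quantum loop algebra -/

/-- The generators of `B_F`: `K 0 = k`, `K 1 = k⁻¹`, and `f i = f^±`, `fb i = f̄^±`, with the sign `+`
for `i = 0` and `-` for `i = 1`. -/
inductive BGen : Type
  | K (i : Fin 2)
  | f (i : Fin 2)
  | fb (i : Fin 2)

/-- The defining relations of `B_F`: `k k⁻¹ = 1 = k⁻¹ k`, `k f^± k⁻¹ = q^{± 2} f^±`, and the same for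
`f̄^±`. -/
inductive BRel (q : ℂˣ) : FreeAlgebra ℂ BGen → FreeAlgebra ℂ BGen → Prop
  | inv (i) : BRel q (.ι ℂ (.K i) * .ι ℂ (.K (i + 1))) 1
  | f (i) : BRel q (.ι ℂ (.K 0) * .ι ℂ (.f i) * .ι ℂ (.K 1))
      ((![(q : ℂ) ^ 2, ((q : ℂ) ^ 2)⁻¹] i) • .ι ℂ (.f i))
  | fb (i) : BRel q (.ι ℂ (.K 0) * .ι ℂ (.fb i) * .ι ℂ (.K 1))
      ((![(q : ℂ) ^ 2, ((q : ℂ) ^ 2)⁻¹] i) • .ι ℂ (.fb i))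

/-- The algebra `B_F`. -/
def BF (q : ℂˣ) : Type := RingQuot (BRel q)

namespace BF

variable (q : ℂˣ)

instance : Ring (BF q) := inferInstanceAs (Ring (RingQuot (BRel q)))
instance : Algebra ℂ (BF q) := inferInstanceAs (Algebra ℂ (RingQuot (BRel q)))

/-- The projection from the free algebra. -/
def mk : FreeAlgebra ℂ BGen →ₐ[ℂ] BF q := RingQuot.mkAlgHom ℂ (BRel q)

/-- The generators of `B_F`. -/
def gen (g : BGen) : BF q := mk q (.ι ℂ g)

theorem mk_rel {a b : FreeAlgebra ℂ BGen} (h : BRel q a b) : mk q a = mk q b :=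
  RingQuot.mkAlgHom_rel ℂ h

theorem inv (i : Fin 2) : gen q (.K i) * gen q (.K (i + 1)) = 1 := by
  simpa [gen] using mk_rel q (.inv i)

theorem unit : IsUnit (gen q (.K 0)) :=
  isUnit_iff_exists.2 ⟨gen q (.K 1), inv q 0, inv q 1⟩

theorem comm_aux {x : BF q} {c : ℂ} (h : gen q (.K 0) * x * gen q (.K 1) = c • x) :
    gen q (.K 0) * x = c • (x * gen q (.K 0)) := by
  have h1 : gen q (.K 1) * gen q (.K 0) = 1 := inv q 1
  have := congrArg (· * gen q (.K 0)) h
  simpa [mul_assoc, h1] using this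

theorem K_f (i : Fin 2) : gen q (.K 0) * gen q (.f i) =
    (![(q : ℂ) ^ 2, ((q : ℂ) ^ 2)⁻¹] i) • (gen q (.f i) * gen q (.K 0)) :=
  comm_aux q (by simpa only [gen, map_mul, map_smul] using mk_rel q (.f i))

theorem K_fb (i : Fin 2) : gen q (.K 0) * gen q (.fb i) =
    (![(q : ℂ) ^ 2, ((q : ℂ) ^ 2)⁻¹] i) • (gen q (.fb i) * gen q (.K 0)) :=
  comm_aux q (by simpa only [gen, map_mul, map_smul] using mk_rel q (.fb i))

/-- The images of the generators under the homomorphism to the quantum loop algebra. -/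
def toUqGen (ζ ξ : ℂ) : BGen → Uq q
  | .K i => Uq.gen q (.K i)
  | .f 0 => Uq.gen q (.ep 0) * Uq.gen q (.K 1)
  | .f 1 => (ξ * ((q - (q : ℂ)⁻¹) / (q : ℂ) ^ 2)) • (Uq.gen q (.ep 1) * Uq.gen q (.K 0))
  | .fb 0 => Uq.gen q (.em 1)
  | .fb 1 => (ζ * ((q - (q : ℂ)⁻¹) / (q : ℂ) ^ 2)) • Uq.gen q (.em 0)

/-- The homomorphism `ψ` from `B_F` to `U_q(L sl₂)`: `k ↦ k_0`, `f^+ ↦ e_0^+ k_0⁻¹`,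
`f^- ↦ ξ (q - q⁻¹) / q² e_1^+ k_1⁻¹`, `f̄^+ ↦ e_1^-`, `f̄^- ↦ ζ (q - q⁻¹) / q² e_0^-`. -/
def toUq (ζ ξ : ℂ) : BF q →ₐ[ℂ] Uq q :=
  RingQuot.liftAlgHom ℂ ⟨FreeAlgebra.lift ℂ (toUqGen q ζ ξ), fun a b hab => by
    have h01 : Uq.gen q (.K 0) * Uq.gen q (.K 1) = 1 := (Uq.rels q).inv 0
    have h10 : Uq.gen q (.K 1) * Uq.gen q (.K 0) = 1 := (Uq.rels q).inv 1
    have p0 : Uq.gen q (.K 0) * Uq.gen q (.ep 0) * Uq.gen q (.K 1) = (q : ℂ) ^ 2 •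
      Uq.gen q (.ep 0) := (Uq.rels q).kp 0
    have m0 : Uq.gen q (.K 0) * Uq.gen q (.em 0) * Uq.gen q (.K 1) = ((q : ℂ) ^ 2)⁻¹ •
      Uq.gen q (.em 0) := (Uq.rels q).km 0
    have p1 : Uq.gen q (.K 0) * Uq.gen q (.ep 1) = ((q : ℂ) ^ 2)⁻¹ •
      (Uq.gen q (.ep 1) * Uq.gen q (.K 0)) := (Uq.rels q).kep' 1
    have m1 : Uq.gen q (.K 0) * Uq.gen q (.em 1) = (q : ℂ) ^ 2 •
      (Uq.gen q (.em 1) * Uq.gen q (.K 0)) := (Uq.rels q).kem' 1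
    induction hab with
    | inv i => simpa [toUqGen] using (Uq.rels q).inv i
    | f i =>
      simp only [map_mul, map_smul, FreeAlgebra.lift_ι_apply]
      fin_cases i
      · change Uq.gen q (.K 0) * (Uq.gen q (.ep 0) * Uq.gen q (.K 1)) * Uq.gen q (.K 1) =
          (q : ℂ) ^ 2 • (Uq.gen q (.ep 0) * Uq.gen q (.K 1))
        rw [← mul_assoc, p0, smul_mul_assoc]
      · change Uq.gen q (.K 0) * (_ • (Uq.gen q (.ep 1) * Uq.gen q (.K 0))) * Uq.gen q (.K 1) =
          ((q : ℂ) ^ 2)⁻¹ • (_ • (Uq.gen q (.ep 1) * Uq.gen q (.K 0)))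
        rw [mul_smul_comm, smul_mul_assoc, mul_assoc, mul_assoc, h01, mul_one, p1, smul_comm]
    | fb i =>
      simp only [map_mul, map_smul, FreeAlgebra.lift_ι_apply]
      fin_cases i
      · change Uq.gen q (.K 0) * Uq.gen q (.em 1) * Uq.gen q (.K 1) =
          (q : ℂ) ^ 2 • Uq.gen q (.em 1)
        rw [m1, smul_mul_assoc, mul_assoc, h01, mul_one]
      · change Uq.gen q (.K 0) * (_ • Uq.gen q (.em 0)) * Uq.gen q (.K 1) =
          ((q : ℂ) ^ 2)⁻¹ • (_ • Uq.gen q (.em 0))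
        rw [mul_smul_comm, smul_mul_assoc, m0, smul_comm]⟩

@[simp] theorem toUq_gen (ζ ξ : ℂ) (g : BGen) : toUq q ζ ξ (gen q g) = toUqGen q ζ ξ g :=
  (RingQuot.liftAlgHom_mkAlgHom_apply _ _ _ _).trans (FreeAlgebra.lift_ι_apply _ _)

end BF

/-! ### The category of pairs over the Cartan part -/

/-- `q` as a unit. -/
def qu (κ r : ℂˣ) : ℂˣ := Units.mk0 (qq κ r) (qq_ne_zero κ r)

/-- Spaces `X` with a diagonalisable automorphism `k`, and morphisms `Ẽ^+ ⊗ X → X` and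
`Ẽ^- ⊗ X → X`, where `Ẽ^± = ℂ_{q^2} ⊕ ℂ_{q^{-2}}`. -/
structure KMod (κ r : ℂˣ) where
  X : KVect
  mp : ((fundK κ r).tens X).V →ₗ[ℂ] X.V
  mm : ((fundK κ r).tens X).V →ₗ[ℂ] X.V
  mp_k : ∀ t, mp (((fundK κ r).tens X).k t) = X.k (mp t)
  mm_k : ∀ t, mm (((fundK κ r).tens X).k t) = X.k (mm t)

/-- `1 ⊗ f` on `Ẽ^± ⊗ X`. -/
def KVect.lmap (Z : KVect) {X Y : KVect} (f : X.V →ₗ[ℂ] Y.V) :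
    (Z.tens X).V →ₗ[ℂ] (Z.tens Y).V := TensorProduct.map LinearMap.id f

theorem KVect.lmap_id (Z X : KVect) : Z.lmap (LinearMap.id : X.V →ₗ[ℂ] X.V) = LinearMap.id :=
  TensorProduct.map_id

theorem KVect.lmap_comp (Z : KVect) {X Y W : KVect} (g : Y.V →ₗ[ℂ] W.V) (f : X.V →ₗ[ℂ] Y.V) :
    Z.lmap (g ∘ₗ f) = Z.lmap g ∘ₗ Z.lmap f :=
  TensorProduct.ext' fun _ _ => rfl

theorem KVect.lmap_k (Z : KVect) {X Y : KVect} (f : X.V →ₗ[ℂ] Y.V) (hf : ∀ v, f (X.k v) = Y.k (f v))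
    (t : (Z.tens X).V) : Z.lmap f ((Z.tens X).k t) = (Z.tens Y).k (Z.lmap f t) := by
  refine LinearMap.congr_fun (f := Z.lmap f ∘ₗ (Z.tens X).k) (g := (Z.tens Y).k ∘ₗ Z.lmap f)
    (TensorProduct.ext' fun z x => ?_) t
  change Z.k z ⊗ₜ[ℂ] f (X.k x) = Z.k z ⊗ₜ[ℂ] Y.k (f x)
  rw [hf]

namespace KMod

variable {κ r : ℂˣ}

/-- Morphisms of pairs. -/
@[ext]
structure Hom (X Y : KMod κ r) where
  lin : X.X.V →ₗ[ℂ] Y.X.V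
  comm_k : ∀ v, lin (X.X.k v) = Y.X.k (lin v)
  comm_p : ∀ t, lin (X.mp t) = Y.mp ((fundK κ r).lmap lin t)
  comm_m : ∀ t, lin (X.mm t) = Y.mm ((fundK κ r).lmap lin t)

instance : Category (KMod κ r) where
  Hom := Hom
  id X := ⟨LinearMap.id, fun _ => rfl, fun t => by rw [KVect.lmap_id]; rfl,
    fun t => by rw [KVect.lmap_id]; rfl⟩
  comp f g := ⟨g.lin.comp f.lin,
    fun v => by rw [LinearMap.comp_apply, f.comm_k, g.comm_k, LinearMap.comp_apply],
    fun t => by rw [LinearMap.comp_apply, f.comm_p, g.comm_p, KVect.lmap_comp, LinearMap.comp_apply],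
    fun t => by rw [LinearMap.comp_apply, f.comm_m, g.comm_m, KVect.lmap_comp, LinearMap.comp_apply]⟩

theorem hom_ext {X Y : KMod κ r} {f g : X ⟶ Y} (h : f.lin = g.lin) : f = g := Hom.ext h

@[simp] theorem id_lin (X : KMod κ r) : (𝟙 X : X ⟶ X).lin = LinearMap.id := rfl
@[simp] theorem comp_lin {X Y Z : KMod κ r} (f : X ⟶ Y) (g : Y ⟶ Z) :
    (f ≫ g).lin = g.lin.comp f.lin := rfl

/-- `φ ⊗ v ↦ (φ_0 s_0 + φ_1 s_1) v` -/
def mact (κ r : ℂˣ) (X : KVect) (s : Fin 2 → Module.End ℂ X.V) :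
    ((fundK κ r).tens X).V →ₗ[ℂ] X.V :=
  TensorProduct.lift (Finsupp.linearCombination ℂ s)

/-- `e_i ⊗ v` -/
def et (κ r : ℂˣ) (X : KVect) (i : Fin 2) (v : X.V) : ((fundK κ r).tens X).V :=
  (Finsupp.single i (1 : ℂ) ⊗ₜ[ℂ] v : (Fin 2 →₀ ℂ) ⊗[ℂ] X.V)

theorem et_ext {X : KVect} {M : Type} [AddCommGroup M] [Module ℂ M]
    {f g : ((fundK κ r).tens X).V →ₗ[ℂ] M} (h : ∀ i (v : X.V), f (et κ r X i v) = g (et κ r X i v)) :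
    f = g :=
  TensorProduct.ext (Finsupp.lhom_ext' fun i => LinearMap.ext_ring (LinearMap.ext (h i)))

theorem mact_et (X : KVect) (s : Fin 2 → Module.End ℂ X.V) (i : Fin 2) (v : X.V) :
    mact κ r X s (et κ r X i v) = s i v := by
  have h : Finsupp.linearCombination ℂ s (Finsupp.single i (1 : ℂ)) = s i := by
    rw [Finsupp.linearCombination_single, one_smul]
  exact (TensorProduct.lift.tmul (R := ℂ) _ _).trans (LinearMap.congr_fun h v)

theorem k_et (X : KVect) (i : Fin 2) (v : X.V) : ((fundK κ r).tens X).k (et κ r X i v) =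
    (![qq κ r ^ 2, (qq κ r ^ 2)⁻¹] i) • et κ r X i (X.k v) := by
  change (diagEnd _ (Finsupp.single i (1 : ℂ)) ⊗ₜ[ℂ] X.k v : (Fin 2 →₀ ℂ) ⊗[ℂ] X.V) = _
  rw [diagEnd_single, ← TensorProduct.smul_tmul']
  rfl

theorem lmap_et {X Y : KVect} (f : X.V →ₗ[ℂ] Y.V) (i : Fin 2) (v : X.V) :
    (fundK κ r).lmap f (et κ r X i v) = et κ r Y i (f v) := rfl

theorem mact_k (X : KVect) (s : Fin 2 → Module.End ℂ X.V)
    (hs : ∀ i v, X.k (s i v) = (![qq κ r ^ 2, (qq κ r ^ 2)⁻¹] i) • s i (X.k v))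
    (t : ((fundK κ r).tens X).V) :
    mact κ r X s (((fundK κ r).tens X).k t) = X.k (mact κ r X s t) := by
  refine LinearMap.congr_fun (f := mact κ r X s ∘ₗ ((fundK κ r).tens X).k)
    (g := X.k ∘ₗ mact κ r X s) (et_ext fun i v => ?_) t
  rw [LinearMap.comp_apply, LinearMap.comp_apply, mact_et, hs, k_et, map_smul, mact_et]

theorem mact_natural {X Y : KVect} (f : X.V →ₗ[ℂ] Y.V) (s : Fin 2 → Module.End ℂ X.V)
    (s' : Fin 2 → Module.End ℂ Y.V) (hs : ∀ i v, f (s i v) = s' i (f v))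
    (t : ((fundK κ r).tens X).V) :
    f (mact κ r X s t) = mact κ r Y s' ((fundK κ r).lmap f t) := by
  refine LinearMap.congr_fun (f := f ∘ₗ mact κ r X s)
    (g := mact κ r Y s' ∘ₗ (fundK κ r).lmap f) (et_ext fun i v => ?_) t
  rw [LinearMap.comp_apply, LinearMap.comp_apply, lmap_et, mact_et, mact_et, hs]

/-- The space with automorphism `k` which underlies a representation of `B_F`. -/
def kv (X : RepK (BF (qu κ r)) (BF.gen _ (.K 0))) : KVect where
  V := X.V
  k := X.ρ (BF.gen _ (.K 0))
  unit := (BF.unit (qu κ r)).map X.ρ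
  diag := X.diag

theorem act_comm {q : ℂˣ} {X : RepK (BF q) (BF.gen _ (.K 0))} {x : BF q} {c : ℂ}
    (h : BF.gen q (.K 0) * x = c • (x * BF.gen q (.K 0))) (v : X.V) :
    X.ρ (BF.gen q (.K 0)) (X.ρ x v) = c • X.ρ x (X.ρ (BF.gen q (.K 0)) v) := by
  rw [← Module.End.mul_apply, ← map_mul, h, map_smul, map_mul]
  rfl

/-- The functor from representations of `B_F` to pairs: on `Ẽ^+ ⊗ X` the morphism is
`φ ⊗ v ↦ (φ^+ f^+ + φ^- f^-) v`, and on `Ẽ^- ⊗ X` it is `φ ⊗ v ↦ (φ^+ f̄^+ + φ^- f̄^-) v`. -/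
def ofRep (κ r : ℂˣ) : RepK (BF (qu κ r)) (BF.gen _ (.K 0)) ⥤ KMod κ r where
  obj X :=
    { X := kv X
      mp := mact κ r (kv X) fun i => X.ρ (BF.gen _ (.f i))
      mm := mact κ r (kv X) fun i => X.ρ (BF.gen _ (.fb i))
      mp_k := mact_k (kv X) _ fun i v => act_comm (BF.K_f (qu κ r) i) v
      mm_k := mact_k (kv X) _ fun i v => act_comm (BF.K_fb (qu κ r) i) v }
  map {X Y} f :=
    { lin := f.lin
      comm_k := fun v => f.comm _ v
      comm_p := mact_natural (X := kv X) (Y := kv Y) f.lin _ _ fun i v => f.comm _ v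
      comm_m := mact_natural (X := kv X) (Y := kv Y) f.lin _ _ fun i v => f.comm _ v }

end KMod
end CBoson

end

noncomputable section

namespace CBoson

open Bim

/-- The identification of `X` with the space which underlies `X.wt r`. -/
def KVect.el (X : KVect) (r : ℂ) : X.V →ₗ[ℂ] (X.wt r).V := LinearMap.id

/-- The element `a ⊗ v` of `𝓘(X)`. -/
def KVect.ia (X : KVect) (r : ℂ) (a : Alg) (v : X.V) : (X.I r).V := aa r 0 (X.wt r) a (X.el r v)

theorem KVect.I_ind {X : KVect} {r : ℂ} {P : (X.I r).V → Prop} (t : (X.I r).V)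
    (h0 : P 0) (h1 : ∀ a v, P (X.ia r a v)) (h2 : ∀ t s, P t → P s → P (t + s)) : P t :=
  aa_ind₂ t h0 h1 h2

theorem ihom_ext {X : KVect} {r : ℂ} {Y : Bim r} {f g : X.I r ⟶ Y}
    (h : ∀ a v, f.lin (X.ia r a v) = g.lin (X.ia r a v)) : f = g :=
  hom_ext (LinearMap.ext fun t => by
    induction t using KVect.I_ind with
    | h0 => simp
    | h1 a v => exact h a v
    | h2 t s ht hs => simp only [map_add, ht, hs])

theorem KVect.mapI_ia {X Y : KVect} (r : ℂ) (f : X.V →ₗ[ℂ] Y.V) (hf : ∀ v, f (X.k v) = Y.k (f v))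
    (a : Alg) (v : X.V) : (KVect.mapI r f hf).lin (X.ia r a v) = Y.ia r a (f v) := by
  refine (homOf_aa _ _ _ _ a _).trans ?_
  refine (lact_aa _ _ _).trans ?_
  rw [mul_one]
  rfl

theorem KVect.mapI_comp {X Y Z : KVect} (r : ℂ) (f : X.V →ₗ[ℂ] Y.V)
    (hf : ∀ v, f (X.k v) = Y.k (f v)) (g : Y.V →ₗ[ℂ] Z.V) (hg : ∀ v, g (Y.k v) = Z.k (g v))
    (hgf : ∀ v, (g ∘ₗ f) (X.k v) = Z.k ((g ∘ₗ f) v)) :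
    KVect.mapI r f hf ≫ KVect.mapI r g hg = KVect.mapI r (g ∘ₗ f) hgf :=
  ihom_ext fun a v => by
    rw [comp_lin, LinearMap.comp_apply, mapI_ia, mapI_ia, mapI_ia, LinearMap.comp_apply]

theorem KVect.mapI_id (X : KVect) (r : ℂ) :
    KVect.mapI (X := X) r LinearMap.id (fun _ => rfl) = 𝟙 (X.I r) :=
  ihom_ext fun a v => KVect.mapI_ia (X := X) r LinearMap.id (fun _ => rfl) a v

theorem KVect.mu_ia (X Y : KVect) (r : ℂ) (a b : Alg) (x : X.V) (y : Y.V) :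
    (X.mu Y r).lin (tmul (X.ia r a x) (Y.ia r b y)) =
      ((X.tens Y).I r).lact (a * b) (X.sig Y r x y) := by
  have h : (X.mu Y r).lin (tmul (X.ia r a x) (Y.ia r b y)) =
      abil (E := X.wt r) (E' := Y.wt r) (X := (X.tens Y).I r) (κ := 0) (κ' := 0) (X.sig Y r)
        (X.ia r a x) (Y.ia r b y) := rfl
  exact h.trans (abil_aa _ _ _ _ _)

theorem KVect.sig_natural {Z X Y : KVect} (r : ℂ) (f : X.V →ₗ[ℂ] Y.V)
    (hf : ∀ v, f (X.k v) = Y.k (f v))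
    (hf' : ∀ v, Z.lmap f ((Z.tens X).k v) = (Z.tens Y).k (Z.lmap f v)) (z : Z.V)
    (x : X.V) : (KVect.mapI (X := Z.tens X) (Y := Z.tens Y) r (Z.lmap f) hf').lin (Z.sig X r z x) =
      Z.sig Y r z (f x) :=
  KVect.bil_ext (f := (Z.sig X r).compr₂
      (KVect.mapI (X := Z.tens X) (Y := Z.tens Y) r (Z.lmap f) hf').lin)
    (g := (Z.sig Y r).compl₂ f) (fun a b z x _ _ hz hx => by
      have hfx : Y.k (f x) = b • f x := by rw [← hf x, hx, map_smul]
      rw [LinearMap.compr₂_apply, LinearMap.compl₂_apply, Z.sig_apply X r hz hx,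
        Z.sig_apply Y r hz hfx]
      exact KVect.mapI_ia (X := Z.tens X) (Y := Z.tens Y) r (Z.lmap f) hf' _ _) z x

theorem KVect.mu_natural (Z : KVect) {X Y : KVect} (r : ℂ) (f : X.V →ₗ[ℂ] Y.V)
    (hf : ∀ v, f (X.k v) = Y.k (f v))
    (hf' : ∀ v, Z.lmap f ((Z.tens X).k v) = (Z.tens Y).k (Z.lmap f v)) :
    Z.I r ◁ KVect.mapI r f hf ≫ Z.mu Y r =
      Z.mu X r ≫ KVect.mapI (X := Z.tens X) (Y := Z.tens Y) r (Z.lmap f) hf' :=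
  thom_ext fun t s => by
    induction t using KVect.I_ind with
    | h0 => simp
    | h2 t t' h h' => simp only [map_add, LinearMap.add_apply, h, h']
    | h1 a z =>
      induction s using KVect.I_ind with
      | h0 => simp
      | h2 s s' h h' => simp only [map_add, h, h']
      | h1 b x =>
        change (Z.mu Y r).lin ((Z.I r ◁ KVect.mapI r f hf).lin
            (tmul (Z.ia r a z) (X.ia r b x))) =
          (KVect.mapI (X := Z.tens X) (Y := Z.tens Y) r (Z.lmap f) hf').lin ((Z.mu X r).lin
            (tmul (Z.ia r a z) (X.ia r b x)))
        rw [whiskerLeft_tmul, KVect.mapI_ia, KVect.mu_ia, KVect.mu_ia, Hom.comm_l,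
          KVect.sig_natural r f hf]

/-- The morphism `𝓘(m) (g⁻¹ ⊗ 1)`, for a morphism `m : Ẽ^± ⊗ X → X`. -/
def gAct (κ r : ℂˣ) {s : ℂ} (hs : s = κ ∨ s = -κ) (c : Fin 2 → ℂˣ) (X : KVect)
    (m : ((fundK κ r).tens X).V →ₗ[ℂ] X.V) (hm : ∀ t, m (((fundK κ r).tens X).k t) = X.k (m t)) :
    alpha (r : ℂ) s (fund (om κ r)) ⊗ X.I r ⟶ X.I r :=
  (gIso κ r hs c).inv ▷ X.I r ≫ (fundK κ r).mu X r ≫ KVect.mapI r m hm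

theorem gAct_natural (κ r : ℂˣ) {s : ℂ} (hs : s = κ ∨ s = -κ) (c : Fin 2 → ℂˣ) {X Y : KVect}
    (m : ((fundK κ r).tens X).V →ₗ[ℂ] X.V) (hm : ∀ t, m (((fundK κ r).tens X).k t) = X.k (m t))
    (n : ((fundK κ r).tens Y).V →ₗ[ℂ] Y.V) (hn : ∀ t, n (((fundK κ r).tens Y).k t) = Y.k (n t))
    (f : X.V →ₗ[ℂ] Y.V) (hf : ∀ v, f (X.k v) = Y.k (f v))
    (h : ∀ t, f (m t) = n ((fundK κ r).lmap f t)) :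
    alpha (r : ℂ) s (fund (om κ r)) ◁ KVect.mapI r f hf ≫ gAct κ r hs c Y n hn =
      gAct κ r hs c X m hm ≫ KVect.mapI r f hf := by
  have h1 : f ∘ₗ m = n ∘ₗ (fundK κ r).lmap f := LinearMap.ext h
  have hl := KVect.lmap_k (fundK κ r) f hf
  have e1 : ∀ t, (f ∘ₗ m) (((fundK κ r).tens X).k t) = Y.k ((f ∘ₗ m) t) := fun t => by
    rw [LinearMap.comp_apply, hm, hf, LinearMap.comp_apply]
  have e2 : ∀ t, (n ∘ₗ (fundK κ r).lmap f) (((fundK κ r).tens X).k t) =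
      Y.k ((n ∘ₗ (fundK κ r).lmap f) t) := fun t => by rw [← h1]; exact e1 t
  have e3 : (fundK κ r).mu X r ≫ KVect.mapI (r : ℂ) (n ∘ₗ (fundK κ r).lmap f) e2 =
      (fundK κ r).mu X r ≫ KVect.mapI (r : ℂ) (f ∘ₗ m) e1 := by simp only [h1]
  rw [gAct, gAct, MonoidalCategory.whisker_exchange_assoc, ← Category.assoc (_ ◁ _),
    KVect.mu_natural (fundK κ r) r f hf hl, Category.assoc, Category.assoc, Category.assoc,
    KVect.mapI_comp r _ hl n hn e2, KVect.mapI_comp r m hm f hf e1, e3]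

/-- The functor `𝓘_g`, for the isomorphism `g` with components `gIso κ r _ c` on `Ẽ^+` and
`gIso κ r _ c'` on `Ẽ^-`. -/
def KMod.toDF (κ r : ℂˣ) (c c' : Fin 2 → ℂˣ) : KMod κ r ⥤ DF (Fp κ r) (Fm κ r) where
  obj X :=
    { X := X.X.I r
      mp := gAct κ r (Or.inl rfl) c X.X X.mp X.mp_k
      mm := gAct κ r (Or.inr rfl) c' X.X X.mm X.mm_k }
  map f :=
    { hom := KVect.mapI r f.lin f.comm_k
      comm_p := gAct_natural κ r (Or.inl rfl) c _ _ _ _ f.lin f.comm_k f.comm_p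
      comm_m := gAct_natural κ r (Or.inr rfl) c' _ _ _ _ f.lin f.comm_k f.comm_m }
  map_id X := DF.Hom.ext (KVect.mapI_id X.X r)
  map_comp f g := DF.Hom.ext
    (KVect.mapI_comp r f.lin f.comm_k g.lin g.comm_k (f ≫ g).comm_k).symm

/-- The representations of `U_q(L sl₂)` on which `k` acts diagonalisably. -/
abbrev RepUq (κ r : ℂˣ) : Type 1 := RepK (Uq (qu κ r)) (Uq.gen (qu κ r) (.K 0))

/-- The composition of the pullback along `ψ`, the functor to pairs over the Cartan part, and `𝓘_g`. Here
`g` has the components `c_0`, `c_1` on `Ẽ^+` and `c_1⁻¹`, `c_0⁻¹` on `Ẽ^-`, so that the pairing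
`b` on `F^+ ⊗ F^-` corresponds to the pairing with values `ζ`, `ξ` on `Ẽ^+ ⊗ Ẽ^-`. -/
def repToDF (κ r ζ ξ : ℂˣ) (c : Fin 2 → ℂˣ) : RepUq κ r ⥤ DF (Fp κ r) (Fm κ r) :=
  RepK.pullback (BF.toUq (qu κ r) ζ ξ) (BF.toUq_gen (qu κ r) ζ ξ (.K 0)) ⋙ KMod.ofRep κ r ⋙
    KMod.toDF κ r c ![(c 1)⁻¹, (c 0)⁻¹]

/-- The space with automorphism `k` which underlies a representation of `U_q(L sl₂)`. -/
def repKv (κ r ζ ξ : ℂˣ) (V : RepUq κ r) : KVect :=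
  KMod.kv ((RepK.pullback (BF.toUq (qu κ r) ζ ξ) (BF.toUq_gen (qu κ r) ζ ξ (.K 0))).obj V)

theorem repKv_k (κ r ζ ξ : ℂˣ) (V : RepUq κ r) :
    (repKv κ r ζ ξ V).k = V.ρ (Uq.gen (qu κ r) (.K 0)) :=
  congrArg V.ρ (BF.toUq_gen (qu κ r) ζ ξ (.K 0))

/-- The identity `V ⊗ W → V ⊗ W`, where `k` acts on the source as `k ⊗ k` and on the target
through the coproduct. -/
def repTens (κ r ζ ξ : ℂˣ) (V W : RepUq κ r) :
    ((repKv κ r ζ ξ V).tens (repKv κ r ζ ξ W)).V →ₗ[ℂ] (repKv κ r ζ ξ (V ⊗ W)).V :=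
  (LinearMap.id : V.V ⊗[ℂ] W.V →ₗ[ℂ] V.V ⊗[ℂ] W.V)

theorem repTens_k (κ r ζ ξ : ℂˣ) (V W : RepUq κ r)
    (t : ((repKv κ r ζ ξ V).tens (repKv κ r ζ ξ W)).V) :
    repTens κ r ζ ξ V W (((repKv κ r ζ ξ V).tens (repKv κ r ζ ξ W)).k t) =
      (repKv κ r ζ ξ (V ⊗ W)).k (repTens κ r ζ ξ V W t) := by
  have h1 : ((repKv κ r ζ ξ V).tens (repKv κ r ζ ξ W)).k =
      TensorProduct.map (V.ρ (Uq.gen (qu κ r) (.K 0))) (W.ρ (Uq.gen (qu κ r) (.K 0))) :=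
    congrArg₂ (fun (a : Module.End ℂ V.V) (b : Module.End ℂ W.V) => TensorProduct.map a b)
      (repKv_k κ r ζ ξ V) (repKv_k κ r ζ ξ W)
  have h2 : (V ⊗ W).ρ (Uq.gen (qu κ r) (.K 0)) =
      TensorProduct.map (V.ρ (Uq.gen (qu κ r) (.K 0))) (W.ρ (Uq.gen (qu κ r) (.K 0))) := by
    have h3 : Coalgebra.comul (R := ℂ) (Uq.gen (qu κ r) (.K 0)) =
      Uq.gen (qu κ r) (.K 0) ⊗ₜ[ℂ] Uq.gen (qu κ r) (.K 0) := Uq.comul_K (qu κ r) 0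
    exact (congrArg (act₂ V.ρ W.ρ) h3).trans (TensorProduct.ext' fun _ _ => rfl)
  rw [h1, repKv_k]
  exact (LinearMap.congr_fun h2 t).symm

/-- The morphism `𝓘(V) ⊗ 𝓘(W) ⟶ 𝓘(V ⊗ W)` of the tensor structure of `𝓘`. -/
def repMu (κ r ζ ξ : ℂˣ) (c : Fin 2 → ℂˣ) (V W : RepUq κ r) :
    ((repToDF κ r ζ ξ c).obj V).X ⊗ ((repToDF κ r ζ ξ c).obj W).X ⟶
      ((repToDF κ r ζ ξ c).obj (V ⊗ W)).X :=
  (repKv κ r ζ ξ V).mu (repKv κ r ζ ξ W) r ≫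
    KVect.mapI r (repTens κ r ζ ξ V W) (repTens_k κ r ζ ξ V W)

/-- The identification of the underlying objects for a functor `Φ` to Yetter-Drinfeld modules whose
restriction is `Ψ`. -/
def undHom {D : Type 1} [Category.{0} D] [MonoidalCategory D] [Preadditive D] {P M : Center D}
    {A : TensorAlg P braidOver} {B : TensorAlg M braidUnder} {ρ : A.T.1 ⊗ B.T.1 ⟶ 𝟙_ D}
    {C : Type 1} [Category.{0} C] {Φ : C ⥤ YD A B ρ} {Ψ : C ⥤ DF P M}
    (h : Φ ⋙ YD.restrict A B ρ = Ψ) (V : C) :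
    (YD.forget A B ρ).obj (Φ.obj V) ⟶ (Ψ.obj V).X :=
  eqToHom (congrArg DF.X (Functor.congr_obj h V))

end CBoson

end

open CBoson

/-!
The objects `F^±` are free bimodules on two vectors of weights `±ω`, and `exp(κ n r ω) = 1` for
all integers `n`. Hence the right action of `A_r` on `F^±` and on their tensor powers agrees with
the left action, and all half-braidings are given on homogeneous vectors by scalars `exp(± κ μ ν)`.
The theorem is reduced to computations with words in two letters.

*Tensor algebras.* The bimodule on all words, with concatenation as product, is a tensor algebra
(`nonempty_tensorAlg`), and the words are a basis of every tensor algebra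
(`isFree_of_isColimit`). The coproduct of a word is the braided unshuffle sum `copSum`, whose
coefficients have the same form for `F^+` with the braiding and for `F^-` with the inverse braiding
(`cop_wd`).

*The Hopf pairing.* The axioms of a Hopf pairing force a letter `f_i` of `F^+` to act on words in
`F^-` as a skew derivation `der i`; this gives a recursion for the values of the pairing on words
(`pair`), and thereby uniqueness. Conversely the pairing which is defined by the recursion
satisfies the axioms: one of them holds by coassociativity (`pair_append`), the other by the
Leibniz rule (`pair_append_right`).

*Yetter-Drinfeld modules and `D_F'`.* An action of a tensor algebra is the same as a pair of
operators of weights `±ω` which commute with `A_r`. For operators `P_i`, `N_j` from `F^+` and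
`F^-`, where `N_j` is normalised as a right action, the condition which defines `D_F'` becomes
`P_i N_j - N_j P_i = β_{ij} (exp(κ ω_j h) - exp(κ ω_i h))` (`commCond_iff`), where `ω_i` is the
weight of the letter `i` and `β` is the matrix of `b`. The Yetter-Drinfeld condition on the
generators is the same relation (`ydL_sub_ydR_letters`), and it implies the condition for all words,
because both sides satisfy the same recursion (`ydL_cons`, `ydR_cons`, `ydL_eq_ydR`). Therefore the
restriction functor is an isomorphism of categories (`restrict_sFunctor`, `sFunctor_restrict`). The
same description shows that the tensor product of two Yetter-Drinfeld modules is a Yetter-Drinfeld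
module (`tens_comm`); the associator and the unitors are those of bimodules.

*The quantum loop algebra.* On `𝓘(V)` the operators `P_i`, `N_i` are `f^±`, `f̄^±` up to scalars,
together with a shift by the element of `A_r` which makes the weights match (`pOp_ia`, `nOp_ia`).
The operator `exp(κ ω h)` is induced by `k⁻¹` (`kop_ia`), so that the commutation relation above is
the image of the commutation relations of `e_i^±` under `ψ` (`pOp_nOp`). The shifts in the operators
and in the maps `𝓘_{V,W}` satisfy cocycle identities (`sh_floor`, `floor_assoc`); each of them
is proved by comparing weights. Together with the coproducts of `ψ(f^±)` and `ψ(f̄^±)`, which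
are skew primitive, they show that `𝓘_{V,W}` is a coherent isomorphism of Yetter-Drinfeld modules
(`repYDCore`). A vector of `𝓘(V)` of weight `r ℓ` with the real part of `ℓ` in `[0, 1)` is of the
form `1 ⊗ v` (`KVect.eq_ia_one`); hence a homomorphism `𝓘(V) → 𝓘(W)` is induced by a unique linear
map `V → W`. If it commutes with `P_i` and `N_i`, then the linear map commutes with the image of `ψ`,
which is the whole of `U_q` since `q ≠ ± 1` (`Uq.subalgebra_eq_top`). This proves that the functor
is full and faithful.
-/

noncomputable section

namespace CBoson

open Bim

/-! ### Words in two letters -/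

section Words

variable (κ ω : ℂ) (β : Fin 2 → Fin 2 → ℂ) {M N : Type} [AddCommGroup M] [Module ℂ M]
  [AddCommGroup N] [Module ℂ N]

/-- The weight of a word in the basis vectors of weights `ω` and `-ω`. -/
def wt : List (Fin 2) → ℂ
  | [] => 0
  | i :: w => ![ω, -ω] i + wt w

@[simp] theorem wt_nil : wt ω [] = 0 := rfl
@[simp] theorem wt_cons (i : Fin 2) (w : List (Fin 2)) : wt ω (i :: w) = ![ω, -ω] i + wt ω w := rfl

theorem wt_append (u w : List (Fin 2)) : wt ω (u ++ w) = wt ω u + wt ω w := by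
  induction u with
  | nil => simp
  | cons i u ih => simp [ih, add_assoc]

/-- The sum of `G(w₁, w₂)` over the terms `w₁ ⊗ w₂` of the braided coproduct of the word `w`. -/
def copSum : List (Fin 2) → (List (Fin 2) → List (Fin 2) → M) →ₗ[ℂ] M
  | [] =>
    { toFun G := G [] []
      map_add' _ _ := rfl
      map_smul' _ _ := rfl }
  | i :: w =>
    { toFun G := copSum w fun u v => G (i :: u) v + Complex.exp (κ * ![ω, -ω] i * wt ω u) • G u (i :: v)
      map_add' G H := by
        rw [← map_add]; congr 1; funext u v; simp only [Pi.add_apply, smul_add]; abel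
      map_smul' c G := by
        rw [RingHom.id_apply, ← map_smul]; congr 1; funext u v
        simp only [Pi.smul_apply, smul_add, smul_comm c] }

@[simp] theorem copSum_nil (G : List (Fin 2) → List (Fin 2) → M) :
    copSum κ ω [] G = G [] [] := rfl

theorem copSum_cons (i : Fin 2) (w : List (Fin 2)) (G : List (Fin 2) → List (Fin 2) → M) :
    copSum κ ω (i :: w) G = copSum κ ω w fun u v =>
      G (i :: u) v + Complex.exp (κ * ![ω, -ω] i * wt ω u) • G u (i :: v) := rfl

theorem copSum_add (w : List (Fin 2)) (G H : List (Fin 2) → List (Fin 2) → M) :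
    copSum κ ω w (fun u v => G u v + H u v) = copSum κ ω w G + copSum κ ω w H :=
  map_add (copSum κ ω w) G H

theorem copSum_smul (w : List (Fin 2)) (c : ℂ) (G : List (Fin 2) → List (Fin 2) → M) :
    copSum κ ω w (fun u v => c • G u v) = c • copSum κ ω w G :=
  map_smul (copSum κ ω w) c G

theorem map_copSum (f : M →ₗ[ℂ] N) (w : List (Fin 2)) (G : List (Fin 2) → List (Fin 2) → M) :
    f (copSum κ ω w G) = copSum κ ω w fun u v => f (G u v) := by
  induction w generalizing G with
  | nil => rfl
  | cons i w ih => simp only [copSum_cons, ih, map_add, map_smul]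

/-- The terms of the coproduct of `w` have the weight of `w`. -/
theorem copSum_congr (w : List (Fin 2)) {G H : List (Fin 2) → List (Fin 2) → M}
    (h : ∀ u v, wt ω u + wt ω v = wt ω w → G u v = H u v) : copSum κ ω w G = copSum κ ω w H := by
  induction w generalizing G H with
  | nil => exact h [] [] (by simp)
  | cons i w ih =>
    rw [copSum_cons, copSum_cons]
    refine ih fun u v huv => ?_
    rw [h (i :: u) v, h u (i :: v)] <;> simp only [wt_cons, ← huv] <;> ring

/-- The terms of the coproduct of `w` whose second factor is the empty word. -/
theorem copSum_counit (w : List (Fin 2)) (G : List (Fin 2) → List (Fin 2) → M) :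
    copSum κ ω w (fun u v => if v = [] then G u v else 0) = G w [] := by
  induction w generalizing G with
  | nil => simp
  | cons i w ih => simpa [copSum_cons] using ih fun u v => G (i :: u) v

/-- The terms of the coproduct of `w` whose first factor is the empty word. -/
theorem copSum_counit' (w : List (Fin 2)) (G : List (Fin 2) → List (Fin 2) → M) :
    copSum κ ω w (fun u v => if u = [] then G u v else 0) = G [] w := by
  induction w generalizing G with
  | nil => simp
  | cons i w ih =>
    rw [copSum_cons, ← ih fun u v => G u (i :: v)]
    refine copSum_congr κ ω w fun u v _ => ?_
    by_cases h : u = [] <;> simp [h]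

/-- The coproduct is multiplicative for the braided product on the tensor square. -/
theorem copSum_append (w w' : List (Fin 2)) (G : List (Fin 2) → List (Fin 2) → M) :
    copSum κ ω (w ++ w') G = copSum κ ω w fun u v => copSum κ ω w' fun u' v' =>
      Complex.exp (κ * wt ω v * wt ω u') • G (u ++ u') (v ++ v') := by
  induction w generalizing G with
  | nil => simp
  | cons i w ih =>
    rw [List.cons_append, copSum_cons, ih, copSum_cons]
    refine copSum_congr κ ω w fun u v _ => ?_
    rw [← copSum_smul, ← copSum_add]
    refine copSum_congr κ ω w' fun u' v' _ => ?_
    simp only [List.cons_append, wt_cons, wt_append, smul_add, smul_smul, ← Complex.exp_add]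
    congr 3
    ring

/-- Iterated coproduct sums may be exchanged. -/
theorem copSum_comm (w w' : List (Fin 2)) (G : List (Fin 2) → List (Fin 2) → List (Fin 2) →
    List (Fin 2) → M) :
    (copSum κ ω w fun u v => copSum κ ω w' fun u' v' => G u v u' v') =
      copSum κ ω w' fun u' v' => copSum κ ω w fun u v => G u v u' v' := by
  induction w generalizing G with
  | nil => rfl
  | cons i w ih => simp only [copSum_cons, ← copSum_smul, ← copSum_add, ih]

/-- The skew derivation `b ↦ b₁ ρ(f_i, b₂)`, where `β` is the matrix of the pairing: the value of
the linear map `G` at the result. -/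
def der (i : Fin 2) : List (Fin 2) → (List (Fin 2) → M) →ₗ[ℂ] M
  | [] => 0
  | j :: b =>
    { toFun G := der i b (fun u => G (j :: u)) + (β i j * Complex.exp (κ * ![ω, -ω] j * wt ω b)) • G b
      map_add' G H := by
        rw [show (fun u => (G + H) (j :: u)) = (fun u => G (j :: u)) + fun u => H (j :: u) from rfl,
          map_add, Pi.add_apply, smul_add]; abel
      map_smul' c G := by
        rw [show (fun u => (c • G) (j :: u)) = c • (fun u => G (j :: u)) from rfl,
          map_smul, Pi.smul_apply, RingHom.id_apply, smul_add, smul_comm c] }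

/-- The skew derivation `b ↦ ρ(f_i, b₁) b₂`: the value of the linear map `G` at the result. -/
def der' (i : Fin 2) : List (Fin 2) → (List (Fin 2) → M) →ₗ[ℂ] M
  | [] => 0
  | j :: b =>
    { toFun G := Complex.exp (-(κ * ![ω, -ω] j * ![ω, -ω] i)) • der' i b (fun u => G (j :: u)) + β i j • G b
      map_add' G H := by
        rw [show (fun u => (G + H) (j :: u)) = (fun u => G (j :: u)) + fun u => H (j :: u) from rfl,
          map_add, Pi.add_apply, smul_add, smul_add]; abel
      map_smul' c G := by
        rw [show (fun u => (c • G) (j :: u)) = c • (fun u => G (j :: u)) from rfl,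
          map_smul, Pi.smul_apply, RingHom.id_apply, smul_add, smul_comm c, smul_comm c] }

@[simp] theorem der_nil (i : Fin 2) (G : List (Fin 2) → M) : der κ ω β i [] G = 0 := rfl
@[simp] theorem der'_nil (i : Fin 2) (G : List (Fin 2) → M) : der' κ ω β i [] G = 0 := rfl
theorem der_cons (i j : Fin 2) (b : List (Fin 2)) (G : List (Fin 2) → M) :
    der κ ω β i (j :: b) G = der κ ω β i b (fun u => G (j :: u)) +
      (β i j * Complex.exp (κ * ![ω, -ω] j * wt ω b)) • G b := rfl
theorem der'_cons (i j : Fin 2) (b : List (Fin 2)) (G : List (Fin 2) → M) :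
    der' κ ω β i (j :: b) G = Complex.exp (-(κ * ![ω, -ω] j * ![ω, -ω] i)) •
      der' κ ω β i b (fun u => G (j :: u)) + β i j • G b := rfl

theorem der_add (i : Fin 2) (b : List (Fin 2)) (G H : List (Fin 2) → M) :
    der κ ω β i b (fun u => G u + H u) = der κ ω β i b G + der κ ω β i b H :=
  map_add (der κ ω β i b) G H

theorem der_smul (i : Fin 2) (b : List (Fin 2)) (c : ℂ) (G : List (Fin 2) → M) :
    der κ ω β i b (fun u => c • G u) = c • der κ ω β i b G :=
  map_smul (der κ ω β i b) c G

theorem der'_smul (i : Fin 2) (b : List (Fin 2)) (c : ℂ) (G : List (Fin 2) → M) :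
    der' κ ω β i b (fun u => c • G u) = c • der' κ ω β i b G :=
  map_smul (der' κ ω β i b) c G

theorem map_der (f : M →ₗ[ℂ] N) (i : Fin 2) (b : List (Fin 2)) (G : List (Fin 2) → M) :
    f (der κ ω β i b G) = der κ ω β i b fun u => f (G u) := by
  induction b generalizing G with
  | nil => simp
  | cons j b ih => simp only [der_cons, ih, map_add, map_smul]

theorem copSum_der (w : List (Fin 2)) (i : Fin 2) (b : List (Fin 2))
    (G : List (Fin 2) → List (Fin 2) → List (Fin 2) → M) :
    copSum κ ω w (fun u v => der κ ω β i b (G u v)) =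
      der κ ω β i b fun b' => copSum κ ω w fun u v => G u v b' := by
  induction w generalizing G with
  | nil => rfl
  | cons j w ih => simp only [copSum_cons, ← der_smul, ← der_add, ih]

/-- The coproduct commutes with the skew derivation `b ↦ b₁ ρ(f_i, b₂)`, which acts on the last
tensor factor, by coassociativity. -/
theorem copSum_der_right (i : Fin 2) (b : List (Fin 2)) (G : List (Fin 2) → List (Fin 2) → M) :
    copSum κ ω b (fun u v => der κ ω β i v (G u)) =
      der κ ω β i b fun b' => copSum κ ω b' G := by
  induction b generalizing G with
  | nil => simp
  | cons j b ih =>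
    simp only [copSum_cons, der_cons, smul_add, copSum_add, ih, der_add]
    rw [add_assoc]
    congr 2
    · rw [← ih]
      exact copSum_congr κ ω b fun u v _ => (der_smul κ ω β i v _ _).symm
    · rw [← copSum_smul]
      refine copSum_congr κ ω b fun u v h => ?_
      rw [smul_smul, ← h, mul_left_comm, ← Complex.exp_add]
      ring_nf

variable {β} (hβ : ∀ i j, β i j ≠ 0 → ![ω, -ω] i + ![ω, -ω] j = 0)
include hβ

/-- The terms of `der i b` have the weight of `b` with the weight of the removed letter subtracted;
this letter has the weight opposite to that of `f_i`. -/
theorem der_congr (i : Fin 2) (b : List (Fin 2)) {G H : List (Fin 2) → M}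
    (h : ∀ u, wt ω u = ![ω, -ω] i + wt ω b → G u = H u) :
    der κ ω β i b G = der κ ω β i b H := by
  induction b generalizing G H with
  | nil => rfl
  | cons j b ih =>
    rw [der_cons, der_cons, ih fun u hu => h (j :: u) (by rw [wt_cons, hu, wt_cons]; ring)]
    by_cases hb : β i j = 0
    · simp [hb]
    · rw [h b]
      rw [wt_cons]
      linear_combination -(hβ i j hb)

/-- Coassociativity on the middle factor of the twofold coproduct: `b₁ ρ(f_i, b₂) ⊗ b₃` can be
read as a derivation of the first or of the second factor. -/
theorem copSum_der_left (i : Fin 2) (b : List (Fin 2)) (G : List (Fin 2) → List (Fin 2) → M) :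
    copSum κ ω b (fun u v => der κ ω β i u fun u' => G u' v) =
      copSum κ ω b fun u v => der' κ ω β i v (G u) := by
  induction b generalizing G with
  | nil => simp
  | cons j b ih =>
    simp only [copSum_cons, der_cons, der'_cons, smul_add, copSum_add, ih, smul_smul]
    rw [add_assoc]
    congr 1
    rw [add_comm]
    congr 1
    · have : ∀ u v, Complex.exp (κ * ![ω, -ω] j * wt ω u) • der κ ω β i u (fun u' => G u' (j :: v)) =
          der κ ω β i u fun u' => Complex.exp (κ * ![ω, -ω] j * (wt ω u' - ![ω, -ω] i)) •
            G u' (j :: v) := fun u v => by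
        rw [← der_smul]
        refine der_congr κ ω hβ i u fun u' hu' => ?_
        rw [hu']; ring_nf
      simp only [this]
      rw [ih fun u v => Complex.exp (κ * ![ω, -ω] j * (wt ω u - ![ω, -ω] i)) • G u (j :: v)]
      refine copSum_congr κ ω b fun u v _ => ?_
      rw [der'_smul, ← Complex.exp_add]
      ring_nf
    · refine copSum_congr κ ω b fun u v _ => ?_
      rw [mul_comm]

/-- The Leibniz rule of the skew derivation. -/
theorem der_append (i : Fin 2) (b b' : List (Fin 2)) (G : List (Fin 2) → M) :
    der κ ω β i (b ++ b') G = der κ ω β i b' (fun u => G (b ++ u)) +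
      Complex.exp (-(κ * ![ω, -ω] i * wt ω b')) • der κ ω β i b fun u => G (u ++ b') := by
  induction b generalizing G with
  | nil => simp
  | cons j b ih =>
    simp only [List.cons_append, der_cons, ih, smul_add, smul_smul, add_assoc]
    congr 2
    by_cases hb : β i j = 0
    · simp [hb]
    · rw [wt_append, mul_left_comm, ← Complex.exp_add]
      congr 3
      linear_combination κ * wt ω b' * hβ i j hb

variable (β) in
omit hβ in
/-- The Hopf pairing on words: a letter `f_i` on the left acts on the second argument as the skew
derivation `der i`. -/
def pair : List (Fin 2) → List (Fin 2) → ℂ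
  | [], b => if b = [] then 1 else 0
  | i :: a, b => der κ ω β i b (pair a)

omit hβ in
theorem pair_nil (b : List (Fin 2)) : pair κ ω β [] b = if b = [] then 1 else 0 := rfl

omit hβ in
theorem pair_cons (i : Fin 2) (a b : List (Fin 2)) :
    pair κ ω β (i :: a) b = der κ ω β i b (pair κ ω β a) := rfl

omit hβ in
theorem pair_nil_right (a : List (Fin 2)) : pair κ ω β a [] = if a = [] then 1 else 0 := by
  cases a <;> simp [pair_nil, pair_cons]

omit hβ in
theorem pair_letters (i j : Fin 2) : pair κ ω β [i] [j] = β i j := by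
  simp [pair_cons, der_cons, pair_nil]

/-- Words can only be paired nontrivially if their weights are opposite. -/
theorem pair_wt (a b : List (Fin 2)) (h : wt ω a + wt ω b ≠ 0) : pair κ ω β a b = 0 := by
  induction a generalizing b with
  | nil =>
    rw [pair_nil, if_neg]
    rintro rfl
    simp at h
  | cons i a ih =>
    rw [pair_cons, der_congr κ ω hβ i b (H := fun _ => 0)]
    · exact map_zero (der κ ω β i b)
    intro u hu
    apply ih
    rw [hu]
    intro h'
    apply h
    rw [wt_cons, ← h']
    ring

omit hβ in
/-- The Hopf pairing turns a product in the first argument into the coproduct of the second; this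
is built into the recursive definition of `pair`, and follows from `copSum_der_right`. -/
theorem pair_append (a a' b : List (Fin 2)) : pair κ ω β (a ++ a') b =
    copSum κ ω b fun u v => pair κ ω β a' u * pair κ ω β a v := by
  induction a generalizing b with
  | nil =>
    rw [List.nil_append, ← copSum_counit κ ω b fun u _ => pair κ ω β a' u]
    refine copSum_congr κ ω b fun u v _ => ?_
    simp [pair_nil]
  | cons i a ih =>
    rw [List.cons_append, pair_cons, show pair κ ω β (a ++ a') = _ from funext ih,
      ← copSum_der_right]
    refine copSum_congr κ ω b fun u v _ => ?_
    rw [pair_cons]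
    exact der_smul κ ω β i v (pair κ ω β a' u) (pair κ ω β a)

/-- The Hopf pairing turns a product in the second argument into the coproduct of the first, by the
Leibniz rule of the skew derivations. -/
theorem pair_append_right (a b b' : List (Fin 2)) : pair κ ω β a (b ++ b') =
    copSum κ ω a fun u v => pair κ ω β v b * pair κ ω β u b' := by
  induction a generalizing b b' with
  | nil => cases b <;> cases b' <;> simp [pair_nil]
  | cons i a ih =>
    rw [pair_cons, der_append κ ω hβ, copSum_cons, copSum_add]
    congr 1
    · rw [der_congr κ ω hβ i b' fun u _ => ih b u, ← copSum_der]
      refine copSum_congr κ ω a fun u v _ => ?_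
      exact der_smul κ ω β i b' (pair κ ω β v b) (pair κ ω β u)
    · rw [der_congr κ ω hβ i b fun u _ => ih u b', ← copSum_der, ← copSum_smul]
      refine copSum_congr κ ω a fun u v _ => ?_
      have h1 := der_smul κ ω β i b (pair κ ω β u b') (pair κ ω β v)
      simp only [smul_eq_mul, mul_comm (pair κ ω β u b')] at h1
      rw [h1, pair_cons]
      by_cases h : wt ω u + wt ω b' = 0
      · rw [show wt ω u = -wt ω b' by linear_combination h, smul_eq_mul, smul_eq_mul]
        ring_nf
      · simp [pair_wt κ ω hβ u b' h]

end Words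

/-! ### Elements of bimodules -/

section Elements

variable {r : ℂ} {X Y Z X' Y' : Bim r}

theorem add_tmul (x x' : X.V) (y : Y.V) : tmul (x + x') y = tmul x y + tmul x' y :=
  LinearMap.map_add₂ tm x x' y

theorem tmul_add (x : X.V) (y y' : Y.V) : tmul x (y + y') = tmul x y + tmul x y' :=
  map_add (tm x) y y'

theorem zero_tmul (y : Y.V) : tmul (0 : X.V) y = 0 := LinearMap.map_zero₂ tm y

theorem tmul_zero (x : X.V) : tmul x (0 : Y.V) = 0 := map_zero (tm x)

@[simp] theorem comp_apply' (f : X ⟶ Y) (g : Y ⟶ Z) (x : X.V) :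
    (f ≫ g).lin x = g.lin (f.lin x) := rfl

@[simp] theorem id_apply' (x : X.V) : (𝟙 X : X ⟶ X).lin x = x := rfl

@[simp] theorem tensorHom_tmul (f : X ⟶ X') (g : Y ⟶ Y') (x : X.V) (y : Y.V) :
    (f ⊗ₘ g).lin (tmul x y) = tmul (f.lin x) (g.lin y) := mapHom_tm f g x y

theorem lin_add_apply (f g : X ⟶ Y) (x : X.V) : (f + g).lin x = f.lin x + g.lin x := rfl

theorem lin_sub_apply (f g : X ⟶ Y) (x : X.V) : (f - g).lin x = f.lin x - g.lin x := rfl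

/-- An element of `A_r` as an element of the tensor unit. -/
def un (a : Alg) : (𝟙_ (Bim r)).V := uu a

theorem un_ind {P : (𝟙_ (Bim r)).V → Prop} (h : ∀ a, P (un a)) (t : (𝟙_ (Bim r)).V) : P t := h t

theorem lact_un (a b : Alg) : (𝟙_ (Bim r)).lact a (un b) = un (a * b) := rfl
theorem ract_un (a b : Alg) : (𝟙_ (Bim r)).ract a (un b) = un (a * b) := rfl
theorem h_un (a : Alg) : (𝟙_ (Bim r)).h (un a) = un (algH r a) := rfl
theorem h_un_one : (𝟙_ (Bim r)).h (un 1) = 0 := (h_un 1).trans (congrArg un (algH_one r))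

theorem un_eq (a : Alg) : (un a : (𝟙_ (Bim r)).V) = (𝟙_ (Bim r)).lact a (un 1) := by
  rw [lact_un, mul_one]

@[simp] theorem leftUnitor_tmul (a : Alg) (x : X.V) :
    (λ_ X).hom.lin (tmul (un a) x) = X.lact a x := lunit_tm X a x

@[simp] theorem rightUnitor_tmul (x : X.V) (a : Alg) :
    (ρ_ X).hom.lin (tmul x (un a)) = X.ract a x := runit_tm X a x

theorem inv_lin_eq (e : X ≅ Y) {x : X.V} {y : Y.V} (h : e.hom.lin x = y) : e.inv.lin y = x := by
  rw [← h, ← comp_apply', e.hom_inv_id]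
  rfl

end Elements

/-! ### Homogeneous maps and the operators `exp(κ c h)` -/

section Shift

variable {r : ℂ} {X Y Z : Bim r}

/-- A linear map between bimodules which commutes with both actions of `A_r` and is homogeneous
of degree `μ` for `h`. -/
structure IsShift (μ : ℂ) (f : X.V →ₗ[ℂ] Y.V) : Prop where
  h : ∀ x, Y.h (f x) = f (X.h x) + μ • f x
  l : ∀ a x, Y.lact a (f x) = f (X.lact a x)
  r : ∀ a x, Y.ract a (f x) = f (X.ract a x)

theorem IsShift.comp {μ ν : ℂ} {g : Y.V →ₗ[ℂ] Z.V} {f : X.V →ₗ[ℂ] Y.V} (hg : IsShift ν g)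
    (hf : IsShift μ f) : IsShift (μ + ν) (g ∘ₗ f) where
  h x := by simp only [LinearMap.comp_apply, hg.h, hf.h, map_add, map_smul, add_smul, add_assoc]
  l a x := by simp only [LinearMap.comp_apply, hg.l, hf.l]
  r a x := by simp only [LinearMap.comp_apply, hg.r, hf.r]

theorem IsShift.id : IsShift 0 (LinearMap.id : X.V →ₗ[ℂ] X.V) where
  h x := by simp
  l a x := rfl
  r a x := rfl

theorem Hom.isShift (f : X ⟶ Y) : IsShift 0 f.lin where
  h x := by simp
  l a x := by simp
  r a x := by simp

/-- The operator `exp(κ c h)`. -/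
def kop (κ : ℂ) (X : Bim r) (c : ℂ) : Module.End ℂ X.V :=
  fcalc X.h fun z => Complex.exp (κ * c * z)

variable (κ : ℂ)

theorem kop_apply (c : ℂ) {ν : ℂ} {x : X.V} (hx : X.h x = ν • x) :
    kop κ X c x = Complex.exp (κ * c * ν) • x := fcalc_apply X.diag _ hx

theorem kop_kop (c d : ℂ) (x : X.V) : kop κ X c (kop κ X d x) = kop κ X (c + d) x := by
  have : kop κ X c * kop κ X d = kop κ X (c + d) := by
    rw [kop, kop, kop, ← fcalc_mul X.diag]
    congr 1; funext z
    rw [← Complex.exp_add]; ring_nf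
  rw [← this]; rfl

theorem kop_zero (x : X.V) : kop κ X 0 x = x := by
  have : kop κ X 0 = 1 := by
    rw [kop, ← fcalc_one X.diag]; congr 1; funext z; simp
  rw [this]; rfl

theorem kop_neg (c : ℂ) : kop (-κ) X c = kop κ X (-c) := by
  rw [kop, kop]; congr 1; funext z; ring_nf

/-- `exp(κ c h)` commutes with a homogeneous map up to a scalar. -/
theorem kop_shift' {μ : ℂ} {f : X.V →ₗ[ℂ] Y.V} (hf : ∀ x, Y.h (f x) = f (X.h x) + μ • f x)
    (c : ℂ) (x : X.V) : kop κ Y c (f x) = Complex.exp (κ * c * μ) • f (kop κ X c x) := by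
  refine LinearMap.congr_fun (f := kop κ Y c ∘ₗ f)
    (g := Complex.exp (κ * c * μ) • (f ∘ₗ kop κ X c)) (X.diag.ext fun ν x hx => ?_) x
  have h2 : Y.h (f x) = (ν + μ) • f x := by rw [hf, hx, map_smul, add_smul]
  simp only [LinearMap.comp_apply, LinearMap.smul_apply, kop_apply κ c hx, kop_apply κ c h2,
    map_smul, smul_smul, ← Complex.exp_add]
  ring_nf

theorem IsShift.kop {μ : ℂ} {f : X.V →ₗ[ℂ] Y.V} (hf : IsShift μ f) (c : ℂ) (x : X.V) :
    kop κ Y c (f x) = Complex.exp (κ * c * μ) • f (kop κ X c x) := kop_shift' κ hf.h c x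

theorem kop_hom (f : X ⟶ Y) (c : ℂ) (x : X.V) : kop κ Y c (f.lin x) = f.lin (kop κ X c x) := by
  simpa using (Hom.isShift f).kop κ c x

theorem kop_tmul (c : ℂ) (x : X.V) (y : Y.V) :
    kop κ (X ⊗ Y) c (tmul x y) = tmul (kop κ X c x) (kop κ Y c y) := by
  refine LinearMap.congr_fun₂ (f := (tm (X := X) (Y := Y)).compr₂ (kop κ (X ⊗ Y) c))
    (g := (tm ∘ₗ kop κ X c).compl₂ (kop κ Y c)) (X.diag.ext fun μ x hx => Y.diag.ext fun ν y hy => ?_) x y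
  have h2 : (X ⊗ Y).h (tmul x y) = (μ + ν) • tmul x y := by
    rw [h_tmul, hx, hy, smul_tmul, tmul_smul, add_smul]
  refine (kop_apply κ c h2).trans ?_
  change _ = tmul (kop κ X c x) (kop κ Y c y)
  rw [kop_apply κ c hx, kop_apply κ c hy, smul_tmul, tmul_smul, smul_smul, ← Complex.exp_add]
  ring_nf

theorem kop_un_one (c : ℂ) : kop κ (𝟙_ (Bim r)) c (un 1) = un 1 := by
  have : (𝟙_ (Bim r)).h (un 1) = (0 : ℂ) • un 1 := by rw [h_un_one, zero_smul]
  rw [kop_apply κ c this]; simp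

/-- `exp(κ c h)` commutes with the actions of `A_r` if `exp(κ c r) = 1`. -/
theorem kop_isShift {c : ℂ} (hc : ∀ n : ℤ, Complex.exp (κ * (n * r) * c) = 1) :
    IsShift 0 (kop κ X c) where
  h x := by
    refine LinearMap.congr_fun (f := X.h ∘ₗ kop κ X c) (g := kop κ X c ∘ₗ X.h + (0 : ℂ) • kop κ X c)
      (X.diag.ext fun ν x hx => ?_) x
    simp [kop_apply κ c hx, hx, smul_smul, mul_comm]
  l a x := by
    induction a using Alg.ind with
    | h0 => simp
    | h2 a b ha hb => simp only [map_add, LinearMap.add_apply, ha, hb]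
    | h1 d n =>
      have := kop_shift' κ (f := X.lact (dl n)) (μ := n * r)
        (fun x => by rw [X.h_lact, algH_dl, map_smul, LinearMap.smul_apply, add_comm]) c x
      simp only [map_smul, LinearMap.smul_apply]
      rw [this, mul_right_comm, hc, one_smul]
  r a x := by
    induction a using Alg.ind with
    | h0 => simp
    | h2 a b ha hb => simp only [map_add, LinearMap.add_apply, ha, hb]
    | h1 d n =>
      have := kop_shift' κ (f := X.ract (dl n)) (μ := n * r)
        (fun x => by rw [X.h_ract, algH_dl, map_smul, LinearMap.smul_apply, add_comm]) c x
      simp only [map_smul, LinearMap.smul_apply]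
      rw [this, mul_right_comm, hc, one_smul]

end Shift

/-! ### Homomorphisms out of tensor products with symmetric induced bimodules -/

section Lifts

variable {r s : ℂ} {E : HVect} {X Y Z : Bim r}

/-- The half-braiding of an induced bimodule, with the scalar `exp(s μ ν)` written as an
operator. -/
theorem hb_tmul {μ : ℂ} {v : E.V} (hv : E.h v = μ • v) (x : X.V) :
    (hb r s E X).hom.lin (tmul (aa r s E 1 v) x) = tmul (kop s X μ x) (aa r s E 1 v) := by
  refine LinearMap.congr_fun (f := (hb r s E X).hom.lin ∘ₗ tm (aa r s E 1 v))
    (g := (tm.flip (aa r s E 1 v)) ∘ₗ kop s X μ) (X.diag.ext fun ν x hx => ?_) x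
  refine (hb_tm hv hx).trans ?_
  change _ = tm (kop s X μ x) (aa r s E 1 v)
  rw [kop_apply s μ hx, map_smul]; rfl

variable (hE : ∀ a b v, (alpha r s E).ract a (aa r s E b v) = aa r s E (a * b) v)

theorem h_aa' (a : Alg) (v : E.V) :
    (alpha r s E).h (aa r s E a v) = aa r s E (algH r a) v + aa r s E a (E.h v) :=
  alphaH_tmul r E a v

/-- The bilinear map `(a ⊗ v, x) ↦ a S(v, x)`. -/
def abl (S : E.V →ₗ[ℂ] X.V →ₗ[ℂ] Z.V) : (alpha r s E).V →ₗ[ℂ] X.V →ₗ[ℂ] Z.V :=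
  TensorProduct.lift (LinearMap.mk₂ ℂ (fun a v => Z.lact a ∘ₗ S v)
    (by intros; ext; simp) (by intros; ext; simp) (by intros; ext; simp) (by intros; ext; simp))

theorem abl_aa (S : E.V →ₗ[ℂ] X.V →ₗ[ℂ] Z.V) (a : Alg) (v : E.V) (x : X.V) :
    abl (s := s) S (aa r s E a v) x = Z.lact a (S v x) :=
  LinearMap.congr_fun (TensorProduct.lift.tmul (R := ℂ) a v) x

/-- The bilinear map `(x, a ⊗ v) ↦ S(v, x) a`. -/
def abr (S : E.V →ₗ[ℂ] X.V →ₗ[ℂ] Z.V) : (alpha r s E).V →ₗ[ℂ] X.V →ₗ[ℂ] Z.V :=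
  TensorProduct.lift (LinearMap.mk₂ ℂ (fun a v => Z.ract a ∘ₗ S v)
    (by intros; ext; simp) (by intros; ext; simp) (by intros; ext; simp) (by intros; ext; simp))

theorem abr_aa (S : E.V →ₗ[ℂ] X.V →ₗ[ℂ] Z.V) (a : Alg) (v : E.V) (x : X.V) :
    abr (s := s) S (aa r s E a v) x = Z.ract a (S v x) :=
  LinearMap.congr_fun (TensorProduct.lift.tmul (R := ℂ) a v) x

/-- The homomorphism `(a ⊗ v) ⊗ x ↦ a S(v, x)`, for a bilinear map `S` which is compatible with `h`
and with the actions of `A_r` on its second argument. -/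
def leftHom (S : E.V →ₗ[ℂ] X.V →ₗ[ℂ] Z.V)
    (hh : ∀ v x, Z.h (S v x) = S (E.h v) x + S v (X.h x))
    (hl : ∀ a v x, Z.lact a (S v x) = S v (X.lact a x))
    (hr : ∀ a v x, Z.ract a (S v x) = S v (X.ract a x)) : alpha r s E ⊗ X ⟶ Z :=
  liftHom (abl S)
    (fun t b x => by
      induction t using aa_ind₂ with
      | h0 => simp
      | h2 t s ht hs => simp only [map_add, LinearMap.add_apply, ht, hs]
      | h1 a v => rw [hE, abl_aa, abl_aa, ← hl, mul_comm, map_mul]; rfl)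
    (fun t x => by
      induction t using aa_ind₂ with
      | h0 => simp
      | h2 t s ht hs => simp only [map_add, LinearMap.add_apply, ← ht, ← hs]; abel
      | h1 a v =>
        rw [h_aa', map_add, LinearMap.add_apply, abl_aa, abl_aa, abl_aa, abl_aa, Z.h_lact, hh,
          map_add, add_assoc])
    (fun b t x => by
      induction t using aa_ind₂ with
      | h0 => simp
      | h2 t s ht hs => simp only [map_add, LinearMap.add_apply, ht, hs]
      | h1 a v => rw [lact_aa, abl_aa, abl_aa, map_mul]; rfl)
    (fun b t x => by
      induction t using aa_ind₂ with
      | h0 => simp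
      | h2 t s ht hs => simp only [map_add, LinearMap.add_apply, ht, hs]
      | h1 a v => rw [abl_aa, abl_aa, ← hr, Z.middle])

theorem leftHom_tmul (S : E.V →ₗ[ℂ] X.V →ₗ[ℂ] Z.V) (hh hl hr) (v : E.V) (x : X.V) :
    (leftHom (Z := Z) hE S hh hl hr).lin (tmul (aa r s E 1 v) x) = S v x := by
  refine (liftHom_tm _ _ _ _ _ _ _).trans ?_
  rw [abl_aa, map_one]; rfl

/-- The homomorphism `x ⊗ (a ⊗ v) ↦ S(v, x) a`, for a bilinear map `S` which is compatible with `h`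
and with the actions of `A_r` on its second argument. -/
def rightHom (S : E.V →ₗ[ℂ] X.V →ₗ[ℂ] Z.V)
    (hh : ∀ v x, Z.h (S v x) = S (E.h v) x + S v (X.h x))
    (hl : ∀ a v x, Z.lact a (S v x) = S v (X.lact a x))
    (hr : ∀ a v x, Z.ract a (S v x) = S v (X.ract a x)) : X ⊗ alpha r s E ⟶ Z :=
  liftHom (abr S).flip
    (fun x b t => by
      simp only [LinearMap.flip_apply]
      induction t using aa_ind₂ with
      | h0 => simp
      | h2 t s ht hs => simp only [map_add, LinearMap.add_apply, ht, hs]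
      | h1 a v => rw [lact_aa, abr_aa, abr_aa, ← hr, mul_comm, map_mul]; rfl)
    (fun x t => by
      simp only [LinearMap.flip_apply]
      induction t using aa_ind₂ with
      | h0 => simp
      | h2 t s ht hs => simp only [map_add, LinearMap.add_apply, ← ht, ← hs]; abel
      | h1 a v =>
        rw [h_aa', map_add, LinearMap.add_apply, abr_aa, abr_aa, abr_aa, abr_aa, Z.h_ract, hh,
          map_add]
        abel)
    (fun b x t => by
      simp only [LinearMap.flip_apply]
      induction t using aa_ind₂ with
      | h0 => simp
      | h2 t s ht hs => simp only [map_add, LinearMap.add_apply, ht, hs]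
      | h1 a v => rw [abr_aa, abr_aa, ← hl, Z.middle])
    (fun b x t => by
      simp only [LinearMap.flip_apply]
      induction t using aa_ind₂ with
      | h0 => simp
      | h2 t s ht hs => simp only [map_add, LinearMap.add_apply, ht, hs]
      | h1 a v => rw [hE, abr_aa, abr_aa, map_mul]; rfl)

theorem rightHom_tmul (S : E.V →ₗ[ℂ] X.V →ₗ[ℂ] Z.V) (hh hl hr) (v : E.V) (x : X.V) :
    (rightHom (Z := Z) hE S hh hl hr).lin (tmul x (aa r s E 1 v)) = S v x := by
  refine (liftHom_tm _ _ _ _ _ _ _).trans ?_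
  rw [LinearMap.flip_apply, abr_aa, map_one]; rfl

end Lifts

/-! ### Word bases -/

section WordBasis

variable {r : ℂ}

/-- A family of elements, indexed by words, which commute with `A_r`, are homogeneous for `h`, and
generate the bimodule. -/
structure IsWords (ω : ℂ) {T : Bim r} (a : List (Fin 2) → T.V) : Prop where
  sym : ∀ b w, T.ract b (a w) = T.lact b (a w)
  h : ∀ w, T.h (a w) = wt ω w • a w
  ind : ∀ {P : T.V → Prop}, P 0 → (∀ b w, P (T.lact b (a w))) → (∀ x y, P x → P y → P (x + y)) →
    ∀ t, P t

namespace IsWords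

variable {ω : ℂ} {T T' : Bim r} {a : List (Fin 2) → T.V} {a' : List (Fin 2) → T'.V} {X Y Z : Bim r}

theorem ind_left (ha : IsWords ω a) {P : (T ⊗ X).V → Prop} (h0 : P 0)
    (h1 : ∀ w x, P (tmul (a w) x)) (h2 : ∀ x y, P x → P y → P (x + y)) (t : (T ⊗ X).V) : P t := by
  refine tens_ind t h0 (fun t x => ?_) h2
  refine ha.ind (P := fun t => P (tm t x)) (by simpa using h0) (fun b w => ?_)
    (fun t t' h h' => by simpa using h2 _ _ h h') t
  rw [← ha.sym]
  have h := h1 w (X.lact b x)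
  rw [← tmul_balanced] at h
  exact h

theorem ind_right (ha : IsWords ω a) {P : (X ⊗ T).V → Prop} (h0 : P 0)
    (h1 : ∀ w x, P (tmul x (a w))) (h2 : ∀ x y, P x → P y → P (x + y)) (t : (X ⊗ T).V) : P t := by
  refine tens_ind t h0 (fun x t => ?_) h2
  refine ha.ind (P := fun t => P (tm x t)) (by simpa using h0) (fun b w => ?_)
    (fun t t' h h' => by simpa using h2 _ _ h h') t
  have h := h1 w (X.ract b x)
  rw [tmul_balanced] at h
  exact h

theorem ext (ha : IsWords ω a) {f g : T ⟶ Z} (h : ∀ w, f.lin (a w) = g.lin (a w)) : f = g :=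
  hom_ext (LinearMap.ext (ha.ind (by simp) (fun b w => by simp [h])
    (fun x y hx hy => by simp only [map_add, hx, hy])))

theorem ext_left (ha : IsWords ω a) {f g : T ⊗ X ⟶ Z}
    (h : ∀ w x, f.lin (tmul (a w) x) = g.lin (tmul (a w) x)) : f = g :=
  hom_ext (LinearMap.ext (ha.ind_left (by simp) h
    (fun x y hx hy => by simp only [map_add, hx, hy])))

theorem ext_right (ha : IsWords ω a) {f g : X ⊗ T ⟶ Z}
    (h : ∀ w x, f.lin (tmul x (a w)) = g.lin (tmul x (a w))) : f = g :=
  hom_ext (LinearMap.ext (ha.ind_right (by simp) h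
    (fun x y hx hy => by simp only [map_add, hx, hy])))

theorem ext₂ (ha : IsWords ω a) (ha' : IsWords ω a') {f g : T ⊗ T' ⟶ Z}
    (h : ∀ w u, f.lin (tmul (a w) (a' u)) = g.lin (tmul (a w) (a' u))) : f = g :=
  ha.ext_left fun w x => by
    refine ha'.ind (P := fun x => f.lin (tmul (a w) x) = g.lin (tmul (a w) x)) (by simp [tmul_zero])
      (fun b u => ?_) (fun x y hx hy => by simp only [tmul_add, map_add, hx, hy]) x
    rw [← ha'.sym, ← ract_tmul, f.comm_r, g.comm_r, h]

/-- Homomorphisms out of `T ⊗ T' ⊗ X`. -/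
theorem ext_left₂ (ha : IsWords ω a) (ha' : IsWords ω a') {f g : (T ⊗ T') ⊗ X ⟶ Z}
    (h : ∀ w u x, f.lin (tmul (tmul (a w) (a' u)) x) = g.lin (tmul (tmul (a w) (a' u)) x)) :
    f = g := by
  rw [← cancel_epi (α_ T T' X).inv]
  refine ha.ext_left fun w t => ?_
  refine ha'.ind_left (P := fun t => ((α_ T T' X).inv ≫ f).lin (tmul (a w) t) =
    ((α_ T T' X).inv ≫ g).lin (tmul (a w) t)) (by simp [tmul_zero]) (fun u x => ?_)
    (fun x y hx hy => by simp only [tmul_add, map_add, hx, hy]) t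
  simp [h]

/-- Homomorphisms out of `X ⊗ T ⊗ T'`. -/
theorem ext_right₂ (ha : IsWords ω a) (ha' : IsWords ω a') {f g : X ⊗ (T ⊗ T') ⟶ Z}
    (h : ∀ w u x, f.lin (tmul x (tmul (a w) (a' u))) = g.lin (tmul x (tmul (a w) (a' u)))) :
    f = g := by
  rw [← cancel_epi (α_ X T T').hom]
  refine ha'.ext_right fun u t => ?_
  refine ha.ind_right (P := fun t => ((α_ X T T').hom ≫ f).lin (tmul t (a' u)) =
    ((α_ X T T').hom ≫ g).lin (tmul t (a' u))) (by simp [zero_tmul]) (fun w x => ?_)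
    (fun x y hx hy => by simp only [add_tmul, map_add, hx, hy]) t
  simp [h]

/-- Homomorphisms out of `T ⊗ X ⊗ T'`. -/
theorem ext_mid (ha : IsWords ω a) (ha' : IsWords ω a') {f g : (T ⊗ X) ⊗ T' ⟶ Z}
    (h : ∀ w u x, f.lin (tmul (tmul (a w) x) (a' u)) = g.lin (tmul (tmul (a w) x) (a' u))) :
    f = g := by
  refine ha'.ext_right fun u t => ?_
  refine ha.ind_left (P := fun t => f.lin (tmul t (a' u)) =
    g.lin (tmul t (a' u))) (by simp [zero_tmul]) (fun w x => h w u x)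
    (fun x y hx hy => by simp only [add_tmul, map_add, hx, hy]) t

end IsWords

theorem un_ext_left {X Z : Bim r} {f g : 𝟙_ (Bim r) ⊗ X ⟶ Z}
    (h : ∀ x, f.lin (tmul (un 1) x) = g.lin (tmul (un 1) x)) : f = g :=
  thom_ext fun t x => by
    refine un_ind (P := fun t => f.lin (tm t x) = g.lin (tm t x)) (fun a => ?_) t
    rw [un_eq]
    change f.lin (tmul _ x) = g.lin (tmul _ x)
    rw [← lact_tmul, f.comm_l, g.comm_l, h]

theorem un_ext_right {X Z : Bim r} {f g : X ⊗ 𝟙_ (Bim r) ⟶ Z}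
    (h : ∀ x, f.lin (tmul x (un 1)) = g.lin (tmul x (un 1))) : f = g :=
  thom_ext fun x t => by
    refine un_ind (P := fun t => f.lin (tm x t) = g.lin (tm x t)) (fun a => ?_) t
    rw [un_eq]
    change f.lin (tmul x _) = g.lin (tmul x _)
    rw [← tmul_balanced, h]

theorem un_ext {Z : Bim r} {f g : 𝟙_ (Bim r) ⟶ Z} (h : f.lin (un 1) = g.lin (un 1)) : f = g :=
  hom_ext (LinearMap.ext fun t => by
    refine un_ind (P := fun t => f.lin t = g.lin t) (fun a => ?_) t
    rw [un_eq, f.comm_l, g.comm_l, h])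

end WordBasis

/-! ### Words in an algebra of the centre -/

section Words

variable {r s : ℂ} {ω : ℂ}

/-- The generators of the bimodule `A_r ⊗ (ℂ_ω ⊕ ℂ_{-ω})`. -/
def ff (r s ω : ℂ) (i : Fin 2) : (alpha r s (fund ω)).V := aa r s (fund ω) 1 (fe ω i)

theorem ff_h (i : Fin 2) : (alpha r s (fund ω)).h (ff r s ω i) = ![ω, -ω] i • ff r s ω i := by
  rw [ff, h_aa_one, fe_h, map_smul]

/-- The half-braiding with an element of the centre of degree `μ`. -/
def IsCent (s μ : ℂ) {T : Center (Bim r)} (t : T.1.V) : Prop :=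
  ∀ (X : Bim r) (x : X.V), (T.2.β X).hom.lin (tmul t x) = tmul (kop s X μ x) t

theorem IsCent.inv {s μ : ℂ} {T : Center (Bim r)} {t : T.1.V} (ht : IsCent s μ t) (X : Bim r)
    (x : X.V) : (T.2.β X).inv.lin (tmul x t) = tmul t (kop (-s) X μ x) := by
  refine inv_lin_eq _ ?_
  rw [ht, kop_neg, kop_kop, add_neg_cancel, kop_zero]

theorem isCent_alpha {E : HVect} {μ : ℂ} {v : E.V} (hv : E.h v = μ • v) :
    IsCent (T := alphaC r s E) s μ (aa r s E 1 v) := fun _ x => hb_tmul hv x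

theorem IsCent.map {s μ : ℂ} {T T' : Center (Bim r)} (f : T ⟶ T') {t : T.1.V} (ht : IsCent s μ t) :
    IsCent s μ (f.f.lin t) := fun X x => by
  have h := congrArg (fun g => g.lin (tmul t x)) (f.comm X)
  simp only [comp_apply', whiskerRight_tmul, whiskerLeft_tmul, ht X x] at h
  exact h

theorem IsCent.tmul {s μ μ' : ℂ} {T T' : Center (Bim r)} {t : T.1.V} {t' : T'.1.V}
    (ht : IsCent s μ t) (ht' : IsCent s μ' t') :
    IsCent (T := T ⊗ T') s (μ + μ') (Bim.tmul t t') := fun X x => by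
  have h : ((T ⊗ T').2.β X).hom = (α_ _ _ _).hom ≫ T.1 ◁ (T'.2.β X).hom ≫ (α_ _ _ _).inv ≫
    (T.2.β X).hom ▷ T'.1 ≫ (α_ _ _ _).hom := by simp
  rw [h]
  refine (congrArg (fun z => ((α_ T.1 X T'.1).inv ≫ (T.2.β X).hom ▷ T'.1 ≫ (α_ _ _ _).hom).lin
    (Bim.tmul t z)) (ht' X x)).trans ?_
  simp only [comp_apply', associator_inv_tmul, whiskerRight_tmul, ht X, kop_kop]
  rfl

theorem IsCent.one : IsCent (T := 𝟙_ (Center (Bim r))) s 0 (un 1) := fun X x => by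
  have h : ((𝟙_ (Center (Bim r))).2.β X).hom = (λ_ X).hom ≫ (ρ_ X).inv := rfl
  rw [h]
  refine (congrArg (ρ_ X).inv.lin (leftUnitor_tmul 1 x)).trans ?_
  rw [kop_zero, map_one]
  rfl

variable {T : Center (Bim r)} [MonObj T]

theorem mulC_assoc (x y z : T.1.V) : (mulC T).lin (tmul ((mulC T).lin (tmul x y)) z) =
    (mulC T).lin (tmul x ((mulC T).lin (tmul y z))) := by
  have h : mulC T ▷ T.1 ≫ mulC T = (α_ T.1 T.1 T.1).hom ≫ T.1 ◁ mulC T ≫ mulC T :=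
    congrArg Center.Hom.f (MonObj.mul_assoc T)
  have h := congrArg (fun f => f.lin (tmul (tmul x y) z)) h
  simpa using h

theorem mulC_one_left (x : T.1.V) : (mulC T).lin (tmul ((oneC T).lin (un 1)) x) = x := by
  have h : oneC T ▷ T.1 ≫ mulC T = (λ_ T.1).hom := congrArg Center.Hom.f (MonObj.one_mul T)
  have h := congrArg (fun f => f.lin (tmul (un 1) x)) h
  simpa using h

theorem mulC_one_right (x : T.1.V) : (mulC T).lin (tmul x ((oneC T).lin (un 1))) = x := by
  have h : T.1 ◁ oneC T ≫ mulC T = (ρ_ T.1).hom := congrArg Center.Hom.f (MonObj.mul_one T)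
  have h := congrArg (fun f => f.lin (tmul x (un 1))) h
  simpa using h

/-- The product of the images of the generators along a word. -/
def wd (ι : alphaC r s (fund ω) ⟶ T) : List (Fin 2) → T.1.V
  | [] => (oneC T).lin (un 1)
  | i :: w => (mulC T).lin (tmul (ι.f.lin (ff r s ω i)) (wd ι w))

variable (ι : alphaC r s (fund ω) ⟶ T)

theorem wd_nil : wd ι [] = (oneC T).lin (un 1) := rfl

theorem wd_cons (i : Fin 2) (w : List (Fin 2)) :
    wd ι (i :: w) = (mulC T).lin (tmul (ι.f.lin (ff r s ω i)) (wd ι w)) := rfl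

theorem wd_single (i : Fin 2) : wd ι [i] = ι.f.lin (ff r s ω i) := mulC_one_right _

theorem mulC_wd (u w : List (Fin 2)) : (mulC T).lin (tmul (wd ι u) (wd ι w)) = wd ι (u ++ w) := by
  induction u with
  | nil => exact mulC_one_left _
  | cons i u ih => rw [List.cons_append, wd_cons, wd_cons, mulC_assoc, ih]

theorem wd_h (w : List (Fin 2)) : T.1.h (wd ι w) = wt ω w • wd ι w := by
  induction w with
  | nil => rw [wd_nil, ← Hom.comm_h, h_un_one, map_zero, wt_nil, zero_smul]
  | cons i w ih =>
    have h1 : T.1.h (ι.f.lin (ff r s ω i)) = ![ω, -ω] i • ι.f.lin (ff r s ω i) :=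
      (ι.f.comm_h _).symm.trans ((congrArg ι.f.lin (ff_h i)).trans (ι.f.lin.map_smul _ _))
    rw [wd_cons, ← Hom.comm_h, h_tmul, h1, ih, Bim.smul_tmul, tmul_smul, ← add_smul, map_smul, wt_cons]

theorem wd_cent (w : List (Fin 2)) : IsCent s (wt ω w) (wd ι w) := by
  induction w with
  | nil => exact IsCent.one.map (MonObj.one (X := T))
  | cons i w ih =>
    exact (((isCent_alpha (fe_h ω i)).map ι).tmul ih).map (MonObj.mul (X := T))

theorem wd_sym (hf : ∀ a b v, (alpha r s (fund ω)).ract a (aa r s (fund ω) b v) =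
    aa r s (fund ω) (a * b) v) (b : Alg) (w : List (Fin 2)) :
    T.1.ract b (wd ι w) = T.1.lact b (wd ι w) := by
  induction w with
  | nil => rw [wd_nil, ← Hom.comm_r, ← Hom.comm_l, lact_un, ract_un]
  | cons i w ih =>
    rw [wd_cons, ← Hom.comm_r, ← Hom.comm_l, lact_tmul, ract_tmul, ih, ← tmul_balanced]
    congr 2
    have h1 := ι.f.comm_r b (ff r s ω i)
    have h2 := ι.f.comm_l b (ff r s ω i)
    refine h1.symm.trans (Eq.trans ?_ h2)
    congr 1
    exact (hf b 1 _).trans (lact_aa b 1 _).symm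

theorem cpowMap_succ (n : ℕ) : (cpowMap ι (n + 1)).f = ((cpowMap ι n).f ⊗ₘ ι.f) ≫ mulC T := rfl

/-- The element of the tensor power which corresponds to a word, read from the right to the left. -/
def el (r s ω : ℂ) : (n : ℕ) → List (Fin 2) → (cpow (alphaC r s (fund ω)) n).1.V
  | 0, [] => un 1
  | 0, _ :: _ => 0
  | _ + 1, [] => 0
  | n + 1, i :: w => tmul (el r s ω n w) (ff r s ω i)

theorem cpowMap_el (w : List (Fin 2)) : (cpowMap ι w.length).f.lin (el r s ω w.length w) =
    wd ι w.reverse := by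
  induction w with
  | nil => rfl
  | cons i w ih =>
    rw [List.reverse_cons, ← mulC_wd, wd_single, ← ih]
    rw [List.length_cons, cpowMap_succ]
    exact congrArg (mulC T).lin (tensorHom_tmul _ _ _ _)

theorem el_h (n : ℕ) (w : List (Fin 2)) : (cpow (alphaC r s (fund ω)) n).1.h (el r s ω n w) =
    wt ω w • el r s ω n w := by
  induction n generalizing w with
  | zero =>
    cases w with
    | nil => rw [wt_nil, zero_smul]; exact h_un_one
    | cons i w => simp [el]
  | succ n ih =>
    cases w with
    | nil => simp [el]
    | cons i w =>
      refine (h_tmul (el r s ω n w) (ff r s ω i)).trans ?_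
      rw [ih, ff_h, Bim.smul_tmul, tmul_smul, ← add_smul, wt_cons, add_comm]
      rfl

theorem el_sym (hf : ∀ a b v, (alpha r s (fund ω)).ract a (aa r s (fund ω) b v) =
    aa r s (fund ω) (a * b) v) (b : Alg) (n : ℕ) (w : List (Fin 2)) :
    (cpow (alphaC r s (fund ω)) n).1.ract b (el r s ω n w) =
      (cpow (alphaC r s (fund ω)) n).1.lact b (el r s ω n w) := by
  induction n generalizing w with
  | zero =>
    cases w with
    | nil => rfl
    | cons i w => simp [el]
  | succ n ih =>
    cases w with
    | nil => simp [el]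
    | cons i w =>
      refine (ract_tmul b (el r s ω n w) (ff r s ω i)).trans (Eq.trans ?_
        (lact_tmul b (el r s ω n w) (ff r s ω i)).symm)
      rw [← ih, tmul_balanced]
      exact congrArg (tmul (el r s ω n w)) ((hf b 1 _).trans (lact_aa b 1 _).symm)

theorem fund_ind {P : (alpha r s (fund ω)).V → Prop} (t : (alpha r s (fund ω)).V) (h0 : P 0)
    (h1 : ∀ a i, P ((alpha r s (fund ω)).lact a (ff r s ω i))) (h2 : ∀ t s, P t → P s → P (t + s)) :
    P t := by
  refine aa_ind₂ t h0 (fun a v => ?_) h2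
  have key (j : Fin 2) (c : ℂ) : aa r s (fund ω) a (c • fe ω j) =
      (alpha r s (fund ω)).lact (c • a) (ff r s ω j) := by
    rw [ff, lact_aa, mul_one, map_smul, map_smul]; rfl
  have hv : ∀ v : Fin 2 →₀ ℂ, ∃ c d : ℂ, v = c • Finsupp.single 0 1 + d • Finsupp.single 1 1 :=
    fun v => ⟨v 0, v 1, by ext i; fin_cases i <;> simp⟩
  obtain ⟨c, d, rfl⟩ := hv v
  have h3 := h2 _ _ (h1 (c • a) 0) (h1 (d • a) 1)
  rw [← key, ← key, ← map_add] at h3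
  exact h3

theorem el_ind (hf : ∀ a b v, (alpha r s (fund ω)).ract a (aa r s (fund ω) b v) =
    aa r s (fund ω) (a * b) v) (n : ℕ)
    {P : (cpow (alphaC r s (fund ω)) n).1.V → Prop} (h0 : P 0)
    (h1 : ∀ b w, w.length = n → P ((cpow (alphaC r s (fund ω)) n).1.lact b (el r s ω n w)))
    (h2 : ∀ x y, P x → P y → P (x + y)) (t : (cpow (alphaC r s (fund ω)) n).1.V) : P t := by
  induction n with
  | zero =>
    refine un_ind (P := P) (fun a => ?_) t
    rw [un_eq]
    exact h1 a [] rfl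
  | succ n ih =>
    refine tens_ind t h0 (fun t x => ?_) h2
    refine ih (P := fun t => P (tm t x)) ?_ (fun b w hw => ?_) (fun x' y hx hy => ?_) t
    · exact (congrArg P (LinearMap.map_zero₂ tm x)).mpr h0
    rotate_left
    · exact (congrArg P (LinearMap.map_add₂ tm x' y x)).mpr (h2 _ _ hx hy)
    refine fund_ind (P := fun x => P (tm _ x)) x ?_ (fun c i => ?_) (fun x y hx hy => ?_)
    · exact (congrArg P (map_zero (tm _))).mpr h0
    rotate_left
    · exact (congrArg P (map_add (tm _) x y)).mpr (h2 _ _ hx hy)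
    have := h1 (b * c) (i :: w) (by simp [hw])
    have h3 : (cpow (alphaC r s (fund ω)) (n + 1)).1.lact (b * c) (el r s ω (n + 1) (i :: w)) =
        tmul ((cpow (alphaC r s (fund ω)) n).1.lact b (el r s ω n w))
          ((alpha r s (fund ω)).lact c (ff r s ω i)) := by
      refine (lact_tmul (b * c) (el r s ω n w) (ff r s ω i)).trans ?_
      rw [← tmul_balanced, ← Bim.middle, el_sym hf, map_mul]
      rfl
    rw [h3] at this
    exact this

end Words

/-! ### The induced bimodule on the space of words -/

section WordModule

variable {r s ω : ℂ} {X Z : Bim r}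

/-- The vector space with basis the words in two letters, graded by the weight. -/
def wordsH (ω : ℂ) : HVect where
  V := List (Fin 2) →₀ ℂ
  h := diagEnd (wt ω)
  diag := isDiag_diagEnd _

/-- The basis vector of a word. -/
def wv (ω : ℂ) (w : List (Fin 2)) : (wordsH ω).V := Finsupp.single w 1

theorem wv_h (w : List (Fin 2)) : (wordsH ω).h (wv ω w) = wt ω w • wv ω w :=
  diagEnd_single _ w 1

theorem wordsH_ext {M : Type} [AddCommGroup M] [Module ℂ M] {f g : (wordsH ω).V →ₗ[ℂ] M}
    (h : ∀ w, f (wv ω w) = g (wv ω w)) : f = g :=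
  Finsupp.lhom_ext' fun w => LinearMap.ext_ring (h w)

/-- The linear extension of a function on words. -/
def wordsLin {M : Type} [AddCommGroup M] [Module ℂ M] (ω : ℂ) (z : List (Fin 2) → M) :
    (wordsH ω).V →ₗ[ℂ] M := Finsupp.linearCombination ℂ z

theorem wordsLin_wv {M : Type} [AddCommGroup M] [Module ℂ M] (z : List (Fin 2) → M)
    (w : List (Fin 2)) : wordsLin ω z (wv ω w) = z w :=
  (Finsupp.linearCombination_single ℂ 1 w).trans (one_smul _ _)

/-- The element of a word. -/
def ww (r s ω : ℂ) (w : List (Fin 2)) : (alpha r s (wordsH ω)).V := aa r s (wordsH ω) 1 (wv ω w)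

variable (hx : ∀ n : ℤ, Complex.exp (s * (n * r) * ω) = 1)
include hx

theorem exp_wt_letter (n : ℤ) (i : Fin 2) : Complex.exp (s * (n * r) * ![ω, -ω] i) = 1 := by
  fin_cases i
  · exact hx n
  · have : s * (n * r) * -ω = -(s * (n * r) * ω) := by ring
    change Complex.exp (s * (n * r) * -ω) = 1
    rw [this, Complex.exp_neg, hx, inv_one]

theorem exp_wt (n : ℤ) (w : List (Fin 2)) : Complex.exp (s * (n * r) * wt ω w) = 1 := by
  induction w with
  | nil => simp
  | cons i w ih => rw [wt_cons, mul_add, Complex.exp_add, ih, exp_wt_letter hx, one_mul]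

theorem ract_wordsH (a b : Alg) (v : (wordsH ω).V) :
    (alpha r s (wordsH ω)).ract a (aa r s (wordsH ω) b v) = aa r s (wordsH ω) (a * b) v := by
  induction a using Alg.ind with
  | h0 => simp
  | h2 a c ha hc => simp only [map_add, LinearMap.add_apply, ha, hc, add_mul]
  | h1 c n =>
    have : ((alpha r s (wordsH ω)).ract (dl n)) ∘ₗ (aa r s (wordsH ω) b) =
        aa r s (wordsH ω) (dl n * b) := wordsH_ext fun w => by
      rw [LinearMap.comp_apply, ract_aa n b (wv_h w), exp_wt hx, one_smul]
    simp only [map_smul, LinearMap.smul_apply, smul_mul_assoc]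
    rw [← this]
    rfl

theorem ract_fund' (a b : Alg) (v : (fund ω).V) :
    (alpha r s (fund ω)).ract a (aa r s (fund ω) b v) = aa r s (fund ω) (a * b) v := by
  induction a using Alg.ind with
  | h0 => simp
  | h2 a c ha hc => simp only [map_add, LinearMap.add_apply, ha, hc, add_mul]
  | h1 c n =>
    have : ((alpha r s (fund ω)).ract (dl n)) ∘ₗ (aa r s (fund ω) b) =
        aa r s (fund ω) (dl n * b) :=
      Finsupp.lhom_ext' fun i => LinearMap.ext_ring
        ((ract_aa n b (fe_h ω i)).trans (by rw [exp_wt_letter hx, one_smul]; rfl))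
    simp only [map_smul, LinearMap.smul_apply, smul_mul_assoc]
    rw [← this]
    rfl

theorem isWords_ww : IsWords ω (ww r s ω) where
  sym b w := (ract_wordsH hx b 1 _).trans (lact_aa b 1 _).symm
  h w := by rw [ww, h_aa_one, wv_h, map_smul]
  ind {P} h0 h1 h2 t := by
    refine aa_ind₂ t h0 (fun a v => ?_) h2
    have key : ∀ v : List (Fin 2) →₀ ℂ, P (aa r s (wordsH ω) a v) := fun v => by
      induction v using Finsupp.induction_linear with
      | zero => exact (congrArg P (map_zero _)).mpr h0
      | add v w hv hw => exact (congrArg P (map_add _ v w)).mpr (h2 _ _ hv hw)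
      | single w c =>
        have h3 := h1 (c • a) w
        rw [ww, lact_aa, mul_one, map_smul, LinearMap.smul_apply, ← map_smul] at h3
        have h4 : c • wv ω w = Finsupp.single w c := by
          refine (Finsupp.smul_single c w 1).trans ?_
          rw [smul_eq_mul, mul_one]
        rw [h4] at h3
        exact h3
    exact key v

/-- The homomorphism of bimodules which sends the word `w` to `z w`. -/
def wordHom (z : List (Fin 2) → Z.V) (hz : ∀ w, Z.h (z w) = wt ω w • z w)
    (hs : ∀ b w, Z.ract b (z w) = Z.lact b (z w)) : alpha r s (wordsH ω) ⟶ Z :=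
  homOf (wordsLin ω z) (ract_wordsH hx)
    (LinearMap.congr_fun (f := Z.h ∘ₗ wordsLin ω z) (g := wordsLin ω z ∘ₗ (wordsH ω).h)
      (wordsH_ext fun w => by
        simp only [LinearMap.comp_apply, wordsLin_wv, wv_h, map_smul, hz]))
    (fun a => LinearMap.congr_fun (f := Z.ract a ∘ₗ wordsLin ω z) (g := Z.lact a ∘ₗ wordsLin ω z)
      (wordsH_ext fun w => by simp only [LinearMap.comp_apply, wordsLin_wv, hs]))

theorem wordHom_ww (z : List (Fin 2) → Z.V) (hz) (hs) (w : List (Fin 2)) :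
    (wordHom (s := s) (ω := ω) hx z hz hs).lin (ww r s ω w) = z w := by
  refine (homOf_aa _ _ _ _ _ _).trans ?_
  rw [map_one, wordsLin_wv]
  rfl

/-- The homomorphism `w ⊗ x ↦ O_w(x)`, for homogeneous maps `O_w` of the degree of `w`. -/
def wordLeft (O : List (Fin 2) → X.V →ₗ[ℂ] Z.V) (hO : ∀ w, IsShift (wt ω w) (O w)) :
    alpha r s (wordsH ω) ⊗ X ⟶ Z :=
  leftHom (ract_wordsH hx) (wordsLin ω O)
    (fun v x => LinearMap.congr_fun (f := Z.h ∘ₗ (wordsLin ω O).flip x)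
      (g := (wordsLin ω O).flip x ∘ₗ (wordsH ω).h + (wordsLin ω O).flip (X.h x))
      (wordsH_ext fun w => by
        simp only [LinearMap.comp_apply, LinearMap.flip_apply, wordsLin_wv, wv_h, map_smul,
          LinearMap.add_apply, (hO w).h]
        exact add_comm _ _) v)
    (fun a v x => LinearMap.congr_fun (f := Z.lact a ∘ₗ (wordsLin ω O).flip x)
      (g := (wordsLin ω O).flip (X.lact a x))
      (wordsH_ext fun w => by
        simp only [LinearMap.comp_apply, LinearMap.flip_apply, wordsLin_wv, (hO w).l]) v)
    (fun a v x => LinearMap.congr_fun (f := Z.ract a ∘ₗ (wordsLin ω O).flip x)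
      (g := (wordsLin ω O).flip (X.ract a x))
      (wordsH_ext fun w => by
        simp only [LinearMap.comp_apply, LinearMap.flip_apply, wordsLin_wv, (hO w).r]) v)

theorem wordLeft_ww (O : List (Fin 2) → X.V →ₗ[ℂ] Z.V) (hO : ∀ w, IsShift (wt ω w) (O w))
    (w : List (Fin 2)) (x : X.V) :
    (wordLeft (s := s) hx O hO).lin (tmul (ww r s ω w) x) = O w x := by
  refine (leftHom_tmul _ _ _ _ _ _ _).trans ?_
  rw [wordsLin_wv]

/-- The homomorphism `x ⊗ w ↦ O_w(x)`, for homogeneous maps `O_w` of the degree of `w`. -/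
def wordRight (O : List (Fin 2) → X.V →ₗ[ℂ] Z.V) (hO : ∀ w, IsShift (wt ω w) (O w)) :
    X ⊗ alpha r s (wordsH ω) ⟶ Z :=
  rightHom (ract_wordsH hx) (wordsLin ω O)
    (fun v x => LinearMap.congr_fun (f := Z.h ∘ₗ (wordsLin ω O).flip x)
      (g := (wordsLin ω O).flip x ∘ₗ (wordsH ω).h + (wordsLin ω O).flip (X.h x))
      (wordsH_ext fun w => by
        simp only [LinearMap.comp_apply, LinearMap.flip_apply, wordsLin_wv, wv_h, map_smul,
          LinearMap.add_apply, (hO w).h]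
        exact add_comm _ _) v)
    (fun a v x => LinearMap.congr_fun (f := Z.lact a ∘ₗ (wordsLin ω O).flip x)
      (g := (wordsLin ω O).flip (X.lact a x))
      (wordsH_ext fun w => by
        simp only [LinearMap.comp_apply, LinearMap.flip_apply, wordsLin_wv, (hO w).l]) v)
    (fun a v x => LinearMap.congr_fun (f := Z.ract a ∘ₗ (wordsLin ω O).flip x)
      (g := (wordsLin ω O).flip (X.ract a x))
      (wordsH_ext fun w => by
        simp only [LinearMap.comp_apply, LinearMap.flip_apply, wordsLin_wv, (hO w).r]) v)

theorem wordRight_ww (O : List (Fin 2) → X.V →ₗ[ℂ] Z.V) (hO : ∀ w, IsShift (wt ω w) (O w))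
    (w : List (Fin 2)) (x : X.V) :
    (wordRight (s := s) hx O hO).lin (tmul x (ww r s ω w)) = O w x := by
  refine (rightHom_tmul _ _ _ _ _ _ _).trans ?_
  rw [wordsLin_wv]

end WordModule

/-! ### The algebra of words in the centre -/

section WordAlgebra

variable {r s ω : ℂ} {Z : Bim r}

/-- The homomorphism `a ↦ a z` for an element `z` of degree `0` which commutes with `A_r`. -/
def unHom (z : Z.V) (hz : Z.h z = 0) (hs : ∀ b, Z.ract b z = Z.lact b z) : 𝟙_ (Bim r) ⟶ Z where
  lin := Z.lact.toLinearMap.flip z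
  comm_h a := (Eq.symm <| (Z.h_lact a z).trans (by rw [hz, map_zero, add_zero]; rfl))
  comm_l a (b : Alg) := by
    change Z.lact (a * b) z = Z.lact a (Z.lact b z)
    rw [map_mul]; rfl
  comm_r a (b : Alg) := by
    change Z.lact (a * b) z = Z.ract a (Z.lact b z)
    rw [← Z.middle, hs, mul_comm, map_mul]; rfl

theorem unHom_un_one (z : Z.V) (hz) (hs) : (unHom z hz hs).lin (un 1) = z := by
  change Z.lact 1 z = z
  rw [map_one]; rfl

variable (hx : ∀ n : ℤ, Complex.exp (s * (n * r) * ω) = 1)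

/-- The linear map which commutes with the left action of `A_r` and sends the word `w` to `z w`. -/
def wordShift (z : List (Fin 2) → Z.V) : (alpha r s (wordsH ω)).V →ₗ[ℂ] Z.V := alift (wordsLin ω z)

theorem wordShift_ww (z : List (Fin 2) → Z.V) (u : List (Fin 2)) :
    wordShift z (ww r s ω u) = z u := by
  rw [wordShift, ww, alift_aa, map_one, wordsLin_wv]; rfl

theorem wordShift_lact (z : List (Fin 2) → Z.V) (a : Alg) (t : (alpha r s (wordsH ω)).V) :
    wordShift z ((alpha r s (wordsH ω)).lact a t) = Z.lact a (wordShift z t) := by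
  induction t using aa_ind₂ with
  | h0 => simp
  | h1 b v => rw [lact_aa, wordShift, alift_aa, alift_aa, map_mul]; rfl
  | h2 t s ht hs => simp only [map_add, ht, hs]

include hx in
theorem wordShift_isShift {μ : ℂ} (z : List (Fin 2) → Z.V)
    (hz : ∀ w, Z.h (z w) = (wt ω w + μ) • z w) (hs : ∀ b w, Z.ract b (z w) = Z.lact b (z w)) :
    IsShift μ (wordShift (r := r) (s := s) (ω := ω) z) where
  l a t := (wordShift_lact z a t).symm
  r a t := by
    refine (isWords_ww hx).ind (P := fun t => Z.ract a (wordShift z t) =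
      wordShift z ((alpha r s (wordsH ω)).ract a t)) (by simp) (fun b u => ?_)
      (fun x y hx hy => by simp only [map_add, hx, hy]) t
    rw [wordShift_lact, wordShift_ww, ← Bim.middle, ← Bim.middle, (isWords_ww hx).sym, hs,
      wordShift_lact, wordShift_lact, wordShift_ww]
  h t := by
    refine (isWords_ww hx).ind (P := fun t => Z.h (wordShift z t) =
      wordShift z ((alpha r s (wordsH ω)).h t) + μ • wordShift z t) (by simp) (fun b u => ?_)
      (fun x y hx hy => by simp only [map_add, hx, hy, smul_add]; abel) t
    rw [wordShift_lact, wordShift_ww, Bim.h_lact, Bim.h_lact, (isWords_ww hx).h, hz,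
      map_add, wordShift_lact, wordShift_lact, map_smul, wordShift_ww, map_smul, map_smul,
      wordShift_ww, add_smul]
    abel

/-- Concatenation with the word `w`. -/
def cat (r s ω : ℂ) (w : List (Fin 2)) : Module.End ℂ (alpha r s (wordsH ω)).V :=
  wordShift fun u => ww r s ω (w ++ u)

theorem cat_ww (w u : List (Fin 2)) : cat r s ω w (ww r s ω u) = ww r s ω (w ++ u) :=
  wordShift_ww _ _

include hx in
theorem cat_isShift (w : List (Fin 2)) : IsShift (wt ω w) (cat r s ω w) :=
  wordShift_isShift hx _ (fun u => by rw [(isWords_ww hx).h, wt_append, add_comm])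
    fun b u => (isWords_ww hx).sym b _

/-- The multiplication of words. -/
def wordMul : alpha r s (wordsH ω) ⊗ alpha r s (wordsH ω) ⟶ alpha r s (wordsH ω) :=
  wordLeft hx (cat r s ω) (cat_isShift hx)

theorem wordMul_ww (w u : List (Fin 2)) :
    (wordMul hx).lin (tmul (ww r s ω w) (ww r s ω u)) = ww r s ω (w ++ u) :=
  (wordLeft_ww hx _ _ w _).trans (cat_ww w u)

/-- The empty word as a homomorphism. -/
def wordOne : 𝟙_ (Bim r) ⟶ alpha r s (wordsH ω) :=
  unHom (ww r s ω []) (by rw [(isWords_ww hx).h, wt_nil, zero_smul]) fun b => (isWords_ww hx).sym b []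

theorem wordOne_un : (wordOne hx).lin (un 1) = ww r s ω [] := unHom_un_one _ _ _

theorem isCent_ww (w : List (Fin 2)) :
    IsCent (T := alphaC r s (wordsH ω)) s (wt ω w) (ww r s ω w) := isCent_alpha (wv_h w)

/-- A homomorphism commutes with the half-braidings on elements whose degree it preserves. -/
theorem IsCent.comm {T T' : Center (Bim r)} (f : T.1 ⟶ T'.1) {μ : ℂ} {t : T.1.V}
    (ht : IsCent s μ t) (ht' : IsCent s μ (f.lin t)) (U : Bim r) (x : U.V) :
    (f ▷ U ≫ (T'.2.β U).hom).lin (Bim.tmul t x) = ((T.2.β U).hom ≫ U ◁ f).lin (Bim.tmul t x) := by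
  rw [comp_apply', comp_apply', whiskerRight_tmul, ht U, ht' U, whiskerLeft_tmul]

/-- The unit of the algebra of words, in the centre. -/
def wordOneC : 𝟙_ (Center (Bim r)) ⟶ alphaC r s (wordsH ω) where
  f := wordOne hx
  comm U := un_ext_left fun x => IsCent.comm (T := 𝟙_ (Center (Bim r)))
    (T' := alphaC r s (wordsH ω)) (wordOne hx) IsCent.one
    ((congrArg (IsCent (T := alphaC r s (wordsH ω)) s 0) (wordOne_un hx)).mpr (isCent_ww [])) U x

/-- The multiplication of the algebra of words, in the centre. -/
def wordMulC : alphaC r s (wordsH ω) ⊗ alphaC r s (wordsH ω) ⟶ alphaC r s (wordsH ω) where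
  f := wordMul hx
  comm U := (isWords_ww hx).ext_left₂ (isWords_ww hx) fun w u x => IsCent.comm
    (T := alphaC r s (wordsH ω) ⊗ alphaC r s (wordsH ω)) (T' := alphaC r s (wordsH ω))
    (wordMul hx) ((isCent_ww w).tmul (isCent_ww u))
    ((congrArg (IsCent (T := alphaC r s (wordsH ω)) s (wt ω w + wt ω u)) (wordMul_ww hx w u)).mpr
      (wt_append ω w u ▸ isCent_ww (w ++ u))) U x

/-- The algebra of words in the centre. -/
@[reducible]
def wordMon : MonObj (alphaC r s (wordsH ω)) where
  one := wordOneC hx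
  mul := wordMulC hx
  one_mul := Center.ext _ _ (un_ext_left (Z := alpha r s (wordsH ω)) fun t => by
    refine (isWords_ww hx).ind (P := fun t => (wordOne hx ▷ alpha r s (wordsH ω) ≫ wordMul hx).lin
      (tmul (un 1) t) = (λ_ (alpha r s (wordsH ω))).hom.lin (tmul (un 1) t)) (by simp [tmul_zero])
      (fun b w => ?_) (fun x y hx hy => by simp only [tmul_add, map_add, hx, hy]) t
    rw [← (isWords_ww hx).sym, ← ract_tmul, Hom.comm_r, Hom.comm_r, comp_apply', whiskerRight_tmul,
      wordOne_un, wordMul_ww, leftUnitor_tmul, map_one]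
    rfl)
  mul_one := Center.ext _ _ ((isWords_ww hx).ext_left (Z := alpha r s (wordsH ω)) fun w t => by
    refine un_ind (P := fun t => (alpha r s (wordsH ω) ◁ wordOne hx ≫ wordMul hx).lin
      (tmul (ww r s ω w) t) = (ρ_ (alpha r s (wordsH ω))).hom.lin (tmul (ww r s ω w) t))
      (fun a => ?_) t
    rw [un_eq, lact_un, mul_one, comp_apply', whiskerLeft_tmul, rightUnitor_tmul, un_eq, Hom.comm_l,
      wordOne_un, ← (isWords_ww hx).sym, ← ract_tmul, Hom.comm_r, wordMul_ww, List.append_nil])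
  mul_assoc := Center.ext _ _ ((isWords_ww hx).ext_left₂ (isWords_ww hx) (Z := alpha r s (wordsH ω))
      fun w u t => by
    refine (isWords_ww hx).ind (P := fun t => (wordMul hx ▷ alpha r s (wordsH ω) ≫ wordMul hx).lin
      (tmul (tmul (ww r s ω w) (ww r s ω u)) t) = ((α_ _ _ _).hom ≫
        alpha r s (wordsH ω) ◁ wordMul hx ≫ wordMul hx).lin
      (tmul (tmul (ww r s ω w) (ww r s ω u)) t)) (by simp [tmul_zero])
      (fun b v => ?_) (fun x y hx hy => by simp only [tmul_add, map_add, hx, hy]) t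
    rw [← (isWords_ww hx).sym, ← ract_tmul, Hom.comm_r, Hom.comm_r]
    simp only [comp_apply', whiskerRight_tmul, whiskerLeft_tmul, associator_tmul, wordMul_ww,
      List.append_assoc])

end WordAlgebra

/-! ### Word bases of tensor algebras -/

section Free

variable {r s ω : ℂ}

/-- A family of elements, indexed by words, which is a basis over `A_r` in the sense that
homomorphisms out of the bimodule can be prescribed on it. -/
structure IsFree (ω : ℂ) {T : Bim r} (a : List (Fin 2) → T.V) : Prop extends IsWords ω a where
  lift : ∀ {Z : Bim r} (z : List (Fin 2) → Z.V), (∀ w, Z.h (z w) = wt ω w • z w) →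
    (∀ b w, Z.ract b (z w) = Z.lact b (z w)) → ∃ g : T ⟶ Z, ∀ w, g.lin (a w) = z w

variable (hx : ∀ n : ℤ, Complex.exp (s * (n * r) * ω) = 1)
include hx

theorem isFree_ww : IsFree ω (ww r s ω) where
  toIsWords := isWords_ww hx
  lift z hz hs := ⟨wordHom hx z hz hs, wordHom_ww hx z hz hs⟩

theorem IsFree.lift_left {T X Z : Bim r} {a : List (Fin 2) → T.V} (ha : IsFree ω a)
    (O : List (Fin 2) → X.V →ₗ[ℂ] Z.V) (hO : ∀ w, IsShift (wt ω w) (O w)) :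
    ∃ g : T ⊗ X ⟶ Z, ∀ w x, g.lin (tmul (a w) x) = O w x := by
  obtain ⟨η, hη⟩ := ha.lift (ww r s ω) (isWords_ww hx).h (isWords_ww hx).sym
  refine ⟨η ▷ X ≫ wordLeft hx O hO, fun w x => ?_⟩
  rw [comp_apply', whiskerRight_tmul, hη, wordLeft_ww]

theorem IsFree.lift_right {T X Z : Bim r} {a : List (Fin 2) → T.V} (ha : IsFree ω a)
    (O : List (Fin 2) → X.V →ₗ[ℂ] Z.V) (hO : ∀ w, IsShift (wt ω w) (O w)) :
    ∃ g : X ⊗ T ⟶ Z, ∀ w x, g.lin (tmul x (a w)) = O w x := by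
  obtain ⟨η, hη⟩ := ha.lift (ww r s ω) (isWords_ww hx).h (isWords_ww hx).sym
  refine ⟨X ◁ η ≫ wordRight hx O hO, fun w x => ?_⟩
  rw [comp_apply', whiskerLeft_tmul, hη, wordRight_ww]

theorem IsFree.lift_shift {T Z : Bim r} {a : List (Fin 2) → T.V} (ha : IsFree ω a) {μ : ℂ}
    (z : List (Fin 2) → Z.V) (hz : ∀ w, Z.h (z w) = (wt ω w + μ) • z w)
    (hs : ∀ b w, Z.ract b (z w) = Z.lact b (z w)) :
    ∃ g : T.V →ₗ[ℂ] Z.V, IsShift μ g ∧ ∀ w, g (a w) = z w := by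
  obtain ⟨η, hη⟩ := ha.lift (ww r s ω) (isWords_ww hx).h (isWords_ww hx).sym
  have h := (wordShift_isShift hx z hz hs).comp (Hom.isShift η)
  rw [zero_add] at h
  refine ⟨_, h, fun w => ?_⟩
  rw [LinearMap.comp_apply, hη, wordShift_ww]

omit hx in
theorem fund_ext_left {X Z : Bim r} {f g : alpha r s (fund ω) ⊗ X ⟶ Z}
    (hs : ∀ b i, (alpha r s (fund ω)).ract b (ff r s ω i) = (alpha r s (fund ω)).lact b (ff r s ω i))
    (h : ∀ i x, f.lin (tmul (ff r s ω i) x) = g.lin (tmul (ff r s ω i) x)) : f = g :=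
  thom_ext fun t x => by
    refine fund_ind (P := fun t => f.lin (tm t x) = g.lin (tm t x)) t (by simp) (fun b i => ?_)
      (fun t t' h h' => by simp only [map_add, LinearMap.add_apply, h, h'])
    change f.lin (tmul _ x) = g.lin (tmul _ x)
    rw [← hs, tmul_balanced, h]

theorem ff_sym (b : Alg) (i : Fin 2) :
    (alpha r s (fund ω)).ract b (ff r s ω i) = (alpha r s (fund ω)).lact b (ff r s ω i) :=
  (ract_fund' hx b 1 _).trans (lact_aa b 1 _).symm

omit hx in
theorem fund_lin_ext {M : Type} [AddCommGroup M] [Module ℂ M] {f g : (fund ω).V →ₗ[ℂ] M}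
    (h : ∀ i, f (fe ω i) = g (fe ω i)) : f = g :=
  Finsupp.lhom_ext' fun i => LinearMap.ext_ring (h i)

/-- The linear map which sends the basis vectors to the words of length one. -/
def letterLin (r s ω : ℂ) : (fund ω).V →ₗ[ℂ] (alpha r s (wordsH ω)).V :=
  Finsupp.linearCombination ℂ fun i => ww r s ω [i]

omit hx in
theorem letterLin_fe (i : Fin 2) : letterLin r s ω (fe ω i) = ww r s ω [i] :=
  (Finsupp.linearCombination_single ℂ 1 i).trans (one_smul _ _)

/-- The homomorphism of bimodules which sends the generators to the words of length one. -/
def letterHom : alpha r s (fund ω) ⟶ alpha r s (wordsH ω) :=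
  homOf (letterLin r s ω) (ract_fund' hx)
    (LinearMap.congr_fun (f := (alpha r s (wordsH ω)).h ∘ₗ letterLin r s ω)
      (g := letterLin r s ω ∘ₗ (fund ω).h)
      (fund_lin_ext fun i => by
        rw [LinearMap.comp_apply, LinearMap.comp_apply, fe_h, letterLin_fe, (isWords_ww hx).h,
          map_smul, letterLin_fe, wt_cons, wt_nil, add_zero]))
    (fun a => LinearMap.congr_fun (f := (alpha r s (wordsH ω)).ract a ∘ₗ letterLin r s ω)
      (g := (alpha r s (wordsH ω)).lact a ∘ₗ letterLin r s ω)
      (fund_lin_ext fun i => by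
        rw [LinearMap.comp_apply, LinearMap.comp_apply, letterLin_fe, (isWords_ww hx).sym]))

theorem letterHom_ff (i : Fin 2) : (letterHom hx).lin (ff r s ω i) = ww r s ω [i] := by
  refine (homOf_aa _ _ _ _ _ _).trans ?_
  rw [map_one, letterLin_fe]
  rfl

/-- The inclusion of the generators into the algebra of words, in the centre. -/
def letterC : alphaC r s (fund ω) ⟶ alphaC r s (wordsH ω) where
  f := letterHom hx
  comm U := fund_ext_left (ff_sym hx) fun i x => IsCent.comm
    (T := alphaC r s (fund ω)) (T' := alphaC r s (wordsH ω)) (letterHom hx)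
    (isCent_alpha (fe_h ω i))
    ((congrArg (IsCent (T := alphaC r s (wordsH ω)) s (![ω, -ω] i)) (letterHom_ff hx i)).mpr
      ((add_zero (![ω, -ω] i)) ▸ isCent_ww [i])) U x

/-- In the algebra of words, the product of the generators along a word is the word. -/
theorem wd_letterC (w : List (Fin 2)) :
    letI := wordMon hx
    wd (letterC hx) w = ww r s ω w := by
  induction w with
  | nil => exact wordOne_un hx
  | cons i w ih =>
    refine (congrArg (wordMul hx).lin (congrArg₂ tmul (letterHom_ff hx i) ih)).trans ?_
    exact wordMul_ww hx [i] w

/-- An algebra with a word basis is the direct sum of the tensor powers of the generators. -/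
theorem IsFree.isColimit {T : Center (Bim r)} [MonObj T] {ι : alphaC r s (fund ω) ⟶ T}
    (ha : IsFree ω (wd ι)) : Nonempty (IsColimit (Cofan.mk T.1 fun n => (cpowMap ι n).f)) := by
  have key : ∀ c : Cofan fun n => (cpow (alphaC r s (fund ω)) n).1, ∃ g : T.1 ⟶ c.pt,
      ∀ n, (cpowMap ι n).f ≫ g = c.inj n := fun c => by
    -- The word `w` corresponds to the element `el` of the reversed word, since `el` reads words
    -- from the right to the left.
    obtain ⟨g, hg⟩ := ha.lift (fun w => (c.inj w.length).lin (el r s ω w.length w.reverse))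
      (fun w => by
        have h : wt ω w = wt ω w.reverse := by
          induction w with
          | nil => rfl
          | cons i w ih => rw [List.reverse_cons, wt_append, wt_cons, ih, wt_cons, wt_nil]; ring
        rw [← Hom.comm_h, el_h, map_smul, h])
      (fun b w => by
        rw [← Hom.comm_r, ← Hom.comm_l, el_sym (ract_fund' hx)])
    refine ⟨g, fun n => hom_ext (LinearMap.ext fun t => ?_)⟩
    refine el_ind (ract_fund' hx) n (P := fun t => ((cpowMap ι n).f ≫ g).lin t = (c.inj n).lin t)
      ?_ (fun b w hw => ?_) (fun x y hx hy => ?_) t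
    · rw [map_zero, map_zero]
    · subst hw
      rw [Hom.comm_l, Hom.comm_l, comp_apply', cpowMap_el, hg, List.reverse_reverse,
        List.length_reverse]
    · rw [map_add, map_add, hx, hy]
  choose g hg using key
  exact ⟨Cofan.IsColimit.mk _ g hg fun c m hm => ha.ext fun w => by
    have h1 := cpowMap_el ι w.reverse
    rw [List.reverse_reverse] at h1
    rw [← h1, ← comp_apply', ← comp_apply']
    exact congrArg (fun f => f.lin (el r s ω w.reverse.length w.reverse))
      ((hm _).trans (hg c _).symm)⟩

/-- The direct sum of the tensor powers of the generators has a word basis. -/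
theorem isFree_of_isColimit {T : Center (Bim r)} [MonObj T] {ι : alphaC r s (fund ω) ⟶ T}
    (hT : IsColimit (Cofan.mk T.1 fun n => (cpowMap ι n).f)) : IsFree ω (wd ι) := by
  let _ := wordMon hx
  have key : ∀ {Z : Bim r} (z : List (Fin 2) → Z.V), (∀ w, Z.h (z w) = wt ω w • z w) →
      (∀ b w, Z.ract b (z w) = Z.lact b (z w)) → ∃ g : T.1 ⟶ Z, ∀ w, g.lin (wd ι w) = z w := by
    intro Z z hz hs
    let c : Cofan fun n => (cpow (alphaC r s (fund ω)) n).1 :=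
      Cofan.mk Z fun n => (cpowMap (letterC hx) n).f ≫ wordHom hx z hz hs
    refine ⟨hT.desc c, fun w => ?_⟩
    have h1 := cpowMap_el ι w.reverse
    have h2 := cpowMap_el (letterC hx) w.reverse
    rw [List.reverse_reverse] at h1 h2
    have h3 := congrArg (fun f => f.lin (el r s ω w.reverse.length w.reverse))
      (hT.fac c ⟨w.reverse.length⟩)
    refine (congrArg (hT.desc c).lin h1.symm).trans (h3.trans ?_)
    exact (congrArg (wordHom hx z hz hs).lin (h2.trans (wd_letterC hx w))).trans
      (wordHom_ww hx z hz hs w)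
  refine ⟨⟨fun b w => wd_sym ι (ract_fund' hx) b w, wd_h ι, fun {P} h0 h1 h2 t => ?_⟩, key⟩
  obtain ⟨η, hη⟩ := key (ww r s ω) (isWords_ww hx).h (isWords_ww hx).sym
  let θ := wordHom hx (wd ι) (wd_h ι) (wd_sym ι (ract_fund' hx))
  -- `θ` from the algebra of words to `T` has the right inverse `η`, so that the words generate `T`.
  have hθ : η ≫ θ = 𝟙 T.1 := hT.hom_ext fun ⟨n⟩ => hom_ext (LinearMap.ext fun t => by
    change θ.lin (η.lin ((cpowMap ι n).f.lin t)) = (cpowMap ι n).f.lin t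
    refine el_ind (ract_fund' hx) n (P := fun t => θ.lin (η.lin ((cpowMap ι n).f.lin t)) =
      (cpowMap ι n).f.lin t) (by simp only [map_zero]) (fun b w hw => ?_)
      (fun x y hx hy => by simp only [map_add, hx, hy]) t
    subst hw
    rw [Hom.comm_l, cpowMap_el, Hom.comm_l, hη, Hom.comm_l]
    exact congrArg _ (wordHom_ww hx _ _ _ _))
  have h3 : θ.lin (η.lin t) = t := congrArg (fun f => f.lin t) hθ
  rw [← h3]
  refine (isWords_ww hx).ind (P := fun t => P (θ.lin t)) (by simpa using h0) (fun b w => ?_)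
    (fun x y hx hy => by rw [map_add]; exact h2 _ _ hx hy) _
  rw [Hom.comm_l]
  exact (congrArg (fun z => P (T.1.lact b z)) (wordHom_ww hx _ _ _ w)).mpr (h1 b w)

end Free

/-! ### Coproducts and counits of tensor algebras -/

section Coproduct

variable {r s ω κ : ℂ}

theorem copSum_tmul {X Y : Bim r} (w : List (Fin 2)) (G : List (Fin 2) → List (Fin 2) → X.V)
    (y : Y.V) : tmul (copSum κ ω w G) y = copSum κ ω w fun u v => tmul (G u v) y :=
  map_copSum κ ω (tm.flip y) w G

theorem tmul_copSum {X Y : Bim r} (w : List (Fin 2)) (G : List (Fin 2) → List (Fin 2) → Y.V)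
    (x : X.V) : tmul x (copSum κ ω w G) = copSum κ ω w fun u v => tmul x (G u v) :=
  map_copSum κ ω (tm x) w G

theorem copSum_h {Z : Bim r} (w : List (Fin 2)) {G : List (Fin 2) → List (Fin 2) → Z.V}
    (h : ∀ u v, Z.h (G u v) = (wt ω u + wt ω v) • G u v) :
    Z.h (copSum κ ω w G) = wt ω w • copSum κ ω w G := by
  rw [map_copSum, ← copSum_smul]
  exact copSum_congr κ ω w fun u v huv => by rw [h, huv]

theorem copSum_sym {Z : Bim r} (w : List (Fin 2)) {G : List (Fin 2) → List (Fin 2) → Z.V} (b : Alg)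
    (h : ∀ u v, Z.ract b (G u v) = Z.lact b (G u v)) :
    Z.ract b (copSum κ ω w G) = Z.lact b (copSum κ ω w G) := by
  rw [map_copSum, map_copSum]
  exact copSum_congr κ ω w fun u v _ => h u v

theorem IsWords.tmul_h {T T' : Bim r} {a : List (Fin 2) → T.V} {a' : List (Fin 2) → T'.V}
    (ha : IsWords ω a) (ha' : IsWords ω a') (u v : List (Fin 2)) :
    (T ⊗ T').h (tmul (a u) (a' v)) = (wt ω u + wt ω v) • tmul (a u) (a' v) := by
  rw [h_tmul, ha.h, ha'.h, Bim.smul_tmul, tmul_smul, add_smul]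

theorem IsWords.tmul_sym {T T' : Bim r} {a : List (Fin 2) → T.V} {a' : List (Fin 2) → T'.V}
    (ha : IsWords ω a) (ha' : IsWords ω a') (b : Alg) (u v : List (Fin 2)) :
    (T ⊗ T').ract b (tmul (a u) (a' v)) = (T ⊗ T').lact b (tmul (a u) (a' v)) := by
  rw [ract_tmul, lact_tmul, ha'.sym, ← tmul_balanced, ha.sym]

theorem IsFree.exists_cop {T : Bim r} {a : List (Fin 2) → T.V} (ha : IsFree ω a) (κ : ℂ) :
    ∃ Δ : T ⟶ T ⊗ T, ∀ w, Δ.lin (a w) = copSum κ ω w fun u v => tmul (a u) (a v) :=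
  ha.lift _ (fun w => copSum_h w (ha.tmul_h ha.toIsWords))
    fun b w => copSum_sym w b (ha.tmul_sym ha.toIsWords b)

theorem IsFree.exists_counit {T : Bim r} {a : List (Fin 2) → T.V} (ha : IsFree ω a) :
    ∃ ε : T ⟶ 𝟙_ (Bim r), ∀ w, ε.lin (a w) = if w = [] then un 1 else 0 :=
  ha.lift _ (fun w => by
    by_cases h : w = []
    · simp [h, h_un_one]
    · simp [h])
    fun b w => by
      by_cases h : w = []
      · simp [h, lact_un, ract_un]
      · simp [h]

/-- The braiding which enters the coproduct, on homogeneous central elements: both for the algebra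
over `F^+` with the braiding and for the algebra over `F^-` with the inverse braiding. -/
def IsBraid (κ ω : ℂ) {T : Bim r} (a : List (Fin 2) → T.V) (c : T ⊗ T ⟶ T ⊗ T) : Prop :=
  ∀ u v, c.lin (tmul (a u) (a v)) = Complex.exp (κ * wt ω u * wt ω v) • tmul (a v) (a u)

theorem isBraid_over {T : Center (Bim r)} {a : List (Fin 2) → T.1.V} (ha : IsWords ω a)
    (hc : ∀ w, IsCent κ (wt ω w) (a w)) : IsBraid κ ω a (braidOver T) := fun u v => by
  refine (hc u T.1 (a v)).trans ?_
  rw [kop_apply κ _ (ha.h v), Bim.smul_tmul]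

theorem isBraid_under {T : Center (Bim r)} {a : List (Fin 2) → T.1.V} (ha : IsWords ω a)
    (hc : ∀ w, IsCent (-κ) (wt ω w) (a w)) : IsBraid κ ω a (braidUnder T) := fun u v => by
  refine ((hc v).inv T.1 (a u)).trans ?_
  rw [neg_neg, kop_apply κ _ (ha.h u), tmul_smul]
  ring_nf

section Alg

variable {T : Center (Bim r)} [MonObj T] {ι : alphaC r s (fund ω) ⟶ T} {Δ : T.1 ⟶ T.1 ⊗ T.1}
  {ε : T.1 ⟶ 𝟙_ (Bim r)} {c : T.1 ⊗ T.1 ⟶ T.1 ⊗ T.1}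

/-- The braided product of two coproducts of words is the coproduct of the concatenation. -/
theorem mul_cop_apply (hc : IsBraid κ ω (wd ι) c) {u w : List (Fin 2)}
    (hu : Δ.lin (wd ι u) = copSum κ ω u fun u v => tmul (wd ι u) (wd ι v))
    (hw : Δ.lin (wd ι w) = copSum κ ω w fun u v => tmul (wd ι u) (wd ι v)) :
    ((Δ ⊗ₘ Δ) ⊗≫ T.1 ◁ c ▷ T.1 ⊗≫ (mulC T ⊗ₘ mulC T)).lin (tmul (wd ι u) (wd ι w)) =
      copSum κ ω (u ++ w) fun u v => tmul (wd ι u) (wd ι v) := by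
  rw [copSum_append]
  simp only [monoidalComp, comp_apply', tensorHom_tmul, whiskerRight_tmul, whiskerLeft_tmul,
    associator_tmul, associator_inv_tmul, MonoidalCoherence.refl_iso,
    MonoidalCoherence.whiskerRight_iso, MonoidalCoherence.whiskerLeft_iso,
    MonoidalCoherence.assoc_iso, MonoidalCoherence.assoc'_iso, Iso.trans_hom, whiskerRightIso_hom,
    whiskerLeftIso_hom, Iso.symm_hom, id_apply', Iso.refl_hom, hu, hw, copSum_tmul, tmul_copSum,
    map_copSum, hc _ _, Bim.smul_tmul, tmul_smul, map_smul, mulC_wd, id_whiskerRight]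
  exact copSum_comm κ ω w u _

/-- The axioms of the coproduct (unital, multiplicative, primitive on the generators) determine its
values on words. -/
theorem cop_wd (hc : IsBraid κ ω (wd ι) c)
    (h1 : oneC T ≫ Δ = (λ_ (𝟙_ (Bim r))).inv ≫ (oneC T ⊗ₘ oneC T))
    (hm : mulC T ≫ Δ = (Δ ⊗ₘ Δ) ⊗≫ T.1 ◁ c ▷ T.1 ⊗≫ (mulC T ⊗ₘ mulC T))
    (hι : ι.f ≫ Δ = (ρ_ (alpha r s (fund ω))).inv ≫ (ι.f ⊗ₘ oneC T) +
      (λ_ (alpha r s (fund ω))).inv ≫ (oneC T ⊗ₘ ι.f)) (w : List (Fin 2)) :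
    Δ.lin (wd ι w) = copSum κ ω w fun u v => tmul (wd ι u) (wd ι v) := by
  have h2 (i : Fin 2) : Δ.lin (wd ι [i]) = copSum κ ω [i] fun u v => tmul (wd ι u) (wd ι v) := by
    rw [wd_single]
    refine (congrArg (fun f => f.lin (ff r s ω i)) hι).trans ?_
    have h3 : (copSum κ ω [i] fun u v => tmul (wd ι u) (wd ι v)) =
        tmul (ι.f.lin (ff r s ω i)) ((oneC T).lin (un 1)) +
          tmul ((oneC T).lin (un 1)) (ι.f.lin (ff r s ω i)) := by
      simp only [copSum_cons, copSum_nil, wd_single, wd_nil, wt_nil, mul_zero, Complex.exp_zero,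
        one_smul]
    refine ((lin_add_apply _ _ _).trans ?_).trans h3.symm
    exact congrArg₂ (· + ·) (tensorHom_tmul _ _ _ _) (tensorHom_tmul _ _ _ _)
  induction w with
  | nil =>
    have h3 := congrArg (fun f => f.lin (un 1)) h1
    simp only [comp_apply'] at h3
    exact h3
  | cons i w ih =>
    have h3 := congrArg (fun f => f.lin (tmul (wd ι [i]) (wd ι w))) hm
    simp only [mul_cop_apply hc (h2 i) ih, comp_apply', mulC_wd] at h3
    exact h3

/-- The axioms of the counit determine its values on words. -/
theorem counit_wd (h1 : oneC T ≫ ε = 𝟙 _)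
    (hm : mulC T ≫ ε = (ε ⊗ₘ ε) ≫ (λ_ (𝟙_ (Bim r))).hom) (hι : ι.f ≫ ε = 0) (w : List (Fin 2)) :
    ε.lin (wd ι w) = if w = [] then un 1 else 0 := by
  cases w with
  | nil => exact congrArg (fun f => f.lin (un 1)) h1
  | cons i w =>
    have h2 : ε.lin (wd ι [i]) = 0 := by
      rw [wd_single]
      exact congrArg (fun f => f.lin (ff r s ω i)) hι
    have h3 := congrArg (fun f => f.lin (tmul (wd ι [i]) (wd ι w))) hm
    simp only [comp_apply', mulC_wd, tensorHom_tmul, h2, zero_tmul, map_zero] at h3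
    simpa using h3

end Alg

variable (hx : ∀ n : ℤ, Complex.exp (s * (n * r) * ω) = 1)
include hx

/-- The tensor algebra exists: the bimodule on all words, with concatenation as product, is the
direct sum of the tensor powers, and coproduct and counit can be prescribed on the word basis. -/
theorem nonempty_tensorAlg {c : ∀ T : Center (Bim r), T.1 ⊗ T.1 ⟶ T.1 ⊗ T.1}
    (hc : ∀ (T : Center (Bim r)) (a : List (Fin 2) → T.1.V), IsWords ω a →
      (∀ w, IsCent s (wt ω w) (a w)) → IsBraid κ ω a (c T)) :
    Nonempty (TensorAlg (alphaC r s (fund ω)) c) := by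
  suffices H : ∀ (T : Center (Bim r)) [MonObj T] (ι : alphaC r s (fund ω) ⟶ T),
      IsFree ω (wd ι) → Nonempty (TensorAlg (alphaC r s (fund ω)) c) by
    let _ := wordMon hx
    refine H (alphaC r s (wordsH ω)) (letterC hx) ?_
    rw [show wd (letterC hx) = ww r s ω from funext (wd_letterC hx)]
    exact isFree_ww hx
  intro T _ ι ha
  obtain ⟨hT⟩ := ha.isColimit hx
  obtain ⟨Δ, hΔ⟩ := ha.exists_cop κ
  obtain ⟨ε, hε⟩ := ha.exists_counit
  refine ⟨⟨T, ι, hT, Δ, ε, ?_, ?_, ?_, ?_, ?_, ?_⟩⟩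
  · refine un_ext ?_
    have := hΔ []
    simp only [comp_apply']
    exact this
  · refine ha.ext₂ ha.toIsWords fun w u => ?_
    rw [mul_cop_apply (hc T (wd ι) ha.toIsWords (wd_cent ι)) (hΔ w) (hΔ u), comp_apply', mulC_wd,
      hΔ]
  · refine hom_ext (LinearMap.ext fun t => ?_)
    refine fund_ind (P := fun t => (ι.f ≫ Δ).lin t = ((ρ_ (alpha r s (fund ω))).inv ≫
      (ι.f ⊗ₘ oneC T) + (λ_ (alpha r s (fund ω))).inv ≫ (oneC T ⊗ₘ ι.f)).lin t) t
      ((map_zero _).trans (map_zero _).symm) (fun a i => ?_)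
      (fun x y hx hy => (map_add _ _ _).trans ((congrArg₂ (· + ·) hx hy).trans (map_add _ _ _).symm))
    refine (Hom.comm_l _ _ _).trans (Eq.trans ?_ (Hom.comm_l _ _ _).symm)
    refine congrArg _ ?_
    have := hΔ [i]
    simp only [copSum_cons, copSum_nil, wd_single, wd_nil, wt_nil, mul_zero, Complex.exp_zero,
      one_smul] at this
    refine this.trans (congrArg₂ (· + ·) (tensorHom_tmul _ _ _ _) (tensorHom_tmul _ _ _ _)).symm
  · exact un_ext (hε [])
  · refine ha.ext₂ ha.toIsWords fun w u => ?_
    simp only [comp_apply', mulC_wd, tensorHom_tmul, hε]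
    by_cases h : w = []
    · by_cases h' : u = []
      · simp [h, h']
      · simp [h, h', tmul_zero]
    · simp [h, zero_tmul]
  · refine hom_ext (LinearMap.ext fun t => ?_)
    refine fund_ind (P := fun t => (ι.f ≫ ε).lin t = 0) t (map_zero _) (fun a i => ?_)
      (fun x y hx hy => (map_add _ _ _).trans (by rw [hx, hy, add_zero]))
    refine (Hom.comm_l _ _ _).trans ?_
    have := hε [i]
    rw [wd_single] at this
    exact (congrArg _ this).trans (map_zero _)

end Coproduct

/-! ### The Hopf pairing -/

section Pairing

variable {r ω κ : ℂ} {A : TensorAlg (alphaC r κ (fund ω)) braidOver}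
  {B : TensorAlg (alphaC r (-κ) (fund ω)) braidUnder}

/-- The words in the tensor algebra of `F^+`. -/
def wa (A : TensorAlg (alphaC r κ (fund ω)) braidOver) (w : List (Fin 2)) : A.T.1.V := wd A.ι w

/-- The words in the tensor algebra of `F^-`. -/
def wb (B : TensorAlg (alphaC r (-κ) (fund ω)) braidUnder) (w : List (Fin 2)) : B.T.1.V := wd B.ι w

theorem exp_neg_one (hx : ∀ n : ℤ, Complex.exp (κ * (n * r) * ω) = 1) (n : ℤ) :
    Complex.exp (-κ * (n * r) * ω) = 1 := by
  rw [neg_mul, neg_mul, Complex.exp_neg, hx, inv_one]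

theorem wa_cent (w : List (Fin 2)) : IsCent κ (wt ω w) (wa A w) := wd_cent A.ι w
theorem wb_cent (w : List (Fin 2)) : IsCent (-κ) (wt ω w) (wb B w) := wd_cent B.ι w
theorem mulC_wa (u w : List (Fin 2)) : (mulC A.T).lin (tmul (wa A u) (wa A w)) = wa A (u ++ w) :=
  mulC_wd A.ι u w
theorem mulC_wb (u w : List (Fin 2)) : (mulC B.T).lin (tmul (wb B u) (wb B w)) = wb B (u ++ w) :=
  mulC_wd B.ι u w
theorem oneC_wa : (oneC A.T).lin (un 1) = wa A [] := rfl
theorem oneC_wb : (oneC B.T).lin (un 1) = wb B [] := rfl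
theorem ι_wa (i : Fin 2) : A.ι.f.lin (ff r κ ω i) = wa A [i] := (wd_single A.ι i).symm
theorem ι_wb (i : Fin 2) : B.ι.f.lin (ff r (-κ) ω i) = wb B [i] := (wd_single B.ι i).symm
theorem ε_wa (w : List (Fin 2)) : A.ε.lin (wa A w) = if w = [] then un 1 else 0 :=
  counit_wd A.one_ε A.mul_ε A.ι_ε w
theorem ε_wb (w : List (Fin 2)) : B.ε.lin (wb B w) = if w = [] then un 1 else 0 :=
  counit_wd B.one_ε B.mul_ε B.ι_ε w

variable (hx : ∀ n : ℤ, Complex.exp (κ * (n * r) * ω) = 1)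
include hx

/-- A tensor algebra has a word basis, whichever model has been chosen. -/
theorem isFree_wa : IsFree ω (wa A) := isFree_of_isColimit hx A.isColimit
theorem isFree_wb : IsFree ω (wb B) := isFree_of_isColimit (exp_neg_one hx) B.isColimit

theorem Δ_wa (w : List (Fin 2)) :
    A.Δ.lin (wa A w) = copSum κ ω w fun u v => tmul (wa A u) (wa A v) :=
  cop_wd (isBraid_over (isFree_wa (A := A) hx).toIsWords wa_cent) A.one_Δ A.mul_Δ A.ι_Δ w

theorem Δ_wb (w : List (Fin 2)) :
    B.Δ.lin (wb B w) = copSum κ ω w fun u v => tmul (wb B u) (wb B v) :=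
  cop_wd (isBraid_under (isFree_wb (B := B) hx).toIsWords wb_cent) B.one_Δ B.mul_Δ B.ι_Δ w

theorem rho_mul_left (ρ : A.T.1 ⊗ B.T.1 ⟶ 𝟙_ (Bim r)) (w w' u : List (Fin 2)) :
    ((A.T.1 ⊗ A.T.1) ◁ B.Δ ⊗≫ A.T.1 ◁ ρ ▷ B.T.1 ⊗≫ ρ).lin
      (tmul (tmul (wa A w) (wa A w')) (wb B u)) = copSum κ ω u fun u₁ u₂ =>
        ρ.lin (tmul (wa A w) ((λ_ B.T.1).hom.lin (tmul (ρ.lin (tmul (wa A w') (wb B u₁)))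
          (wb B u₂)))) := by
  simp only [monoidalComp, comp_apply', whiskerRight_tmul, whiskerLeft_tmul,
    associator_tmul, associator_inv_tmul, MonoidalCoherence.refl_iso,
    MonoidalCoherence.whiskerRight_iso, MonoidalCoherence.whiskerLeft_iso,
    MonoidalCoherence.assoc_iso, MonoidalCoherence.assoc'_iso, Iso.trans_hom, whiskerRightIso_hom,
    whiskerLeftIso_hom, Iso.symm_hom, id_apply', Iso.refl_hom, tmul_copSum, map_copSum,
    id_whiskerRight, Δ_wb hx, MonoidalCoherence.left_iso]

theorem rho_mul_right (ρ : A.T.1 ⊗ B.T.1 ⟶ 𝟙_ (Bim r)) (w u u' : List (Fin 2)) :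
    (A.Δ ▷ (B.T.1 ⊗ B.T.1) ⊗≫ A.T.1 ◁ ρ ▷ B.T.1 ⊗≫ ρ).lin
      (tmul (wa A w) (tmul (wb B u) (wb B u'))) = copSum κ ω w fun w₁ w₂ =>
        ρ.lin (tmul (wa A w₁) ((λ_ B.T.1).hom.lin (tmul (ρ.lin (tmul (wa A w₂) (wb B u)))
          (wb B u')))) := by
  simp only [monoidalComp, comp_apply', whiskerRight_tmul, whiskerLeft_tmul,
    associator_tmul, associator_inv_tmul, MonoidalCoherence.refl_iso,
    MonoidalCoherence.whiskerRight_iso, MonoidalCoherence.whiskerLeft_iso,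
    MonoidalCoherence.assoc_iso, MonoidalCoherence.assoc'_iso, Iso.trans_hom, whiskerRightIso_hom,
    whiskerLeftIso_hom, Iso.symm_hom, id_apply', Iso.refl_hom, copSum_tmul, map_copSum,
    id_whiskerRight, Δ_wa hx, MonoidalCoherence.left_iso]

omit hx in
theorem rho_scalar (ρ : A.T.1 ⊗ B.T.1 ⟶ 𝟙_ (Bim r)) (c : ℂ) (x : A.T.1.V) (y : B.T.1.V) :
    ρ.lin (tmul x ((λ_ B.T.1).hom.lin (tmul (c • un 1) y))) = c • ρ.lin (tmul x y) := by
  rw [Bim.smul_tmul, map_smul, leftUnitor_tmul, map_one, Module.End.one_apply, tmul_smul, map_smul]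

variable {β : Fin 2 → Fin 2 → ℂ} (hβ : ∀ i j, β i j ≠ 0 → ![ω, -ω] i + ![ω, -ω] j = 0)

include hβ in
/-- The word pairing defines a homomorphism of bimodules; it preserves the weights by `pair_wt`. -/
theorem exists_rho (A : TensorAlg (alphaC r κ (fund ω)) braidOver)
    (B : TensorAlg (alphaC r (-κ) (fund ω)) braidUnder) : ∃ ρ : A.T.1 ⊗ B.T.1 ⟶ 𝟙_ (Bim r),
    ∀ w u, ρ.lin (tmul (wa A w) (wb B u)) = pair κ ω β w u • un 1 := by
  have h1 (w : List (Fin 2)) := (isFree_wb (B := B) hx).lift_shift (exp_neg_one hx) (μ := wt ω w)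
    (Z := 𝟙_ (Bim r)) (fun u => pair κ ω β w u • un 1)
    (fun u => by
      rw [map_smul, h_un_one, smul_zero, smul_smul]
      by_cases h : wt ω w + wt ω u = 0
      · rw [add_comm, h, zero_mul, zero_smul]
      · rw [pair_wt κ ω hβ w u h, mul_zero, zero_smul])
    (fun b u => by rw [map_smul, map_smul, lact_un, ract_un])
  choose O hO hO' using h1
  obtain ⟨ρ, hρ⟩ := (isFree_wa (A := A) hx).lift_left hx O hO
  exact ⟨ρ, fun w u => by rw [hρ, hO']⟩

include hβ in
/-- The identities of a Hopf pairing hold on word bases, by `pair_append` and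
`pair_append_right`. -/
theorem isHopfPairing_of_pair {ρ : A.T.1 ⊗ B.T.1 ⟶ 𝟙_ (Bim r)}
    (hρ : ∀ w u, ρ.lin (tmul (wa A w) (wb B u)) = pair κ ω β w u • un 1) :
    IsHopfPairing A B ρ where
  mul_left := (isFree_wa hx).ext_left₂ (isFree_wa hx).toIsWords fun w w' x => by
    refine (isFree_wb hx).ind (P := fun x => (mulC A.T ▷ B.T.1 ≫ ρ).lin
      (tmul (tmul (wa A w) (wa A w')) x) = ((A.T.1 ⊗ A.T.1) ◁ B.Δ ⊗≫ A.T.1 ◁ ρ ▷ B.T.1 ⊗≫ ρ).lin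
      (tmul (tmul (wa A w) (wa A w')) x)) (by simp only [tmul_zero, map_zero]) (fun b u => ?_)
      (fun x y hx hy => by simp only [tmul_add, map_add, hx, hy]) x
    rw [← (isFree_wb hx).sym, ← ract_tmul, Hom.comm_r, Hom.comm_r, rho_mul_left hx]
    congr 1
    simp only [comp_apply', whiskerRight_tmul, mulC_wa, hρ, rho_scalar, smul_smul]
    rw [pair_append]
    exact map_copSum κ ω (LinearMap.toSpanSingleton ℂ (𝟙_ (Bim r)).V (un 1)) u _
  mul_right := (isFree_wa hx).ext_left fun w x => by
    refine (isFree_wb hx).ind_left (P := fun x => (A.T.1 ◁ mulC B.T ≫ ρ).lin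
      (tmul (wa A w) x) = (A.Δ ▷ (B.T.1 ⊗ B.T.1) ⊗≫ A.T.1 ◁ ρ ▷ B.T.1 ⊗≫ ρ).lin
      (tmul (wa A w) x)) (by simp only [tmul_zero, map_zero]) (fun u x => ?_)
      (fun x y hx hy => by simp only [tmul_add, map_add, hx, hy]) x
    refine (isFree_wb hx).ind (P := fun x => (A.T.1 ◁ mulC B.T ≫ ρ).lin
      (tmul (wa A w) (tmul (wb B u) x)) = (A.Δ ▷ (B.T.1 ⊗ B.T.1) ⊗≫ A.T.1 ◁ ρ ▷ B.T.1 ⊗≫ ρ).lin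
      (tmul (wa A w) (tmul (wb B u) x))) (by simp only [tmul_zero, map_zero]) (fun b u' => ?_)
      (fun x y hx hy => by simp only [tmul_add, map_add, hx, hy]) x
    rw [← (isFree_wb hx).sym, ← ract_tmul, ← ract_tmul, Hom.comm_r, Hom.comm_r, rho_mul_right hx]
    congr 1
    simp only [comp_apply', whiskerLeft_tmul, mulC_wb, hρ, rho_scalar, smul_smul]
    rw [pair_append_right κ ω hβ]
    exact map_copSum κ ω (LinearMap.toSpanSingleton ℂ (𝟙_ (Bim r)).V (un 1)) w _
  one_left := un_ext_left fun x => by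
    refine (isFree_wb hx).ind (P := fun x => (oneC A.T ▷ B.T.1 ≫ ρ).lin (tmul (un 1) x) =
      ((λ_ B.T.1).hom ≫ B.ε).lin (tmul (un 1) x)) (by simp only [tmul_zero, map_zero]) (fun b u => ?_)
      (fun x y hx hy => by simp only [tmul_add, map_add, hx, hy]) x
    rw [← (isFree_wb hx).sym, ← ract_tmul, Hom.comm_r, Hom.comm_r]
    congr 1
    rw [comp_apply', whiskerRight_tmul, comp_apply', leftUnitor_tmul, map_one, Module.End.one_apply,
      oneC_wa, hρ, ε_wb, pair_nil, ite_smul, one_smul, zero_smul]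
  one_right := (isFree_wa hx).ext_left fun w t => by
    refine un_ind (P := fun t => (A.T.1 ◁ oneC B.T ≫ ρ).lin (tmul (wa A w) t) =
      ((ρ_ A.T.1).hom ≫ A.ε).lin (tmul (wa A w) t)) (fun a => ?_) t
    rw [un_eq, lact_un, mul_one, show (un a : (𝟙_ (Bim r)).V) = (𝟙_ (Bim r)).ract a (un 1) by
      rw [ract_un, mul_one], ← ract_tmul, Hom.comm_r, Hom.comm_r]
    congr 1
    rw [comp_apply', whiskerLeft_tmul, comp_apply', rightUnitor_tmul, map_one, Module.End.one_apply,
      oneC_wb, hρ, ε_wa, pair_nil_right, ite_smul, one_smul, zero_smul]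

include hβ in
/-- A Hopf pairing is determined by its values on the generators. -/
theorem IsHopfPairing.apply_words {ρ : A.T.1 ⊗ B.T.1 ⟶ 𝟙_ (Bim r)} (h : IsHopfPairing A B ρ)
    (hg : ∀ i j, ρ.lin (tmul (wa A [i]) (wb B [j])) = β i j • un 1) (w u : List (Fin 2)) :
    ρ.lin (tmul (wa A w) (wb B u)) = pair κ ω β w u • un 1 := by
  have h0 (u : List (Fin 2)) : ρ.lin (tmul (wa A []) (wb B u)) = pair κ ω β [] u • un 1 := by
    have h1 := congrArg (fun f => f.lin (tmul (un 1) (wb B u))) h.one_left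
    simp only [comp_apply', whiskerRight_tmul, leftUnitor_tmul, map_one, Module.End.one_apply,
      oneC_wa, ε_wb] at h1
    rw [h1, pair_nil, ite_smul, one_smul, zero_smul]
  have h1 (i : Fin 2) (u : List (Fin 2)) :
      ρ.lin (tmul (wa A [i]) (wb B u)) = pair κ ω β [i] u • un 1 := by
    induction u with
    | nil =>
      have h1 := congrArg (fun f => f.lin (tmul (wa A [i]) (un 1))) h.one_right
      simp only [comp_apply', whiskerLeft_tmul, rightUnitor_tmul, map_one, Module.End.one_apply,
        oneC_wb, ε_wa] at h1
      rw [h1, pair_nil_right, ite_smul, one_smul, zero_smul]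
    | cons j u ih =>
      have h2 := congrArg (fun f => f.lin (tmul (wa A [i]) (tmul (wb B [j]) (wb B u)))) h.mul_right
      simp only [rho_mul_right hx, comp_apply', whiskerLeft_tmul, mulC_wb] at h2
      refine h2.trans ?_
      have h3 := pair_append_right κ ω hβ [i] [j] u
      rw [List.singleton_append] at h3
      simp only [copSum_cons, copSum_nil, hg, h0, rho_scalar, ih, wt_nil, mul_zero,
        Complex.exp_zero, one_smul, pair_letters, smul_smul, ← add_smul] at h3 ⊢
      rw [h3, one_mul]
  induction w generalizing u with
  | nil => exact h0 u
  | cons i w ih =>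
    have h2 := congrArg (fun f => f.lin (tmul (tmul (wa A [i]) (wa A w)) (wb B u))) h.mul_left
    simp only [rho_mul_left hx, comp_apply', whiskerRight_tmul, mulC_wa, ih, rho_scalar, h1,
      smul_smul] at h2
    refine h2.trans ?_
    have h3 := pair_append κ ω (β := β) [i] w u
    rw [List.singleton_append] at h3
    rw [h3]
    exact (map_copSum κ ω (LinearMap.toSpanSingleton ℂ (𝟙_ (Bim r)).V (un 1)) u _).symm

end Pairing

/-! ### The Yetter-Drinfeld condition for operators -/

section Operators

variable {V : Type} [AddCommGroup V] [Module ℂ V]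

/-- The left action of a word. -/
def opL (P : Fin 2 → Module.End ℂ V) : List (Fin 2) → Module.End ℂ V
  | [] => LinearMap.id
  | i :: w => P i ∘ₗ opL P w

/-- The right action of a word. -/
def opR (N : Fin 2 → Module.End ℂ V) : List (Fin 2) → Module.End ℂ V
  | [] => LinearMap.id
  | j :: u => opR N u ∘ₗ N j

@[simp] theorem opL_nil (P : Fin 2 → Module.End ℂ V) (x : V) : opL P [] x = x := rfl
theorem opL_cons (P : Fin 2 → Module.End ℂ V) (i : Fin 2) (w : List (Fin 2)) (x : V) :
    opL P (i :: w) x = P i (opL P w x) := rfl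
@[simp] theorem opR_nil (N : Fin 2 → Module.End ℂ V) (x : V) : opR N [] x = x := rfl
theorem opR_cons (N : Fin 2 → Module.End ℂ V) (j : Fin 2) (u : List (Fin 2)) (x : V) :
    opR N (j :: u) x = opR N u (N j x) := rfl

variable {r κ ω : ℂ} {β : Fin 2 → Fin 2 → ℂ} {X : Bim r} {P N : Fin 2 → Module.End ℂ X.V}

theorem opL_isShift (hP : ∀ i, IsShift (![ω, -ω] i) (P i)) (w : List (Fin 2)) :
    IsShift (wt ω w) (opL P w) := by
  induction w with
  | nil => exact IsShift.id
  | cons i w ih =>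
    rw [wt_cons, add_comm]
    exact (hP i).comp ih

theorem opR_isShift (hN : ∀ i, IsShift (![ω, -ω] i) (N i)) (u : List (Fin 2)) :
    IsShift (wt ω u) (opR N u) := by
  induction u with
  | nil => exact IsShift.id
  | cons i u ih =>
    rw [wt_cons]
    exact ih.comp (hN i)

variable (hβ : ∀ i j, β i j ≠ 0 → ![ω, -ω] i + ![ω, -ω] j = 0)
  (hP : ∀ i, IsShift (![ω, -ω] i) (P i)) (hN : ∀ i, IsShift (![ω, -ω] i) (N i))
  (hc : ∀ i j x, P i (N j x) - N j (P i x) =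
    β i j • (kop κ X (![ω, -ω] j) x - kop κ X (![ω, -ω] i) x))
include hβ hP hN hc

omit hP in
/-- The commutator of a generator of `F^+` with a word in the generators of `F^-` is given by
the two skew derivations. -/
theorem opR_comm (i : Fin 2) (u : List (Fin 2)) (x : X.V) :
    opR N u (P i x) = P i (opR N u x) +
      kop κ X (![ω, -ω] i) (der κ ω β i u fun v => opR N v x) -
      der' κ ω β i u fun v => opR N v (kop κ X (-![ω, -ω] i) x) := by
  induction u generalizing x with
  | nil => simp
  | cons j u ih =>
    have h1 : N j (P i x) = P i (N j x) -
        β i j • (kop κ X (![ω, -ω] j) x - kop κ X (![ω, -ω] i) x) := by rw [← hc]; abel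
    have h2 : kop κ X (-![ω, -ω] i) (N j x) =
        Complex.exp (-(κ * ![ω, -ω] j * ![ω, -ω] i)) • N j (kop κ X (-![ω, -ω] i) x) := by
      rw [(hN j).kop]; ring_nf
    rw [opR_cons, h1, map_sub, ih, map_smul, map_sub, der_cons, der'_cons, map_add, map_smul]
    simp only [h2, map_smul, opR_cons, der'_smul]
    by_cases hb : β i j = 0
    · simp [hb]
    -- If `β i j` does not vanish, then the letters have opposite weights.
    · have h3 : ![ω, -ω] j = -![ω, -ω] i := by linear_combination hβ i j hb
      have h4 : opR N u (kop κ X (![ω, -ω] i) x) =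
          Complex.exp (κ * ![ω, -ω] j * wt ω u) • kop κ X (![ω, -ω] i) (opR N u x) := by
        rw [(opR_isShift hN u).kop, smul_smul, ← Complex.exp_add, h3,
          show κ * -![ω, -ω] i * wt ω u + κ * ![ω, -ω] i * wt ω u = 0 by ring, Complex.exp_zero,
          one_smul]
      rw [h4, h3, smul_sub, smul_smul]
      abel

variable (κ ω β P N) in
omit hβ hP hN hc in
/-- The left side of the Yetter-Drinfeld condition on words. -/
def ydL (w u : List (Fin 2)) (x : X.V) : X.V :=
  copSum κ ω w fun w₁ w₂ => copSum κ ω u fun u₁ u₂ =>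
    pair κ ω β w₂ u₂ • opL P w₁ (kop κ X (wt ω w₂) (opR N u₁ x))

variable (κ ω β P N) in
omit hβ hP hN hc in
/-- The right side of the Yetter-Drinfeld condition on words. -/
def ydR (w u : List (Fin 2)) (x : X.V) : X.V :=
  copSum κ ω w fun w₁ w₂ => copSum κ ω u fun u₁ u₂ =>
    pair κ ω β w₁ u₁ • opR N u₂ (kop κ X (wt ω u₁) (opL P w₂ x))

omit hβ hP hN hc in
theorem ydL_nil (u : List (Fin 2)) (x : X.V) : ydL κ ω β P N [] u x = opR N u x := by
  rw [ydL, copSum_nil, ← copSum_counit κ ω u fun v _ => opR N v x]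
  refine copSum_congr κ ω u fun u v _ => ?_
  rw [pair_nil, ite_smul, zero_smul, one_smul, opL_nil, wt_nil, kop_zero]

omit hβ hP hN hc in
theorem ydR_nil (u : List (Fin 2)) (x : X.V) : ydR κ ω β P N [] u x = opR N u x := by
  rw [ydR, copSum_nil, ← copSum_counit' κ ω u fun _ v => opR N v x]
  refine copSum_congr κ ω u fun u v _ => ?_
  by_cases h : u = []
  · rw [h, pair_nil, if_pos rfl, if_pos rfl, one_smul, opL_nil, wt_nil, kop_zero]
  · rw [pair_nil, if_neg h, if_neg h, zero_smul]

omit hβ hN hc in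
/-- The recursion for the left side of the Yetter-Drinfeld condition in the first word. It is the
same as the recursion `ydR_cons` for the right side. -/
theorem ydL_cons (i : Fin 2) (w u : List (Fin 2)) (x : X.V) : ydL κ ω β P N (i :: w) u x =
    P i (ydL κ ω β P N w u x) + kop κ X (![ω, -ω] i)
      (der κ ω β i u fun v => ydL κ ω β P N w v x) := by
  simp only [ydL]
  rw [copSum_cons, copSum_add]
  congr 1
  · simp only [map_copSum, map_smul, opL_cons]
  · rw [← copSum_der, map_copSum]
    refine copSum_congr κ ω w fun w₁ w₂ _ => ?_
    rw [← copSum_der_right, map_copSum, ← copSum_smul]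
    refine copSum_congr κ ω u fun u₁ u₂ _ => ?_
    rw [pair_cons, map_der]
    have h (c : ℂ) : kop κ X (![ω, -ω] i) (c • opL P w₁ (kop κ X (wt ω w₂) (opR N u₁ x))) =
        c • Complex.exp (κ * ![ω, -ω] i * wt ω w₁) •
          opL P w₁ (kop κ X (wt ω (i :: w₂)) (opR N u₁ x)) := by
      rw [map_smul, (opL_isShift hP w₁).kop, kop_kop, wt_cons]
    simp only [h]
    have h2 := map_der κ ω β (LinearMap.toSpanSingleton ℂ X.V
      (Complex.exp (κ * ![ω, -ω] i * wt ω w₁) •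
        opL P w₁ (kop κ X (wt ω (i :: w₂)) (opR N u₁ x)))) i u₂ (pair κ ω β w₂)
    simp only [LinearMap.toSpanSingleton_apply] at h2
    rw [← h2, smul_comm]

/-- The recursion for the right side of the Yetter-Drinfeld condition in the first word: the
operator `P i` is moved to the left by `opR_comm`, and one of the two skew derivations which appear
cancels against the terms with the letter `i` in the pairing, by `copSum_der_left`. -/
theorem ydR_cons (i : Fin 2) (w u : List (Fin 2)) (x : X.V) : ydR κ ω β P N (i :: w) u x =
    P i (ydR κ ω β P N w u x) + kop κ X (![ω, -ω] i)
      (der κ ω β i u fun v => ydR κ ω β P N w v x) := by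
  simp only [ydR]
  rw [copSum_cons, ← copSum_der, map_copSum, map_copSum, ← copSum_add]
  refine copSum_congr κ ω w fun w₁ w₂ _ => ?_
  set y := opL P w₂ x
  have h1 : (copSum κ ω u fun u₁ u₂ => pair κ ω β (i :: w₁) u₁ •
      opR N u₂ (kop κ X (wt ω u₁) y)) = copSum κ ω u fun u₁ u₂ => der' κ ω β i u₂ fun v =>
        pair κ ω β w₁ u₁ • opR N v (kop κ X (-![ω, -ω] i) (kop κ X (wt ω u₁) y)) := by
    rw [← copSum_der_left κ ω hβ i u fun u₁ v =>
      pair κ ω β w₁ u₁ • opR N v (kop κ X (-![ω, -ω] i) (kop κ X (wt ω u₁) y))]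
    refine copSum_congr κ ω u fun u₁ u₂ _ => ?_
    have h2 := map_der κ ω β (LinearMap.toSpanSingleton ℂ X.V
      (opR N u₂ (kop κ X (wt ω u₁) y))) i u₁ (pair κ ω β w₁)
    simp only [LinearMap.toSpanSingleton_apply] at h2
    rw [pair_cons, h2]
    refine der_congr κ ω hβ i u₁ fun v hv => ?_
    rw [kop_kop, hv, neg_add_cancel_left]
  have h2 : (Complex.exp (κ * ![ω, -ω] i * wt ω w₁) • copSum κ ω u fun u₁ u₂ =>
      pair κ ω β w₁ u₁ • opR N u₂ (kop κ X (wt ω u₁) (P i y))) = copSum κ ω u fun u₁ u₂ =>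
        pair κ ω β w₁ u₁ • opR N u₂ (P i (kop κ X (wt ω u₁) y)) := by
    rw [← copSum_smul]
    refine copSum_congr κ ω u fun u₁ u₂ _ => ?_
    by_cases h : wt ω w₁ + wt ω u₁ = 0
    · rw [(hP i).kop, map_smul, smul_comm, smul_smul (Complex.exp _), ← Complex.exp_add,
        show κ * ![ω, -ω] i * wt ω w₁ + κ * wt ω u₁ * ![ω, -ω] i =
          κ * ![ω, -ω] i * (wt ω w₁ + wt ω u₁) by ring, h, mul_zero, Complex.exp_zero, one_smul]
    · rw [pair_wt κ ω hβ w₁ u₁ h, zero_smul, zero_smul, smul_zero]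
  simp only [opL_cons]
  change _ + Complex.exp (κ * ![ω, -ω] i * wt ω w₁) • (copSum κ ω u fun u₁ u₂ =>
    pair κ ω β w₁ u₁ • opR N u₂ (kop κ X (wt ω u₁) (P i y))) = _
  rw [h1, h2, ← copSum_add, ← copSum_der_right, map_copSum, map_copSum, ← copSum_add]
  refine copSum_congr κ ω u fun u₁ u₂ _ => ?_
  rw [opR_comm hβ hN hc, der'_smul, der_smul, map_smul, map_smul, smul_sub, smul_add]
  abel

/-- The Yetter-Drinfeld condition follows from its special case for generators. -/
theorem ydL_eq_ydR (w u : List (Fin 2)) (x : X.V) : ydL κ ω β P N w u x = ydR κ ω β P N w u x := by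
  induction w generalizing u with
  | nil => rw [ydL_nil, ydR_nil]
  | cons i w ih =>
    rw [ydL_cons hP, ydR_cons hβ hP hN hc, ih]
    simp only [ih]

omit hβ hP hN hc in
/-- The Yetter-Drinfeld condition on generators. -/
theorem ydL_sub_ydR_letters (i j : Fin 2) (x : X.V) :
    ydL κ ω β P N [i] [j] x - ydR κ ω β P N [i] [j] x = P i (N j x) - N j (P i x) -
      β i j • (kop κ X (![ω, -ω] j) x - kop κ X (![ω, -ω] i) x) := by
  simp only [ydL, ydR, copSum_cons, copSum_nil, pair_letters, pair_nil, pair_nil_right, opL_cons,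
    opL_nil, opR_cons, opR_nil, wt_cons, wt_nil, mul_zero, Complex.exp_zero, one_smul, kop_zero,
    add_zero, List.cons_ne_nil, if_false, if_true, zero_smul, zero_add, smul_sub]
  abel

end Operators

/-! ### Actions of the tensor algebras in terms of operators -/

section Actions

variable {r ω κ : ℂ} {A : TensorAlg (alphaC r κ (fund ω)) braidOver}
  {B : TensorAlg (alphaC r (-κ) (fund ω)) braidUnder} {X Z : Bim r}

theorem tm_isShift {T : Bim r} {μ : ℂ} {t : T.V} (ht : T.h t = μ • t)
    (hs : ∀ b, T.ract b t = T.lact b t) (f : T ⊗ X ⟶ Z) : IsShift μ (f.lin ∘ₗ tm t) where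
  h x := by
    refine (f.comm_h _).symm.trans ((congrArg f.lin (h_tmul t x)).trans ?_)
    rw [map_add, ht, Bim.smul_tmul, map_smul, add_comm]
    rfl
  l b x := by
    refine (f.comm_l b _).symm.trans (congrArg f.lin ((lact_tmul b t x).trans ?_))
    rw [← hs, tmul_balanced]
    rfl
  r b x := (f.comm_r b _).symm.trans (congrArg f.lin (ract_tmul b t x))

theorem tm_flip_isShift {T : Bim r} {μ : ℂ} {t : T.V} (ht : T.h t = μ • t)
    (hs : ∀ b, T.ract b t = T.lact b t) (f : X ⊗ T ⟶ Z) : IsShift μ (f.lin ∘ₗ tm.flip t) where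
  h x := by
    refine (f.comm_h _).symm.trans ((congrArg f.lin (h_tmul x t)).trans ?_)
    rw [map_add, ht, tmul_smul, map_smul]
    rfl
  l b x := (f.comm_l b _).symm.trans (congrArg f.lin (lact_tmul b x t))
  r b x := by
    refine (f.comm_r b _).symm.trans (congrArg f.lin ((ract_tmul b x t).trans ?_))
    rw [hs, ← tmul_balanced]
    rfl

/-- The action of a generator on the left. -/
def actP (A : TensorAlg (alphaC r κ (fund ω)) braidOver) (m : A.T.1 ⊗ X ⟶ X) (i : Fin 2) :
    Module.End ℂ X.V := m.lin ∘ₗ tm (wa A [i])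

/-- The action of a generator on the right. -/
def actN (B : TensorAlg (alphaC r (-κ) (fund ω)) braidUnder) (m : X ⊗ B.T.1 ⟶ X) (i : Fin 2) :
    Module.End ℂ X.V := m.lin ∘ₗ tm.flip (wb B [i])

theorem actP_apply (m : A.T.1 ⊗ X ⟶ X) (i : Fin 2) (x : X.V) :
    actP A m i x = m.lin (tmul (wa A [i]) x) := rfl

theorem actN_apply (m : X ⊗ B.T.1 ⟶ X) (i : Fin 2) (x : X.V) :
    actN B m i x = m.lin (tmul x (wb B [i])) := rfl

/-- The left action of the tensor algebra is determined by the operators of the generators. -/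
theorem act_words {m : A.T.1 ⊗ X ⟶ X} (h1 : oneC A.T ▷ X ≫ m = (λ_ X).hom)
    (hm : mulC A.T ▷ X ≫ m = (α_ A.T.1 A.T.1 X).hom ≫ A.T.1 ◁ m ≫ m) (w : List (Fin 2))
    (x : X.V) : m.lin (tmul (wa A w) x) = opL (actP A m) w x := by
  induction w with
  | nil =>
    have h := congrArg (fun f => f.lin (tmul (un 1) x)) h1
    simp only [comp_apply', whiskerRight_tmul, leftUnitor_tmul, map_one, Module.End.one_apply,
      oneC_wa] at h
    exact h
  | cons i w ih =>
    have h := congrArg (fun f => f.lin (tmul (tmul (wa A [i]) (wa A w)) x)) hm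
    simp only [comp_apply', whiskerRight_tmul, associator_tmul, whiskerLeft_tmul, mulC_wa,
      ih] at h
    exact h

/-- The right action of the tensor algebra is determined by the operators of the generators. -/
theorem act_words' {m : X ⊗ B.T.1 ⟶ X} (h1 : X ◁ oneC B.T ≫ m = (ρ_ X).hom)
    (hm : X ◁ mulC B.T ≫ m = (α_ X B.T.1 B.T.1).inv ≫ m ▷ B.T.1 ≫ m) (u : List (Fin 2))
    (x : X.V) : m.lin (tmul x (wb B u)) = opR (actN B m) u x := by
  induction u generalizing x with
  | nil =>
    have h := congrArg (fun f => f.lin (tmul x (un 1))) h1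
    simp only [comp_apply', whiskerLeft_tmul, rightUnitor_tmul, map_one, Module.End.one_apply,
      oneC_wb] at h
    exact h
  | cons i u ih =>
    have h := congrArg (fun f => f.lin (tmul x (tmul (wb B [i]) (wb B u)))) hm
    simp only [comp_apply', whiskerRight_tmul, associator_inv_tmul, whiskerLeft_tmul, mulC_wb,
      ih] at h
    exact h

variable (hx : ∀ n : ℤ, Complex.exp (κ * (n * r) * ω) = 1)
include hx

/-- A morphism which is given on words by products of operators is associative. -/
theorem mul_of_act_words {m : A.T.1 ⊗ X ⟶ X} {P : Fin 2 → Module.End ℂ X.V}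
    (h : ∀ w x, m.lin (tmul (wa A w) x) = opL P w x) :
    mulC A.T ▷ X ≫ m = (α_ A.T.1 A.T.1 X).hom ≫ A.T.1 ◁ m ≫ m :=
  (isFree_wa hx).ext_left₂ (isFree_wa hx).toIsWords fun w w' x => by
    simp only [comp_apply', whiskerRight_tmul, associator_tmul, whiskerLeft_tmul, mulC_wa, h]
    induction w with
    | nil => rfl
    | cons i w ih => rw [List.cons_append, opL_cons, opL_cons, ih]

omit hx in
theorem one_of_act_words {m : A.T.1 ⊗ X ⟶ X} {P : Fin 2 → Module.End ℂ X.V}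
    (h : ∀ w x, m.lin (tmul (wa A w) x) = opL P w x) : oneC A.T ▷ X ≫ m = (λ_ X).hom :=
  un_ext_left fun x => by
    rw [comp_apply', whiskerRight_tmul, oneC_wa, h, leftUnitor_tmul, map_one]
    rfl

theorem mul_of_act_words' {m : X ⊗ B.T.1 ⟶ X} {N : Fin 2 → Module.End ℂ X.V}
    (h : ∀ u x, m.lin (tmul x (wb B u)) = opR N u x) :
    X ◁ mulC B.T ≫ m = (α_ X B.T.1 B.T.1).inv ≫ m ▷ B.T.1 ≫ m :=
  (isFree_wb hx).ext_right₂ (isFree_wb hx).toIsWords fun w w' x => by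
    simp only [comp_apply', whiskerRight_tmul, associator_inv_tmul, whiskerLeft_tmul, mulC_wb, h]
    induction w generalizing x with
    | nil => rfl
    | cons i w ih => rw [List.cons_append, opR_cons, opR_cons, ih]

omit hx in
theorem one_of_act_words' {m : X ⊗ B.T.1 ⟶ X} {N : Fin 2 → Module.End ℂ X.V}
    (h : ∀ u x, m.lin (tmul x (wb B u)) = opR N u x) : X ◁ oneC B.T ≫ m = (ρ_ X).hom :=
  un_ext_right fun x => by
    rw [comp_apply', whiskerLeft_tmul, oneC_wb, h, rightUnitor_tmul, map_one]
    rfl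

theorem actP_isShift (m : A.T.1 ⊗ X ⟶ X) (i : Fin 2) : IsShift (![ω, -ω] i) (actP A m i) :=
  tm_isShift (by rw [(isFree_wa hx).h, wt_cons, wt_nil, add_zero])
    (fun b => (isFree_wa hx).sym b [i]) m

theorem actN_isShift (m : X ⊗ B.T.1 ⟶ X) (i : Fin 2) : IsShift (![ω, -ω] i) (actN B m i) :=
  tm_flip_isShift (by rw [(isFree_wb hx).h, wt_cons, wt_nil, add_zero])
    (fun b => (isFree_wb hx).sym b [i]) m

variable {β : Fin 2 → Fin 2 → ℂ}
  {ρ : A.T.1 ⊗ B.T.1 ⟶ 𝟙_ (Bim r)} (hρ : ∀ w u, ρ.lin (tmul (wa A w) (wb B u)) =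
    pair κ ω β w u • un 1)
include hρ

/-- The left side of the Yetter-Drinfeld condition, evaluated on words. -/
theorem yd_left_apply {mp : A.T.1 ⊗ X ⟶ X} {mm : X ⊗ B.T.1 ⟶ X} {P N : Fin 2 → Module.End ℂ X.V}
    (hp : ∀ w x, mp.lin (tmul (wa A w) x) = opL P w x)
    (hm : ∀ u x, mm.lin (tmul x (wb B u)) = opR N u x) (w u : List (Fin 2)) (x : X.V) :
    (((A.Δ ▷ X) ⊗ₘ B.Δ) ⊗≫ (A.T.1 ⊗ A.T.1) ◁ mm ▷ B.T.1 ⊗≫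
      A.T.1 ◁ (A.T.2.β X).hom ▷ B.T.1 ⊗≫ (mp ⊗ₘ ρ) ≫ (ρ_ X).hom).lin
        (tmul (tmul (wa A w) x) (wb B u)) = ydL κ ω β P N w u x := by
  simp only [monoidalComp, comp_apply', tensorHom_tmul, whiskerRight_tmul, whiskerLeft_tmul,
    associator_tmul, associator_inv_tmul, MonoidalCoherence.refl_iso,
    MonoidalCoherence.whiskerRight_iso, MonoidalCoherence.whiskerLeft_iso,
    MonoidalCoherence.assoc_iso, MonoidalCoherence.assoc'_iso, Iso.trans_hom, whiskerRightIso_hom,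
    whiskerLeftIso_hom, Iso.symm_hom, id_apply', Iso.refl_hom, copSum_tmul, tmul_copSum, map_copSum,
    id_whiskerRight, Δ_wa hx, Δ_wb hx, wa_cent _ _ _, hp, hm, hρ, tmul_smul, map_smul,
    rightUnitor_tmul, map_one, Module.End.one_apply]
  exact copSum_comm κ ω u w _

/-- The right side of the Yetter-Drinfeld condition, evaluated on words. -/
theorem yd_right_apply {mp : A.T.1 ⊗ X ⟶ X} {mm : X ⊗ B.T.1 ⟶ X} {P N : Fin 2 → Module.End ℂ X.V}
    (hp : ∀ w x, mp.lin (tmul (wa A w) x) = opL P w x)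
    (hm : ∀ u x, mm.lin (tmul x (wb B u)) = opR N u x) (w u : List (Fin 2)) (x : X.V) :
    (((A.Δ ▷ X) ⊗ₘ B.Δ) ⊗≫ A.T.1 ◁ mp ▷ (B.T.1 ⊗ B.T.1) ⊗≫
      A.T.1 ◁ (B.T.2.β X).inv ▷ B.T.1 ⊗≫ (ρ ⊗ₘ mm) ≫ (λ_ X).hom).lin
        (tmul (tmul (wa A w) x) (wb B u)) = ydR κ ω β P N w u x := by
  simp only [monoidalComp, comp_apply', tensorHom_tmul, whiskerRight_tmul, whiskerLeft_tmul,
    associator_tmul, associator_inv_tmul, MonoidalCoherence.refl_iso,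
    MonoidalCoherence.whiskerRight_iso, MonoidalCoherence.whiskerLeft_iso,
    MonoidalCoherence.assoc_iso, MonoidalCoherence.assoc'_iso, Iso.trans_hom, whiskerRightIso_hom,
    whiskerLeftIso_hom, Iso.symm_hom, id_apply', Iso.refl_hom, copSum_tmul, tmul_copSum, map_copSum,
    id_whiskerRight, Δ_wa hx, Δ_wb hx, (wb_cent _).inv _ _, neg_neg, hp, hm, hρ, Bim.smul_tmul, map_smul,
    leftUnitor_tmul, map_one, Module.End.one_apply]
  exact copSum_comm κ ω u w _

end Actions

/-! ### The commutation condition in terms of operators -/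

section Commutation

variable {r ω κ : ℂ}

/-- The operators on an object of `D_F` which come from `F^+`. -/
def dfP (Y : DF (alphaC r κ (fund ω)) (alphaC r (-κ) (fund ω))) (i : Fin 2) :
    Module.End ℂ Y.X.V := Y.mp.lin ∘ₗ tm (ff r κ ω i)

/-- The operators on an object of `D_F` which come from `F^-`, normalised as a right action. -/
def dfN (Y : DF (alphaC r κ (fund ω)) (alphaC r (-κ) (fund ω))) (i : Fin 2) :
    Module.End ℂ Y.X.V := Y.mm.lin ∘ₗ tm (ff r (-κ) ω i) ∘ₗ kop κ Y.X (![ω, -ω] i)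

theorem dfN_apply (Y : DF (alphaC r κ (fund ω)) (alphaC r (-κ) (fund ω))) (i : Fin 2) (x : Y.X.V) :
    dfN Y i x = Y.mm.lin (tmul (ff r (-κ) ω i) (kop κ Y.X (![ω, -ω] i) x)) := rfl

theorem dfN_kop (Y : DF (alphaC r κ (fund ω)) (alphaC r (-κ) (fund ω))) (i : Fin 2) (x : Y.X.V) :
    Y.mm.lin (tmul (ff r (-κ) ω i) x) = dfN Y i (kop κ Y.X (-![ω, -ω] i) x) := by
  rw [dfN_apply, kop_kop, add_neg_cancel, kop_zero]

variable (hx : ∀ n : ℤ, Complex.exp (κ * (n * r) * ω) = 1)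
include hx

theorem dfP_isShift (Y : DF (alphaC r κ (fund ω)) (alphaC r (-κ) (fund ω))) (i : Fin 2) :
    IsShift (![ω, -ω] i) (dfP Y i) := tm_isShift (ff_h i) (fun b => ff_sym hx b i) Y.mp

theorem dfN_isShift (Y : DF (alphaC r κ (fund ω)) (alphaC r (-κ) (fund ω))) (i : Fin 2) :
    IsShift (![ω, -ω] i) (dfN Y i) := by
  have h1 : IsShift (![ω, -ω] i) (Y.mm.lin ∘ₗ tm (ff r (-κ) ω i)) :=
    tm_isShift (ff_h i) (fun b => ff_sym (exp_neg_one hx) b i) Y.mm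
  have h2 := h1.comp (kop_isShift κ (X := Y.X) fun n => exp_wt_letter hx n i)
  rwa [zero_add] at h2

theorem fund_ext_left₂ {X Z : Bim r}
    {f g : (alpha r κ (fund ω) ⊗ alpha r (-κ) (fund ω)) ⊗ X ⟶ Z}
    (h : ∀ i j x, f.lin (tmul (tmul (ff r κ ω i) (ff r (-κ) ω j)) x) =
      g.lin (tmul (tmul (ff r κ ω i) (ff r (-κ) ω j)) x)) : f = g := by
  rw [← cancel_epi (α_ (alpha r κ (fund ω)) (alpha r (-κ) (fund ω)) X).inv]
  refine fund_ext_left (ff_sym hx) fun i t => ?_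
  refine LinearMap.congr_fun (f := ((α_ _ _ _).inv ≫ f).lin ∘ₗ tm (ff r κ ω i))
    (g := ((α_ _ _ _).inv ≫ g).lin ∘ₗ tm (ff r κ ω i)) (lin_ext fun t x => ?_) t
  refine fund_ind (P := fun t => ((α_ _ _ _).inv ≫ f).lin (tmul (ff r κ ω i) (tmul t x)) =
    ((α_ _ _ _).inv ≫ g).lin (tmul (ff r κ ω i) (tmul t x))) t
    (by simp only [zero_tmul, tmul_zero, map_zero]) (fun b j => ?_)
    (fun t t' h h' => by simp only [add_tmul, tmul_add, map_add, h, h'])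
  rw [← ff_sym (exp_neg_one hx), tmul_balanced, comp_apply', comp_apply', associator_inv_tmul, h]

omit hx in
theorem commCond_left_apply {P M : Center (Bim r)} (Y : DF P M) {μ μ' : ℂ} {t : P.1.V} {t' : M.1.V}
    (ht : IsCent κ μ t) (ht' : M.1.h t' = μ' • t') (x : Y.X.V) :
    ((α_ P.1 M.1 Y.X).hom ≫ P.1 ◁ Y.mm ≫ Y.mp -
      (P.2.β M.1).hom ▷ Y.X ≫ (α_ M.1 P.1 Y.X).hom ≫ M.1 ◁ Y.mp ≫ Y.mm).lin
        (tmul (tmul t t') x) = Y.mp.lin (tmul t (Y.mm.lin (tmul t' x))) -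
      Complex.exp (κ * μ * μ') • Y.mm.lin (tmul t' (Y.mp.lin (tmul t x))) := by
  rw [lin_sub_apply]
  simp only [comp_apply', associator_tmul, whiskerLeft_tmul, whiskerRight_tmul, ht M.1 t',
    kop_apply κ μ ht', Bim.smul_tmul, map_smul]

omit hx in
theorem commCond_right_apply {P M : Center (Bim r)} (X : Bim r) {b : P.1 ⊗ M.1 ⟶ 𝟙_ (Bim r)}
    {μ μ' c : ℂ} {t : P.1.V} {t' : M.1.V} (hb : b.lin (tmul t t') = c • un 1)
    (ht : IsCent κ μ t) (ht' : IsCent (-κ) μ' t') (x : X.V) :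
    (b ▷ X ≫ (λ_ X).hom - DF.halfBr P M X ≫ X ◁ b ≫ (ρ_ X).hom).lin (tmul (tmul t t') x) =
      c • (x - kop κ X (μ - μ') x) := by
  have h : (DF.halfBr P M X).lin (tmul (tmul t t') x) =
      tmul (kop κ X (μ - μ') x) (tmul t t') := by
    have h1 : DF.halfBr P M X = (α_ _ _ _).hom ≫ P.1 ◁ (M.2.β X).hom ≫ (α_ _ _ _).inv ≫
        (P.2.β X).hom ▷ M.1 ≫ (α_ _ _ _).hom := by simp [DF.halfBr]
    rw [h1]
    simp only [comp_apply', associator_tmul, associator_inv_tmul, whiskerLeft_tmul,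
      whiskerRight_tmul, ht X, ht' X, kop_neg, kop_kop, sub_eq_add_neg]
  rw [lin_sub_apply]
  simp only [comp_apply', h, whiskerLeft_tmul, whiskerRight_tmul, hb, Bim.smul_tmul, tmul_smul,
    map_smul, leftUnitor_tmul, rightUnitor_tmul, map_one, Module.End.one_apply, smul_sub]

variable {β : Fin 2 → Fin 2 → ℂ} {b : alpha r κ (fund ω) ⊗ alpha r (-κ) (fund ω) ⟶ 𝟙_ (Bim r)}
  (hb : ∀ i j, b.lin (tmul (ff r κ ω i) (ff r (-κ) ω j)) = β i j • un 1)
include hb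

/-- The condition which defines `D_F'`, as a commutation relation between operators. -/
theorem commCond_iff (Y : DF (alphaC r κ (fund ω)) (alphaC r (-κ) (fund ω))) :
    DF.CommCond (P := alphaC r κ (fund ω)) (M := alphaC r (-κ) (fund ω)) b Y ↔
    ∀ i j x, dfP Y i (dfN Y j x) - dfN Y j (dfP Y i x) =
      β i j • (kop κ Y.X (![ω, -ω] j) x - kop κ Y.X (![ω, -ω] i) x) := by
  have hf (i : Fin 2) : IsCent (T := alphaC r κ (fund ω)) κ (![ω, -ω] i) (ff r κ ω i) :=
    isCent_alpha (fe_h ω i)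
  have hf' (i : Fin 2) : IsCent (T := alphaC r (-κ) (fund ω)) (-κ) (![ω, -ω] i) (ff r (-κ) ω i) :=
    isCent_alpha (fe_h ω i)
  -- The values of both sides on a vector of the form `kop κ Y.X (![ω, -ω] j) x`.
  have h1 (i j : Fin 2) (x : Y.X.V) := commCond_left_apply Y (hf i) (ff_h (s := -κ) j)
    (kop κ Y.X (![ω, -ω] j) x)
  have h2 (i j : Fin 2) (x : Y.X.V) := commCond_right_apply Y.X (hb i j) (hf i) (hf' j)
    (kop κ Y.X (![ω, -ω] j) x)
  have h3 (i j : Fin 2) (x : Y.X.V) :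
      Y.mp.lin (tmul (ff r κ ω i) (Y.mm.lin (tmul (ff r (-κ) ω j) (kop κ Y.X (![ω, -ω] j) x)))) -
        Complex.exp (κ * ![ω, -ω] i * ![ω, -ω] j) • Y.mm.lin (tmul (ff r (-κ) ω j)
          (Y.mp.lin (tmul (ff r κ ω i) (kop κ Y.X (![ω, -ω] j) x)))) =
      dfP Y i (dfN Y j x) - dfN Y j (dfP Y i x) := by
    have h4 := congrArg (Y.mm.lin ∘ₗ tm (ff r (-κ) ω j))
      ((dfP_isShift hx Y i).kop κ (![ω, -ω] j) x)
    rw [map_smul, mul_right_comm κ] at h4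
    exact congrArg (dfP Y i (dfN Y j x) - ·) h4.symm
  have h4 (i j : Fin 2) (x : Y.X.V) : kop κ Y.X (![ω, -ω] i - ![ω, -ω] j)
      (kop κ Y.X (![ω, -ω] j) x) = kop κ Y.X (![ω, -ω] i) x := by
    rw [kop_kop, sub_add_cancel]
  constructor
  · intro h i j x
    have h5 := congrArg (fun f => f.lin (tmul (tmul (ff r κ ω i) (ff r (-κ) ω j))
      (kop κ Y.X (![ω, -ω] j) x))) h
    refine (h3 i j x).symm.trans ((h1 i j x).symm.trans (h5.trans ((h2 i j x).trans ?_)))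
    rw [h4]
  · intro h
    refine fund_ext_left₂ hx (X := Y.X) (Z := Y.X) fun i j x => ?_
    -- The operator `kop` is invertible, so that these vectors are all vectors.
    have hk : x = kop κ Y.X (![ω, -ω] j) (kop κ Y.X (-![ω, -ω] j) x) := by
      rw [kop_kop, add_neg_cancel, kop_zero]
    rw [hk]
    refine (h1 i j _).trans (((h3 i j _).trans (h i j _)).trans (Eq.trans ?_ (h2 i j _).symm))
    rw [h4]

end Commutation

/-! ### The equivalence of Yetter-Drinfeld modules with perturbed pairs -/

section Equivalence

variable {r ω κ : ℂ} {A : TensorAlg (alphaC r κ (fund ω)) braidOver}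
  {B : TensorAlg (alphaC r (-κ) (fund ω)) braidUnder} {ρ : A.T.1 ⊗ B.T.1 ⟶ 𝟙_ (Bim r)}

theorem dfP_restrict (Y : YD A B ρ) (i : Fin 2) :
    dfP ((YD.restrict A B ρ).obj Y) i = actP A Y.mp i :=
  LinearMap.ext fun x => (congrArg Y.mp.lin ((whiskerRight_tmul A.ι.f (ff r κ ω i) x).trans
    (congrArg (fun t => tmul t x) (ι_wa i))))

/-- The operators of the restriction are those of the actions: the normalisation of `dfN` undoes the
half-braiding in the definition of the restriction functor. -/
theorem dfN_restrict (Y : YD A B ρ) (i : Fin 2) :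
    dfN ((YD.restrict A B ρ).obj Y) i = actN B Y.mm i :=
  LinearMap.ext fun x => by
    have hf' : IsCent (T := alphaC r (-κ) (fund ω)) (-κ) (![ω, -ω] i) (ff r (-κ) ω i) :=
      isCent_alpha (fe_h ω i)
    have hk (x : Y.X.V) : kop (-κ) Y.X (![ω, -ω] i) (kop κ Y.X (![ω, -ω] i) x) = x := by
      rw [kop_neg, kop_kop, neg_add_cancel, kop_zero]
    have h1 := (hf' Y.X (kop κ Y.X (![ω, -ω] i) x)).trans
      (congrArg (fun z => tmul z (ff r (-κ) ω i)) (hk x))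
    have h2 := congrArg (fun t => Y.mm.lin ((Y.X ◁ B.ι.f).lin t)) h1
    refine h2.trans (congrArg Y.mm.lin ((whiskerLeft_tmul B.ι.f x (ff r (-κ) ω i)).trans ?_))
    exact congrArg (tmul x) (ι_wb i)

variable (hx : ∀ n : ℤ, Complex.exp (κ * (n * r) * ω) = 1) {β : Fin 2 → Fin 2 → ℂ}
  (hβ : ∀ i j, β i j ≠ 0 → ![ω, -ω] i + ![ω, -ω] j = 0)
  (hρ : ∀ w u, ρ.lin (tmul (wa A w) (wb B u)) = pair κ ω β w u • un 1)
  {b : alpha r κ (fund ω) ⊗ alpha r (-κ) (fund ω) ⟶ 𝟙_ (Bim r)}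
  (hb : ∀ i j, b.lin (tmul (ff r κ ω i) (ff r (-κ) ω j)) = β i j • un 1)

include hx hρ in
/-- The operators of a Yetter-Drinfeld module satisfy the commutation relation: this is the
Yetter-Drinfeld condition on generators. -/
theorem yd_act_comm (Y : YD A B ρ) (i j : Fin 2) (x : Y.X.V) :
    actP A Y.mp i (actN B Y.mm j x) - actN B Y.mm j (actP A Y.mp i x) =
      β i j • (kop κ Y.X (![ω, -ω] j) x - kop κ Y.X (![ω, -ω] i) x) := by
  have hp := act_words Y.one_mp Y.mul_mp
  have hm := act_words' Y.one_mm Y.mul_mm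
  have h := congrArg (fun f => f.lin (tmul (tmul (wa A [i]) x) (wb B [j]))) Y.yd
  rw [yd_left_apply hx hρ hp hm, yd_right_apply hx hρ hp hm] at h
  rw [← sub_eq_zero, ← ydL_sub_ydR_letters, h, sub_self]

include hx hρ hb in
theorem commCond_restrict (Y : YD A B ρ) :
    DF.CommCond (P := alphaC r κ (fund ω)) (M := alphaC r (-κ) (fund ω)) b
      ((YD.restrict A B ρ).obj Y) :=
  (commCond_iff hx hb _).2 fun i j x => by
    rw [dfP_restrict, dfN_restrict]
    exact yd_act_comm hx hρ Y i j x

/-- Homogeneous operators define a left action of the tensor algebra, which is freely generated. -/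
theorem exists_left_act (hx : ∀ n : ℤ, Complex.exp (κ * (n * r) * ω) = 1)
    (A : TensorAlg (alphaC r κ (fund ω)) braidOver) {X : Bim r}
    {P : Fin 2 → Module.End ℂ X.V} (hP : ∀ i, IsShift (![ω, -ω] i) (P i)) :
    ∃ m : A.T.1 ⊗ X ⟶ X, ∀ w x, m.lin (tmul (wa A w) x) = opL P w x :=
  (isFree_wa hx).lift_left hx (opL P) (opL_isShift hP)

theorem exists_right_act (hx : ∀ n : ℤ, Complex.exp (κ * (n * r) * ω) = 1)
    (B : TensorAlg (alphaC r (-κ) (fund ω)) braidUnder) {X : Bim r}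
    {N : Fin 2 → Module.End ℂ X.V} (hN : ∀ i, IsShift (![ω, -ω] i) (N i)) :
    ∃ m : X ⊗ B.T.1 ⟶ X, ∀ u x, m.lin (tmul x (wb B u)) = opR N u x :=
  (isFree_wb hx).lift_right (exp_neg_one hx) (opR N) (opR_isShift hN)

/-- The Yetter-Drinfeld module of two actions which are given on words by operators which satisfy
the commutation relations. -/
def ydMk (hx : ∀ n : ℤ, Complex.exp (κ * (n * r) * ω) = 1)
    (hβ : ∀ i j, β i j ≠ 0 → ![ω, -ω] i + ![ω, -ω] j = 0)
    (hρ : ∀ w u, ρ.lin (tmul (wa A w) (wb B u)) = pair κ ω β w u • un 1) {X : Bim r}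
    {P N : Fin 2 → Module.End ℂ X.V} (hP : ∀ i, IsShift (![ω, -ω] i) (P i))
    (hN : ∀ i, IsShift (![ω, -ω] i) (N i)) (hc : ∀ i j x, P i (N j x) - N j (P i x) =
      β i j • (kop κ X (![ω, -ω] j) x - kop κ X (![ω, -ω] i) x)) (mp : A.T.1 ⊗ X ⟶ X)
    (mm : X ⊗ B.T.1 ⟶ X) (hp : ∀ w x, mp.lin (tmul (wa A w) x) = opL P w x)
    (hm : ∀ u x, mm.lin (tmul x (wb B u)) = opR N u x) : YD A B ρ where
  X := X
  mp := mp
  mm := mm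
  one_mp := one_of_act_words hp
  mul_mp := mul_of_act_words hx hp
  one_mm := one_of_act_words' hm
  mul_mm := mul_of_act_words' hx hm
  yd := (isFree_wa hx).ext_mid (isFree_wb hx).toIsWords fun w u x => by
    rw [yd_left_apply hx hρ hp hm, yd_right_apply hx hρ hp hm]
    exact ydL_eq_ydR hβ hP hN hc w u x

/-- The Yetter-Drinfeld module of operators which satisfy the commutation relations. -/
def ydOf (hx : ∀ n : ℤ, Complex.exp (κ * (n * r) * ω) = 1)
    (hβ : ∀ i j, β i j ≠ 0 → ![ω, -ω] i + ![ω, -ω] j = 0)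
    (hρ : ∀ w u, ρ.lin (tmul (wa A w) (wb B u)) = pair κ ω β w u • un 1) {X : Bim r}
    {P N : Fin 2 → Module.End ℂ X.V} (hP : ∀ i, IsShift (![ω, -ω] i) (P i))
    (hN : ∀ i, IsShift (![ω, -ω] i) (N i)) (hc : ∀ i j x, P i (N j x) - N j (P i x) =
      β i j • (kop κ X (![ω, -ω] j) x - kop κ X (![ω, -ω] i) x)) : YD A B ρ :=
  ydMk hx hβ hρ hP hN hc (exists_left_act hx A hP).choose (exists_right_act hx B hN).choose
    (exists_left_act hx A hP).choose_spec (exists_right_act hx B hN).choose_spec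

theorem actP_ydOf {X : Bim r} {P N : Fin 2 → Module.End ℂ X.V} (hP) (hN) (hc) (i : Fin 2) :
    actP A (ydOf (X := X) (P := P) (N := N) hx hβ hρ hP hN hc).mp i = P i :=
  LinearMap.ext fun x => (exists_left_act hx A hP).choose_spec [i] x

theorem actN_ydOf {X : Bim r} {P N : Fin 2 → Module.End ℂ X.V} (hP) (hN) (hc) (i : Fin 2) :
    actN B (ydOf (X := X) (P := P) (N := N) hx hβ hρ hP hN hc).mm i = N i :=
  LinearMap.ext fun x => (exists_right_act hx B hN).choose_spec [i] x

include hx in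
/-- A bimodule homomorphism which intertwines the operators is a homomorphism of Yetter-Drinfeld
modules. -/
theorem yd_comm_p {Y Y' : YD A B ρ} (f : Y.X ⟶ Y'.X)
    (h : ∀ i x, f.lin (actP A Y.mp i x) = actP A Y'.mp i (f.lin x)) :
    A.T.1 ◁ f ≫ Y'.mp = Y.mp ≫ f :=
  (isFree_wa hx).ext_left fun w x => by
    rw [comp_apply', comp_apply', whiskerLeft_tmul, act_words Y.one_mp Y.mul_mp,
      act_words Y'.one_mp Y'.mul_mp]
    induction w with
    | nil => rfl
    | cons i w ih => rw [opL_cons, opL_cons, h, ih]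

include hx in
theorem yd_comm_m {Y Y' : YD A B ρ} (f : Y.X ⟶ Y'.X)
    (h : ∀ i x, f.lin (actN B Y.mm i x) = actN B Y'.mm i (f.lin x)) :
    f ▷ B.T.1 ≫ Y'.mm = Y.mm ≫ f :=
  (isFree_wb hx).ext_right fun u x => by
    rw [comp_apply', comp_apply', whiskerRight_tmul, act_words' Y.one_mm Y.mul_mm,
      act_words' Y'.one_mm Y'.mul_mm]
    induction u generalizing x with
    | nil => rfl
    | cons i u ih => rw [opR_cons, opR_cons, ← h, ih]

theorem df_comm_p {Y Y' : DF (alphaC r κ (fund ω)) (alphaC r (-κ) (fund ω))} (f : Y ⟶ Y')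
    (i : Fin 2) (x : Y.X.V) : f.hom.lin (dfP Y i x) = dfP Y' i (f.hom.lin x) := by
  have h := congrArg (fun g => g.lin (tmul (ff r κ ω i) x)) f.comm_p
  exact h.symm.trans (congrArg Y'.mp.lin (whiskerLeft_tmul f.hom (ff r κ ω i) x))

theorem df_comm_m {Y Y' : DF (alphaC r κ (fund ω)) (alphaC r (-κ) (fund ω))} (f : Y ⟶ Y')
    (i : Fin 2) (x : Y.X.V) : f.hom.lin (dfN Y i x) = dfN Y' i (f.hom.lin x) := by
  have h := congrArg (fun g => g.lin (tmul (ff r (-κ) ω i) (kop κ Y.X (![ω, -ω] i) x))) f.comm_m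
  refine h.symm.trans ((congrArg Y'.mm.lin (whiskerLeft_tmul f.hom (ff r (-κ) ω i) _)).trans ?_)
  exact congrArg (fun z => Y'.mm.lin (tmul (ff r (-κ) ω i) z)) (kop_hom κ f.hom _ x).symm

/-- The inverse of the restriction functor. -/
def sFunctor : (DF.CommCond (P := alphaC r κ (fund ω)) (M := alphaC r (-κ) (fund ω))
    b).FullSubcategory ⥤ YD A B ρ where
  obj Y := ydOf hx hβ hρ (dfP_isShift hx Y.obj) (dfN_isShift hx Y.obj)
    ((commCond_iff hx hb Y.obj).1 Y.property)
  map {Y Y'} f :=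
    { hom := f.hom.hom
      comm_p := yd_comm_p hx _ fun i x => by
        rw [actP_ydOf, actP_ydOf]; exact df_comm_p f.hom i x
      comm_m := yd_comm_m hx _ fun i x => by
        rw [actN_ydOf, actN_ydOf]; exact df_comm_m f.hom i x }

theorem actP_sFunctor (Y : (DF.CommCond (P := alphaC r κ (fund ω)) (M := alphaC r (-κ) (fund ω))
    b).FullSubcategory) (i : Fin 2) :
    actP A ((sFunctor hx hβ hρ hb).obj Y).mp i = dfP Y.obj i :=
  actP_ydOf hx hβ hρ (dfP_isShift hx Y.obj) (dfN_isShift hx Y.obj)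
    ((commCond_iff hx hb Y.obj).1 Y.property) i

theorem actN_sFunctor (Y : (DF.CommCond (P := alphaC r κ (fund ω)) (M := alphaC r (-κ) (fund ω))
    b).FullSubcategory) (i : Fin 2) :
    actN B ((sFunctor hx hβ hρ hb).obj Y).mm i = dfN Y.obj i :=
  actN_ydOf hx hβ hρ (dfP_isShift hx Y.obj) (dfN_isShift hx Y.obj)
    ((commCond_iff hx hb Y.obj).1 Y.property) i

theorem YD.ext_of_eq {Y : YD A B ρ} {mp mm h1 h2 h3 h4 h5} (hp : mp = Y.mp) (hm : mm = Y.mm) :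
    YD.mk Y.X mp mm h1 h2 h3 h4 h5 = Y := by
  subst hp hm; rfl

theorem YD.eqToHom_hom {Y Y' : YD A B ρ} (h : Y = Y') :
    (eqToHom h).hom = eqToHom (congrArg YD.X h) := by
  subst h; rfl

theorem DF.ext_of_eq {P M : Center (Bim r)} {Y : DF P M} {mp mm} (hp : mp = Y.mp)
    (hm : mm = Y.mm) : DF.mk Y.X mp mm = Y := by
  subst hp hm; rfl

/-- The two functors are mutually inverse on the nose: an action is equal to the action which is
built from the operators of its generators. -/
theorem restrict_sFunctor :
    ObjectProperty.lift _ (YD.restrict A B ρ) (commCond_restrict hx hρ hb) ⋙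
      sFunctor hx hβ hρ hb = 𝟭 _ := by
  have h (Y : YD A B ρ) : (sFunctor hx hβ hρ hb).obj ((ObjectProperty.lift _ (YD.restrict A B ρ)
      (commCond_restrict hx hρ hb)).obj Y) = Y := by
    refine YD.ext_of_eq ?_ ?_
    · refine (isFree_wa hx).ext_left fun w x => ?_
      refine ((exists_left_act hx A (dfP_isShift hx ((YD.restrict A B ρ).obj Y))).choose_spec
        w x).trans (Eq.trans ?_ (act_words Y.one_mp Y.mul_mp w x).symm)
      exact congrArg (fun P => opL P w x) (funext (dfP_restrict Y))
    · refine (isFree_wb hx).ext_right fun w x => ?_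
      refine ((exists_right_act hx B (dfN_isShift hx ((YD.restrict A B ρ).obj Y))).choose_spec
        w x).trans (Eq.trans ?_ (act_words' Y.one_mm Y.mul_mm w x).symm)
      exact congrArg (fun P => opR P w x) (funext (dfN_restrict Y))
  refine CategoryTheory.Functor.ext h fun Y Y' f => YD.Hom.ext ?_
  have h1 := YD.eqToHom_hom (h Y)
  have h2 := YD.eqToHom_hom (h Y').symm
  change f.hom = (eqToHom (h Y)).hom ≫ f.hom ≫ (eqToHom (h Y').symm).hom
  rw [h1, h2]
  exact ((Category.id_comp _).trans (Category.comp_id _)).symm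

theorem sFunctor_restrict :
    sFunctor hx hβ hρ hb ⋙ ObjectProperty.lift _ (YD.restrict A B ρ)
      (commCond_restrict hx hρ hb) = 𝟭 _ := by
  have h (Y : (DF.CommCond (P := alphaC r κ (fund ω)) (M := alphaC r (-κ) (fund ω))
      b).FullSubcategory) :
      (YD.restrict A B ρ).obj ((sFunctor hx hβ hρ hb).obj Y) = Y.obj := by
    refine DF.ext_of_eq ?_ ?_
    · refine fund_ext_left (ff_sym hx) (X := Y.obj.X) (Z := Y.obj.X) fun i x => ?_
      refine (LinearMap.congr_fun (dfP_restrict ((sFunctor hx hβ hρ hb).obj Y) i) x).trans ?_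
      exact LinearMap.congr_fun (actP_sFunctor hx hβ hρ hb Y i) x
    · refine fund_ext_left (ff_sym (exp_neg_one hx)) (X := Y.obj.X) (Z := Y.obj.X) fun i x => ?_
      refine (dfN_kop ((YD.restrict A B ρ).obj ((sFunctor hx hβ hρ hb).obj Y)) i x).trans
        (Eq.trans ?_ (dfN_kop Y.obj i x).symm)
      refine (LinearMap.congr_fun (dfN_restrict ((sFunctor hx hβ hρ hb).obj Y) i) _).trans ?_
      exact LinearMap.congr_fun (actN_sFunctor hx hβ hρ hb Y i) _
  have h' (Y) : (sFunctor hx hβ hρ hb ⋙ ObjectProperty.lift _ (YD.restrict A B ρ)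
      (commCond_restrict hx hρ hb)).obj Y = Y := ObjectProperty.FullSubcategory.ext (h Y)
  refine CategoryTheory.Functor.ext h' fun Y Y' f => ObjectProperty.hom_ext _ (DF.Hom.ext ?_)
  have h1 {Y Y' : (DF.CommCond (P := alphaC r κ (fund ω)) (M := alphaC r (-κ) (fund ω))
      b).FullSubcategory} (h : Y = Y') : (eqToHom h).hom.hom =
        eqToHom (congrArg (fun Y => Y.obj.X) h) := by subst h; rfl
  change f.hom.hom = (eqToHom (h' Y)).hom.hom ≫ f.hom.hom ≫ (eqToHom (h' Y').symm).hom.hom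
  rw [h1, h1]
  exact ((Category.id_comp _).trans (Category.comp_id _)).symm

end Equivalence

/-! ### The tensor product of Yetter-Drinfeld modules -/

section Tensor

variable {r ω κ : ℂ} {A : TensorAlg (alphaC r κ (fund ω)) braidOver}
  {B : TensorAlg (alphaC r (-κ) (fund ω)) braidUnder} {ρ : A.T.1 ⊗ B.T.1 ⟶ 𝟙_ (Bim r)}
  (hx : ∀ n : ℤ, Complex.exp (κ * (n * r) * ω) = 1)

include hx in
theorem tensP_words (Y Z : YD A B ρ) (w : List (Fin 2)) (y : Y.X.V) (z : Z.X.V) :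
    (YD.tensP Y Z).lin (tmul (wa A w) (tmul y z)) = copSum κ ω w fun u v =>
      tmul (opL (actP A Y.mp) u (kop κ Y.X (wt ω v) y)) (opL (actP A Z.mp) v z) := by
  have hp := act_words Y.one_mp Y.mul_mp
  have hp' := act_words Z.one_mp Z.mul_mp
  simp only [YD.tensP, monoidalComp, comp_apply', tensorHom_tmul, whiskerRight_tmul,
    whiskerLeft_tmul, associator_tmul, associator_inv_tmul, MonoidalCoherence.refl_iso,
    MonoidalCoherence.whiskerRight_iso, MonoidalCoherence.whiskerLeft_iso,
    MonoidalCoherence.assoc_iso, MonoidalCoherence.assoc'_iso, Iso.trans_hom, whiskerRightIso_hom,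
    whiskerLeftIso_hom, Iso.symm_hom, id_apply', Iso.refl_hom, copSum_tmul, map_copSum,
    id_whiskerRight, Δ_wa hx, wa_cent _ _ _, hp, hp']

include hx in
theorem tensM_words (Y Z : YD A B ρ) (w : List (Fin 2)) (y : Y.X.V) (z : Z.X.V) :
    (YD.tensM Y Z).lin (tmul (tmul y z) (wb B w)) = copSum κ ω w fun u v =>
      tmul (opR (actN B Y.mm) u y) (opR (actN B Z.mm) v (kop κ Z.X (wt ω u) z)) := by
  have hp := act_words' Y.one_mm Y.mul_mm
  have hp' := act_words' Z.one_mm Z.mul_mm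
  simp only [YD.tensM, monoidalComp, comp_apply', tensorHom_tmul, whiskerRight_tmul,
    whiskerLeft_tmul, associator_tmul, associator_inv_tmul, MonoidalCoherence.refl_iso,
    MonoidalCoherence.whiskerRight_iso, MonoidalCoherence.whiskerLeft_iso,
    MonoidalCoherence.assoc_iso, MonoidalCoherence.assoc'_iso, Iso.trans_hom, whiskerRightIso_hom,
    whiskerLeftIso_hom, Iso.symm_hom, id_apply', Iso.refl_hom, tmul_copSum, map_copSum,
    id_whiskerRight, Δ_wb hx, (wb_cent _).inv _ _, neg_neg, hp, hp']

include hx in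
/-- The generators of `F^+` are primitive, so that they act on a tensor product as braided
derivations. -/
theorem actP_tensP (Y Z : YD A B ρ) (i : Fin 2) (y : Y.X.V) (z : Z.X.V) :
    actP A (YD.tensP Y Z) i (tmul y z) =
      tmul (actP A Y.mp i y) z + tmul (kop κ Y.X (![ω, -ω] i) y) (actP A Z.mp i z) := by
  rw [actP_apply, tensP_words hx]
  simp [copSum_cons, copSum_nil, wt_cons, wt_nil, opL_cons, kop_zero]

include hx in
/-- The generators of `F^-` are primitive, so that they act on a tensor product as braided
derivations. -/
theorem actN_tensM (Y Z : YD A B ρ) (i : Fin 2) (y : Y.X.V) (z : Z.X.V) :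
    actN B (YD.tensM Y Z) i (tmul y z) =
      tmul (actN B Y.mm i y) (kop κ Z.X (![ω, -ω] i) z) + tmul y (actN B Z.mm i z) := by
  rw [actN_apply, tensM_words hx]
  simp [copSum_cons, copSum_nil, wt_cons, wt_nil, opR_cons, kop_zero]

include hx in
/-- The formula for the action on the tensor product defines an action, since the coproduct is
multiplicative. -/
theorem tensP_eq_opL (Y Z : YD A B ρ) (w : List (Fin 2)) (t : (Y.X ⊗ Z.X).V) :
    (YD.tensP Y Z).lin (tmul (wa A w) t) = opL (actP A (YD.tensP Y Z)) w t := by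
  refine LinearMap.congr_fun (f := (YD.tensP Y Z).lin ∘ₗ tm (wa A w))
    (g := opL (actP A (YD.tensP Y Z)) w) (lin_ext fun y z => ?_) t
  refine (tensP_words hx Y Z w y z).trans ?_
  induction w with
  | nil => simp [copSum_nil, wt_nil, kop_zero]; rfl
  | cons i w ih =>
    refine Eq.trans ?_ (congrArg (actP A (YD.tensP Y Z) i) ih)
    rw [map_copSum, copSum_cons]
    refine copSum_congr κ ω w fun u v _ => ?_
    rw [actP_tensP hx, (opL_isShift (actP_isShift hx Y.mp) u).kop, Bim.smul_tmul, kop_kop, opL_cons,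
      opL_cons, wt_cons]

include hx in
theorem tensM_eq_opR (Y Z : YD A B ρ) (w : List (Fin 2)) (t : (Y.X ⊗ Z.X).V) :
    (YD.tensM Y Z).lin (tmul t (wb B w)) = opR (actN B (YD.tensM Y Z)) w t := by
  refine LinearMap.congr_fun (f := (YD.tensM Y Z).lin ∘ₗ tm.flip (wb B w))
    (g := opR (actN B (YD.tensM Y Z)) w) (lin_ext fun y z => ?_) t
  refine (tensM_words hx Y Z w y z).trans ?_
  induction w generalizing y z with
  | nil => simp [copSum_nil, wt_nil, kop_zero]; rfl
  | cons i w ih =>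
    refine Eq.trans ?_ (congrArg (opR (actN B (YD.tensM Y Z)) w) (actN_tensM hx Y Z i y z)).symm
    rw [map_add]
    refine Eq.trans ?_ (congrArg₂ (· + ·) (ih _ _) (ih _ _))
    rw [← copSum_add, copSum_cons]
    refine copSum_congr κ ω w fun u v _ => ?_
    rw [(actN_isShift hx Z.mm i).kop, map_smul, tmul_smul, kop_kop, opR_cons,
      opR_cons, wt_cons, mul_right_comm, add_comm (wt ω u)]

include hx in
/-- The commutation relation of the operators is stable under the tensor product. -/
theorem tens_comm {β : Fin 2 → Fin 2 → ℂ}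
    (hρ : ∀ w u, ρ.lin (tmul (wa A w) (wb B u)) = pair κ ω β w u • un 1) (Y Z : YD A B ρ)
    (i j : Fin 2) (t : (Y.X ⊗ Z.X).V) :
    actP A (YD.tensP Y Z) i (actN B (YD.tensM Y Z) j t) -
      actN B (YD.tensM Y Z) j (actP A (YD.tensP Y Z) i t) =
      β i j • (kop κ (Y.X ⊗ Z.X) (![ω, -ω] j) t - kop κ (Y.X ⊗ Z.X) (![ω, -ω] i) t) := by
  refine LinearMap.congr_fun (f := actP A (YD.tensP Y Z) i ∘ₗ actN B (YD.tensM Y Z) j -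
    actN B (YD.tensM Y Z) j ∘ₗ actP A (YD.tensP Y Z) i) (g := β i j •
      (kop κ (Y.X ⊗ Z.X) (![ω, -ω] j) - kop κ (Y.X ⊗ Z.X) (![ω, -ω] i)))
    (lin_ext fun y z => ?_) t
  change actP A (YD.tensP Y Z) i (actN B (YD.tensM Y Z) j (tmul y z)) -
    actN B (YD.tensM Y Z) j (actP A (YD.tensP Y Z) i (tmul y z)) = β i j •
      (kop κ (Y.X ⊗ Z.X) (![ω, -ω] j) (tmul y z) - kop κ (Y.X ⊗ Z.X) (![ω, -ω] i) (tmul y z))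
  have h1 := yd_act_comm hx hρ Y i j y
  have h2 := yd_act_comm hx hρ Z i j z
  rw [actN_tensM hx, actP_tensP hx, map_add, map_add, actP_tensP hx, actP_tensP hx, actN_tensM hx,
    actN_tensM hx, kop_tmul, kop_tmul, (actN_isShift hx Y.mm j).kop, (actP_isShift hx Z.mp i).kop,
    sub_eq_iff_eq_add.1 h1, sub_eq_iff_eq_add.1 h2, Bim.smul_tmul, tmul_smul,
    mul_right_comm κ (![ω, -ω] i)]
  have h3 (a b c : Y.X.V) (d : Z.X.V) (e : ℂ) : tmul (e • (a - b) + c) d =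
      e • (tmul a d - tmul b d) + tmul c d := by
    rw [add_tmul, Bim.smul_tmul, sub_eq_add_neg, add_tmul, ← neg_one_smul ℂ b, Bim.smul_tmul,
      neg_one_smul, sub_eq_add_neg]
  have h4 (a b c : Z.X.V) (d : Y.X.V) (e : ℂ) : tmul d (e • (a - b) + c) =
      e • (tmul d a - tmul d b) + tmul d c := by
    rw [tmul_add, tmul_smul, sub_eq_add_neg, tmul_add, ← neg_one_smul ℂ b, tmul_smul,
      neg_one_smul, sub_eq_add_neg]
  rw [h3, h4, smul_sub, smul_sub, smul_sub]
  abel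

end Tensor

/-! ### The monoidal category of Yetter-Drinfeld modules -/

section Monoidal

variable {r ω κ : ℂ} {A : TensorAlg (alphaC r κ (fund ω)) braidOver}
  {B : TensorAlg (alphaC r (-κ) (fund ω)) braidUnder} {ρ : A.T.1 ⊗ B.T.1 ⟶ 𝟙_ (Bim r)}

theorem opL_zero (A : TensorAlg (alphaC r κ (fund ω)) braidOver) (w : List (Fin 2))
    (t : (𝟙_ (Bim r)).V) : (A.ε ▷ 𝟙_ (Bim r) ≫ (λ_ (𝟙_ (Bim r))).hom).lin (tmul (wa A w) t) =
      opL (0 : Fin 2 → Module.End ℂ (𝟙_ (Bim r)).V) w t := by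
  rw [comp_apply', whiskerRight_tmul, ε_wa]
  cases w with
  | nil => rw [if_pos rfl, leftUnitor_tmul, map_one]; rfl
  | cons i w => rw [if_neg (List.cons_ne_nil i w), zero_tmul, map_zero]; rfl

theorem opR_zero (B : TensorAlg (alphaC r (-κ) (fund ω)) braidUnder) (w : List (Fin 2))
    (t : (𝟙_ (Bim r)).V) : (𝟙_ (Bim r) ◁ B.ε ≫ (λ_ (𝟙_ (Bim r))).hom).lin (tmul t (wb B w)) =
      opR (0 : Fin 2 → Module.End ℂ (𝟙_ (Bim r)).V) w t := by
  rw [unitors_equal, comp_apply', whiskerLeft_tmul, ε_wb]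
  cases w with
  | nil => rw [if_pos rfl, rightUnitor_tmul, map_one]; rfl
  | cons i w =>
    rw [if_neg (List.cons_ne_nil i w), tmul_zero, map_zero, opR_cons, Pi.zero_apply,
      LinearMap.zero_apply, map_zero]

theorem isShift_zero {X : Bim r} (μ : ℂ) : IsShift μ (0 : Module.End ℂ X.V) where
  h x := by simp
  l a x := by simp
  r a x := by simp

theorem kop_unit {c : ℂ} (hc : ∀ n : ℤ, Complex.exp (κ * (n * r) * c) = 1)
    (t : (𝟙_ (Bim r)).V) : kop κ (𝟙_ (Bim r)) c t = t :=
  un_ind (P := fun t => kop κ (𝟙_ (Bim r)) c t = t) (fun a => by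
    rw [un_eq, ← (kop_isShift κ hc).l, kop_un_one]) t

variable (hx : ∀ n : ℤ, Complex.exp (κ * (n * r) * ω) = 1) {β : Fin 2 → Fin 2 → ℂ}
  (hβ : ∀ i j, β i j ≠ 0 → ![ω, -ω] i + ![ω, -ω] j = 0)
  (hρ : ∀ w u, ρ.lin (tmul (wa A w) (wb B u)) = pair κ ω β w u • un 1)

/-- The tensor product of Yetter-Drinfeld modules. -/
def ydTensor (Y Z : YD A B ρ) : YD A B ρ :=
  ydMk hx hβ hρ (actP_isShift hx (YD.tensP Y Z)) (actN_isShift hx (YD.tensM Y Z))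
    (tens_comm hx hρ Y Z) (YD.tensP Y Z) (YD.tensM Y Z) (tensP_eq_opL hx Y Z) (tensM_eq_opR hx Y Z)

/-- The unit object of the category of Yetter-Drinfeld modules. -/
def ydUnit : YD A B ρ :=
  ydMk hx hβ hρ (P := 0) (N := 0) (fun i => isShift_zero _) (fun i => isShift_zero _)
    (fun i j t => by
      rw [kop_unit fun n => exp_wt_letter hx n i, kop_unit fun n => exp_wt_letter hx n j]; simp)
    (A.ε ▷ 𝟙_ (Bim r) ≫ (λ_ (𝟙_ (Bim r))).hom) (𝟙_ (Bim r) ◁ B.ε ≫ (λ_ (𝟙_ (Bim r))).hom)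
    (opL_zero A) (opR_zero B)

theorem actP_unit (i : Fin 2) (t : (𝟙_ (Bim r)).V) :
    actP A (A.ε ▷ 𝟙_ (Bim r) ≫ (λ_ (𝟙_ (Bim r))).hom) i t = 0 := opL_zero A [i] t

theorem actN_unit (i : Fin 2) (t : (𝟙_ (Bim r)).V) :
    actN B (𝟙_ (Bim r) ◁ B.ε ≫ (λ_ (𝟙_ (Bim r))).hom) i t = 0 := opR_zero B [i] t

/-- A bimodule homomorphism which commutes with the operators, as a homomorphism of
Yetter-Drinfeld modules. -/
def ydHom (hx : ∀ n : ℤ, Complex.exp (κ * (n * r) * ω) = 1) {Y Y' : YD A B ρ} (f : Y.X ⟶ Y'.X)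
    (hp : ∀ i x, f.lin (actP A Y.mp i x) = actP A Y'.mp i (f.lin x))
    (hm : ∀ i x, f.lin (actN B Y.mm i x) = actN B Y'.mm i (f.lin x)) : Y ⟶ Y' :=
  ⟨f, yd_comm_p hx f hp, yd_comm_m hx f hm⟩

theorem hom_actP {Y Y' : YD A B ρ} (f : Y ⟶ Y') (i : Fin 2) (x : Y.X.V) :
    f.hom.lin (actP A Y.mp i x) = actP A Y'.mp i (f.hom.lin x) := by
  have h := congrArg (fun g => g.lin (tmul (wa A [i]) x)) f.comm_p
  exact h.symm.trans (congrArg Y'.mp.lin (whiskerLeft_tmul f.hom _ x))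

theorem hom_actN {Y Y' : YD A B ρ} (f : Y ⟶ Y') (i : Fin 2) (x : Y.X.V) :
    f.hom.lin (actN B Y.mm i x) = actN B Y'.mm i (f.hom.lin x) := by
  have h := congrArg (fun g => g.lin (tmul x (wb B [i]))) f.comm_m
  exact h.symm.trans (congrArg Y'.mm.lin (whiskerRight_tmul f.hom x _))

/-- An isomorphism of bimodules which commutes with the operators, as an isomorphism of
Yetter-Drinfeld modules. -/
def ydIso (hx : ∀ n : ℤ, Complex.exp (κ * (n * r) * ω) = 1) {Y Y' : YD A B ρ} (f : Y.X ≅ Y'.X)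
    (hp : ∀ i x, f.hom.lin (actP A Y.mp i x) = actP A Y'.mp i (f.hom.lin x))
    (hm : ∀ i x, f.hom.lin (actN B Y.mm i x) = actN B Y'.mm i (f.hom.lin x)) : Y ≅ Y' where
  hom := ydHom hx f.hom hp hm
  inv := ydHom hx f.inv
    (fun i x => by
      have h := hp i (f.inv.lin x)
      rw [← comp_apply' f.inv f.hom, f.inv_hom_id] at h
      refine (congrArg f.inv.lin h).symm.trans ?_
      rw [← comp_apply' f.hom f.inv, f.hom_inv_id]; rfl)
    (fun i x => by
      have h := hm i (f.inv.lin x)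
      rw [← comp_apply' f.inv f.hom, f.inv_hom_id] at h
      refine (congrArg f.inv.lin h).symm.trans ?_
      rw [← comp_apply' f.hom f.inv, f.hom_inv_id]; rfl)
  hom_inv_id := YD.Hom.ext f.hom_inv_id
  inv_hom_id := YD.Hom.ext f.inv_hom_id

/-- The tensor product of homomorphisms of Yetter-Drinfeld modules. -/
def ydTensorHom {Y Y' Z Z' : YD A B ρ} (f : Y ⟶ Y') (g : Z ⟶ Z') :
    ydTensor hx hβ hρ Y Z ⟶ ydTensor hx hβ hρ Y' Z' :=
  ydHom hx (Y := ydTensor hx hβ hρ Y Z) (Y' := ydTensor hx hβ hρ Y' Z') (f.hom ⊗ₘ g.hom)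
    (fun i x => LinearMap.congr_fun (f := (f.hom ⊗ₘ g.hom).lin ∘ₗ actP A (YD.tensP Y Z) i)
      (g := actP A (YD.tensP Y' Z') i ∘ₗ (f.hom ⊗ₘ g.hom).lin) (lin_ext fun y z => by
        change (f.hom ⊗ₘ g.hom).lin (actP A (YD.tensP Y Z) i (tmul y z)) =
          actP A (YD.tensP Y' Z') i ((f.hom ⊗ₘ g.hom).lin (tmul y z))
        rw [actP_tensP hx, tensorHom_tmul, actP_tensP hx, map_add, tensorHom_tmul, tensorHom_tmul,
          hom_actP, hom_actP, kop_hom]) x)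
    (fun i x => LinearMap.congr_fun (f := (f.hom ⊗ₘ g.hom).lin ∘ₗ actN B (YD.tensM Y Z) i)
      (g := actN B (YD.tensM Y' Z') i ∘ₗ (f.hom ⊗ₘ g.hom).lin) (lin_ext fun y z => by
        change (f.hom ⊗ₘ g.hom).lin (actN B (YD.tensM Y Z) i (tmul y z)) =
          actN B (YD.tensM Y' Z') i ((f.hom ⊗ₘ g.hom).lin (tmul y z))
        rw [actN_tensM hx, tensorHom_tmul, actN_tensM hx, map_add, tensorHom_tmul, tensorHom_tmul,
          hom_actN, hom_actN, kop_hom]) x)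

theorem actP_tensP_left (Y Z W : YD A B ρ) (i : Fin 2) (y : Y.X.V) (z : Z.X.V) (w : W.X.V) :
    actP A (X := (Y.X ⊗ Z.X) ⊗ W.X) (YD.tensP (ydTensor hx hβ hρ Y Z) W) i (tmul (tmul y z) w) =
      tmul (tmul (actP A Y.mp i y) z) w +
        (tmul (tmul (kop κ Y.X (![ω, -ω] i) y) (actP A Z.mp i z)) w +
        tmul (tmul (kop κ Y.X (![ω, -ω] i) y) (kop κ Z.X (![ω, -ω] i) z)) (actP A W.mp i w)) :=
  (actP_tensP hx (ydTensor hx hβ hρ Y Z) W i (tmul y z) w).trans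
    ((congrArg₂ (fun a b => (tmul (X := Y.X ⊗ Z.X) a w + tmul (X := Y.X ⊗ Z.X) b (actP A W.mp i w) :
      ((Y.X ⊗ Z.X) ⊗ W.X).V)) (actP_tensP hx Y Z i y z) (kop_tmul κ _ y z)).trans
      (by rw [add_tmul, add_assoc]))

theorem actP_tensP_right (Y Z W : YD A B ρ) (i : Fin 2) (y : Y.X.V) (z : Z.X.V) (w : W.X.V) :
    actP A (X := Y.X ⊗ (Z.X ⊗ W.X)) (YD.tensP Y (ydTensor hx hβ hρ Z W)) i (tmul y (tmul z w)) =
      tmul (actP A Y.mp i y) (tmul z w) +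
        (tmul (kop κ Y.X (![ω, -ω] i) y) (tmul (actP A Z.mp i z) w) +
        tmul (kop κ Y.X (![ω, -ω] i) y) (tmul (kop κ Z.X (![ω, -ω] i) z) (actP A W.mp i w))) :=
  (actP_tensP hx Y (ydTensor hx hβ hρ Z W) i y (tmul z w)).trans
    ((congrArg (fun a => (tmul (Y := Z.X ⊗ W.X) (actP A Y.mp i y) (tmul z w) +
      tmul (Y := Z.X ⊗ W.X) (kop κ Y.X (![ω, -ω] i) y) a : (Y.X ⊗ (Z.X ⊗ W.X)).V))
        (actP_tensP hx Z W i z w)).trans (by rw [tmul_add]))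

theorem actN_tensM_left (Y Z W : YD A B ρ) (i : Fin 2) (y : Y.X.V) (z : Z.X.V) (w : W.X.V) :
    actN B (X := (Y.X ⊗ Z.X) ⊗ W.X) (YD.tensM (ydTensor hx hβ hρ Y Z) W) i (tmul (tmul y z) w) =
      tmul (tmul (actN B Y.mm i y) (kop κ Z.X (![ω, -ω] i) z)) (kop κ W.X (![ω, -ω] i) w) +
        (tmul (tmul y (actN B Z.mm i z)) (kop κ W.X (![ω, -ω] i) w) +
        tmul (tmul y z) (actN B W.mm i w)) :=
  (actN_tensM hx (ydTensor hx hβ hρ Y Z) W i (tmul y z) w).trans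
    ((congrArg (fun a => (tmul (X := Y.X ⊗ Z.X) a (kop κ W.X (![ω, -ω] i) w) +
      tmul (X := Y.X ⊗ Z.X) (tmul y z) (actN B W.mm i w) : ((Y.X ⊗ Z.X) ⊗ W.X).V))
        (actN_tensM hx Y Z i y z)).trans (by rw [add_tmul, add_assoc]))

theorem actN_tensM_right (Y Z W : YD A B ρ) (i : Fin 2) (y : Y.X.V) (z : Z.X.V) (w : W.X.V) :
    actN B (X := Y.X ⊗ (Z.X ⊗ W.X)) (YD.tensM Y (ydTensor hx hβ hρ Z W)) i (tmul y (tmul z w)) =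
      tmul (actN B Y.mm i y) (tmul (kop κ Z.X (![ω, -ω] i) z) (kop κ W.X (![ω, -ω] i) w)) +
        (tmul y (tmul (actN B Z.mm i z) (kop κ W.X (![ω, -ω] i) w)) +
        tmul y (tmul z (actN B W.mm i w))) :=
  (actN_tensM hx Y (ydTensor hx hβ hρ Z W) i y (tmul z w)).trans
    ((congrArg₂ (fun a b => (tmul (Y := Z.X ⊗ W.X) (actN B Y.mm i y) b +
      tmul (Y := Z.X ⊗ W.X) y a : (Y.X ⊗ (Z.X ⊗ W.X)).V))
        (actN_tensM hx Z W i z w) (kop_tmul κ _ z w)).trans (by rw [tmul_add]))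

/-- Two linear maps on a threefold tensor product agree if they agree on pure tensors. -/
theorem lin_ext₃ {X Y Z : Bim r} {M : Type} [AddCommGroup M] [Module ℂ M]
    {f g : ((X ⊗ Y) ⊗ Z).V →ₗ[ℂ] M} (h : ∀ x y z, f (tmul (tmul x y) z) = g (tmul (tmul x y) z)) :
    f = g :=
  lin_ext fun t z => LinearMap.congr_fun (f := f ∘ₗ tm.flip z) (g := g ∘ₗ tm.flip z)
    (lin_ext fun x y => h x y z) t

/-- The associator of Yetter-Drinfeld modules. -/
def ydAssoc (Y Z W : YD A B ρ) :
    ydTensor hx hβ hρ (ydTensor hx hβ hρ Y Z) W ≅ ydTensor hx hβ hρ Y (ydTensor hx hβ hρ Z W) :=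
  ydIso hx (Y := ydTensor hx hβ hρ (ydTensor hx hβ hρ Y Z) W)
    (Y' := ydTensor hx hβ hρ Y (ydTensor hx hβ hρ Z W)) (α_ Y.X Z.X W.X)
    (fun i x => LinearMap.congr_fun (f := (α_ Y.X Z.X W.X).hom.lin ∘ₗ
        actP A (X := (Y.X ⊗ Z.X) ⊗ W.X) (YD.tensP (ydTensor hx hβ hρ Y Z) W) i)
      (g := actP A (X := Y.X ⊗ (Z.X ⊗ W.X)) (YD.tensP Y (ydTensor hx hβ hρ Z W)) i ∘ₗ
        (α_ Y.X Z.X W.X).hom.lin) (lin_ext₃ fun y z w => by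
          rw [LinearMap.comp_apply, LinearMap.comp_apply, actP_tensP_left, associator_tmul,
            actP_tensP_right, map_add, map_add, associator_tmul, associator_tmul,
            associator_tmul]) x)
    (fun i x => LinearMap.congr_fun (f := (α_ Y.X Z.X W.X).hom.lin ∘ₗ
        actN B (X := (Y.X ⊗ Z.X) ⊗ W.X) (YD.tensM (ydTensor hx hβ hρ Y Z) W) i)
      (g := actN B (X := Y.X ⊗ (Z.X ⊗ W.X)) (YD.tensM Y (ydTensor hx hβ hρ Z W)) i ∘ₗ
        (α_ Y.X Z.X W.X).hom.lin) (lin_ext₃ fun y z w => by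
          rw [LinearMap.comp_apply, LinearMap.comp_apply, actN_tensM_left, associator_tmul,
            actN_tensM_right, map_add, map_add, associator_tmul, associator_tmul,
            associator_tmul]) x)

/-- Two linear maps on the tensor product with the unit object agree if they agree on the
tensors with the unit element and commute with left multiplication. -/
theorem shift_ext_left {X Z : Bim r} {μ ν : ℂ} {f g : (𝟙_ (Bim r) ⊗ X).V →ₗ[ℂ] Z.V}
    (hf : IsShift μ f) (hg : IsShift ν g)
    (h : ∀ x, f (tmul (un 1) x) = g (tmul (un 1) x)) : f = g :=
  lin_ext fun t x => by
    refine un_ind (P := fun t => f (tmul t x) = g (tmul t x)) (fun a => ?_) t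
    rw [un_eq, ← lact_tmul, ← hf.l, ← hg.l, h]

theorem shift_ext_right {X Z : Bim r} {μ ν : ℂ} {f g : (X ⊗ 𝟙_ (Bim r)).V →ₗ[ℂ] Z.V}
    (hf : IsShift μ f) (hg : IsShift ν g)
    (h : ∀ x, f (tmul x (un 1)) = g (tmul x (un 1))) : f = g :=
  lin_ext fun x t => by
    refine un_ind (P := fun t => f (tmul x t) = g (tmul x t)) (fun a => ?_) t
    have h1 : (un a : (𝟙_ (Bim r)).V) = (𝟙_ (Bim r)).ract a (un 1) := by rw [ract_un, mul_one]
    rw [h1, ← ract_tmul, ← hf.r, ← hg.r, h]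

/-- The left unitor of Yetter-Drinfeld modules. -/
def ydLeftUnitor (Y : YD A B ρ) : ydTensor hx hβ hρ (ydUnit hx hβ hρ) Y ≅ Y :=
  ydIso hx (Y := ydTensor hx hβ hρ (ydUnit hx hβ hρ) Y) (Y' := Y) (λ_ Y.X)
    (fun i x => LinearMap.congr_fun (f := (λ_ Y.X).hom.lin ∘ₗ
        actP A (X := 𝟙_ (Bim r) ⊗ Y.X) (YD.tensP (ydUnit hx hβ hρ) Y) i)
      (g := actP A Y.mp i ∘ₗ (λ_ Y.X).hom.lin)
      (shift_ext_left ((Hom.isShift (λ_ Y.X).hom).comp (actP_isShift hx (X := 𝟙_ (Bim r) ⊗ Y.X)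
          (YD.tensP (ydUnit hx hβ hρ) Y) i))
        ((actP_isShift hx Y.mp i).comp (Hom.isShift (λ_ Y.X).hom)) fun y => by
          have h1 : actP A (X := 𝟙_ (Bim r) ⊗ Y.X) (YD.tensP (ydUnit hx hβ hρ) Y) i
              (tmul (un 1) y) = tmul (un 1) (actP A Y.mp i y) :=
            (actP_tensP hx (ydUnit hx hβ hρ) Y i (un 1) y).trans
              ((congrArg₂ (fun a b => (tmul a y + tmul b (actP A Y.mp i y) :
                (𝟙_ (Bim r) ⊗ Y.X).V)) (actP_unit i (un 1)) (kop_un_one κ _)).trans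
                (by rw [zero_tmul, zero_add]))
          rw [LinearMap.comp_apply, LinearMap.comp_apply, h1, leftUnitor_tmul,
            leftUnitor_tmul, map_one]
          rfl) x)
    (fun i x => LinearMap.congr_fun (f := (λ_ Y.X).hom.lin ∘ₗ
        actN B (X := 𝟙_ (Bim r) ⊗ Y.X) (YD.tensM (ydUnit hx hβ hρ) Y) i)
      (g := actN B Y.mm i ∘ₗ (λ_ Y.X).hom.lin)
      (shift_ext_left ((Hom.isShift (λ_ Y.X).hom).comp (actN_isShift hx (X := 𝟙_ (Bim r) ⊗ Y.X)
          (YD.tensM (ydUnit hx hβ hρ) Y) i))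
        ((actN_isShift hx Y.mm i).comp (Hom.isShift (λ_ Y.X).hom)) fun y => by
          have h1 : actN B (X := 𝟙_ (Bim r) ⊗ Y.X) (YD.tensM (ydUnit hx hβ hρ) Y) i
              (tmul (un 1) y) = tmul (un 1) (actN B Y.mm i y) :=
            (actN_tensM hx (ydUnit hx hβ hρ) Y i (un 1) y).trans
              ((congrArg (fun a => (tmul a (kop κ Y.X (![ω, -ω] i) y) + tmul (un 1)
                (actN B Y.mm i y) : (𝟙_ (Bim r) ⊗ Y.X).V)) (actN_unit i (un 1))).trans
                (by rw [zero_tmul, zero_add]))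
          rw [LinearMap.comp_apply, LinearMap.comp_apply, h1, leftUnitor_tmul,
            leftUnitor_tmul, map_one]
          rfl) x)

/-- The right unitor of Yetter-Drinfeld modules. -/
def ydRightUnitor (Y : YD A B ρ) : ydTensor hx hβ hρ Y (ydUnit hx hβ hρ) ≅ Y :=
  ydIso hx (Y := ydTensor hx hβ hρ Y (ydUnit hx hβ hρ)) (Y' := Y) (ρ_ Y.X)
    (fun i x => LinearMap.congr_fun (f := (ρ_ Y.X).hom.lin ∘ₗ
        actP A (X := Y.X ⊗ 𝟙_ (Bim r)) (YD.tensP Y (ydUnit hx hβ hρ)) i)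
      (g := actP A Y.mp i ∘ₗ (ρ_ Y.X).hom.lin)
      (shift_ext_right ((Hom.isShift (ρ_ Y.X).hom).comp (actP_isShift hx (X := Y.X ⊗ 𝟙_ (Bim r))
          (YD.tensP Y (ydUnit hx hβ hρ)) i))
        ((actP_isShift hx Y.mp i).comp (Hom.isShift (ρ_ Y.X).hom)) fun y => by
          have h1 : actP A (X := Y.X ⊗ 𝟙_ (Bim r)) (YD.tensP Y (ydUnit hx hβ hρ)) i
              (tmul y (un 1)) = tmul (actP A Y.mp i y) (un 1) :=
            (actP_tensP hx Y (ydUnit hx hβ hρ) i y (un 1)).trans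
              ((congrArg (fun a => (tmul (actP A Y.mp i y) (un 1) +
                tmul (kop κ Y.X (![ω, -ω] i) y) a : (Y.X ⊗ 𝟙_ (Bim r)).V))
                (actP_unit i (un 1))).trans (by rw [tmul_zero, add_zero]))
          rw [LinearMap.comp_apply, LinearMap.comp_apply, h1, rightUnitor_tmul,
            rightUnitor_tmul, map_one]
          rfl) x)
    (fun i x => LinearMap.congr_fun (f := (ρ_ Y.X).hom.lin ∘ₗ
        actN B (X := Y.X ⊗ 𝟙_ (Bim r)) (YD.tensM Y (ydUnit hx hβ hρ)) i)
      (g := actN B Y.mm i ∘ₗ (ρ_ Y.X).hom.lin)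
      (shift_ext_right ((Hom.isShift (ρ_ Y.X).hom).comp (actN_isShift hx (X := Y.X ⊗ 𝟙_ (Bim r))
          (YD.tensM Y (ydUnit hx hβ hρ)) i))
        ((actN_isShift hx Y.mm i).comp (Hom.isShift (ρ_ Y.X).hom)) fun y => by
          have h1 : actN B (X := Y.X ⊗ 𝟙_ (Bim r)) (YD.tensM Y (ydUnit hx hβ hρ)) i
              (tmul y (un 1)) = tmul (actN B Y.mm i y) (un 1) :=
            (actN_tensM hx Y (ydUnit hx hβ hρ) i y (un 1)).trans
              ((congrArg₂ (fun a b => (tmul (actN B Y.mm i y) b + tmul y a :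
                (Y.X ⊗ 𝟙_ (Bim r)).V)) (actN_unit i (un 1)) (kop_un_one κ _)).trans
                (by rw [tmul_zero, add_zero]))
          rw [LinearMap.comp_apply, LinearMap.comp_apply, h1, rightUnitor_tmul,
            rightUnitor_tmul, map_one]
          rfl) x)

instance : (YD.forget A B ρ).Faithful := ⟨fun h => YD.Hom.ext h⟩

/-- The operations of the monoidal category of Yetter-Drinfeld modules. -/
@[reducible]
def ydMonoidalStruct : MonoidalCategoryStruct (YD A B ρ) where
  tensorObj := ydTensor hx hβ hρ
  whiskerLeft Y _ _ f := ydTensorHom hx hβ hρ (𝟙 Y) f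
  whiskerRight f Z := ydTensorHom hx hβ hρ f (𝟙 Z)
  tensorHom := ydTensorHom hx hβ hρ
  tensorUnit := ydUnit hx hβ hρ
  associator := ydAssoc hx hβ hρ
  leftUnitor := ydLeftUnitor hx hβ hρ
  rightUnitor := ydRightUnitor hx hβ hρ

/-- The forgetful functor preserves the monoidal operations strictly. -/
def ydInducing : letI := ydMonoidalStruct hx hβ hρ
    Monoidal.InducingFunctorData (YD.forget A B ρ) :=
  letI := ydMonoidalStruct hx hβ hρ
  { μIso := fun Y Z => Iso.refl (Y.X ⊗ Z.X)
    εIso := Iso.refl (𝟙_ (Bim r))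
    whiskerLeft_eq := fun Y _ _ f => by
      change 𝟙 Y.X ⊗ₘ f.hom = 𝟙 _ ≫ Y.X ◁ f.hom ≫ 𝟙 _
      simp
    whiskerRight_eq := fun f Z => by
      change f.hom ⊗ₘ 𝟙 Z.X = 𝟙 _ ≫ f.hom ▷ Z.X ≫ 𝟙 _
      simp
    tensorHom_eq := fun f g => by
      change f.hom ⊗ₘ g.hom = 𝟙 _ ≫ (f.hom ⊗ₘ g.hom) ≫ 𝟙 _
      simp
    associator_eq := fun Y Z W => by
      change (α_ Y.X Z.X W.X).hom = (𝟙 _ ≫ (𝟙 (Y.X ⊗ Z.X) ⊗ₘ 𝟙 W.X)) ≫ (α_ Y.X Z.X W.X).hom ≫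
        (𝟙 Y.X ⊗ₘ 𝟙 (Z.X ⊗ W.X)) ≫ 𝟙 _
      simp
    leftUnitor_eq := fun Y => by
      change (λ_ Y.X).hom = (𝟙 _ ≫ (𝟙 _ ⊗ₘ 𝟙 Y.X)) ≫ (λ_ Y.X).hom
      simp
    rightUnitor_eq := fun Y => by
      change (ρ_ Y.X).hom = (𝟙 _ ≫ (𝟙 Y.X ⊗ₘ 𝟙 _)) ≫ (ρ_ Y.X).hom
      simp }

/-- The monoidal category of Yetter-Drinfeld modules. -/
@[reducible]
def ydMonoidal : MonoidalCategory (YD A B ρ) :=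
  letI := ydMonoidalStruct hx hβ hρ
  Monoidal.induced (YD.forget A B ρ) (ydInducing hx hβ hρ)

/-- The forgetful functor from Yetter-Drinfeld modules to bimodules is strict monoidal. -/
@[reducible]
def ydForgetMonoidal : letI := ydMonoidal hx hβ hρ
    (YD.forget A B ρ).Monoidal :=
  letI := ydMonoidalStruct hx hβ hρ
  Monoidal.fromInducedMonoidal (YD.forget A B ρ) (ydInducing hx hβ hρ)

theorem isStd : letI := ydMonoidal hx hβ hρ
    letI := ydForgetMonoidal hx hβ hρ
    YD.IsStd A B ρ :=
  letI := ydMonoidal hx hβ hρ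
  letI := ydForgetMonoidal hx hβ hρ
  { tens_p := fun Y Z => by
      change A.T.1 ◁ 𝟙 (Y.X ⊗ Z.X) ≫ YD.tensP Y Z = YD.tensP Y Z ≫ 𝟙 (Y.X ⊗ Z.X)
      simp
    tens_m := fun Y Z => by
      change 𝟙 (Y.X ⊗ Z.X) ▷ B.T.1 ≫ YD.tensM Y Z = YD.tensM Y Z ≫ 𝟙 (Y.X ⊗ Z.X)
      simp
    one_p := by
      change A.T.1 ◁ 𝟙 (𝟙_ (Bim r)) ≫ (A.ε ▷ 𝟙_ (Bim r) ≫ (λ_ (𝟙_ (Bim r))).hom) =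
        (A.ε ▷ 𝟙_ (Bim r) ≫ (λ_ (𝟙_ (Bim r))).hom) ≫ 𝟙 (𝟙_ (Bim r))
      simp
    one_m := by
      change 𝟙 (𝟙_ (Bim r)) ▷ B.T.1 ≫ (𝟙_ (Bim r) ◁ B.ε ≫ (λ_ (𝟙_ (Bim r))).hom) =
        (𝟙_ (Bim r) ◁ B.ε ≫ (λ_ (𝟙_ (Bim r))).hom) ≫ 𝟙 (𝟙_ (Bim r))
      simp }

end Monoidal

/-! ### Operators on the bimodules induced from spaces with an automorphism -/

theorem lg_re (z : ℂ) : 0 ≤ (lg z).re ∧ (lg z).re < 1 := by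
  have h : (lg z).re = Int.fract (Complex.log z / (2 * Real.pi * Complex.I)).re := by
    rw [lg, Complex.sub_re, Complex.intCast_re]; rfl
  rw [h]
  exact ⟨Int.fract_nonneg _, Int.fract_lt_one _⟩

theorem lg_one : lg 1 = 0 := by simp [lg]

theorem floor_lg (z : ℂ) : ⌊(lg z).re⌋ = 0 := Int.floor_eq_zero_iff.2 (lg_re z)

section KVect

variable {X Y : KVect} {r : ℂ}

theorem KVect.ext_eigen {M : Type} [AddCommGroup M] [Module ℂ M] {f g : X.V →ₗ[ℂ] M}
    (h : ∀ (z : ℂ) (v : X.V), z ≠ 0 → X.k v = z • v → f v = g v) : f = g :=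
  X.diag.ext fun z v hv => by
    rcases eq_or_ne v 0 with rfl | hv0
    · simp
    · exact h z v (X.ne_zero hv hv0) hv

/-- The linear map `v ↦ a ⊗ v`. -/
def KVect.iaLin (X : KVect) (r : ℂ) (a : Alg) : X.V →ₗ[ℂ] (X.I r).V := aa r 0 (X.wt r) a

theorem KVect.ia_add (a : Alg) (v w : X.V) : X.ia r a (v + w) = X.ia r a v + X.ia r a w :=
  map_add (X.iaLin r a) v w

theorem KVect.ia_smul (a : Alg) (c : ℂ) (v : X.V) : X.ia r a (c • v) = c • X.ia r a v :=
  map_smul (X.iaLin r a) c v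

theorem KVect.lact_ia (a b : Alg) (v : X.V) : (X.I r).lact a (X.ia r b v) = X.ia r (a * b) v :=
  lact_aa a b (X.el r v)

theorem KVect.ract_ia (a b : Alg) (v : X.V) : (X.I r).ract a (X.ia r b v) = X.ia r (a * b) v :=
  ract_zero a b (X.el r v)

theorem KVect.ia_eq (a : Alg) (v : X.V) : X.ia r a v = (X.I r).lact a (X.ia r 1 v) := by
  rw [KVect.lact_ia, mul_one]

theorem KVect.h_ia_one {z : ℂ} {v : X.V} (hv : X.k v = z • v) :
    (X.I r).h (X.ia r 1 v) = (r * lg z) • X.ia r 1 v := by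
  have h0 : (X.wt r).h (X.el r v) = (r * lg z) • X.el r v := X.wt_h r hv
  have h := h_aa (r := r) (κ := 0) (E := X.wt r) 1 h0
  rw [algH_one, map_zero, LinearMap.zero_apply, zero_add] at h
  exact h

theorem KVect.h_ia_dl {z : ℂ} {v : X.V} (hv : X.k v = z • v) (n : ℤ) :
    (X.I r).h (X.ia r (dl n) v) = (r * (n + lg z)) • X.ia r (dl n) v := by
  have h0 : (X.wt r).h (X.el r v) = (r * lg z) • X.el r v := X.wt_h r hv
  have h := h_aa (r := r) (κ := 0) (E := X.wt r) (dl n) h0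
  rw [algH_dl, map_smul, LinearMap.smul_apply, ← add_smul, mul_comm (n : ℂ), ← mul_add] at h
  exact h

/-- Linear maps on `𝓘(X)` agree if they agree on the elements `a ⊗ v` with an eigenvector `v`. -/
theorem KVect.I_ext {M : Type} [AddCommGroup M] [Module ℂ M] {f g : (X.I r).V →ₗ[ℂ] M}
    (h : ∀ (a : Alg) (z : ℂ) (v : X.V), z ≠ 0 → X.k v = z • v →
      f (X.ia r a v) = g (X.ia r a v)) : f = g :=
  LinearMap.ext fun t => by
    induction t using KVect.I_ind with
    | h0 => simp
    | h2 t s ht hs => simp only [map_add, ht, hs]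
    | h1 a v =>
      exact LinearMap.congr_fun (KVect.ext_eigen (f := f ∘ₗ X.iaLin r a) (g := g ∘ₗ X.iaLin r a)
        fun z v hz hv => h a z v hz hv) v

/-- The projection `δ_n ⊗ v ↦ δ_{n,0} v`. -/
def KVect.proj (X : KVect) (r : ℂ) : (X.I r).V →ₗ[ℂ] X.V :=
  TensorProduct.lift (LinearMap.toSpanSingleton ℂ (Module.End ℂ X.V) 1 ∘ₗ
    (Finsupp.lapply (0 : ℤ)) ∘ₗ (AddMonoidAlgebra.coeffLinearEquiv ℂ).toLinearMap)

theorem KVect.proj_ia (n : ℤ) (v : X.V) :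
    X.proj r (X.ia r (dl n) v) = if n = 0 then v else 0 := by
  have h : X.proj r (X.ia r (dl n) v) =
      ((AddMonoidAlgebra.coeffLinearEquiv ℂ (dl n)) 0 : ℂ) • v :=
    TensorProduct.lift.tmul (R := ℂ) _ _
  have h2 : ((AddMonoidAlgebra.coeffLinearEquiv ℂ (dl n)) 0 : ℂ) = (Finsupp.single n (1 : ℂ)) 0 :=
    rfl
  rw [h, h2, Finsupp.single_apply]
  split_ifs <;> simp

theorem KVect.proj_ia_one (v : X.V) : X.proj r (X.ia r 1 v) = v := by
  rw [← dl_zero, KVect.proj_ia, if_pos rfl]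

theorem KVect.ia_one_injective {v w : X.V} (h : X.ia r 1 v = X.ia r 1 w) : v = w := by
  rw [← X.proj_ia_one (r := r) v, h, X.proj_ia_one]

/-- The vectors of `𝓘(X)` of weight `r ℓ` with the real part of `ℓ` in `[0, 1)` are of the
form `1 ⊗ v`. -/
theorem KVect.eq_ia_one (hr : r ≠ 0) {z : ℂ} {t : (X.I r).V} (ht : (X.I r).h t = (r * lg z) • t) :
    t = X.ia r 1 (X.proj r t) := by
  -- The projection to the elements `1 ⊗ v` is a spectral projection of `h`.
  have h : fcalc (X.I r).h (fun μ => if ⌊(μ / r).re⌋ = 0 then 1 else 0) =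
      X.iaLin r 1 ∘ₗ X.proj r := KVect.I_ext fun a z v hz hv => by
    refine LinearMap.congr_fun (f := fcalc (X.I r).h (fun μ => if ⌊(μ / r).re⌋ = 0 then 1 else 0) ∘ₗ
      (aa r 0 (X.wt r)).flip (X.el r v)) (g := (X.iaLin r 1 ∘ₗ X.proj r) ∘ₗ
      (aa r 0 (X.wt r)).flip (X.el r v)) (Alg.ext fun n => ?_) a
    change fcalc (X.I r).h _ (X.ia r (dl n) v) = X.iaLin r 1 (X.proj r (X.ia r (dl n) v))
    rw [fcalc_apply (X.I r).diag _ (X.h_ia_dl hv n), mul_div_cancel_left₀ _ hr, Complex.add_re,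
      Complex.intCast_re, Int.floor_intCast_add, floor_lg, add_zero, X.proj_ia]
    split_ifs with h
    · rw [h, one_smul]; rfl
    · rw [zero_smul, map_zero]
  have h2 := fcalc_apply (X.I r).diag (fun μ => if ⌊(μ / r).re⌋ = 0 then 1 else 0) ht
  rw [mul_div_cancel_left₀ _ hr, floor_lg, if_pos rfl, one_smul, h] at h2
  exact h2.symm

end KVect

section Operators

variable {κ r : ℂˣ} {X Y : KVect}

/-- The eigenvalues `q^{± 2}` of `k` on the generators. -/
abbrev qw (κ r : ℂˣ) (i : Fin 2) : ℂ := ![qq κ r ^ 2, (qq κ r ^ 2)⁻¹] i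

theorem qw_ne_zero (i : Fin 2) : qw κ r i ≠ 0 := by
  have := qq_ne_zero κ r
  fin_cases i <;> simp [qw, this]

/-- The degree in `A_r` by which a generator shifts a vector with eigenvalue `z`. -/
def sh (κ r : ℂˣ) (i : Fin 2) (z : ℂ) : ℤ := -nn κ r i + ⌊(lg (qw κ r i) + lg z).re⌋

/-- The shift compensates the difference between the weight of `f v` and the sum of the weights of
`f` and `v`, where the weights of `f v` and `v` are those chosen by `𝓘`. -/
theorem r_mul_sh (i : Fin 2) {z : ℂ} (hz : z ≠ 0) :
    (r : ℂ) * sh κ r i z = ![om κ r, -om κ r] i + r * lg z - r * lg (qw κ r i * z) := by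
  have h1 := lg_mul (qw_ne_zero (κ := κ) (r := r) i) hz
  have h2 : (r : ℂ) * lg (qw κ r i) = (nn κ r i : ℤ) * r + ![om κ r, -om κ r] i := lg_qq κ r i
  rw [sh]
  push_cast
  linear_combination (-(r : ℂ)) * h1 + h2

theorem int_ext {m n : ℤ} (h : (r : ℂ) * m = r * n) : m = n :=
  Int.cast_injective (mul_left_cancel₀ r.ne_zero h)

/-- The shift in the tensor structure compensates the difference between the weight of `v ⊗ w` and
the sum of the weights of `v` and `w`. -/
theorem r_mul_floor {z w : ℂ} (hz : z ≠ 0) (hw : w ≠ 0) :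
    (r : ℂ) * (⌊(lg z + lg w).re⌋ : ℤ) = r * lg z + r * lg w - r * lg (z * w) := by
  linear_combination (-(r : ℂ)) * lg_mul hz hw

/-- Both sides are the total shift caused by two generators, which does not depend on their
order. -/
theorem sh_comm (i j : Fin 2) {z : ℂ} (hz : z ≠ 0) :
    sh κ r i z + sh κ r j (qw κ r i * z) = sh κ r j z + sh κ r i (qw κ r j * z) := by
  refine int_ext (r := r) ?_
  have hi := mul_ne_zero (qw_ne_zero (κ := κ) (r := r) i) hz
  have hj := mul_ne_zero (qw_ne_zero (κ := κ) (r := r) j) hz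
  push_cast
  rw [mul_add, mul_add, r_mul_sh i hz, r_mul_sh j hz, r_mul_sh i hj, r_mul_sh j hi,
    mul_left_comm (qw κ r i) (qw κ r j)]
  ring

/-- The shifts of two generators of opposite weights cancel. -/
theorem sh_add_sh {i j : Fin 2} (hij : i ≠ j) {z : ℂ} (hz : z ≠ 0) :
    sh κ r i z + sh κ r j (qw κ r i * z) = 0 := by
  refine int_ext (r := r) ?_
  have hi := mul_ne_zero (qw_ne_zero (κ := κ) (r := r) i) hz
  have h1 : qw κ r j * (qw κ r i * z) = z := by
    have := qq_ne_zero κ r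
    fin_cases i <;> fin_cases j <;> first | exact absurd rfl hij | (simp [qw]; field_simp)
  have h2 : ![om κ r, -om κ r] i + ![om κ r, -om κ r] j = 0 := by
    fin_cases i <;> fin_cases j <;> first | exact absurd rfl hij | simp
  push_cast
  rw [mul_add, r_mul_sh i hz, r_mul_sh j hi, h1]
  linear_combination h2

/-- Shifting the first factor and then multiplying is the same as multiplying and then shifting. -/
theorem sh_floor (i : Fin 2) {z w : ℂ} (hz : z ≠ 0) (hw : w ≠ 0) :
    sh κ r i z + ⌊(lg (qw κ r i * z) + lg w).re⌋ = ⌊(lg z + lg w).re⌋ + sh κ r i (z * w) := by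
  refine int_ext (r := r) ?_
  have hi := mul_ne_zero (qw_ne_zero (κ := κ) (r := r) i) hz
  push_cast
  rw [mul_add, mul_add, r_mul_sh i hz, r_mul_sh i (mul_ne_zero hz hw), r_mul_floor hi hw,
    r_mul_floor hz hw, mul_assoc]
  ring

/-- Shifting the second factor and then multiplying is the same as multiplying and then shifting. -/
theorem sh_floor' (i : Fin 2) {z w : ℂ} (hz : z ≠ 0) (hw : w ≠ 0) :
    sh κ r i w + ⌊(lg z + lg (qw κ r i * w)).re⌋ = ⌊(lg z + lg w).re⌋ + sh κ r i (z * w) := by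
  rw [add_comm (lg z), sh_floor i hw hz, add_comm (lg z), mul_comm z]

/-- The integral parts which appear in the tensor structure form a cocycle. -/
theorem floor_assoc {z w u : ℂ} (hz : z ≠ 0) (hw : w ≠ 0) (hu : u ≠ 0) :
    ⌊(lg z + lg w).re⌋ + ⌊(lg (z * w) + lg u).re⌋ =
      ⌊(lg w + lg u).re⌋ + ⌊(lg z + lg (w * u)).re⌋ := by
  have h1 := lg_mul (mul_ne_zero hz hw) hu
  rw [mul_assoc] at h1
  refine Int.cast_injective (α := ℂ) ?_
  push_cast
  linear_combination lg_mul hw hu + lg_mul hz (mul_ne_zero hw hu) - lg_mul hz hw - h1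

/-- The basis vectors of `ℂ_{q^2} ⊕ ℂ_{q^{-2}}`, as elements of the space with automorphism `k`. -/
def fk (κ r : ℂˣ) (i : Fin 2) : (fundK κ r).V := Finsupp.single i (1 : ℂ)

theorem gIso_inv_ff {s : ℂ} (hs : s = κ ∨ s = -κ) (c : Fin 2 → ℂˣ) (i : Fin 2) :
    (gIso κ r hs c).inv.lin (ff r s (om κ r) i) =
      ((c i)⁻¹ : ℂ) • (fundK κ r).ia r (dl (-nn κ r i)) (fk κ r i) := by
  have h : (gIso κ r hs c).inv.lin (ff r s (om κ r) i) =
      ((fundK κ r).I r).lact 1 (gS' κ r c (fe (om κ r) i)) := alift_aa _ _ _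
  rw [h, gS'_fe, map_one]
  rfl

/-- The action of a generator of `F^±` on `𝓘(X)`: the action on `X`, together with a shift in
`A_r`. -/
theorem gAct_ia {s : ℂ} (hs : s = κ ∨ s = -κ) (c : Fin 2 → ℂˣ)
    (m : ((fundK κ r).tens X).V →ₗ[ℂ] X.V) (hm : ∀ t, m (((fundK κ r).tens X).k t) = X.k (m t))
    (i : Fin 2) (a : Alg) {z : ℂ} {v : X.V} (hv : X.k v = z • v) :
    (gAct κ r hs c X m hm).lin (tmul (ff r s (om κ r) i) (X.ia r a v)) =
      ((c i)⁻¹ : ℂ) • X.ia r (a * dl (sh κ r i z)) (m (KMod.et κ r X i v)) := by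
  have h1 : (fundK κ r).k (fk κ r i) = qw κ r i • fk κ r i :=
    diagEnd_single _ i 1
  have h2 : ((fundK κ r).mu X r).lin (tmul ((fundK κ r).ia r (dl (-nn κ r i))
      (fk κ r i)) (X.ia r a v)) =
        ((fundK κ r).tens X).ia r (a * dl (sh κ r i z)) (KMod.et κ r X i v) := by
    rw [KVect.mu_ia, (fundK κ r).sig_apply X r h1 hv, sh, ← dl_mul, mul_left_comm, ← mul_assoc]
    exact lact_aa _ _ _
  rw [gAct, comp_apply', comp_apply', whiskerRight_tmul, gIso_inv_ff, Bim.smul_tmul, map_smul,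
    map_smul, h2, KVect.mapI_ia]

/-- The operator `exp(κ (± ω) h)` on `𝓘(X)` is induced by `k^{∓ 1}`, since `κ ω r = - 2 π i`. -/
theorem kop_ia (i : Fin 2) (a : Alg) {z : ℂ} (hz : z ≠ 0) {v : X.V} (hv : X.k v = z • v) :
    kop (κ : ℂ) (X.I r) (![om κ r, -om κ r] i) (X.ia r a v) = (![z⁻¹, z] i) • X.ia r a v := by
  rw [KVect.ia_eq, ← (kop_isShift (κ : ℂ) (X := X.I r)
    fun n => exp_wt_letter (exp_om κ r) n i).l, kop_apply (κ : ℂ) _ (X.h_ia_one hv), map_smul]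
  congr 1
  have h : (κ : ℂ) * om κ r * (r * lg z) = -(2 * Real.pi * Complex.I * lg z) := by
    have := κ.ne_zero
    have := r.ne_zero
    rw [om]
    field_simp
  fin_cases i
  · change Complex.exp (κ * om κ r * (r * lg z)) = z⁻¹
    rw [h, Complex.exp_neg, exp_lg hz]
  · change Complex.exp (κ * -om κ r * (r * lg z)) = z
    rw [mul_neg, neg_mul, h, neg_neg, exp_lg hz]

end Operators

/-! ### Relations between the images of the generators in the quantum loop algebra -/

section Relations

variable (q : ℂˣ) (ζ ξ : ℂ)

/-- The images of `f^+` and `f̄^+`, and those of `f^-` and `f̄^-`, commute up to the factor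
`q^{-2}`. -/
theorem toUqGen_same (i : Fin 2) : BF.toUqGen q ζ ξ (.f i) * BF.toUqGen q ζ ξ (.fb i) =
    ((q : ℂ) ^ 2)⁻¹ • (BF.toUqGen q ζ ξ (.fb i) * BF.toUqGen q ζ ξ (.f i)) := by
  have h := (Uq.rels q).comm i (i + 1)
  have hk := (Uq.rels q).kem
  rw [if_neg (by fin_cases i <;> simp), sub_eq_zero] at h
  fin_cases i
  · have h1 : Uq.gen q (.ep 0) * Uq.gen q (.em 1) = Uq.gen q (.em 1) * Uq.gen q (.ep 0) := h
    have h2 : Uq.gen q (.K 1) * Uq.gen q (.em 1) =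
      ((q : ℂ) ^ 2)⁻¹ • (Uq.gen q (.em 1) * Uq.gen q (.K 1)) := hk 1
    change Uq.gen q (.ep 0) * Uq.gen q (.K 1) * Uq.gen q (.em 1) =
      _ • (Uq.gen q (.em 1) * (Uq.gen q (.ep 0) * Uq.gen q (.K 1)))
    rw [mul_assoc, h2, mul_smul_comm, ← mul_assoc, h1, mul_assoc]
  · have h1 : Uq.gen q (.ep 1) * Uq.gen q (.em 0) = Uq.gen q (.em 0) * Uq.gen q (.ep 1) := h
    have h2 : Uq.gen q (.K 0) * Uq.gen q (.em 0) =
      ((q : ℂ) ^ 2)⁻¹ • (Uq.gen q (.em 0) * Uq.gen q (.K 0)) := hk 0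
    change (_ • (Uq.gen q (.ep 1) * Uq.gen q (.K 0))) * (_ • Uq.gen q (.em 0)) =
      _ • ((_ • Uq.gen q (.em 0)) * (_ • (Uq.gen q (.ep 1) * Uq.gen q (.K 0))))
    rw [smul_mul_smul_comm, smul_mul_smul_comm, mul_assoc (Uq.gen q (.ep 1)), h2, mul_smul_comm,
      ← mul_assoc (Uq.gen q (.ep 1)), h1,
      mul_assoc (Uq.gen q (.em 0)), smul_comm, mul_comm (ζ * _)]

variable (hq : (q : ℂ) ^ 2 ≠ 1)
include hq

theorem q_sub_inv_ne_zero : (q : ℂ) - (q : ℂ)⁻¹ ≠ 0 := by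
  intro h
  apply hq
  have h1 := q.ne_zero
  field_simp at h
  linear_combination h

/-- The relation between the images of `f^+` and `f̄^-`. -/
theorem toUqGen_01 : BF.toUqGen q ζ ξ (.f 0) * BF.toUqGen q ζ ξ (.fb 1) -
    (q : ℂ) ^ 2 • (BF.toUqGen q ζ ξ (.fb 1) * BF.toUqGen q ζ ξ (.f 0)) =
      ζ • ((Uq.gen q (.K 0) - Uq.gen q (.K 1)) * Uq.gen q (.K 1)) := by
  have h : Uq.gen q (.ep 0) * Uq.gen q (.em 0) - Uq.gen q (.em 0) * Uq.gen q (.ep 0) =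
    ((q : ℂ) - (q : ℂ)⁻¹)⁻¹ • (Uq.gen q (.K 0) - Uq.gen q (.K 1)) := (Uq.rels q).comm 0 0
  have h2 : Uq.gen q (.K 1) * Uq.gen q (.em 0) =
    (q : ℂ) ^ 2 • (Uq.gen q (.em 0) * Uq.gen q (.K 1)) := (Uq.rels q).kem' 0
  change Uq.gen q (.ep 0) * Uq.gen q (.K 1) * (_ • Uq.gen q (.em 0)) -
    _ • ((_ • Uq.gen q (.em 0)) * (Uq.gen q (.ep 0) * Uq.gen q (.K 1))) = _
  have hs := q_sub_inv_ne_zero q hq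
  have hq0 := q.ne_zero
  rw [mul_smul_comm, mul_assoc, h2, mul_smul_comm, smul_mul_assoc, smul_comm (_ ^ 2), ← smul_sub,
    ← smul_sub, ← mul_assoc, ← mul_assoc, ← sub_mul, h, smul_mul_assoc, smul_smul, smul_smul]
  congr 1
  field_simp

/-- The relation between the images of `f^-` and `f̄^+`. -/
theorem toUqGen_10 : BF.toUqGen q ζ ξ (.f 1) * BF.toUqGen q ζ ξ (.fb 0) -
    (q : ℂ) ^ 2 • (BF.toUqGen q ζ ξ (.fb 0) * BF.toUqGen q ζ ξ (.f 1)) =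
      ξ • ((Uq.gen q (.K 1) - Uq.gen q (.K 0)) * Uq.gen q (.K 0)) := by
  have h : Uq.gen q (.ep 1) * Uq.gen q (.em 1) - Uq.gen q (.em 1) * Uq.gen q (.ep 1) =
    ((q : ℂ) - (q : ℂ)⁻¹)⁻¹ • (Uq.gen q (.K 1) - Uq.gen q (.K 0)) := (Uq.rels q).comm 1 1
  have h2 : Uq.gen q (.K 0) * Uq.gen q (.em 1) =
    (q : ℂ) ^ 2 • (Uq.gen q (.em 1) * Uq.gen q (.K 0)) := (Uq.rels q).kem' 1
  change (_ • (Uq.gen q (.ep 1) * Uq.gen q (.K 0))) * Uq.gen q (.em 1) -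
    _ • (Uq.gen q (.em 1) * (_ • (Uq.gen q (.ep 1) * Uq.gen q (.K 0)))) = _
  have hs := q_sub_inv_ne_zero q hq
  have hq0 := q.ne_zero
  rw [smul_mul_assoc, mul_assoc, h2, mul_smul_comm, mul_smul_comm, smul_comm (_ ^ 2), ← smul_sub,
    ← smul_sub, ← mul_assoc, ← mul_assoc, ← sub_mul, h, smul_mul_assoc, smul_smul, smul_smul]
  congr 1
  field_simp

end Relations

/-! ### The operators on the bimodules of representations -/

section Rep

variable {κ r ζ ξ : ℂˣ} {c : Fin 2 → ℂˣ}

/-- The action of the quantum loop algebra on the space with automorphism `k` which underlies a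
representation. -/
def rhoK (ζ ξ : ℂˣ) (V : RepUq κ r) : Uq (qu κ r) →ₐ[ℂ] Module.End ℂ (repKv κ r ζ ξ V).V := V.ρ

/-- The action of `f^±` on a representation. -/
def fOp (ζ ξ : ℂˣ) (V : RepUq κ r) (i : Fin 2) : Module.End ℂ (repKv κ r ζ ξ V).V :=
  rhoK ζ ξ V (BF.toUqGen (qu κ r) ζ ξ (.f i))

/-- The action of `f̄^±` on a representation. -/
def fbOp (ζ ξ : ℂˣ) (V : RepUq κ r) (i : Fin 2) : Module.End ℂ (repKv κ r ζ ξ V).V :=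
  rhoK ζ ξ V (BF.toUqGen (qu κ r) ζ ξ (.fb i))

theorem rhoK_K0 (V : RepUq κ r) : rhoK ζ ξ V (Uq.gen (qu κ r) (.K 0)) = (repKv κ r ζ ξ V).k :=
  (repKv_k κ r ζ ξ V).symm

theorem k_fOp (V : RepUq κ r) (i : Fin 2) {z : ℂ} {v : (repKv κ r ζ ξ V).V}
    (hv : (repKv κ r ζ ξ V).k v = z • v) :
    (repKv κ r ζ ξ V).k (fOp ζ ξ V i v) = (qw κ r i * z) • fOp ζ ξ V i v := by
  have h := congrArg (fun a => rhoK ζ ξ V (BF.toUq (qu κ r) ζ ξ a) v) (BF.K_f (qu κ r) i)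
  simp only [map_mul, map_smul, BF.toUq_gen, BF.toUqGen.eq_1, rhoK_K0, Module.End.mul_apply,
    LinearMap.smul_apply, hv, smul_smul] at h
  exact h

theorem k_fbOp (V : RepUq κ r) (i : Fin 2) {z : ℂ} {v : (repKv κ r ζ ξ V).V}
    (hv : (repKv κ r ζ ξ V).k v = z • v) :
    (repKv κ r ζ ξ V).k (fbOp ζ ξ V i v) = (qw κ r i * z) • fbOp ζ ξ V i v := by
  have h := congrArg (fun a => rhoK ζ ξ V (BF.toUq (qu κ r) ζ ξ a) v) (BF.K_fb (qu κ r) i)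
  simp only [map_mul, map_smul, BF.toUq_gen, BF.toUqGen.eq_1, rhoK_K0, Module.End.mul_apply,
    LinearMap.smul_apply, hv, smul_smul] at h
  exact h

/-- The element `k⁻¹` acts on an eigenvector of `k` by the inverse eigenvalue. -/
theorem rhoK_K1 (V : RepUq κ r) {z : ℂ} (hz : z ≠ 0) {v : (repKv κ r ζ ξ V).V}
    (hv : (repKv κ r ζ ξ V).k v = z • v) : rhoK ζ ξ V (Uq.gen (qu κ r) (.K 1)) v = z⁻¹ • v := by
  have h : Uq.gen (qu κ r) (.K 1) * Uq.gen (qu κ r) (.K 0) = 1 := (Uq.rels (qu κ r)).inv 1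
  have h1 := congrArg (fun a => rhoK ζ ξ V a v) h
  simp only [map_mul, map_one, Module.End.mul_apply, Module.End.one_apply, rhoK_K0, hv,
    map_smul] at h1
  rw [eq_inv_smul_iff₀ hz]
  exact h1

/-- The values of the form on the basis vectors. -/
def formMat (ζ ξ : ℂˣ) : Fin 2 → Fin 2 → ℂ := ![![0, ζ], ![ξ, 0]]

theorem formMat_wt (ω : ℂ) (i j : Fin 2) (h : formMat ζ ξ i j ≠ 0) :
    ![ω, -ω] i + ![ω, -ω] j = 0 := by
  fin_cases i <;> fin_cases j <;> simp [formMat] at h ⊢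

theorem pairing_ff (i j : Fin 2) : (pairing ζ ξ κ r).lin
    (tmul (ff (r : ℂ) κ (om κ r) i) (ff (r : ℂ) (-κ) (om κ r) j)) = formMat ζ ξ i j • un 1 := by
  have h : (pairing ζ ξ κ r).lin (tmul (ff (r : ℂ) κ (om κ r) i) (ff (r : ℂ) (-κ) (om κ r) j)) =
      (𝟙_ (Bim (r : ℂ))).lact (1 * 1) (form ζ ξ (Finsupp.single i 1) (Finsupp.single j 1) • un 1) :=
    abil_aa (κ := κ) (κ' := -κ) (E := fund (om κ r)) (E' := fund (om κ r)) (X := one (r : ℂ))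
      ((form ζ ξ).compr₂ (LinearMap.toSpanSingleton ℂ (one (r : ℂ)).V (uu 1))) 1
      (Finsupp.single i 1) 1 (Finsupp.single j 1)
  rw [h, mul_one, map_one, Module.End.one_apply]
  congr 1
  fin_cases i <;> fin_cases j <;> simp [form, formMat]

/-- The commutation relations for the operators on a representation. -/
theorem fOp_fbOp (hq : qq κ r ^ 2 ≠ 1) (V : RepUq κ r) (i j : Fin 2) {z : ℂ} (hz : z ≠ 0)
    {v : (repKv κ r ζ ξ V).V} (hv : (repKv κ r ζ ξ V).k v = z • v) :
    (![z⁻¹, z] j) • fOp ζ ξ V i (fbOp ζ ξ V j v) -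
      (![(qw κ r i * z)⁻¹, qw κ r i * z] j) • fbOp ζ ξ V j (fOp ζ ξ V i v) =
      (formMat ζ ξ i j * (![z⁻¹, z] j - ![z⁻¹, z] i)) • v := by
  have hq0 := qq_ne_zero κ r
  have hK1 := rhoK_K1 V hz hv
  have hs (i : Fin 2) : fOp ζ ξ V i (fbOp ζ ξ V i v) =
      (qq κ r ^ 2)⁻¹ • fbOp ζ ξ V i (fOp ζ ξ V i v) := by
    have h := congrArg (fun a => rhoK ζ ξ V a v) (toUqGen_same (qu κ r) ζ ξ i)
    simp only [map_mul, map_smul, LinearMap.smul_apply, Module.End.mul_apply] at h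
    exact h
  have h01 : fOp ζ ξ V 0 (fbOp ζ ξ V 1 v) - qq κ r ^ 2 • fbOp ζ ξ V 1 (fOp ζ ξ V 0 v) =
      (ζ * ((z - z⁻¹) * z⁻¹) : ℂ) • v := by
    have h := congrArg (fun a => rhoK ζ ξ V a v) (toUqGen_01 (qu κ r) ζ ξ hq)
    simp only [map_mul, map_smul, map_sub, LinearMap.smul_apply, LinearMap.sub_apply,
      Module.End.mul_apply, hK1, rhoK_K0, hv] at h
    refine Eq.trans h ?_
    rw [← sub_smul, smul_smul, smul_smul]
    congr 1; ring
  have h10 : fOp ζ ξ V 1 (fbOp ζ ξ V 0 v) - qq κ r ^ 2 • fbOp ζ ξ V 0 (fOp ζ ξ V 1 v) =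
      (ξ * ((z⁻¹ - z) * z) : ℂ) • v := by
    have h := congrArg (fun a => rhoK ζ ξ V a v) (toUqGen_10 (qu κ r) ζ ξ hq)
    simp only [map_mul, map_smul, map_sub, LinearMap.smul_apply, LinearMap.sub_apply,
      Module.End.mul_apply, hK1, rhoK_K0, hv] at h
    refine Eq.trans h ?_
    rw [← sub_smul, smul_smul, smul_smul]
    congr 1; ring
  fin_cases i <;> fin_cases j
  · have h := hs 0
    simp [formMat, qw, h, smul_smul, mul_comm]
  · have h := congrArg (z • ·) h01
    simp only [smul_sub, smul_smul] at h
    simp [formMat, qw]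
    rw [mul_comm (qq κ r ^ 2), h]
    congr 1; field_simp
  · have h := congrArg (z⁻¹ • ·) h10
    simp only [smul_sub, smul_smul] at h
    simp [formMat, qw]
    rw [h]
    congr 1; field_simp
  · have h := hs 1
    simp [formMat, qw, h, smul_smul, mul_comm]

/-- The operators on `𝓘(V)` which come from `F^+`. -/
def pOp (ζ ξ : ℂˣ) (c : Fin 2 → ℂˣ) (V : RepUq κ r) (i : Fin 2) :
    Module.End ℂ ((repKv κ r ζ ξ V).I r).V := dfP ((repToDF κ r ζ ξ c).obj V) i

/-- The operators on `𝓘(V)` which come from `F^-`. -/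
def nOp (ζ ξ : ℂˣ) (c : Fin 2 → ℂˣ) (V : RepUq κ r) (i : Fin 2) :
    Module.End ℂ ((repKv κ r ζ ξ V).I r).V := dfN ((repToDF κ r ζ ξ c).obj V) i

/-- The operators from `F^+` are the operators `f^±` with a shift. -/
theorem pOp_ia (V : RepUq κ r) (i : Fin 2) (a : Alg) {z : ℂ} {v : (repKv κ r ζ ξ V).V}
    (hv : (repKv κ r ζ ξ V).k v = z • v) :
    pOp ζ ξ c V i ((repKv κ r ζ ξ V).ia r a v) =
      ((c i)⁻¹ : ℂ) • (repKv κ r ζ ξ V).ia r (a * dl (sh κ r i z)) (fOp ζ ξ V i v) := by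
  have h : KMod.mact κ r (repKv κ r ζ ξ V)
      (fun i => rhoK ζ ξ V (BF.toUq (qu κ r) ζ ξ (BF.gen _ (.f i))))
      (KMod.et κ r (repKv κ r ζ ξ V) i v) = fOp ζ ξ V i v := by
    rw [KMod.mact_et, BF.toUq_gen]
    rfl
  have h3 (hm) := gAct_ia (κ := κ) (r := r) (Or.inl rfl) c (KMod.mact κ r (repKv κ r ζ ξ V)
      (fun i => rhoK ζ ξ V (BF.toUq (qu κ r) ζ ξ (BF.gen _ (.f i))))) hm i a hv
  rw [← h]
  exact h3 ((RepK.pullback (BF.toUq (qu κ r) ζ ξ) (BF.toUq_gen (qu κ r) ζ ξ (.K 0)) ⋙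
    KMod.ofRep κ r).obj V).mp_k

/-- The operators from `F^-` are the operators `f̄^±` with a shift. The factor `z^{∓ 1}` is due to
the normalisation of `dfN` as a right action. -/
theorem nOp_ia (V : RepUq κ r) (i : Fin 2) (a : Alg) {z : ℂ} (hz : z ≠ 0)
    {v : (repKv κ r ζ ξ V).V} (hv : (repKv κ r ζ ξ V).k v = z • v) :
    nOp ζ ξ c V i ((repKv κ r ζ ξ V).ia r a v) = (![z⁻¹, z] i * ![(c 1 : ℂ), c 0] i) •
      (repKv κ r ζ ξ V).ia r (a * dl (sh κ r i z)) (fbOp ζ ξ V i v) := by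
  have h : KMod.mact κ r (repKv κ r ζ ξ V)
      (fun i => rhoK ζ ξ V (BF.toUq (qu κ r) ζ ξ (BF.gen _ (.fb i))))
      (KMod.et κ r (repKv κ r ζ ξ V) i v) = fbOp ζ ξ V i v := by
    rw [KMod.mact_et, BF.toUq_gen]
    rfl
  have h2 : ((![(c 1)⁻¹, (c 0)⁻¹] i : ℂˣ) : ℂ)⁻¹ = ![(c 1 : ℂ), c 0] i := by
    fin_cases i <;> simp
  have h3 (hm) := gAct_ia (κ := κ) (r := r) (Or.inr rfl) ![(c 1)⁻¹, (c 0)⁻¹]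
    (KMod.mact κ r (repKv κ r ζ ξ V)
      (fun i => rhoK ζ ξ V (BF.toUq (qu κ r) ζ ξ (BF.gen _ (.fb i))))) hm i a hv
  have h4 (m : alpha (r : ℂ) (-κ) (fund (om κ r)) ⊗ (repKv κ r ζ ξ V).I r ⟶
      (repKv κ r ζ ξ V).I r) : m.lin (tmul (ff r (-κ) (om κ r) i)
        (kop (κ : ℂ) ((repKv κ r ζ ξ V).I r) (![om κ r, -om κ r] i)
          ((repKv κ r ζ ξ V).ia r a v))) = (![z⁻¹, z] i) •
            m.lin (tmul (ff r (-κ) (om κ r) i) ((repKv κ r ζ ξ V).ia r a v)) := by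
    have e := kop_ia (κ := κ) (r := r) i a hz hv
    have e2 := congrArg (fun t => m.lin (tmul (ff (r : ℂ) (-κ) (om κ r) i) t)) e
    refine e2.trans ((congrArg m.lin (tmul_smul _ _ _)).trans ?_)
    exact map_smul m.lin _ _
  have h5 : nOp ζ ξ c V i ((repKv κ r ζ ξ V).ia r a v) = ((repToDF κ r ζ ξ c).obj V).mm.lin
      (tmul (ff r (-κ) (om κ r) i) (kop (κ : ℂ) ((repKv κ r ζ ξ V).I r) (![om κ r, -om κ r] i)
          ((repKv κ r ζ ξ V).ia r a v))) := rfl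
  have h6 : ((repToDF κ r ζ ξ c).obj V).mm.lin (tmul (ff r (-κ) (om κ r) i)
      ((repKv κ r ζ ξ V).ia r a v)) = ![(c 1 : ℂ), c 0] i •
        (repKv κ r ζ ξ V).ia r (a * dl (sh κ r i z)) (fbOp ζ ξ V i v) := by
    rw [← h2, ← h]
    exact h3 ((RepK.pullback (BF.toUq (qu κ r) ζ ξ) (BF.toUq_gen (qu κ r) ζ ξ (.K 0)) ⋙
      KMod.ofRep κ r).obj V).mm_k
  rw [h5, mul_smul, ← h6]
  exact h4 ((repToDF κ r ζ ξ c).obj V).mm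

/-- The commutation relation for the operators on `𝓘(V)`. -/
theorem pOp_nOp (hq : qq κ r ^ 2 ≠ 1) (V : RepUq κ r) (i j : Fin 2)
    (x : ((repKv κ r ζ ξ V).I r).V) :
    pOp ζ ξ c V i (nOp ζ ξ c V j x) - nOp ζ ξ c V j (pOp ζ ξ c V i x) = formMat ζ ξ i j •
      (kop (κ : ℂ) ((repKv κ r ζ ξ V).I r) (![om κ r, -om κ r] j) x -
        kop (κ : ℂ) ((repKv κ r ζ ξ V).I r) (![om κ r, -om κ r] i) x) := by
  refine LinearMap.congr_fun (f := pOp ζ ξ c V i ∘ₗ nOp ζ ξ c V j -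
    nOp ζ ξ c V j ∘ₗ pOp ζ ξ c V i) (g := formMat ζ ξ i j •
      (kop (κ : ℂ) ((repKv κ r ζ ξ V).I r) (![om κ r, -om κ r] j) -
        kop (κ : ℂ) ((repKv κ r ζ ξ V).I r) (![om κ r, -om κ r] i)))
      (KVect.I_ext (X := repKv κ r ζ ξ V) fun a z v hz hv => ?_) x
  have hi := mul_ne_zero (qw_ne_zero (κ := κ) (r := r) i) hz
  simp only [LinearMap.sub_apply, LinearMap.comp_apply, LinearMap.smul_apply]
  rw [nOp_ia V j a hz hv, pOp_ia V i a hv, map_smul, map_smul, nOp_ia V j _ hi (k_fOp V i hv),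
    pOp_ia V i _ (k_fbOp V j hv), kop_ia j a hz hv, kop_ia i a hz hv, mul_assoc a, mul_assoc a,
    dl_mul, dl_mul, sh_comm i j hz, ← sub_smul]
  have e := fOp_fbOp hq V i j hz hv
  have e4 (b : Alg) := congrArg ((repKv κ r ζ ξ V).iaLin r b) e
  simp only [map_sub, map_smul] at e4
  have e5 (b : Alg) : (![z⁻¹, z] j) • (repKv κ r ζ ξ V).ia r b (fOp ζ ξ V i (fbOp ζ ξ V j v)) -
      (![(qw κ r i * z)⁻¹, qw κ r i * z] j) •
        (repKv κ r ζ ξ V).ia r b (fbOp ζ ξ V j (fOp ζ ξ V i v)) =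
      (formMat ζ ξ i j * (![z⁻¹, z] j - ![z⁻¹, z] i)) • (repKv κ r ζ ξ V).ia r b v := e4 b
  have e6 := congrArg ((((c i)⁻¹ : ℂ) * ![(c 1 : ℂ), c 0] j) • ·)
    (e5 (a * dl (sh κ r j z + sh κ r i (qw κ r j * z))))
  simp only [smul_sub, smul_smul] at e6 ⊢
  rw [show ![z⁻¹, z] j * ![(c 1 : ℂ), c 0] j * (c i : ℂ)⁻¹ =
    (c i : ℂ)⁻¹ * ![(c 1 : ℂ), c 0] j * ![z⁻¹, z] j by ring,
    show (c i : ℂ)⁻¹ * (![(qw κ r i * z)⁻¹, qw κ r i * z] j * ![(c 1 : ℂ), c 0] j) =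
    (c i : ℂ)⁻¹ * ![(c 1 : ℂ), c 0] j * ![(qw κ r i * z)⁻¹, qw κ r i * z] j by ring, e6]
  by_cases hij : i = j
  · subst hij
    rw [sub_self, mul_zero, mul_zero, zero_smul, zero_smul]
  -- For `i ≠ j` the normalising constants cancel, and so do the shifts.
  · have hc : ((c i)⁻¹ : ℂ) * ![(c 1 : ℂ), c 0] j = 1 := by
      have h0 := (c 0).ne_zero
      have h1 := (c 1).ne_zero
      fin_cases i <;> fin_cases j <;> first | exact absurd rfl hij | simp [h0, h1]
    rw [hc, one_mul, sh_add_sh (Ne.symm hij) hz, dl_zero, mul_one]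

theorem commCond_repToDF (hq : qq κ r ^ 2 ≠ 1) (V : RepUq κ r) :
    DF.CommCond (pairing ζ ξ κ r) ((repToDF κ r ζ ξ c).obj V) :=
  (commCond_iff (exp_om κ r) pairing_ff ((repToDF κ r ζ ξ c).obj V)).2 (pOp_nOp hq V)

end Rep

/-! ### The tensor structure on the bimodules of representations -/

section TensorStructure

theorem KVect.tens_k {X Y : KVect} {z w : ℂ} {x : X.V} {y : Y.V} (hx : X.k x = z • x)
    (hy : Y.k y = w • y) : (X.tens Y).k (x ⊗ₜ[ℂ] y : X.V ⊗[ℂ] Y.V) =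
      ((z * w) • (x ⊗ₜ[ℂ] y) : X.V ⊗[ℂ] Y.V) := by
  change TensorProduct.map X.k Y.k (x ⊗ₜ y) = _
  rw [TensorProduct.map_tmul, hx, hy, TensorProduct.smul_tmul_smul]

/-- The bilinear map `(v, w) ↦ (δ_{-n} ⊗ v) ⊗ (1 ⊗ w)`, where `n` is the integral part of the real
part of `ℓ + ℓ'`, for `v` and `w` eigenvectors of `k` with eigenvalues `exp(2 π i ℓ)` and
`exp(2 π i ℓ')`. -/
def KVect.sigInv (X Y : KVect) (r : ℂ) : X.V →ₗ[ℂ] Y.V →ₗ[ℂ] (X.I r ⊗ Y.I r).V :=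
  glue X.k fun z => LinearMap.flip <| glue Y.k fun w => LinearMap.flip <|
    ((tm (X := X.I r) (Y := Y.I r)) ∘ₗ X.iaLin r (dl (-⌊(lg z + lg w).re⌋))).compl₂ (Y.iaLin r 1)

theorem KVect.sigInv_apply (X Y : KVect) (r : ℂ) {z w : ℂ} {x : X.V} {y : Y.V}
    (hx : X.k x = z • x) (hy : Y.k y = w • y) : X.sigInv Y r x y =
      tmul (X.ia r (dl (-⌊(lg z + lg w).re⌋)) x) (Y.ia r 1 y) := by
  rw [sigInv, glue_apply X.diag _ hx, LinearMap.flip_apply, glue_apply Y.diag _ hy]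
  rfl

/-- The inverse of the tensor structure of `𝓘`. -/
def KVect.muInv (X Y : KVect) (r : ℂ) : ((X.tens Y).I r).V →ₗ[ℂ] (X.I r ⊗ Y.I r).V :=
  alift (E := (X.tens Y).wt r) (X := X.I r ⊗ Y.I r) (TensorProduct.lift (X.sigInv Y r))

theorem KVect.muInv_ia (X Y : KVect) (r : ℂ) {z w : ℂ} {x : X.V} {y : Y.V} (a : Alg)
    (hx : X.k x = z • x) (hy : Y.k y = w • y) :
    X.muInv Y r ((X.tens Y).ia r a (x ⊗ₜ[ℂ] y : X.V ⊗[ℂ] Y.V)) =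
      tmul (X.ia r (a * dl (-⌊(lg z + lg w).re⌋)) x) (Y.ia r 1 y) := by
  have h : X.muInv Y r ((X.tens Y).ia r a (x ⊗ₜ[ℂ] y : X.V ⊗[ℂ] Y.V)) =
      (X.I r ⊗ Y.I r).lact a (TensorProduct.lift (X.sigInv Y r) (x ⊗ₜ[ℂ] y)) := alift_aa _ _ _
  rw [h, TensorProduct.lift.tmul, X.sigInv_apply Y r hx hy, lact_tmul, KVect.lact_ia]

theorem KVect.mu_ia_eigen (X Y : KVect) (r : ℂ) {z w : ℂ} {x : X.V} {y : Y.V} (a b : Alg)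
    (hx : X.k x = z • x) (hy : Y.k y = w • y) :
    (X.mu Y r).lin (tmul (X.ia r a x) (Y.ia r b y)) =
      (X.tens Y).ia r (a * b * dl ⌊(lg z + lg w).re⌋) (x ⊗ₜ[ℂ] y : X.V ⊗[ℂ] Y.V) := by
  rw [KVect.mu_ia, X.sig_apply Y r hx hy]
  exact lact_aa _ _ _

/-- Two linear maps on `𝓘(X) ⊗ 𝓘(Y)` agree if they agree on the tensors of eigenvectors. -/
theorem KVect.I_tens_ext {X Y : KVect} {r : ℂ} {M : Type} [AddCommGroup M] [Module ℂ M]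
    {f g : (X.I r ⊗ Y.I r).V →ₗ[ℂ] M} (h : ∀ (a b : Alg) (z w : ℂ) (x : X.V) (y : Y.V), z ≠ 0 →
      w ≠ 0 → X.k x = z • x → Y.k y = w • y → f (tmul (X.ia r a x) (Y.ia r b y)) =
        g (tmul (X.ia r a x) (Y.ia r b y))) : f = g := by
  have h1 : (tm (X := X.I r) (Y := Y.I r)).compr₂ f = (tm (X := X.I r) (Y := Y.I r)).compr₂ g :=
    KVect.I_ext fun a z x hz hx => KVect.I_ext fun b w y hw hy => h a b z w x y hz hw hx hy
  exact lin_ext fun t s => LinearMap.congr_fun₂ h1 t s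

theorem KVect.I_tens_ext₃ {X Y W : KVect} {r : ℂ} {M : Type} [AddCommGroup M] [Module ℂ M]
    {f g : ((X.I r ⊗ Y.I r) ⊗ W.I r).V →ₗ[ℂ] M} (h : ∀ (a b c : Alg) (z w u : ℂ) (x : X.V)
      (y : Y.V) (v : W.V), z ≠ 0 → w ≠ 0 → u ≠ 0 → X.k x = z • x → Y.k y = w • y → W.k v = u • v →
      f (tmul (tmul (X.ia r a x) (Y.ia r b y)) (W.ia r c v)) =
        g (tmul (tmul (X.ia r a x) (Y.ia r b y)) (W.ia r c v))) : f = g := by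
  have h1 : (tm (X := X.I r ⊗ Y.I r) (Y := W.I r)).compr₂ f =
      (tm (X := X.I r ⊗ Y.I r) (Y := W.I r)).compr₂ g :=
    KVect.I_tens_ext fun a b z w x y hz hw hx hy => KVect.I_ext fun c u v hu hv =>
      h a b c z w u x y v hz hw hu hx hy hv
  exact lin_ext fun t s => LinearMap.congr_fun₂ h1 t s

/-- The tensor structure of `𝓘` is an isomorphism. -/
def KVect.muIso (X Y : KVect) (r : ℂ) : X.I r ⊗ Y.I r ≅ (X.tens Y).I r :=
  isoMk (X.mu Y r) (X.muInv Y r)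
    (KVect.I_tens_ext fun a b z w x y hz hw hx hy => by
      have e : tmul (X.ia r a x) (Y.ia r b y) = tmul (X.ia r (a * b) x) (Y.ia r 1 y) := by
        rw [KVect.ia_eq b y, ← tmul_balanced, KVect.ract_ia, mul_comm]
      rw [LinearMap.comp_apply, X.mu_ia_eigen Y r a b hx hy, X.muInv_ia Y r _ hx hy, mul_assoc,
        dl_mul, add_neg_cancel, dl_zero, mul_one, LinearMap.id_apply, e])
    (LinearMap.ext fun t => by
      induction t using KVect.I_ind with
      | h0 => simp
      | h2 t s ht hs => simp only [map_add, ht, hs]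
      | h1 a v =>
        refine LinearMap.congr_fun (f := ((X.mu Y r).lin ∘ₗ X.muInv Y r) ∘ₗ (X.tens Y).iaLin r a)
          (g := (X.tens Y).iaLin r a) (X.diag.ext₂ Y.diag fun z x w y hx hy => ?_) v
        refine (congrArg (X.mu Y r).lin (X.muInv_ia Y r a hx hy)).trans ?_
        rw [X.mu_ia_eigen Y r _ _ hx hy, mul_one, mul_assoc, dl_mul, neg_add_cancel, dl_zero,
          mul_one]
        rfl)

end TensorStructure

section Coproduct

variable (q : ℂˣ) (ζ ξ : ℂ)

/-- The elements `ψ(f^±)` are skew primitive. -/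
theorem comul_f (i : Fin 2) : Uq.comul q (BF.toUqGen q ζ ξ (.f i)) =
    BF.toUqGen q ζ ξ (.f i) ⊗ₜ 1 + Uq.gen q (.K (i + 1)) ⊗ₜ BF.toUqGen q ζ ξ (.f i) := by
  have h01 : Uq.gen q (.K 0) * Uq.gen q (.K 1) = 1 := (Uq.rels q).inv 0
  have h10 : Uq.gen q (.K 1) * Uq.gen q (.K 0) = 1 := (Uq.rels q).inv 1
  fin_cases i
  · change Uq.comul q (Uq.gen q (.ep 0) * Uq.gen q (.K 1)) =
      (Uq.gen q (.ep 0) * Uq.gen q (.K 1)) ⊗ₜ 1 +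
        Uq.gen q (.K 1) ⊗ₜ (Uq.gen q (.ep 0) * Uq.gen q (.K 1))
    rw [map_mul, Uq.comul_ep, Uq.comul_K, add_mul, Algebra.TensorProduct.tmul_mul_tmul,
      Algebra.TensorProduct.tmul_mul_tmul, one_mul, h01]
  · change Uq.comul q (_ • (Uq.gen q (.ep 1) * Uq.gen q (.K 0))) =
      (_ • (Uq.gen q (.ep 1) * Uq.gen q (.K 0))) ⊗ₜ 1 +
        Uq.gen q (.K 0) ⊗ₜ (_ • (Uq.gen q (.ep 1) * Uq.gen q (.K 0)))
    rw [map_smul, map_mul, Uq.comul_ep, Uq.comul_K, add_mul, Algebra.TensorProduct.tmul_mul_tmul,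
      Algebra.TensorProduct.tmul_mul_tmul, one_mul, h10, smul_add, TensorProduct.tmul_smul,
      TensorProduct.smul_tmul']

/-- The elements `ψ(f̄^±)` are skew primitive. -/
theorem comul_fb (i : Fin 2) : Uq.comul q (BF.toUqGen q ζ ξ (.fb i)) =
    BF.toUqGen q ζ ξ (.fb i) ⊗ₜ 1 + Uq.gen q (.K i) ⊗ₜ BF.toUqGen q ζ ξ (.fb i) := by
  fin_cases i
  · exact Uq.comul_em q 1
  · change Uq.comul q (_ • Uq.gen q (.em 0)) = (_ • Uq.gen q (.em 0)) ⊗ₜ 1 +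
        Uq.gen q (.K 1) ⊗ₜ (_ • Uq.gen q (.em 0))
    rw [map_smul, Uq.comul_em, smul_add, TensorProduct.tmul_smul, TensorProduct.smul_tmul']
    rfl

theorem counit_f (i : Fin 2) : Uq.counit q (BF.toUqGen q ζ ξ (.f i)) = 0 := by
  fin_cases i
  · change Uq.counit q (Uq.gen q (.ep 0) * Uq.gen q (.K 1)) = 0
    rw [map_mul, Uq.counit_ep, zero_mul]
  · change Uq.counit q (_ • (Uq.gen q (.ep 1) * Uq.gen q (.K 0))) = 0
    rw [map_smul, map_mul, Uq.counit_ep, zero_mul, smul_zero]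

theorem counit_fb (i : Fin 2) : Uq.counit q (BF.toUqGen q ζ ξ (.fb i)) = 0 := by
  fin_cases i
  · exact Uq.counit_em q 1
  · change Uq.counit q (_ • Uq.gen q (.em 0)) = 0
    rw [map_smul, Uq.counit_em, smul_zero]

end Coproduct

theorem mul_dl_left (a b : Alg) {m n m' n' : ℤ} (h : m + n = n' + m') :
    a * dl m * b * dl n = a * b * dl n' * dl m' := by
  rw [mul_assoc (a * b), dl_mul, ← h, ← dl_mul, mul_right_comm a, mul_assoc]

theorem mul_dl_right (a b : Alg) {m n m' n' : ℤ} (h : m + n = n' + m') :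
    a * (b * dl m) * dl n = a * b * dl n' * dl m' := by
  rw [mul_assoc (a * b), dl_mul, ← h, ← dl_mul, ← mul_assoc, ← mul_assoc]

section Abstract

variable {κ r : ℂˣ} {X Y Z : KVect} {i : Fin 2} {m : X.V → Y.V → Z.V}
  {μ : (X.I r ⊗ Y.I r).V →ₗ[ℂ] (Z.I r).V} {fX : Module.End ℂ X.V} {fY : Module.End ℂ Y.V}
  {fZ : Module.End ℂ Z.V} {pX : Module.End ℂ (X.I r).V} {pY : Module.End ℂ (Y.I r).V}
  {pZ : Module.End ℂ (Z.I r).V}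

/-- The operator on `𝓘(Z)` defined by a skew primitive operator on `Z` is skew primitive, in the
form needed for `f^±`: here `μ` is the tensor structure of `𝓘`, followed by a map induced
by `X ⊗ Y → Z`. -/
theorem KVect.mu_skewP (hm : ∀ {z w : ℂ} {x : X.V} {y : Y.V}, X.k x = z • x → Y.k y = w • y →
      Z.k (m x y) = (z * w) • m x y)
    (hμ : ∀ (a b : Alg) {z w : ℂ} {x : X.V} {y : Y.V}, X.k x = z • x → Y.k y = w • y →
      μ (tmul (X.ia r a x) (Y.ia r b y)) = Z.ia r (a * b * dl ⌊(lg z + lg w).re⌋) (m x y))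
    (kX : ∀ {z : ℂ} {x : X.V}, X.k x = z • x → X.k (fX x) = (qw κ r i * z) • fX x)
    (kY : ∀ {z : ℂ} {y : Y.V}, Y.k y = z • y → Y.k (fY y) = (qw κ r i * z) • fY y)
    (hZ : ∀ {z : ℂ} (_ : z ≠ 0) {x : X.V} (y : Y.V), X.k x = z • x →
      fZ (m x y) = m (fX x) y + (![z⁻¹, z] i) • m x (fY y)) (c : ℂ)
    (hpX : ∀ (a : Alg) {z : ℂ} {x : X.V}, X.k x = z • x →
      pX (X.ia r a x) = c • X.ia r (a * dl (sh κ r i z)) (fX x))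
    (hpY : ∀ (a : Alg) {z : ℂ} {y : Y.V}, Y.k y = z • y →
      pY (Y.ia r a y) = c • Y.ia r (a * dl (sh κ r i z)) (fY y))
    (hpZ : ∀ (a : Alg) {z : ℂ} {v : Z.V}, Z.k v = z • v →
      pZ (Z.ia r a v) = c • Z.ia r (a * dl (sh κ r i z)) (fZ v))
    (x : (X.I r).V) (y : (Y.I r).V) :
    pZ (μ (tmul x y)) = μ (tmul (pX x) y + tmul (kop (κ : ℂ) (X.I r) (![om κ r, -om κ r] i) x)
      (pY y)) := by
  refine LinearMap.congr_fun₂ (f := tm.compr₂ (pZ ∘ₗ μ))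
    (g := ((tm ∘ₗ pX) + (tm ∘ₗ kop (κ : ℂ) (X.I r) (![om κ r, -om κ r] i)).compl₂ pY).compr₂ μ)
    (KVect.I_ext fun a z v hz hv => KVect.I_ext fun b w u hw hu => ?_) x y
  change pZ (μ (tmul (X.ia r a v) (Y.ia r b u))) = μ (tmul (pX (X.ia r a v)) (Y.ia r b u) +
    tmul (kop (κ : ℂ) (X.I r) (![om κ r, -om κ r] i) (X.ia r a v)) (pY (Y.ia r b u)))
  rw [hμ a b hv hu, hpZ _ (hm hv hu), hpX a hv, hpY b hu, kop_ia i a hz hv, Bim.smul_tmul,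
    Bim.smul_tmul, tmul_smul, map_add, map_smul, map_smul, map_smul, hμ _ _ (kX hv) hu,
    hμ _ _ hv (kY hu), hZ hz u hv, KVect.ia_add, KVect.ia_smul, smul_add, smul_comm c]
  -- It remains to compare the shifts in `A_r`.
  rw [mul_dl_left a b (sh_floor i hz hw), mul_dl_right a b (sh_floor' i hz hw)]

/-- The analogue of `KVect.mu_skewP` in the form needed for `f̄^±`. -/
theorem KVect.mu_skewN (hm : ∀ {z w : ℂ} {x : X.V} {y : Y.V}, X.k x = z • x → Y.k y = w • y →
      Z.k (m x y) = (z * w) • m x y)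
    (hμ : ∀ (a b : Alg) {z w : ℂ} {x : X.V} {y : Y.V}, X.k x = z • x → Y.k y = w • y →
      μ (tmul (X.ia r a x) (Y.ia r b y)) = Z.ia r (a * b * dl ⌊(lg z + lg w).re⌋) (m x y))
    (kX : ∀ {z : ℂ} {x : X.V}, X.k x = z • x → X.k (fX x) = (qw κ r i * z) • fX x)
    (kY : ∀ {z : ℂ} {y : Y.V}, Y.k y = z • y → Y.k (fY y) = (qw κ r i * z) • fY y)
    (hZ : ∀ {z : ℂ} (_ : z ≠ 0) {x : X.V} (y : Y.V), X.k x = z • x →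
      fZ (m x y) = m (fX x) y + (![z⁻¹, z] i)⁻¹ • m x (fY y)) (c : ℂ)
    (hpX : ∀ (a : Alg) {z : ℂ} (_ : z ≠ 0) {x : X.V}, X.k x = z • x →
      pX (X.ia r a x) = (![z⁻¹, z] i * c) • X.ia r (a * dl (sh κ r i z)) (fX x))
    (hpY : ∀ (a : Alg) {z : ℂ} (_ : z ≠ 0) {y : Y.V}, Y.k y = z • y →
      pY (Y.ia r a y) = (![z⁻¹, z] i * c) • Y.ia r (a * dl (sh κ r i z)) (fY y))
    (hpZ : ∀ (a : Alg) {z : ℂ} (_ : z ≠ 0) {v : Z.V}, Z.k v = z • v →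
      pZ (Z.ia r a v) = (![z⁻¹, z] i * c) • Z.ia r (a * dl (sh κ r i z)) (fZ v))
    (x : (X.I r).V) (y : (Y.I r).V) :
    pZ (μ (tmul x y)) = μ (tmul (pX x) (kop (κ : ℂ) (Y.I r) (![om κ r, -om κ r] i) y) +
      tmul x (pY y)) := by
  refine LinearMap.congr_fun₂ (f := tm.compr₂ (pZ ∘ₗ μ))
    (g := ((tm ∘ₗ pX).compl₂ (kop (κ : ℂ) (Y.I r) (![om κ r, -om κ r] i)) +
      tm.compl₂ pY).compr₂ μ)
    (KVect.I_ext fun a z v hz hv => KVect.I_ext fun b w u hw hu => ?_) x y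
  change pZ (μ (tmul (X.ia r a v) (Y.ia r b u))) = μ (tmul (pX (X.ia r a v))
    (kop (κ : ℂ) (Y.I r) (![om κ r, -om κ r] i) (Y.ia r b u)) +
      tmul (X.ia r a v) (pY (Y.ia r b u)))
  have e : ![(z * w)⁻¹, z * w] i = ![z⁻¹, z] i * ![w⁻¹, w] i := by
    fin_cases i <;> simp [mul_comm]
  have e0 : ![z⁻¹, z] i ≠ 0 := by fin_cases i <;> simp [hz]
  rw [hμ a b hv hu, hpZ _ (mul_ne_zero hz hw) (hm hv hu), hpX a hz hv, hpY b hw hu,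
    kop_ia i b hw hu, Bim.smul_tmul, tmul_smul, tmul_smul, map_add, map_smul, map_smul, map_smul,
    hμ _ _ (kX hv) hu, hμ _ _ hv (kY hu), hZ hz u hv, KVect.ia_add, KVect.ia_smul, smul_add,
    smul_smul, smul_smul, e]
  rw [mul_dl_left a b (sh_floor i hz hw), mul_dl_right a b (sh_floor' i hz hw),
    mul_assoc _ _ c, mul_comm (![z⁻¹, z] i), mul_inv_cancel_right₀ e0]
  congr 2
  ring

end Abstract

section RepTensor

variable {κ r ζ ξ : ℂˣ} {c : Fin 2 → ℂˣ}

/-- The element `v ⊗ w` of the tensor product of representations. -/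
def rt (V W : RepUq κ r) (v : (repKv κ r ζ ξ V).V) (w : (repKv κ r ζ ξ W).V) :
    (repKv κ r ζ ξ (V ⊗ W)).V := (v ⊗ₜ[ℂ] w : V.V ⊗[ℂ] W.V)

theorem k_rt (V W : RepUq κ r) {z z' : ℂ} {v : (repKv κ r ζ ξ V).V} {w : (repKv κ r ζ ξ W).V}
    (hv : (repKv κ r ζ ξ V).k v = z • v) (hw : (repKv κ r ζ ξ W).k w = z' • w) :
    (repKv κ r ζ ξ (V ⊗ W)).k (rt V W v w) = (z * z') • rt V W v w :=
  (repTens_k κ r ζ ξ V W _).symm.trans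
    (congrArg (repTens κ r ζ ξ V W) (KVect.tens_k hv hw))

theorem repMu_ia (V W : RepUq κ r) (a b : Alg) {z z' : ℂ} {v : (repKv κ r ζ ξ V).V}
    {w : (repKv κ r ζ ξ W).V} (hv : (repKv κ r ζ ξ V).k v = z • v)
    (hw : (repKv κ r ζ ξ W).k w = z' • w) :
    (repMu κ r ζ ξ c V W).lin (tmul ((repKv κ r ζ ξ V).ia r a v) ((repKv κ r ζ ξ W).ia r b w)) =
      (repKv κ r ζ ξ (V ⊗ W)).ia r (a * b * dl ⌊(lg z + lg z').re⌋) (rt V W v w) :=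
  (congrArg (KVect.mapI r (repTens κ r ζ ξ V W) (repTens_k κ r ζ ξ V W)).lin
    (KVect.mu_ia_eigen _ _ r a b hv hw)).trans
    (KVect.mapI_ia (X := (repKv κ r ζ ξ V).tens (repKv κ r ζ ξ W)) r (repTens κ r ζ ξ V W)
      (repTens_k κ r ζ ξ V W) _ _)

theorem rhoK_tensor (V W : RepUq κ r) {x k : Uq (qu κ r)}
    (h : Uq.comul (qu κ r) x = x ⊗ₜ 1 + k ⊗ₜ x) {s : ℂ} {v : (repKv κ r ζ ξ V).V}
    (w : (repKv κ r ζ ξ W).V) (hv : rhoK ζ ξ V k v = s • v) :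
    rhoK ζ ξ (V ⊗ W) x (rt V W v w) = rt V W (rhoK ζ ξ V x v) w + s • rt V W v (rhoK ζ ξ W x w) := by
  have h1 : rhoK ζ ξ (V ⊗ W) x (rt V W v w) =
      act₂ (rhoK ζ ξ V) (rhoK ζ ξ W) (Uq.comul (qu κ r) x) (v ⊗ₜ w) := rfl
  rw [h1, h, map_add, LinearMap.add_apply, act₂_tmul, act₂_tmul, map_one, hv,
    ← TensorProduct.smul_tmul']
  rfl

theorem fOp_rt (V W : RepUq κ r) (i : Fin 2) {z : ℂ} (hz : z ≠ 0) {v : (repKv κ r ζ ξ V).V}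
    (w : (repKv κ r ζ ξ W).V) (hv : (repKv κ r ζ ξ V).k v = z • v) :
    fOp ζ ξ (V ⊗ W) i (rt V W v w) =
      rt V W (fOp ζ ξ V i v) w + (![z⁻¹, z] i) • rt V W v (fOp ζ ξ W i w) := by
  refine rhoK_tensor V W (comul_f (qu κ r) ζ ξ i) w ?_
  fin_cases i
  · exact rhoK_K1 V hz hv
  · exact (LinearMap.congr_fun (rhoK_K0 V) v).trans hv

theorem fbOp_rt (V W : RepUq κ r) (i : Fin 2) {z : ℂ} (hz : z ≠ 0) {v : (repKv κ r ζ ξ V).V}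
    (w : (repKv κ r ζ ξ W).V) (hv : (repKv κ r ζ ξ V).k v = z • v) :
    fbOp ζ ξ (V ⊗ W) i (rt V W v w) =
      rt V W (fbOp ζ ξ V i v) w + (![z⁻¹, z] i)⁻¹ • rt V W v (fbOp ζ ξ W i w) := by
  refine rhoK_tensor V W (comul_fb (qu κ r) ζ ξ i) w ?_
  fin_cases i
  · exact ((LinearMap.congr_fun (rhoK_K0 V) v).trans hv).trans (by simp)
  · exact rhoK_K1 V hz hv

/-- The tensor structure commutes with the operators from `F^+`. -/
theorem pOp_repMu (V W : RepUq κ r) (i : Fin 2)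
    (x : ((repKv κ r ζ ξ V).I r).V) (y : ((repKv κ r ζ ξ W).I r).V) :
    pOp ζ ξ c (V ⊗ W) i ((repMu κ r ζ ξ c V W).lin (tmul x y)) =
      (repMu κ r ζ ξ c V W).lin (tmul (pOp ζ ξ c V i x) y +
        tmul (kop (κ : ℂ) ((repKv κ r ζ ξ V).I r) (![om κ r, -om κ r] i) x)
          (pOp ζ ξ c W i y)) :=
  KVect.mu_skewP (X := repKv κ r ζ ξ V) (Y := repKv κ r ζ ξ W) (Z := repKv κ r ζ ξ (V ⊗ W))
    (m := rt V W) (μ := (repMu κ r ζ ξ c V W).lin) (k_rt V W) (repMu_ia V W) (k_fOp V i) (k_fOp W i)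
    (fun hz _ y hx => fOp_rt V W i hz y hx) _ (fun a => pOp_ia V i a) (fun a => pOp_ia W i a)
    (fun a => pOp_ia (V ⊗ W) i a) x y

/-- The tensor structure commutes with the operators from `F^-`. -/
theorem nOp_repMu (V W : RepUq κ r) (i : Fin 2)
    (x : ((repKv κ r ζ ξ V).I r).V) (y : ((repKv κ r ζ ξ W).I r).V) :
    nOp ζ ξ c (V ⊗ W) i ((repMu κ r ζ ξ c V W).lin (tmul x y)) =
      (repMu κ r ζ ξ c V W).lin (tmul (nOp ζ ξ c V i x)
        (kop (κ : ℂ) ((repKv κ r ζ ξ W).I r) (![om κ r, -om κ r] i) y) +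
          tmul x (nOp ζ ξ c W i y)) :=
  KVect.mu_skewN (X := repKv κ r ζ ξ V) (Y := repKv κ r ζ ξ W) (Z := repKv κ r ζ ξ (V ⊗ W))
    (m := rt V W) (μ := (repMu κ r ζ ξ c V W).lin) (k_rt V W) (repMu_ia V W) (k_fbOp V i)
    (k_fbOp W i) (fun hz _ y hx => fbOp_rt V W i hz y hx) _ (fun a _ hz _ => nOp_ia V i a hz)
    (fun a _ hz _ => nOp_ia W i a hz) (fun a _ hz _ => nOp_ia (V ⊗ W) i a hz) x y

theorem repToDF_map_ia {V W : RepUq κ r} (f : V ⟶ W) (a : Alg) (v : (repKv κ r ζ ξ V).V) :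
    ((repToDF κ r ζ ξ c).map f).hom.lin ((repKv κ r ζ ξ V).ia r a v) =
      (repKv κ r ζ ξ W).ia r a (f.lin v) :=
  KVect.mapI_ia (X := repKv κ r ζ ξ V) (Y := repKv κ r ζ ξ W) r f.lin
    ((RepK.pullback (BF.toUq (qu κ r) ζ ξ) (BF.toUq_gen (qu κ r) ζ ξ (.K 0)) ⋙
      KMod.ofRep κ r).map f).comm_k a v

end RepTensor

section RepUnit

variable {κ r ζ ξ : ℂˣ} {c : Fin 2 → ℂˣ}

/-- The inverse of the map `repTens`. -/
def repTensInv (κ r ζ ξ : ℂˣ) (V W : RepUq κ r) :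
    (repKv κ r ζ ξ (V ⊗ W)).V →ₗ[ℂ] ((repKv κ r ζ ξ V).tens (repKv κ r ζ ξ W)).V :=
  (LinearMap.id : V.V ⊗[ℂ] W.V →ₗ[ℂ] V.V ⊗[ℂ] W.V)

theorem repTensInv_k (V W : RepUq κ r) (t : (repKv κ r ζ ξ (V ⊗ W)).V) :
    repTensInv κ r ζ ξ V W ((repKv κ r ζ ξ (V ⊗ W)).k t) =
      ((repKv κ r ζ ξ V).tens (repKv κ r ζ ξ W)).k (repTensInv κ r ζ ξ V W t) :=
  (congrArg (repTensInv κ r ζ ξ V W)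
    (repTens_k κ r ζ ξ V W (repTensInv κ r ζ ξ V W t))).symm

/-- The morphism `𝓘(V ⊗ W) ⟶ 𝓘(V ⊗ W)` induced by the identity, where `k` acts on the source through
the coproduct and on the target as `k ⊗ k`, and its inverse. -/
def repTensIso (κ r ζ ξ : ℂˣ) (V W : RepUq κ r) :
    ((repKv κ r ζ ξ V).tens (repKv κ r ζ ξ W)).I r ≅ (repKv κ r ζ ξ (V ⊗ W)).I r where
  hom := KVect.mapI r (repTens κ r ζ ξ V W) (repTens_k κ r ζ ξ V W)
  inv := KVect.mapI r (repTensInv κ r ζ ξ V W) (repTensInv_k V W)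
  hom_inv_id := ihom_ext fun a v => by
    rw [comp_lin, LinearMap.comp_apply, KVect.mapI_ia, KVect.mapI_ia]
    rfl
  inv_hom_id := ihom_ext fun a v => by
    rw [comp_lin, LinearMap.comp_apply, KVect.mapI_ia, KVect.mapI_ia]
    rfl

/-- The tensor structure on the bimodules of representations. -/
def repMuIso (κ r ζ ξ : ℂˣ) (c : Fin 2 → ℂˣ) (V W : RepUq κ r) :
    ((repToDF κ r ζ ξ c).obj V).X ⊗ ((repToDF κ r ζ ξ c).obj W).X ≅
      ((repToDF κ r ζ ξ c).obj (V ⊗ W)).X :=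
  (repKv κ r ζ ξ V).muIso (repKv κ r ζ ξ W) r ≪≫ repTensIso κ r ζ ξ V W

/-- The basis vector of the trivial representation. -/
def rOne (κ r ζ ξ : ℂˣ) : (repKv κ r ζ ξ (𝟙_ (RepUq κ r))).V := (1 : ℂ)

theorem rhoK_rOne (x : Uq (qu κ r)) :
    rhoK ζ ξ (𝟙_ (RepUq κ r)) x (rOne κ r ζ ξ) = Uq.counit (qu κ r) x • rOne κ r ζ ξ := rfl

theorem fOp_rOne (i : Fin 2) : fOp ζ ξ (𝟙_ (RepUq κ r)) i (rOne κ r ζ ξ) = 0 := by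
  rw [fOp, rhoK_rOne, counit_f, zero_smul]

theorem fbOp_rOne (i : Fin 2) : fbOp ζ ξ (𝟙_ (RepUq κ r)) i (rOne κ r ζ ξ) = 0 := by
  rw [fbOp, rhoK_rOne, counit_fb, zero_smul]

theorem k_rOne : (repKv κ r ζ ξ (𝟙_ (RepUq κ r))).k (rOne κ r ζ ξ) = (1 : ℂ) • rOne κ r ζ ξ := by
  rw [← rhoK_K0, rhoK_rOne, Uq.counit_K]

theorem rOne_ext {M : Type} [AddCommGroup M] [Module ℂ M]
    {f g : (repKv κ r ζ ξ (𝟙_ (RepUq κ r))).V →ₗ[ℂ] M}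
    (h : f (rOne κ r ζ ξ) = g (rOne κ r ζ ξ)) : f = g :=
  LinearMap.ext_ring (R := ℂ) (σ := RingHom.id ℂ) h

/-- The morphism `a ↦ a ⊗ 1` from `A_r` to the bimodule of the trivial representation. -/
def repEps (κ r ζ ξ : ℂˣ) : 𝟙_ (Bim (r : ℂ)) ⟶ (repKv κ r ζ ξ (𝟙_ (RepUq κ r))).I r where
  lin := (aa r 0 ((repKv κ r ζ ξ (𝟙_ (RepUq κ r))).wt r)).flip
    ((repKv κ r ζ ξ (𝟙_ (RepUq κ r))).el r (rOne κ r ζ ξ))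
  comm_h t := un_ind (P := fun t => (aa r 0 ((repKv κ r ζ ξ (𝟙_ (RepUq κ r))).wt r)).flip
    ((repKv κ r ζ ξ (𝟙_ (RepUq κ r))).el r (rOne κ r ζ ξ)) ((𝟙_ (Bim (r : ℂ))).h t) =
      ((repKv κ r ζ ξ (𝟙_ (RepUq κ r))).I r).h ((aa r 0
        ((repKv κ r ζ ξ (𝟙_ (RepUq κ r))).wt r)).flip
          ((repKv κ r ζ ξ (𝟙_ (RepUq κ r))).el r (rOne κ r ζ ξ)) t)) (fun a => by
      have h0 := KVect.wt_h (repKv κ r ζ ξ (𝟙_ (RepUq κ r))) r k_rOne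
      rw [lg_one, mul_zero] at h0
      refine Eq.symm ((h_aa a h0).trans ?_)
      rw [zero_smul, add_zero]
      rfl) t
  comm_l a t := un_ind (P := fun t => (aa r 0 ((repKv κ r ζ ξ (𝟙_ (RepUq κ r))).wt r)).flip
    ((repKv κ r ζ ξ (𝟙_ (RepUq κ r))).el r (rOne κ r ζ ξ)) ((𝟙_ (Bim (r : ℂ))).lact a t) =
      ((repKv κ r ζ ξ (𝟙_ (RepUq κ r))).I r).lact a ((aa r 0
        ((repKv κ r ζ ξ (𝟙_ (RepUq κ r))).wt r)).flip
          ((repKv κ r ζ ξ (𝟙_ (RepUq κ r))).el r (rOne κ r ζ ξ)) t))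
    (fun b => (KVect.lact_ia a b (rOne κ r ζ ξ)).symm) t
  comm_r a t := un_ind (P := fun t => (aa r 0 ((repKv κ r ζ ξ (𝟙_ (RepUq κ r))).wt r)).flip
    ((repKv κ r ζ ξ (𝟙_ (RepUq κ r))).el r (rOne κ r ζ ξ)) ((𝟙_ (Bim (r : ℂ))).ract a t) =
      ((repKv κ r ζ ξ (𝟙_ (RepUq κ r))).I r).ract a ((aa r 0
        ((repKv κ r ζ ξ (𝟙_ (RepUq κ r))).wt r)).flip
          ((repKv κ r ζ ξ (𝟙_ (RepUq κ r))).el r (rOne κ r ζ ξ)) t))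
    (fun b => (KVect.ract_ia a b (rOne κ r ζ ξ)).symm) t

theorem repEps_un (a : Alg) : (repEps κ r ζ ξ).lin (un a) =
    (repKv κ r ζ ξ (𝟙_ (RepUq κ r))).ia r a (rOne κ r ζ ξ) := rfl

/-- The inverse of `repEps`. -/
def repEpsInv (κ r ζ ξ : ℂˣ) :
    ((repKv κ r ζ ξ (𝟙_ (RepUq κ r))).I r).V →ₗ[ℂ] (𝟙_ (Bim (r : ℂ))).V :=
  alift (E := (repKv κ r ζ ξ (𝟙_ (RepUq κ r))).wt r) (X := 𝟙_ (Bim (r : ℂ)))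
    (LinearMap.toSpanSingleton ℂ (𝟙_ (Bim (r : ℂ))).V (un 1))

theorem repEpsInv_ia (a : Alg) : repEpsInv κ r ζ ξ
    ((repKv κ r ζ ξ (𝟙_ (RepUq κ r))).ia r a (rOne κ r ζ ξ)) = un a := by
  have h : repEpsInv κ r ζ ξ ((repKv κ r ζ ξ (𝟙_ (RepUq κ r))).ia r a (rOne κ r ζ ξ)) =
    (𝟙_ (Bim (r : ℂ))).lact a ((1 : ℂ) • un 1) := alift_aa _ _ _
  rw [h, one_smul, lact_un, mul_one]

/-- The bimodule of the trivial representation is the unit object. -/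
def repEpsIso (κ r ζ ξ : ℂˣ) : 𝟙_ (Bim (r : ℂ)) ≅ (repKv κ r ζ ξ (𝟙_ (RepUq κ r))).I r :=
  isoMk (repEps κ r ζ ξ) (repEpsInv κ r ζ ξ)
    (LinearMap.ext fun t => un_ind (P := fun t => repEpsInv κ r ζ ξ ((repEps κ r ζ ξ).lin t) = t)
      (fun a => repEpsInv_ia a) t)
    (LinearMap.ext fun t => by
      induction t using KVect.I_ind with
      | h0 => simp
      | h2 t s ht hs => simp only [map_add, ht, hs]
      | h1 a v =>
        exact LinearMap.congr_fun
          (f := ((repEps κ r ζ ξ).lin ∘ₗ repEpsInv κ r ζ ξ) ∘ₗ KVect.iaLin _ r a)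
          (g := KVect.iaLin _ r a) (rOne_ext (congrArg (repEps κ r ζ ξ).lin (repEpsInv_ia a))) v)

theorem pOp_repEps (i : Fin 2) (t : (𝟙_ (Bim (r : ℂ))).V) :
    pOp ζ ξ c (𝟙_ (RepUq κ r)) i ((repEps κ r ζ ξ).lin t) = 0 :=
  un_ind (P := fun t => pOp ζ ξ c (𝟙_ (RepUq κ r)) i ((repEps κ r ζ ξ).lin t) = 0) (fun a => by
    rw [repEps_un, pOp_ia _ i a k_rOne, fOp_rOne]
    exact (congrArg _ (map_zero (KVect.iaLin _ r _))).trans (smul_zero _)) t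

theorem nOp_repEps (i : Fin 2) (t : (𝟙_ (Bim (r : ℂ))).V) :
    nOp ζ ξ c (𝟙_ (RepUq κ r)) i ((repEps κ r ζ ξ).lin t) = 0 :=
  un_ind (P := fun t => nOp ζ ξ c (𝟙_ (RepUq κ r)) i ((repEps κ r ζ ξ).lin t) = 0) (fun a => by
    rw [repEps_un, nOp_ia _ i a one_ne_zero k_rOne, fbOp_rOne]
    exact (congrArg _ (map_zero (KVect.iaLin _ r _))).trans (smul_zero _)) t

end RepUnit

/-! ### Coherence of the tensor structure on bimodules -/

section Coherence

variable {κ r ζ ξ : ℂˣ} {c : Fin 2 → ℂˣ}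

/-- The homomorphism of bimodules induced by a homomorphism of representations. -/
def repMap (ζ ξ : ℂˣ) (c : Fin 2 → ℂˣ) {V W : RepUq κ r} (f : V ⟶ W) :
    (repKv κ r ζ ξ V).I r ⟶ (repKv κ r ζ ξ W).I r := ((repToDF κ r ζ ξ c).map f).hom

theorem repMap_ia {V W : RepUq κ r} (f : V ⟶ W) (a : Alg) (v : (repKv κ r ζ ξ V).V) :
    (repMap ζ ξ c f).lin ((repKv κ r ζ ξ V).ia r a v) =
      (repKv κ r ζ ξ W).ia r a (f.lin v) := repToDF_map_ia f a v

theorem repMap_id (V : RepUq κ r) : repMap ζ ξ c (𝟙 V) = 𝟙 ((repKv κ r ζ ξ V).I r) :=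
  congrArg DF.Hom.hom ((repToDF κ r ζ ξ c).map_id V)

/-- The tensor structure, as a homomorphism between the bimodules `𝓘(V)`. -/
def repMu' (ζ ξ : ℂˣ) (c : Fin 2 → ℂˣ) (V W : RepUq κ r) :
    (repKv κ r ζ ξ V).I r ⊗ (repKv κ r ζ ξ W).I r ⟶ (repKv κ r ζ ξ (V ⊗ W)).I r :=
  repMu κ r ζ ξ c V W

theorem repMu'_ia (V W : RepUq κ r) (a b : Alg) {z z' : ℂ} {v : (repKv κ r ζ ξ V).V}
    {w : (repKv κ r ζ ξ W).V} (hv : (repKv κ r ζ ξ V).k v = z • v)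
    (hw : (repKv κ r ζ ξ W).k w = z' • w) :
    (repMu' ζ ξ c V W).lin (tmul ((repKv κ r ζ ξ V).ia r a v) ((repKv κ r ζ ξ W).ia r b w)) =
      (repKv κ r ζ ξ (V ⊗ W)).ia r (a * b * dl ⌊(lg z + lg z').re⌋) (rt V W v w) :=
  repMu_ia V W a b hv hw

theorem rep_map_k {V W : RepUq κ r} (f : V ⟶ W) {z : ℂ} {v : (repKv κ r ζ ξ V).V}
    (hv : (repKv κ r ζ ξ V).k v = z • v) :
    (repKv κ r ζ ξ W).k (f.lin v) = z • (f.lin v : (repKv κ r ζ ξ W).V) := by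
  rw [← rhoK_K0] at hv ⊢
  exact (f.comm _ v).symm.trans ((congrArg f.lin hv).trans (map_smul f.lin z v))

theorem hom_eigen_ext {X Y : KVect} {Z : Bim (r : ℂ)} {f g : X.I r ⊗ Y.I r ⟶ Z}
    (h : ∀ (a b : Alg) (z w : ℂ) (x : X.V) (y : Y.V), z ≠ 0 →
      w ≠ 0 → X.k x = z • x → Y.k y = w • y → f.lin (tmul (X.ia r a x) (Y.ia r b y)) =
        g.lin (tmul (X.ia r a x) (Y.ia r b y))) : f = g := hom_ext (KVect.I_tens_ext h)

theorem repMu_natural {V V' W W' : RepUq κ r} (f : V ⟶ V') (g : W ⟶ W') :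
    (repMap ζ ξ c f ⊗ₘ repMap ζ ξ c g) ≫ repMu' ζ ξ c V' W' =
      repMu' ζ ξ c V W ≫ repMap ζ ξ c (f ⊗ₘ g) :=
  hom_eigen_ext fun a b z w v u hz hw hv hu => by
    rw [comp_apply', comp_apply', tensorHom_tmul, repMap_ia, repMap_ia,
      repMu'_ia V' W' a b (rep_map_k f hv) (rep_map_k g hu), repMu'_ia V W a b hv hu, repMap_ia]
    rfl

/-- Associativity of the tensor structure, by the cocycle identity `floor_assoc`. -/
theorem repMu_assoc (V W U : RepUq κ r) :
    repMu' ζ ξ c V W ▷ (repKv κ r ζ ξ U).I r ≫ repMu' ζ ξ c (V ⊗ W) U ≫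
      repMap ζ ξ c (α_ V W U).hom =
    (α_ _ _ _).hom ≫ (repKv κ r ζ ξ V).I r ◁ repMu' ζ ξ c W U ≫ repMu' ζ ξ c V (W ⊗ U) :=
  hom_ext (KVect.I_tens_ext₃ fun a b d z w u x y v hz hw hu hx hy hv => by
    have e : rt V (W ⊗ U) x (rt W U y v) =
      ((α_ V W U).hom.lin (rt (V ⊗ W) U (rt V W x y) v) : (repKv κ r ζ ξ (V ⊗ (W ⊗ U))).V) := rfl
    change (repMu' ζ ξ c V W ▷ (repKv κ r ζ ξ U).I r ≫ repMu' ζ ξ c (V ⊗ W) U ≫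
      repMap ζ ξ c (α_ V W U).hom).lin _ = ((α_ _ _ _).hom ≫ (repKv κ r ζ ξ V).I r ◁
        repMu' ζ ξ c W U ≫ repMu' ζ ξ c V (W ⊗ U)).lin _
    rw [comp_apply', comp_apply', comp_apply', comp_apply', whiskerRight_tmul, associator_tmul,
      whiskerLeft_tmul, repMu'_ia V W a b hx hy, repMu'_ia W U b d hy hv,
      repMu'_ia (V ⊗ W) U _ d (k_rt V W hx hy) hv, repMu'_ia V (W ⊗ U) a _ hx (k_rt W U hy hv),
      repMap_ia, e]
    congr 1
    rw [mul_right_comm (a * b), mul_assoc (a * b * d), dl_mul, floor_assoc hz hw hu, ← dl_mul]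
    simp only [mul_assoc])

theorem repMu_left_unit (V : RepUq κ r) : (λ_ ((repKv κ r ζ ξ V).I r)).hom =
    repEps κ r ζ ξ ▷ (repKv κ r ζ ξ V).I r ≫ repMu' ζ ξ c (𝟙_ _) V ≫ repMap ζ ξ c (λ_ V).hom :=
  un_ext_left fun x => LinearMap.congr_fun
    (f := (λ_ ((repKv κ r ζ ξ V).I r)).hom.lin ∘ₗ tm (un 1))
    (g := (repEps κ r ζ ξ ▷ (repKv κ r ζ ξ V).I r ≫ repMu' ζ ξ c (𝟙_ _) V ≫
      repMap ζ ξ c (λ_ V).hom).lin ∘ₗ tm (un 1)) (KVect.I_ext fun a z v hz hv => by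
    have e : (repKv κ r ζ ξ V).ia r a ((λ_ V).hom.lin (rt (𝟙_ _) V (rOne κ r ζ ξ) v)) =
      (repKv κ r ζ ξ V).ia r a v := congrArg _ (one_smul ℂ v)
    change (λ_ ((repKv κ r ζ ξ V).I r)).hom.lin (tmul (un 1) ((repKv κ r ζ ξ V).ia r a v)) =
      (repEps κ r ζ ξ ▷ (repKv κ r ζ ξ V).I r ≫ repMu' ζ ξ c (𝟙_ _) V ≫
        repMap ζ ξ c (λ_ V).hom).lin (tmul (un 1) ((repKv κ r ζ ξ V).ia r a v))
    rw [comp_apply', comp_apply', whiskerRight_tmul, leftUnitor_tmul, map_one, repEps_un,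
      repMu'_ia (𝟙_ _) V 1 a k_rOne hv, repMap_ia, lg_one, zero_add, floor_lg, dl_zero, mul_one,
      one_mul, e]
    rfl) x

theorem repMu_right_unit (V : RepUq κ r) : (ρ_ ((repKv κ r ζ ξ V).I r)).hom =
    (repKv κ r ζ ξ V).I r ◁ repEps κ r ζ ξ ≫ repMu' ζ ξ c V (𝟙_ _) ≫ repMap ζ ξ c (ρ_ V).hom :=
  un_ext_right fun x => LinearMap.congr_fun
    (f := (ρ_ ((repKv κ r ζ ξ V).I r)).hom.lin ∘ₗ tm.flip (un 1))
    (g := ((repKv κ r ζ ξ V).I r ◁ repEps κ r ζ ξ ≫ repMu' ζ ξ c V (𝟙_ _) ≫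
      repMap ζ ξ c (ρ_ V).hom).lin ∘ₗ tm.flip (un 1)) (KVect.I_ext fun a z v hz hv => by
    have e : (repKv κ r ζ ξ V).ia r a ((ρ_ V).hom.lin (rt V (𝟙_ _) v (rOne κ r ζ ξ))) =
      (repKv κ r ζ ξ V).ia r a v := congrArg _ (one_smul ℂ v)
    change (ρ_ ((repKv κ r ζ ξ V).I r)).hom.lin (tmul ((repKv κ r ζ ξ V).ia r a v) (un 1)) =
      ((repKv κ r ζ ξ V).I r ◁ repEps κ r ζ ξ ≫ repMu' ζ ξ c V (𝟙_ _) ≫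
        repMap ζ ξ c (ρ_ V).hom).lin (tmul ((repKv κ r ζ ξ V).ia r a v) (un 1))
    rw [comp_apply', comp_apply', whiskerLeft_tmul, rightUnitor_tmul, map_one, repEps_un,
      repMu'_ia V (𝟙_ _) a 1 hv k_rOne, repMap_ia, lg_one, add_zero, floor_lg, dl_zero, mul_one,
      mul_one, e]
    rfl) x

end Coherence

/-! ### The functor from representations to Yetter-Drinfeld modules -/

section RepFunctor

variable {κ r ζ ξ : ℂˣ} {A : TensorAlg (Fp κ r) braidOver} {B : TensorAlg (Fm κ r) braidUnder}
  {ρ : A.T.1 ⊗ B.T.1 ⟶ 𝟙_ (Bim (r : ℂ))}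
  (hρ : ∀ w u, ρ.lin (tmul (wa (κ := κ) (ω := om κ r) A w) (wb (κ := κ) (ω := om κ r) B u)) =
    pair κ (om κ r) (formMat ζ ξ) w u • un 1)
  (hq : qq κ r ^ 2 ≠ 1) (c : Fin 2 → ℂˣ)

/-- The inverse of the restriction functor, for the quantum loop algebra. -/
def repS : (DF.CommCond (P := Fp κ r) (M := Fm κ r) (pairing ζ ξ κ r)).FullSubcategory ⥤
    YD A B ρ := sFunctor (exp_om κ r) (formMat_wt _) hρ pairing_ff

/-- The functor from representations of the quantum loop algebra to Yetter-Drinfeld modules. -/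
def repYD : RepUq κ r ⥤ YD A B ρ :=
  ObjectProperty.lift _ (repToDF κ r ζ ξ c) (commCond_repToDF hq) ⋙ repS hρ

theorem actP_repYD (V : RepUq κ r) (i : Fin 2) :
    actP A ((repYD hρ hq c).obj V).mp i = pOp ζ ξ c V i :=
  actP_sFunctor (exp_om κ r) (formMat_wt _) hρ pairing_ff
    ((ObjectProperty.lift _ (repToDF κ r ζ ξ c) (commCond_repToDF hq)).obj V) i

theorem actN_repYD (V : RepUq κ r) (i : Fin 2) :
    actN B ((repYD hρ hq c).obj V).mm i = nOp ζ ξ c V i :=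
  actN_sFunctor (exp_om κ r) (formMat_wt _) hρ pairing_ff
    ((ObjectProperty.lift _ (repToDF κ r ζ ξ c) (commCond_repToDF hq)).obj V) i

/-- The monoidal category of Yetter-Drinfeld modules, for the quantum loop algebra. -/
@[reducible]
def repMonoidal : MonoidalCategory (YD A B ρ) := ydMonoidal (exp_om κ r) (formMat_wt _) hρ

/-- The tensor structure of the functor `repYD`. -/
def repYDμ (V W : RepUq κ r) : letI := repMonoidal hρ
    (repYD hρ hq c).obj V ⊗ (repYD hρ hq c).obj W ≅ (repYD hρ hq c).obj (V ⊗ W) :=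
  ydIso (exp_om κ r)
    (Y := ydTensor (exp_om κ r) (formMat_wt _) hρ ((repYD hρ hq c).obj V) ((repYD hρ hq c).obj W))
    (Y' := (repYD hρ hq c).obj (V ⊗ W)) (repMuIso κ r ζ ξ c V W)
    (fun i t => by
      rw [actP_repYD]
      exact LinearMap.congr_fun (f := (repMu' ζ ξ c V W).lin ∘ₗ actP A
          (YD.tensP ((repYD hρ hq c).obj V) ((repYD hρ hq c).obj W)) i)
        (g := pOp ζ ξ c (V ⊗ W) i ∘ₗ (repMu' ζ ξ c V W).lin) (lin_ext fun x y => by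
          have h := actP_tensP (exp_om κ r) ((repYD hρ hq c).obj V) ((repYD hρ hq c).obj W) i x y
          rw [actP_repYD, actP_repYD] at h
          exact (congrArg (repMu' ζ ξ c V W).lin h).trans (pOp_repMu V W i x y).symm) t)
    (fun i t => by
      rw [actN_repYD]
      exact LinearMap.congr_fun (f := (repMu' ζ ξ c V W).lin ∘ₗ actN B
          (YD.tensM ((repYD hρ hq c).obj V) ((repYD hρ hq c).obj W)) i)
        (g := nOp ζ ξ c (V ⊗ W) i ∘ₗ (repMu' ζ ξ c V W).lin) (lin_ext fun x y => by
          have h := actN_tensM (exp_om κ r) ((repYD hρ hq c).obj V) ((repYD hρ hq c).obj W) i x y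
          rw [actN_repYD, actN_repYD] at h
          exact (congrArg (repMu' ζ ξ c V W).lin h).trans (nOp_repMu V W i x y).symm) t)

/-- The unit isomorphism of the functor `repYD`. -/
def repYDε : letI := repMonoidal hρ
    𝟙_ (YD A B ρ) ≅ (repYD hρ hq c).obj (𝟙_ (RepUq κ r)) :=
  ydIso (exp_om κ r) (Y := ydUnit (exp_om κ r) (formMat_wt _) hρ)
    (Y' := (repYD hρ hq c).obj (𝟙_ (RepUq κ r))) (repEpsIso κ r ζ ξ)
    (fun i t => by
      rw [actP_repYD]
      exact (congrArg (repEps κ r ζ ξ).lin (actP_unit i t)).trans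
        ((map_zero _).trans (pOp_repEps i t).symm))
    (fun i t => by
      rw [actN_repYD]
      exact (congrArg (repEps κ r ζ ξ).lin (actN_unit i t)).trans
        ((map_zero _).trans (nOp_repEps i t).symm))

/-- The monoidal structure of the functor `repYD`. -/
def repYDCore : letI := repMonoidal hρ
    (repYD hρ hq c).CoreMonoidal :=
  letI := repMonoidal hρ
  { εIso := repYDε hρ hq c
    μIso := repYDμ hρ hq c
    μIso_hom_natural_left := fun {V V'} f W => YD.Hom.ext (by
      have h := repMu_natural (ζ := ζ) (ξ := ξ) (c := c) f (𝟙 W)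
      rw [repMap_id] at h
      exact h)
    μIso_hom_natural_right := fun {W W'} V f => YD.Hom.ext (by
      have h := repMu_natural (ζ := ζ) (ξ := ξ) (c := c) (𝟙 V) f
      rw [repMap_id] at h
      exact h)
    associativity := fun V W U => YD.Hom.ext (by
      have h := repMu_assoc (ζ := ζ) (ξ := ξ) (c := c) V W U
      rw [← MonoidalCategory.tensorHom_id, ← MonoidalCategory.id_tensorHom] at h
      exact h)
    left_unitality := fun V => YD.Hom.ext (by
      have h := repMu_left_unit (ζ := ζ) (ξ := ξ) (c := c) V
      rw [← MonoidalCategory.tensorHom_id] at h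
      exact h)
    right_unitality := fun V => YD.Hom.ext (by
      have h := repMu_right_unit (ζ := ζ) (ξ := ξ) (c := c) V
      rw [← MonoidalCategory.id_tensorHom] at h
      exact h) }

/-- A homomorphism of representations can be recovered from its action on the elements `1 ⊗ v`. -/
theorem repMap_injective {V W : RepUq κ r} {f g : V ⟶ W} (h : repMap ζ ξ c f = repMap ζ ξ c g) :
    f = g :=
  RepK.hom_ext (LinearMap.ext fun v => KVect.ia_one_injective (X := repKv κ r ζ ξ W) (r := r) (by
    have h1 := congrArg (fun f => f.lin ((repKv κ r ζ ξ V).ia r 1 v)) h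
    exact (repMap_ia f 1 v).symm.trans (h1.trans (repMap_ia g 1 v))))

theorem faithful_repYD : (repYD hρ hq c).Faithful :=
  ⟨fun h => repMap_injective (c := c) (congrArg YD.Hom.hom h)⟩

end RepFunctor

/-! ### Fullness -/

section Generators

variable (q ζ ξ : ℂˣ)

/-- The image of `ψ` generates the quantum loop algebra. -/
theorem Uq.subalgebra_eq_top (hq : (q : ℂ) ^ 2 ≠ 1) (S : Subalgebra ℂ (Uq q))
    (hK : ∀ i, Uq.gen q (.K i) ∈ S) (hf : ∀ i, BF.toUqGen q ζ ξ (.f i) ∈ S)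
    (hfb : ∀ i, BF.toUqGen q ζ ξ (.fb i) ∈ S) (x : Uq q) : x ∈ S := by
  have h01 : Uq.gen q (.K 0) * Uq.gen q (.K 1) = 1 := (Uq.rels q).inv 0
  have h10 : Uq.gen q (.K 1) * Uq.gen q (.K 0) = 1 := (Uq.rels q).inv 1
  have hs (z : ℂˣ) : (z : ℂ) * ((q - (q : ℂ)⁻¹) / (q : ℂ) ^ 2) ≠ 0 :=
    mul_ne_zero z.ne_zero (div_ne_zero (q_sub_inv_ne_zero q hq) (pow_ne_zero 2 q.ne_zero))
  have of_smul {s : ℂ} (hs : s ≠ 0) {y : Uq q} (h : s • y ∈ S) : y ∈ S := by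
    rw [← inv_smul_smul₀ hs y]
    exact S.smul_mem h _
  have hgen (g : UGen) : Uq.gen q g ∈ S := by
    match g with
    | .K i => exact hK i
    | .ep 0 =>
      rw [← mul_one (Uq.gen q (.ep 0)), ← h10, ← mul_assoc]
      exact S.mul_mem (hf 0) (hK 0)
    | .ep 1 =>
      rw [← mul_one (Uq.gen q (.ep 1)), ← h01, ← mul_assoc]
      exact S.mul_mem (of_smul (hs ξ) (hf 1)) (hK 1)
    | .em 0 => exact of_smul (hs ζ) (hfb 1)
    | .em 1 => exact hfb 0
  obtain ⟨y, rfl⟩ := RingQuot.mkAlgHom_surjective ℂ (URel q) x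
  induction y using FreeAlgebra.induction with
  | grade0 s => exact (AlgHom.commutes (RingQuot.mkAlgHom ℂ (URel q)) s) ▸ S.algebraMap_mem s
  | grade1 g => exact hgen g
  | mul a b ha hb => rw [map_mul]; exact S.mul_mem ha hb
  | add a b ha hb => rw [map_add]; exact S.add_mem ha hb

end Generators

section Full

variable {κ r ζ ξ : ℂˣ}

theorem KVect.ia_dl_injective {X : KVect} {r : ℂ} {n : ℤ} {v w : X.V}
    (h : X.ia r (dl n) v = X.ia r (dl n) w) : v = w := by
  refine X.ia_one_injective (r := r) ?_
  rw [← dl_zero, ← neg_add_cancel n, ← dl_mul, ← KVect.lact_ia, h, KVect.lact_ia]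

/-- The operator `k` on `X`, expressed in terms of `h` on `𝓘(X)`. -/
theorem kop_ia_one {X : KVect} (a : Alg) (v : X.V) :
    kop (κ : ℂ) (X.I r) (![om κ r, -om κ r] 1) (X.ia r a v) = X.ia r a (X.k v) :=
  LinearMap.congr_fun (f := kop (κ : ℂ) (X.I r) (![om κ r, -om κ r] 1) ∘ₗ X.iaLin r a)
    (g := X.iaLin r a ∘ₗ X.k) (KVect.ext_eigen fun z v hz hv => by
      change kop (κ : ℂ) (X.I r) (![om κ r, -om κ r] 1) (X.ia r a v) = X.iaLin r a (X.k v)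
      rw [kop_ia 1 a hz hv, hv, map_smul]
      rfl) v

/-- The linear map `f` with `φ(1 ⊗ v) = 1 ⊗ f(v)`, for a homomorphism `φ` of bimodules. -/
def KVect.low {X Y : KVect} {r : ℂ} (φ : X.I r ⟶ Y.I r) : X.V →ₗ[ℂ] Y.V :=
  Y.proj r ∘ₗ φ.lin ∘ₗ X.iaLin r 1

/-- A homomorphism `𝓘(X) → 𝓘(Y)` preserves the weights, so that it maps `1 ⊗ v` to an element of
the form `1 ⊗ w`, by `KVect.eq_ia_one`. -/
theorem KVect.lin_ia {X Y : KVect} (φ : X.I r ⟶ Y.I r) (a : Alg) (v : X.V) :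
    φ.lin (X.ia r a v) = Y.ia r a (KVect.low φ v) := by
  have h : φ.lin ∘ₗ X.iaLin r 1 = Y.iaLin r 1 ∘ₗ KVect.low φ :=
    KVect.ext_eigen fun z v hz hv => Y.eq_ia_one r.ne_zero (z := z) (by
      change (Y.I r).h (φ.lin (X.ia r 1 v)) = (r * lg z) • φ.lin (X.ia r 1 v)
      rw [← φ.comm_h, X.h_ia_one hv, map_smul])
  rw [KVect.ia_eq a v, φ.comm_l, KVect.ia_eq a (KVect.low φ v)]
  exact congrArg _ (LinearMap.congr_fun h v)

theorem KVect.low_k {X Y : KVect} (φ : X.I r ⟶ Y.I r) (v : X.V) :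
    KVect.low φ (X.k v) = Y.k (KVect.low φ v) := by
  refine Y.ia_one_injective (r := r) ?_
  rw [← kop_ia_one (κ := 1), ← KVect.lin_ia, ← KVect.lin_ia, ← kop_ia_one (κ := 1), kop_hom]

end Full

section RepFunctor

variable {κ r ζ ξ : ℂˣ} {c : Fin 2 → ℂˣ}

theorem low_fOp {V W : RepUq κ r} (φ : (repKv κ r ζ ξ V).I r ⟶ (repKv κ r ζ ξ W).I r) (i : Fin 2)
    (h : ∀ x, φ.lin (pOp ζ ξ c V i x) = pOp ζ ξ c W i (φ.lin x)) (v : (repKv κ r ζ ξ V).V) :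
    KVect.low φ (fOp ζ ξ V i v) = fOp ζ ξ W i (KVect.low φ v) :=
  LinearMap.congr_fun (f := KVect.low φ ∘ₗ fOp ζ ξ V i) (g := fOp ζ ξ W i ∘ₗ KVect.low φ)
    (KVect.ext_eigen fun z v _ hv => by
      have hw : (repKv κ r ζ ξ W).k (KVect.low φ v) = z • KVect.low φ v := by
        rw [← KVect.low_k, hv, map_smul]
      have h1 := h ((repKv κ r ζ ξ V).ia r 1 v)
      rw [pOp_ia V i 1 hv, map_smul, KVect.lin_ia, KVect.lin_ia, pOp_ia W i 1 hw, one_mul] at h1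
      exact KVect.ia_dl_injective (smul_right_injective _ (inv_ne_zero (c i).ne_zero) h1)) v

theorem low_fbOp {V W : RepUq κ r} (φ : (repKv κ r ζ ξ V).I r ⟶ (repKv κ r ζ ξ W).I r) (i : Fin 2)
    (h : ∀ x, φ.lin (nOp ζ ξ c V i x) = nOp ζ ξ c W i (φ.lin x)) (v : (repKv κ r ζ ξ V).V) :
    KVect.low φ (fbOp ζ ξ V i v) = fbOp ζ ξ W i (KVect.low φ v) :=
  LinearMap.congr_fun (f := KVect.low φ ∘ₗ fbOp ζ ξ V i) (g := fbOp ζ ξ W i ∘ₗ KVect.low φ)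
    (KVect.ext_eigen fun z v hz hv => by
      have hw : (repKv κ r ζ ξ W).k (KVect.low φ v) = z • KVect.low φ v := by
        rw [← KVect.low_k, hv, map_smul]
      have h1 := h ((repKv κ r ζ ξ V).ia r 1 v)
      have hc : ![z⁻¹, z] i * ![(c 1 : ℂ), c 0] i ≠ 0 := by fin_cases i <;> simp [hz]
      rw [nOp_ia V i 1 hz hv, map_smul, KVect.lin_ia, KVect.lin_ia, nOp_ia W i 1 hz hw,
        one_mul] at h1
      exact KVect.ia_dl_injective (smul_right_injective _ hc h1)) v

/-- A homomorphism of bimodules which commutes with the operators comes from a homomorphism of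
representations. -/
theorem exists_repMap (hq : qq κ r ^ 2 ≠ 1) {V W : RepUq κ r}
    (φ : (repKv κ r ζ ξ V).I r ⟶ (repKv κ r ζ ξ W).I r)
    (hp : ∀ i x, φ.lin (pOp ζ ξ c V i x) = pOp ζ ξ c W i (φ.lin x))
    (hn : ∀ i x, φ.lin (nOp ζ ξ c V i x) = nOp ζ ξ c W i (φ.lin x)) :
    ∃ f : V ⟶ W, repMap ζ ξ c f = φ := by
  -- The elements of the quantum loop algebra which commute with `KVect.low φ`.
  let S : Subalgebra ℂ (Uq (qu κ r)) :=
    { carrier := {x | ∀ v, KVect.low φ (rhoK ζ ξ V x v) = rhoK ζ ξ W x (KVect.low φ v)}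
      mul_mem' := fun {x y} hx hy v => by
        rw [map_mul, map_mul, Module.End.mul_apply, Module.End.mul_apply, hx, hy]
      add_mem' := fun {x y} hx hy v => by
        rw [map_add, map_add, LinearMap.add_apply, LinearMap.add_apply, map_add, hx, hy]
      algebraMap_mem' := fun s v => by
        rw [AlgHom.commutes, AlgHom.commutes, Module.algebraMap_end_apply,
          Module.algebraMap_end_apply, map_smul] }
  have hK0 (v : (repKv κ r ζ ξ V).V) : KVect.low φ (rhoK ζ ξ V (Uq.gen (qu κ r) (.K 0)) v) =
      rhoK ζ ξ W (Uq.gen (qu κ r) (.K 0)) (KVect.low φ v) := by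
    rw [rhoK_K0, rhoK_K0, KVect.low_k]
  have hK1 (v : (repKv κ r ζ ξ V).V) : KVect.low φ (rhoK ζ ξ V (Uq.gen (qu κ r) (.K 1)) v) =
      rhoK ζ ξ W (Uq.gen (qu κ r) (.K 1)) (KVect.low φ v) :=
    LinearMap.congr_fun (f := KVect.low φ ∘ₗ rhoK ζ ξ V (Uq.gen (qu κ r) (.K 1)))
      (g := rhoK ζ ξ W (Uq.gen (qu κ r) (.K 1)) ∘ₗ KVect.low φ)
      (KVect.ext_eigen fun z v hz hv => by
        have hw : (repKv κ r ζ ξ W).k (KVect.low φ v) = z • KVect.low φ v := by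
          rw [← KVect.low_k, hv, map_smul]
        rw [LinearMap.comp_apply, LinearMap.comp_apply, rhoK_K1 V hz hv, rhoK_K1 W hz hw,
          map_smul]) v
  have hS := Uq.subalgebra_eq_top (qu κ r) ζ ξ hq S (Fin.forall_fin_two.2 ⟨hK0, hK1⟩)
    (fun i => low_fOp φ i (hp i)) (fun i => low_fbOp φ i (hn i))
  refine ⟨⟨KVect.low φ, fun x v => hS x v⟩, ihom_ext fun a v => ?_⟩
  rw [repMap_ia, KVect.lin_ia]
  rfl

variable {A : TensorAlg (Fp κ r) braidOver} {B : TensorAlg (Fm κ r) braidUnder}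
  {ρ : A.T.1 ⊗ B.T.1 ⟶ 𝟙_ (Bim (r : ℂ))}
  (hρ : ∀ w u, ρ.lin (tmul (wa (κ := κ) (ω := om κ r) A w) (wb (κ := κ) (ω := om κ r) B u)) =
    pair κ (om κ r) (formMat ζ ξ) w u • un 1)
  (hq : qq κ r ^ 2 ≠ 1)

theorem full_repYD : (repYD hρ hq c).Full where
  map_surjective {V W} φ := by
    obtain ⟨f, hf⟩ := exists_repMap (c := c) (ζ := ζ) (ξ := ξ) hq φ.hom
      (fun i x => by
        have h := hom_actP φ i x
        rw [actP_repYD, actP_repYD] at h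
        exact h)
      (fun i x => by
        have h := hom_actN φ i x
        rw [actN_repYD, actN_repYD] at h
        exact h)
    exact ⟨f, YD.Hom.ext hf⟩

end RepFunctor

/-! ### The Hopf pairing which extends the form -/

section Pairing

variable {κ r ω : ℂ} {A : TensorAlg (alphaC r κ (fund ω)) braidOver}
  {B : TensorAlg (alphaC r (-κ) (fund ω)) braidUnder}
  (hx : ∀ n : ℤ, Complex.exp (κ * (n * r) * ω) = 1) {β : Fin 2 → Fin 2 → ℂ}
  (hβ : ∀ i j, β i j ≠ 0 → ![ω, -ω] i + ![ω, -ω] j = 0)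
  {b : alpha r κ (fund ω) ⊗ alpha r (-κ) (fund ω) ⟶ 𝟙_ (Bim r)}
  (hb : ∀ i j, b.lin (tmul (ff r κ ω i) (ff r (-κ) ω j)) = β i j • un 1)

include hx in
/-- Two homomorphisms on `F^+ ⊗ F^-` agree if they agree on the tensors of generators. -/
theorem fund_tens_ext {Z : Bim r} {f g : alpha r κ (fund ω) ⊗ alpha r (-κ) (fund ω) ⟶ Z}
    (h : ∀ i j, f.lin (tmul (ff r κ ω i) (ff r (-κ) ω j)) =
      g.lin (tmul (ff r κ ω i) (ff r (-κ) ω j))) : f = g := by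
  refine fund_ext_left (ff_sym hx) fun i t => ?_
  refine fund_ind (P := fun t => f.lin (tmul (ff r κ ω i) t) = g.lin (tmul (ff r κ ω i) t)) t
    (by simp only [tmul_zero, map_zero]) (fun a j => ?_)
    (fun t t' h h' => by simp only [tmul_add, map_add, h, h'])
  rw [← ff_sym (exp_neg_one hx), ← ract_tmul, f.comm_r, g.comm_r, h]

theorem ι_tens_lin (ρ : A.T.1 ⊗ B.T.1 ⟶ 𝟙_ (Bim r)) (i j : Fin 2) :
    ((A.ι.f ⊗ₘ B.ι.f) ≫ ρ).lin (tmul (ff r κ ω i) (ff r (-κ) ω j)) =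
      ρ.lin (tmul (wa A [i]) (wb B [j])) := by
  rw [← ι_wa, ← ι_wb]
  exact congrArg ρ.lin (tensorHom_tmul A.ι.f B.ι.f _ _)

include hx hβ hb in
/-- The values on words of a Hopf pairing which extends the form `b`. -/
theorem apply_words_of_extends {ρ : A.T.1 ⊗ B.T.1 ⟶ 𝟙_ (Bim r)} (h : IsHopfPairing A B ρ)
    (hE : (A.ι.f ⊗ₘ B.ι.f) ≫ ρ = b) (w u : List (Fin 2)) :
    ρ.lin (tmul (wa A w) (wb B u)) = pair κ ω β w u • un 1 :=
  IsHopfPairing.apply_words hx hβ h (fun i j => (ι_tens_lin ρ i j).symm.trans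
    ((congrArg (fun f : alpha r κ (fund ω) ⊗ alpha r (-κ) (fund ω) ⟶ 𝟙_ (Bim r) =>
      f.lin (tmul (ff r κ ω i) (ff r (-κ) ω j))) hE).trans (hb i j))) w u

include hx hb in
theorem extends_of_apply_words {ρ : A.T.1 ⊗ B.T.1 ⟶ 𝟙_ (Bim r)}
    (hρ : ∀ w u, ρ.lin (tmul (wa A w) (wb B u)) = pair κ ω β w u • un 1) :
    (A.ι.f ⊗ₘ B.ι.f) ≫ ρ = b :=
  fund_tens_ext hx fun i j => by
    rw [hb, ← pair_letters κ ω (β := β), ← hρ]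
    exact ι_tens_lin ρ i j

include hx in
theorem tens_words_ext {Z : Bim r} {f g : A.T.1 ⊗ B.T.1 ⟶ Z}
    (h : ∀ w u, f.lin (tmul (wa A w) (wb B u)) = g.lin (tmul (wa A w) (wb B u))) : f = g :=
  (isFree_wa hx).ext_left fun w x => by
    refine (isFree_wb hx).ind (P := fun x => f.lin (tmul (wa A w) x) =
      g.lin (tmul (wa A w) x)) (by simp only [tmul_zero, map_zero]) (fun b u => ?_)
      (fun x y hx hy => by simp only [tmul_add, map_add, hx, hy]) x
    rw [← (isFree_wb hx).sym, ← ract_tmul, Hom.comm_r, Hom.comm_r, h]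

include hx hβ hb in
/-- The form `b` extends to a unique Hopf pairing. -/
theorem existsUnique_rho (A : TensorAlg (alphaC r κ (fund ω)) braidOver)
    (B : TensorAlg (alphaC r (-κ) (fund ω)) braidUnder) :
    ∃! ρ : A.T.1 ⊗ B.T.1 ⟶ 𝟙_ (Bim r), IsHopfPairing A B ρ ∧ (A.ι.f ⊗ₘ B.ι.f) ≫ ρ = b := by
  obtain ⟨ρ, hρ⟩ := exists_rho hx hβ A B
  refine ⟨ρ, ⟨isHopfPairing_of_pair hx hβ hρ, extends_of_apply_words hx hb hρ⟩,
    fun ρ' h => tens_words_ext hx fun w u => ?_⟩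
  exact (apply_words_of_extends hx hβ hb h.1 h.2 w u).trans (hρ w u).symm

end Pairing

end CBoson

end

theorem mainTheorem7 (κ r ζ ξ : ℂˣ) (hq : qq κ r ^ 2 ≠ 1) (c : Fin 2 → ℂˣ) :
    Nonempty (TensorAlg (Fp κ r) braidOver) ∧ Nonempty (TensorAlg (Fm κ r) braidUnder) ∧
    ∀ (A : TensorAlg (Fp κ r) braidOver) (B : TensorAlg (Fm κ r) braidUnder),
      (∃! ρ : A.T.1 ⊗ B.T.1 ⟶ 𝟙_ (Bim (r : ℂ)),
        IsHopfPairing A B ρ ∧ (A.ι.f ⊗ₘ B.ι.f) ≫ ρ = pairing ζ ξ κ r) ∧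
      ∀ ρ : A.T.1 ⊗ B.T.1 ⟶ 𝟙_ (Bim (r : ℂ)), IsHopfPairing A B ρ →
        (A.ι.f ⊗ₘ B.ι.f) ≫ ρ = pairing ζ ξ κ r →
        ∃ (hR : ∀ Y, DF.CommCond (pairing ζ ξ κ r) ((YD.restrict A B ρ).obj Y))
          (S : (DF.CommCond (P := Fp κ r) (M := Fm κ r) (pairing ζ ξ κ r)).FullSubcategory ⥤
            YD A B ρ)
          (hΨ : ∀ V, DF.CommCond (pairing ζ ξ κ r) ((repToDF κ r ζ ξ c).obj V)),
          ObjectProperty.lift _ (YD.restrict A B ρ) hR ⋙ S = 𝟭 _ ∧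
          S ⋙ ObjectProperty.lift _ (YD.restrict A B ρ) hR = 𝟭 _ ∧
          ∃ (h : (ObjectProperty.lift _ (repToDF κ r ζ ξ c) hΨ ⋙ S) ⋙ YD.restrict A B ρ =
              repToDF κ r ζ ξ c)
            (_ : MonoidalCategory (YD A B ρ)) (_ : (YD.forget A B ρ).Monoidal)
            (_ : (ObjectProperty.lift _ (repToDF κ r ζ ξ c) hΨ ⋙ S).Monoidal),
            YD.IsStd A B ρ ∧
            (∀ V W : RepUq κ r,
              Functor.LaxMonoidal.μ (YD.forget A B ρ)
                  ((ObjectProperty.lift _ (repToDF κ r ζ ξ c) hΨ ⋙ S).obj V)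
                  ((ObjectProperty.lift _ (repToDF κ r ζ ξ c) hΨ ⋙ S).obj W) ≫
                (YD.forget A B ρ).map (Functor.LaxMonoidal.μ
                  (ObjectProperty.lift _ (repToDF κ r ζ ξ c) hΨ ⋙ S) V W) ≫ undHom h (V ⊗ W) =
              (undHom h V ⊗ₘ undHom h W) ≫ repMu κ r ζ ξ c V W) ∧
            (ObjectProperty.lift _ (repToDF κ r ζ ξ c) hΨ ⋙ S).Full ∧
            (ObjectProperty.lift _ (repToDF κ r ζ ξ c) hΨ ⋙ S).Faithful := by
  refine ⟨nonempty_tensorAlg (exp_om κ r) fun T a ha hc => isBraid_over ha hc,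
    nonempty_tensorAlg (exp_neg_one (exp_om κ r)) fun T a ha hc => isBraid_under ha hc,
    fun A B => ⟨existsUnique_rho (exp_om κ r) (formMat_wt _) pairing_ff A B, fun ρ hH hE => ?_⟩⟩
  have hρ := apply_words_of_extends (exp_om κ r) (formMat_wt _) pairing_ff hH hE
  have hR : ∀ Y, DF.CommCond (P := Fp κ r) (M := Fm κ r) (pairing ζ ξ κ r)
      ((YD.restrict A B ρ).obj Y) := commCond_restrict (exp_om κ r) hρ pairing_ff
  have hRS : ObjectProperty.lift _ (YD.restrict A B ρ) hR ⋙ repS hρ = 𝟭 _ :=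
    restrict_sFunctor (exp_om κ r) (formMat_wt _) hρ pairing_ff
  have hSR : repS hρ ⋙ ObjectProperty.lift _ (YD.restrict A B ρ) hR = 𝟭 _ :=
    sFunctor_restrict (exp_om κ r) (formMat_wt _) hρ pairing_ff
  have h : (ObjectProperty.lift _ (repToDF κ r ζ ξ c) (commCond_repToDF hq) ⋙ repS hρ) ⋙
      YD.restrict A B ρ = repToDF κ r ζ ξ c :=
    congrArg (fun F => ObjectProperty.lift _ (repToDF κ r ζ ξ c) (commCond_repToDF hq) ⋙ F ⋙
      ObjectProperty.ι _) hSR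
  refine ⟨hR, repS hρ, commCond_repToDF hq, hRS, hSR, h, repMonoidal hρ,
    ydForgetMonoidal (exp_om κ r) (formMat_wt _) hρ,
    letI := repMonoidal hρ; (repYDCore hρ hq c).toMonoidal,
    isStd (exp_om κ r) (formMat_wt _) hρ, fun V W => ?_, full_repYD hρ hq,
    faithful_repYD hρ hq c⟩
  change 𝟙 _ ≫ repMu κ r ζ ξ c V W ≫ 𝟙 _ = (𝟙 _ ⊗ₘ 𝟙 _) ≫ repMu κ r ζ ξ c V W
  rw [Category.id_comp, Category.comp_id, MonoidalCategory.id_tensorHom_id, Category.id_comp]
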